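/- **Setting.** Let $(X^{2n},\omega)$ be a symplectic manifold, $(L,\nabla)$ a prequantum line bundle on it (a hermitian line bundle with a unitary connection and $\nabla^2=-\sqrt{-1}\,\omega$), and $\mu\colon X\to B^n$ a proper Lagrangian fiber bundle with connected fibers $X_b=\mu^{-1}(b)$. Action-angle coordinates over an open set of $B$ are fiber-preserving symplectomorphisms onto $(U'\times T^n,\sum_i dx_i\wedge d\theta_i)$ with $U'\subset\mathbb R^n$ open and $T=\mathbb R/2\pi\mathbb Z$; the action coordinates $x$ give $B$ an affine structure, and the vector fields $\partial/\partial\theta_i$ give the canonical flat connection on $\ker d\mu$, hence on the vertical half-densities $|\Lambda|^{1/2}(\ker d\mu)^*$. Fix * a smooth horizontal distribution $H$, $TX=H\oplus\ker d\mu$, which is invariant in the $T^n$-direction in all action-angle coordinates; * a locally finite open covering $\mathcal U$ of $B$ by relatively compact sets such that each member, and each intersection of two members, admits an open affine embedding into $\mathbb R^n$ with convex image. For $k\in\mathbb N$ let $B_k\subset B$ be the set of points $b$ for which $L^k|_{X_b}$ has a non-zero parallel section, and let $$\mathcal H_k=\bigoplus_{b\in B_k}H^0\bigl(X_b;L^k\otimes|\Lambda|^{1/2}X_b\bigr)$$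 be the Hilbert space direct sum of the spaces of parallel sections, with the inner product obtained by integrating the density $\langle\xi,\xi'\rangle$ over $X_b$ (inner products are conjugate-linear in the first argument). Points $b,c\in B$ are called close if they lie in a common $U\in\mathcal U$; then let $\gamma$ be the affine segment between them in $U$ and $(b+c)/2$ its midpoint. Parallel transport along $\gamma$, by means of $H$ for points of the fibers, $\nabla$ for $L^k$ and the canonical flat connection for half-densities, identifies sections over, and functions on, the fibers over points of $\gamma$, and so defines a pairing $\langle\cdot,\cdot\rangle_{\mathcal U}$ between sections of $L^k\otimes|\Lambda|^{1/2}$ over $X_b$ and over $X_c$. For $f\in C_c^\infty(X)=C_c^\infty(X;\mathbb C)$ the operator $\phi^k(f)=\phi^k_{H,\mathcal U}(f)$ on $\mathcal H_k$ is given by $$\phi^k(f)\,\xi=\sum_{b\in B_k,\ b\text{ close to }c}\bigl\langle\psi_b,\ f|_{X_{(b+c)/2}}\,\xi\bigr\rangle_{\mathcal U}\ \psi_b\qquad\bigl(c\in B_k,\ \xi\in H^0(X_c;L^k\otimes|\Lambda|^{1/2}X_c)\bigr),$$ where $\psi_b$ is any unit vector of $H^0(X_b;L^k\otimes|\Lambda|^{1/2}X_b)$.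 The Poisson bracket is normalized by $\{f,g\}=\sum_i\left(\partial_{x_i}f\,\partial_{\theta_i}g-\partial_{\theta_i}f\,\partial_{x_i}g\right)$ in action-angle coordinates. **Theorem.** For all $k\ge1$ and $f\in C_c^\infty(X)$ the operator $\phi^k(f)$ is a well-defined bounded operator on $\mathcal H_k$ (independent of the choice of the $\psi_b$), and for all $f,g\in C_c^\infty(X)$ $$\Bigl\|\phi^k(f)\,\phi^k(g)-\phi^k(fg)-\frac{-\sqrt{-1}}{2k}\,\phi^k(\{f,g\})\Bigr\|=O\Bigl(\frac1{k^2}\Bigr)\qquad\text{as }k\to\infty .$$ -/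

import Mathlib

open scoped Manifold ContDiff Topology
open Bundle Set

noncomputable section

namespace LagrangianQuantization

set_option linter.unusedSectionVars false

/-- Euclidean `d`-space. -/
abbrev Euc (d : ℕ) : Type := EuclideanSpace ℝ (Fin d)

/-! ### Symplectic manifolds and proper Lagrangian fibrations -/

section Fibration

variable {n : ℕ} {X : Type*} [TopologicalSpace X] [ChartedSpace (Euc (2 * n)) X]
  {B : Type*} [TopologicalSpace B] [ChartedSpace (Euc n) B]

variable (n X) in
/-- A (not necessarily continuous) field of alternating 2-forms on the `2n`-manifold `X`. -/
abbrev TwoForm : Type _ := ∀ p : X, TangentSpace (𝓡 (2 * n)) p [⋀^Fin 2]→L[ℝ] ℝ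

/-- The expression of a 2-form in the coordinate chart around `x₀` (pull-back under the inverse of
the chart). -/
def TwoForm.inChart (Ω : TwoForm n X) (x₀ : X) (y : Euc (2 * n)) :
    Euc (2 * n) [⋀^Fin 2]→L[ℝ] ℝ :=
  (Ω ((extChartAt (𝓡 (2 * n)) x₀).symm y)).compContinuousLinearMap
    (mfderiv 𝓘(ℝ, Euc (2 * n)) (𝓡 (2 * n)) (extChartAt (𝓡 (2 * n)) x₀).symm y)

/-- `Ω` is a symplectic form: smooth, closed and non-degenerate. -/
structure IsSymplectic (Ω : TwoForm n X) : Prop where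
  smooth : ∀ x₀ : X, ContDiffOn ℝ ∞ (Ω.inChart x₀) (extChartAt (𝓡 (2 * n)) x₀).target
  closed : ∀ x₀ : X, ∀ y ∈ (extChartAt (𝓡 (2 * n)) x₀).target, extDeriv (Ω.inChart x₀) y = 0
  nondegenerate : ∀ (p : X) (v : TangentSpace (𝓡 (2 * n)) p),
    (∀ w : TangentSpace (𝓡 (2 * n)) p, Ω p ![v, w] = 0) → v = 0

variable (n) in
/-- The differential of the projection `μ : X → B`. -/
abbrev dproj (μ : X → B) (p : X) :
    TangentSpace (𝓡 (2 * n)) p →L[ℝ] TangentSpace (𝓡 n) (μ p) :=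
  mfderiv (𝓡 (2 * n)) (𝓡 n) μ p

/-- `μ : X²ⁿ → Bⁿ` is a proper Lagrangian fibre bundle with connected fibres.  A proper surjective
submersion is the same as a smooth fibre bundle with compact fibres; as the fibres have dimension
`n`, they are Lagrangian as soon as `Ω` vanishes on their tangent spaces. -/
structure IsProperLagrangianFibration (Ω : TwoForm n X) (μ : X → B) : Prop where
  smooth : ContMDiff (𝓡 (2 * n)) (𝓡 n) ∞ μ
  submersion : ∀ p : X, Function.Surjective (dproj n μ p)
  proper : IsProperMap μ
  connected : ∀ b : B, IsConnected (μ ⁻¹' {b})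
  lagrangian : ∀ (p : X) (v w : TangentSpace (𝓡 (2 * n)) p),
    dproj n μ p v = 0 → dproj n μ p w = 0 → Ω p ![v, w] = 0

/-- An action-angle coordinate system over an open set `V ⊆ B`: a fibre-preserving symplectomorphism
`(x(V) × Tⁿ, ∑ dxᵢ ∧ dθᵢ) ≃ (μ⁻¹ V, Ω)` with `T = ℝ / 2πℤ` that covers the inverse of the
coordinate system `x` on `V`.  It is written as a `(2πℤ)ⁿ`-periodic map `Ψ` of
`(ξ, θ) ∈ x(V) × ℝⁿ`. -/
structure ActionAngleChart (Ω : TwoForm n X) (μ : X → B) where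
  V : Set B
  isOpen_V : IsOpen V
  x : B → Euc n
  injOn_x : InjOn x V
  isOpen_image : IsOpen (x '' V)
  Ψ : Euc n × Euc n → X
  smooth : ContMDiffOn 𝓘(ℝ, Euc n × Euc n) (𝓡 (2 * n)) ∞ Ψ ((x '' V) ×ˢ univ)
  proj_mem : ∀ ξ ∈ x '' V, ∀ θ, μ (Ψ (ξ, θ)) ∈ V
  x_proj : ∀ ξ ∈ x '' V, ∀ θ, x (μ (Ψ (ξ, θ))) = ξ
  surjective : ∀ p : X, μ p ∈ V → ∃ θ, Ψ (x (μ p), θ) = p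
  periodic : ∀ ξ ∈ x '' V, ∀ θ θ', Ψ (ξ, θ) = Ψ (ξ, θ') ↔
    ∃ m : Fin n → ℤ, ∀ i, θ i - θ' i = 2 * Real.pi * m i
  symplectic : ∀ ξ ∈ x '' V, ∀ (θ : Euc n) (v w : Euc n × Euc n),
    Ω (Ψ (ξ, θ)) ![mfderiv 𝓘(ℝ, Euc n × Euc n) (𝓡 (2 * n)) Ψ (ξ, θ) v,
        mfderiv 𝓘(ℝ, Euc n × Euc n) (𝓡 (2 * n)) Ψ (ξ, θ) w] =
      ∑ i, (v.1 i * w.2 i - w.1 i * v.2 i)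

namespace ActionAngleChart

variable {Ω : TwoForm n X} {μ : X → B} (c : ActionAngleChart Ω μ)

/-- The point with angle coordinates `θ` on the fibre over `b`. -/
abbrev pt (b : B) (θ : Euc n) : X := c.Ψ (c.x b, θ)

/-- The differential of `Ψ`. -/
abbrev dΨ (ξ θ : Euc n) : Euc n × Euc n →L[ℝ] TangentSpace (𝓡 (2 * n)) (c.Ψ (ξ, θ)) :=
  mfderiv 𝓘(ℝ, Euc n × Euc n) (𝓡 (2 * n)) c.Ψ (ξ, θ)

/-- The vertical vector `∑ wᵢ ∂/∂θᵢ` at the point `c.pt b θ`. -/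
abbrev vert (b : B) (θ w : Euc n) : TangentSpace (𝓡 (2 * n)) (c.pt b θ) :=
  c.dΨ (c.x b) θ (0, w)

/-- The frame `∂/∂θ₁, …, ∂/∂θₙ` of the vertical tangent space at `c.pt b θ`. -/
abbrev frame (b : B) (θ : Euc n) (i : Fin n) : TangentSpace (𝓡 (2 * n)) (c.pt b θ) :=
  c.vert b θ (EuclideanSpace.single i 1)

end ActionAngleChart

/-- `χ` is an open affine embedding of the open set `U ⊆ B` into `ℝⁿ`, for the affine structure on
`B` whose local affine coordinates are the action coordinates. -/
structure IsAffineEmbedding (Ω : TwoForm n X) (μ : X → B) (U : Set B) (χ : B → Euc n) : Prop where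
  isOpen : IsOpen U
  injOn : InjOn χ U
  affine : ∀ b ∈ U, ∃ c : ActionAngleChart Ω μ, b ∈ c.V ∧
    ∃ A : Euc n ≃ᵃ[ℝ] Euc n, ∀ᶠ b' in 𝓝 b, χ b' = A (c.x b')

variable [IsManifold (𝓡 (2 * n)) ∞ X]

/-- A smooth horizontal distribution `H` for `μ`, `TX = H ⊕ ker dμ`, that is invariant in the
`Tⁿ`-direction in every action-angle coordinate system. -/
structure IsInvariantHorizontalDistribution (Ω : TwoForm n X) (μ : X → B)
    (H : ∀ p : X, Submodule ℝ (TangentSpace (𝓡 (2 * n)) p)) : Prop where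
  isCompl : ∀ p : X, IsCompl (H p) (LinearMap.ker (dproj n μ p).toLinearMap)
  smooth : ∀ p : X, ∃ Y : Fin n → ∀ q : X, TangentSpace (𝓡 (2 * n)) q,
    (∀ j, ∀ᶠ q in 𝓝 p, ContMDiffAt (𝓡 (2 * n)) (𝓡 (2 * n)).tangent ∞
      (fun q ↦ (⟨q, Y j q⟩ : TangentBundle (𝓡 (2 * n)) X)) q) ∧
    ∀ᶠ q in 𝓝 p, Submodule.span ℝ (range fun j ↦ Y j q) = H q
  invariant : ∀ (c : ActionAngleChart Ω μ), ∀ ξ ∈ c.x '' c.V, ∀ θ θ' : Euc n,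
    (H (c.Ψ (ξ, θ))).comap (c.dΨ ξ θ).toLinearMap =
      (H (c.Ψ (ξ, θ'))).comap (c.dΨ ξ θ').toLinearMap

/-- The conditions on the open covering `𝒰` of `B`: it is locally finite, its members and their
pairwise intersections admit open affine embeddings into `ℝⁿ` with convex image, and its members
are relatively compact. -/
structure IsConvexAffineCover (Ω : TwoForm n X) (μ : X → B) (𝒰 : Set (Set B)) : Prop where
  covers : ⋃₀ 𝒰 = univ
  locallyFinite : LocallyFinite (fun U : 𝒰 ↦ (U : Set B))
  convex : ∀ U ∈ 𝒰, ∃ χ, IsAffineEmbedding Ω μ U χ ∧ Convex ℝ (χ '' U)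
  convex_inter : ∀ U ∈ 𝒰, ∀ V ∈ 𝒰, ∃ χ, IsAffineEmbedding Ω μ (U ∩ V) χ ∧ Convex ℝ (χ '' (U ∩ V))
  compact_closure : ∀ U ∈ 𝒰, IsCompact (closure U)

/-- The tangent vector `Y` at `p` with `Ω(Y, ·) = α`. -/
def hamVec (Ω : TwoForm n X) (p : X) (α : TangentSpace (𝓡 (2 * n)) p → ℝ) :
    TangentSpace (𝓡 (2 * n)) p :=
  open Classical in
  if h : ∃ Y : TangentSpace (𝓡 (2 * n)) p, ∀ w, Ω p ![Y, w] = α w then h.choose else 0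

/-- The differential at `p` of a complex-valued function, as a function on the tangent space. -/
abbrev dC (f : X → ℂ) (p : X) (v : TangentSpace (𝓡 (2 * n)) p) : ℂ :=
  mvfderiv (𝓡 (2 * n)) f p v

/-- The Poisson bracket of complex-valued functions, `ℂ`-bilinear: `{f, g} = - dg(Y_f)` with
`Ω(Y_f, ·) = df`.  For `Ω = ∑ dxᵢ ∧ dθᵢ` it is `∑ (∂f/∂xᵢ ∂g/∂θᵢ - ∂f/∂θᵢ ∂g/∂xᵢ)`. -/
def poisson (Ω : TwoForm n X) (f g : X → ℂ) (p : X) : ℂ :=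
  -(dC g p (hamVec Ω p fun w ↦ (dC f p w).re) +
    Complex.I * dC g p (hamVec Ω p fun w ↦ (dC f p w).im))

end Fibration

/-! ### Prequantum line bundles -/

section Prequantum

variable {n : ℕ} {X : Type*} [TopologicalSpace X] [ChartedSpace (Euc (2 * n)) X]
  [IsManifold (𝓡 (2 * n)) ∞ X]
  {L : X → Type*} [∀ p, NormedAddCommGroup (L p)] [∀ p, InnerProductSpace ℂ (L p)]
  [TopologicalSpace (TotalSpace ℂ L)] [FiberBundle ℂ L] [VectorBundle ℝ ℂ L]

variable (n) in
/-- The section `s` of `L` is smooth at `p`. -/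
abbrev SmoothSectionAt (s : ∀ p, L p) (p : X) : Prop :=
  ContMDiffAt (𝓡 (2 * n)) ((𝓡 (2 * n)).prod 𝓘(ℝ, ℂ)) ∞ (fun q ↦ TotalSpace.mk' ℂ q (s q)) p

/-- `∇` is a smooth unitary connection on the hermitian line bundle `L` (the metric of which is
smooth) with curvature `∇² = -i Ω`. -/
structure IsPrequantum (Ω : TwoForm n X) (conn : CovariantDerivative (𝓡 (2 * n)) ℂ L) : Prop where
  smooth_metric : ∀ (s t : ∀ p, L p) (p : X), SmoothSectionAt n s p → SmoothSectionAt n t p →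
    ContMDiffAt (𝓡 (2 * n)) 𝓘(ℝ, ℂ) ∞ (fun q ↦ inner ℂ (s q) (t q)) p
  smooth_conn : CovariantDerivative.ContMDiffCovariantDerivative conn ∞
  complex_linear : ∀ (s : ∀ p, L p) (p : X), SmoothSectionAt n s p →
    ∀ v, conn (fun q ↦ Complex.I • s q) p v = Complex.I • conn s p v
  unitary : ∀ (s t : ∀ p, L p) (p : X), SmoothSectionAt n s p → SmoothSectionAt n t p → ∀ v,
    dC (fun q ↦ inner ℂ (s q) (t q)) p v = inner ℂ (conn s p v) (t p) + inner ℂ (s p) (conn t p v)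
  curvature : ∀ (Y Z : ∀ p : X, TangentSpace (𝓡 (2 * n)) p) (s : ∀ p, L p),
    ContMDiff (𝓡 (2 * n)) (𝓡 (2 * n)).tangent ∞
      (fun q ↦ (⟨q, Y q⟩ : TangentBundle (𝓡 (2 * n)) X)) →
    ContMDiff (𝓡 (2 * n)) (𝓡 (2 * n)).tangent ∞
      (fun q ↦ (⟨q, Z q⟩ : TangentBundle (𝓡 (2 * n)) X)) →
    (∀ p, SmoothSectionAt n s p) → ∀ p,
    conn (fun q ↦ conn s q (Z q)) p (Y p) - conn (fun q ↦ conn s q (Y q)) p (Z p)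
        - conn s p (VectorField.mlieBracket (𝓡 (2 * n)) Y Z p) =
      -(Complex.I * (Ω p ![Y p, Z p] : ℂ)) • s p

end Prequantum

/-! ### The setting -/

/-- A prequantized symplectic manifold `(X²ⁿ, Ω, L, ∇)` with a proper Lagrangian fibre bundle
`μ : X → B` with connected fibres, together with a horizontal distribution `H` and an open
covering `𝒰` of the base. -/
structure Setting (n : ℕ) (X : Type*) [TopologicalSpace X] [ChartedSpace (Euc (2 * n)) X]
    [IsManifold (𝓡 (2 * n)) ∞ X]
    (B : Type*) [TopologicalSpace B] [ChartedSpace (Euc n) B]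
    (L : X → Type*) [∀ p, NormedAddCommGroup (L p)] [∀ p, InnerProductSpace ℂ (L p)]
    [TopologicalSpace (TotalSpace ℂ L)] [FiberBundle ℂ L] [VectorBundle ℝ ℂ L] where
  Ω : TwoForm n X
  isSymplectic : IsSymplectic Ω
  μ : X → B
  fibration : IsProperLagrangianFibration Ω μ
  conn : CovariantDerivative (𝓡 (2 * n)) ℂ L
  prequantum : IsPrequantum Ω conn
  H : ∀ p : X, Submodule ℝ (TangentSpace (𝓡 (2 * n)) p)
  horizontal : IsInvariantHorizontalDistribution Ω μ H
  𝒰 : Set (Set B)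
  cover : IsConvexAffineCover Ω μ 𝒰

namespace Setting

variable {n : ℕ} {X : Type*} [TopologicalSpace X] [ChartedSpace (Euc (2 * n)) X]
  [IsManifold (𝓡 (2 * n)) ∞ X]
  {B : Type*} [TopologicalSpace B] [ChartedSpace (Euc n) B]
  {L : X → Type*} [∀ p, NormedAddCommGroup (L p)] [∀ p, InnerProductSpace ℂ (L p)]
  [TopologicalSpace (TotalSpace ℂ L)] [FiberBundle ℂ L] [VectorBundle ℝ ℂ L]
  (S : Setting n X B L)

/-- Action-angle coordinate systems of the fibration. -/
abbrev Chart : Type _ := ActionAngleChart S.Ω S.μ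

theorem exists_chart (b : B) : ∃ c : S.Chart, b ∈ c.V := by
  have hb : b ∈ ⋃₀ S.𝒰 := by rw [S.cover.covers]; trivial
  obtain ⟨U, hU, hbU⟩ := hb
  obtain ⟨χ, hχ, -⟩ := S.cover.convex U hU
  obtain ⟨c, hc, -⟩ := hχ.affine b hbU
  exact ⟨c, hc⟩

/-- A choice of an action-angle coordinate system around `b`. -/
def chartAt (b : B) : S.Chart := (S.exists_chart b).choose

theorem mem_chartAt (b : B) : b ∈ (S.chartAt b).V := (S.exists_chart b).choose_spec

/-! ### Quantum Hilbert spaces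

An element of the line `L_p^{⊗k}` is written through its coefficients `e ↦ a(e)` with respect to
the basis vectors `e^{⊗k}`, `e ∈ L_p` non-zero, so that `a(λ e) = λ⁻ᵏ a(e)`; by convention
`a(0) = 0`. Similarly a half-density on `V = ker dμ_p` is a function `ρ` of `n`-tuples of
vectors of `V` with `ρ(A v) = |det A|^{1/2} ρ(v)`. An element of `L_p^{⊗k} ⊗ |Λ|^{1/2} V` is
therefore a function of both arguments. Sections over the fibre `X_b` are extended by zero. -/

/-- Let `u θ` be the coefficient function of an element of `L^{⊗k}` at each point with angle
coordinates `θ` of the fibre over `b`. The section of `L^{⊗k}` on that fibre so defined is parallel: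
with respect to every smooth local section `s ≠ 0` of `L` it is `a s^{⊗k}` with
`da + k a (∇s / s) = 0` on the fibre. -/
def IsParallelOnFiber (k : ℕ) (c : S.Chart) (b : B) (u : ∀ θ : Euc n, L (c.pt b θ) → ℂ) : Prop :=
  ∀ (θ₀ : Euc n) (s : ∀ p, L p), SmoothSectionAt n s (c.pt b θ₀) → s (c.pt b θ₀) ≠ 0 →
    ∃ D : Euc n →L[ℝ] ℂ, HasFDerivAt (fun θ ↦ u θ (s (c.pt b θ))) D θ₀ ∧
      ∀ w : Euc n, D w • s (c.pt b θ₀) +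
        ((k : ℂ) * u θ₀ (s (c.pt b θ₀))) • S.conn s (c.pt b θ₀) (c.vert b θ₀ w) = 0

variable {S} in
theorem IsParallelOnFiber.add {k : ℕ} {c : S.Chart} {b : B} {u v : ∀ θ : Euc n, L (c.pt b θ) → ℂ}
    (hu : S.IsParallelOnFiber k c b u) (hv : S.IsParallelOnFiber k c b v) :
    S.IsParallelOnFiber k c b (fun θ e ↦ u θ e + v θ e) := by
  intro θ₀ s hs hs0
  obtain ⟨D, hD, hD'⟩ := hu θ₀ s hs hs0
  obtain ⟨E, hE, hE'⟩ := hv θ₀ s hs hs0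
  refine ⟨D + E, hD.add hE, fun w ↦ ?_⟩
  have h := congrArg₂ (· + ·) (hD' w) (hE' w)
  simp only [add_zero] at h
  rw [← h, add_apply, mul_add, add_smul, add_smul]
  abel

variable {S} in
theorem IsParallelOnFiber.smul {k : ℕ} {c : S.Chart} {b : B} {u : ∀ θ : Euc n, L (c.pt b θ) → ℂ}
    (a : ℂ) (hu : S.IsParallelOnFiber k c b u) :
    S.IsParallelOnFiber k c b (fun θ e ↦ a * u θ e) := by
  intro θ₀ s hs hs0
  obtain ⟨D, hD, hD'⟩ := hu θ₀ s hs hs0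
  refine ⟨a • D, hD.const_mul a, fun w ↦ ?_⟩
  have h := congrArg (a • ·) (hD' w)
  simp only [smul_zero, smul_add, smul_smul] at h
  rw [← h, smul_apply, smul_eq_mul, mul_left_comm]

variable {S} in
theorem IsParallelOnFiber.zero {k : ℕ} {c : S.Chart} {b : B} :
    S.IsParallelOnFiber k c b (fun _ _ ↦ 0) := by
  intro θ₀ s _ _
  exact ⟨0, hasFDerivAt_const _ _, fun w ↦ by simp⟩

/-- `H⁰(X_b; L^{⊗k})`: the parallel sections of `(L^{⊗k}, ∇)` over the fibre `X_b`. -/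
def parallelSections (k : ℕ) (b : B) : Submodule ℂ (∀ p : X, L p → ℂ) where
  carrier := {σ | (∀ p, S.μ p ≠ b → ∀ e, σ p e = 0) ∧ (∀ p, σ p 0 = 0) ∧
    (∀ p e (a : ℂ), a ≠ 0 → σ p (a • e) = (a ^ k)⁻¹ * σ p e) ∧
    ∀ c : S.Chart, b ∈ c.V → S.IsParallelOnFiber k c b (fun θ e ↦ σ (c.pt b θ) e)}
  add_mem' := by
    rintro σ τ ⟨h1, h2, h3, h4⟩ ⟨h1', h2', h3', h4'⟩
    refine ⟨fun p hp e ↦ ?_, fun p ↦ ?_, fun p e a ha ↦ ?_, fun c hc ↦ (h4 c hc).add (h4' c hc)⟩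
    · simp [h1 p hp, h1' p hp]
    · simp [h2, h2']
    · simp [h3 p e a ha, h3' p e a ha, mul_add]
  zero_mem' := ⟨by simp, by simp, by simp, fun c _ ↦ IsParallelOnFiber.zero⟩
  smul_mem' := by
    rintro a σ ⟨h1, h2, h3, h4⟩
    refine ⟨fun p hp e ↦ ?_, fun p ↦ ?_, fun p e r hr ↦ ?_, fun c hc ↦ (h4 c hc).smul a⟩
    · simp [h1 p hp]
    · simp [h2]
    · simp [h3 p e r hr, mul_left_comm]

/-- The set `B_k` of `k`-Bohr-Sommerfeld points. -/
def bohrSommerfeld (k : ℕ) : Set B := {b | S.parallelSections k b ≠ ⊥}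

/-- `H⁰(X_b; L^{⊗k} ⊗ |Λ|^{1/2} X_b)`: the parallel sections over the fibre `X_b`, for the
connection induced by `∇` and the canonical flat connection on the vertical half-densities, for
which the half-densities with constant value on the frame `∂/∂θ` are parallel. -/
def parallelHalfForms (k : ℕ) (b : B) :
    Submodule ℂ (∀ p : X, L p → (Fin n → TangentSpace (𝓡 (2 * n)) p) → ℂ) where
  carrier := {τ | (∀ p, S.μ p ≠ b → ∀ e v, τ p e v = 0) ∧ (∀ p v, τ p 0 v = 0) ∧
    (∀ p e v, (∃ i, dproj n S.μ p (v i) ≠ 0) → τ p e v = 0) ∧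
    (∀ p e v (a : ℂ), a ≠ 0 → τ p (a • e) v = (a ^ k)⁻¹ * τ p e v) ∧
    (∀ p e v (A : Matrix (Fin n) (Fin n) ℝ), (∀ i, dproj n S.μ p (v i) = 0) →
      τ p e (fun i ↦ ∑ j, A i j • v j) = (Real.sqrt |A.det| : ℂ) * τ p e v) ∧
    ∀ c : S.Chart, b ∈ c.V → S.IsParallelOnFiber k c b (fun θ e ↦ τ (c.pt b θ) e (c.frame b θ))}
  add_mem' := by
    rintro σ τ ⟨h1, h2, h3, h4, h5, h6⟩ ⟨h1', h2', h3', h4', h5', h6'⟩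
    refine ⟨fun p hp e v ↦ ?_, fun p v ↦ ?_, fun p e v hv ↦ ?_, fun p e v a ha ↦ ?_,
      fun p e v A hv ↦ ?_, fun c hc ↦ (h6 c hc).add (h6' c hc)⟩
    · simp [h1 p hp, h1' p hp]
    · simp [h2, h2']
    · simp [h3 p e v hv, h3' p e v hv]
    · simp [h4 p e v a ha, h4' p e v a ha, mul_add]
    · simp [h5 p e v A hv, h5' p e v A hv, mul_add]
  zero_mem' := ⟨by simp, by simp, by simp, by simp, by simp, fun c _ ↦ IsParallelOnFiber.zero⟩
  smul_mem' := by
    rintro a σ ⟨h1, h2, h3, h4, h5, h6⟩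
    refine ⟨fun p hp e v ↦ ?_, fun p v ↦ ?_, fun p e v hv ↦ ?_, fun p e v r hr ↦ ?_,
      fun p e v A hv ↦ ?_, fun c hc ↦ (h6 c hc).smul a⟩
    · simp [h1 p hp]
    · simp [h2]
    · simp [h3 p e v hv]
    · simp [h4 p e v r hr, mul_left_comm]
    · simp [h5 p e v A hv, mul_left_comm]

/-- The summand `H⁰(X_b; L^{⊗k} ⊗ |Λ|^{1/2} X_b)` of the quantum Hilbert space. -/
def FiberSpace (k : ℕ) (b : B) : Type _ := ↥(S.parallelHalfForms k b)

instance (k : ℕ) (b : B) : AddCommGroup (S.FiberSpace k b) :=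
  inferInstanceAs (AddCommGroup ↥(S.parallelHalfForms k b))

instance (k : ℕ) (b : B) : Module ℂ (S.FiberSpace k b) :=
  inferInstanceAs (Module ℂ ↥(S.parallelHalfForms k b))

/-- The cube `[0, 2π]ⁿ`, a fundamental domain of the torus `Tⁿ`. -/
def box (n : ℕ) : Set (Euc n) := {θ | ∀ i, θ i ∈ Icc 0 (2 * Real.pi)}

theorem isCompact_box : IsCompact (box n) := by
  have h : box n = (EuclideanSpace.equiv (Fin n) ℝ).toHomeomorph ⁻¹'
      (Set.pi univ fun _ ↦ Icc 0 (2 * Real.pi)) := by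
    ext θ; simp [box, Pi.le_def, forall_and]
  rw [h]
  exact (Homeomorph.isCompact_preimage _).2 (isCompact_univ_pi fun _ ↦ isCompact_Icc)

theorem box_subset_closure_interior : box n ⊆ closure (interior (box n)) := by
  have hconv : Convex ℝ (box n) := by
    intro x hx y hy a b ha hb hab i
    exact convex_Icc (0 : ℝ) (2 * Real.pi) (hx i) (hy i) ha hb hab
  have hne : (interior (box n)).Nonempty := by
    have hO : IsOpen {θ : Euc n | ∀ i, θ i ∈ Ioo 0 (2 * Real.pi)} := by
      simp only [ofPred_forall]
      exact isOpen_iInter_of_finite fun i ↦ isOpen_Ioo.preimage (by fun_prop)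
    refine ⟨WithLp.toLp 2 fun _ ↦ Real.pi, interior_maximal ?_ hO fun i ↦ ?_⟩
    · exact fun θ hθ i ↦ Ioo_subset_Icc_self (hθ i)
    · simp only [mem_Ioo]; constructor <;> linarith [Real.pi_pos]
  rw [hconv.closure_interior_eq_closure_of_nonempty_interior hne]
  exact subset_closure

section ChartFacts

variable {S}

theorem proj_pt {c : S.Chart} {b : B} (hb : b ∈ c.V) (θ : Euc n) : S.μ (c.pt b θ) = b :=
  c.injOn_x (c.proj_mem _ (mem_image_of_mem _ hb) θ) hb (c.x_proj _ (mem_image_of_mem _ hb) θ)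

theorem mdifferentiableAt_Ψ (c : S.Chart) {b : B} (hb : b ∈ c.V) (θ : Euc n) :
    ContMDiffAt 𝓘(ℝ, Euc n × Euc n) (𝓡 (2 * n)) ∞ c.Ψ (c.x b, θ) :=
  c.smooth.contMDiffAt ((c.isOpen_image.prod isOpen_univ).mem_nhds
    ⟨mem_image_of_mem _ hb, mem_univ _⟩)

theorem continuous_pt (c : S.Chart) {b : B} (hb : b ∈ c.V) : Continuous (c.pt b) := by
  rw [continuous_iff_continuousAt]
  intro θ
  have h := (mdifferentiableAt_Ψ c hb θ).continuousAt
  exact ContinuousAt.comp (f := fun θ : Euc n ↦ (c.x b, θ)) h (by fun_prop)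

theorem exists_box_pt {c : S.Chart} {b : B} (hb : b ∈ c.V) {p : X} (hp : S.μ p = b) :
    ∃ θ ∈ box n, c.pt b θ = p := by
  subst hp
  obtain ⟨θ, hθ⟩ := c.surjective p hb
  have hpi : 0 < 2 * Real.pi := Real.two_pi_pos
  refine ⟨WithLp.toLp 2 fun i ↦ toIcoMod hpi 0 (θ i), fun i ↦ ?_, ?_⟩
  · have := toIcoMod_mem_Ico hpi 0 (θ i)
    rw [zero_add] at this
    exact Ico_subset_Icc_self this
  · refine Eq.trans ?_ hθ
    refine (c.periodic _ (mem_image_of_mem _ hb) _ _).2 ⟨fun i ↦ -toIcoDiv hpi 0 (θ i), fun i ↦ ?_⟩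
    simp only [toIcoMod, zsmul_eq_mul]
    push_cast
    ring

theorem dproj_vert {c : S.Chart} {b : B} (hb : b ∈ c.V) (θ w : Euc n) :
    dproj n S.μ (c.pt b θ) (c.vert b θ w) = 0 := by
  have h1 : HasMFDerivAt 𝓘(ℝ, Euc n × Euc n) (𝓡 (2 * n)) c.Ψ (c.x b, θ) (c.dΨ (c.x b) θ) :=
    ((mdifferentiableAt_Ψ c hb θ).mdifferentiableAt (by simp)).hasMFDerivAt
  have h2 : HasMFDerivAt (𝓡 (2 * n)) (𝓡 n) S.μ (c.pt b θ) (dproj n S.μ (c.pt b θ)) :=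
    ((S.fibration.smooth _).mdifferentiableAt (by simp)).hasMFDerivAt
  have h0 : HasMFDerivAt 𝓘(ℝ, Euc n) 𝓘(ℝ, Euc n × Euc n) (fun θ : Euc n ↦ (c.x b, θ)) θ
      (ContinuousLinearMap.inr ℝ (Euc n) (Euc n)) :=
    (hasFDerivAt_prodMk_right (c.x b) θ).hasMFDerivAt
  have h3 : HasMFDerivAt 𝓘(ℝ, Euc n) (𝓡 n) (S.μ ∘ c.pt b) θ
      ((dproj n S.μ (c.pt b θ)).comp ((c.dΨ (c.x b) θ).comp
        (ContinuousLinearMap.inr ℝ (Euc n) (Euc n)))) :=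
    HasMFDerivAt.comp (f := c.pt b) θ h2 (HasMFDerivAt.comp θ h1 h0)
  have h4 : S.μ ∘ c.pt b = fun _ ↦ b := by
    funext θ; exact proj_pt hb θ
  rw [h4] at h3
  have h5 := hasMFDerivAt_unique h3 (hasMFDerivAt_const b θ)
  exact congrArg (fun A : Euc n →L[ℝ] Euc n ↦ A w) h5

theorem exists_vert {c : S.Chart} {b : B} (hb : b ∈ c.V) (θ : Euc n)
    (Y : TangentSpace (𝓡 (2 * n)) (c.pt b θ)) (hY : dproj n S.μ (c.pt b θ) Y = 0) :
    ∃ w, c.vert b θ w = Y := by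
  have hξ := mem_image_of_mem c.x hb
  have hinj : Function.Injective (c.dΨ (c.x b) θ) := by
    rw [injective_iff_map_eq_zero]
    intro v hv
    have key : ∀ w : Euc n × Euc n, ∑ i, (v.1 i * w.2 i - w.1 i * v.2 i) = 0 := by
      intro w
      rw [← c.symplectic _ hξ θ v w]
      exact (S.Ω _).map_coord_zero 0 hv
    have h1 : v.1 = 0 := by
      ext i
      simpa using key (0, EuclideanSpace.single i 1)
    have h2 : v.2 = 0 := by
      ext i
      simpa using key (EuclideanSpace.single i 1, 0)
    exact Prod.ext h1 h2
  have hsurj : Function.Surjective (c.dΨ (c.x b) θ) := by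
    have hdim : Module.finrank ℝ (Euc n × Euc n) =
        Module.finrank ℝ (TangentSpace (𝓡 (2 * n)) (c.Ψ (c.x b, θ))) := by
      have : Module.finrank ℝ (TangentSpace (𝓡 (2 * n)) (c.Ψ (c.x b, θ))) = 2 * n :=
        finrank_euclideanSpace_fin
      rw [this, Module.finrank_prod, finrank_euclideanSpace_fin, two_mul]
    have : FiniteDimensional ℝ (TangentSpace (𝓡 (2 * n)) (c.Ψ (c.x b, θ))) :=
      inferInstanceAs (FiniteDimensional ℝ (Euc (2 * n)))
    exact (LinearMap.injective_iff_surjective_of_finrank_eq_finrank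
      (f := (c.dΨ (c.x b) θ).toLinearMap) hdim).1 hinj
  obtain ⟨⟨a, w⟩, haw⟩ := hsurj Y
  have ha : a = 0 := by
    ext i
    have h := S.fibration.lagrangian _ _ _ hY (dproj_vert hb θ (EuclideanSpace.single i 1))
    rw [← haw] at h
    have h' := (c.symplectic _ hξ θ (a, w) (0, EuclideanSpace.single i 1)).symm.trans h
    simpa using h'
  exact ⟨w, by rw [← haw, ha]⟩

end ChartFacts

section Hilbert

variable [VectorBundle ℂ ℂ L] [ContMDiffVectorBundle ∞ ℂ L (𝓡 (2 * n))]

section LineBundle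

variable (L)

theorem finrank_fiber (p : X) : Module.finrank ℂ (L p) = 1 := by
  have e := (trivializationAt ℂ L p).linearEquivAt ℂ p (mem_baseSet_trivializationAt ℂ L p)
  rw [e.finrank_eq, Module.finrank_self]

theorem exists_unitVec (p : X) : ∃ e : L p, ‖e‖ = 1 := by
  have : Nontrivial (L p) :=
    Module.nontrivial_of_finrank_pos (R := ℂ) (by rw [finrank_fiber]; exact one_pos)
  exact exists_norm_eq (L p) zero_le_one

/-- A choice of a unit vector of `L_p`. -/
def unitVec (p : X) : L p := (exists_unitVec L p).choose

theorem norm_unitVec (p : X) : ‖unitVec L p‖ = 1 := (exists_unitVec L p).choose_spec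

theorem exists_smul_unitVec (p : X) (e : L p) : ∃ a : ℂ, a • unitVec L p = e := by
  have h0 : unitVec L p ≠ 0 := by
    intro h
    have := norm_unitVec L p
    rw [h, norm_zero] at this
    exact zero_ne_one this
  exact (finrank_eq_one_iff_of_nonzero' _ h0).1 (finrank_fiber L p) e

theorem exists_localSection (p : X) : ∃ s : ∀ q, L q, ∀ᶠ q in 𝓝 p,
    SmoothSectionAt n s q ∧ s q ≠ 0 := by
  let t := trivializationAt ℂ L p
  refine ⟨t.localFrame Complex.basisOneI 0, ?_⟩
  filter_upwards [t.open_baseSet.mem_nhds (mem_baseSet_trivializationAt ℂ L p)] with q hq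
  refine ⟨contMDiffAt_localFrame_of_mem ∞ t Complex.basisOneI 0 hq, ?_⟩
  rw [t.localFrame_apply_of_mem_baseSet Complex.basisOneI hq]
  exact (t.basisAt Complex.basisOneI hq).ne_zero 0

end LineBundle

variable {S} {k : ℕ} {b : B}

/-- The pointwise hermitian product of two elements of `L_p^{⊗k} ⊗ |Λ|^{1/2} (ker dμ_p)`, which is a
density on `ker dμ_p`, evaluated on the frame `v`. -/
def pairing {p : X} (τ τ' : L p → (Fin n → TangentSpace (𝓡 (2 * n)) p) → ℂ)
    (v : Fin n → TangentSpace (𝓡 (2 * n)) p) : ℂ :=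
  starRingEnd ℂ (τ (unitVec L p) v) * τ' (unitVec L p) v

theorem pairing_eq (τ τ' : S.FiberSpace k b) {p : X} {e : L p} (he : e ≠ 0)
    (v : Fin n → TangentSpace (𝓡 (2 * n)) p) :
    pairing (τ.1 p) (τ'.1 p) v =
      starRingEnd ℂ (τ.1 p e v) * τ'.1 p e v * ((‖e‖ ^ 2 : ℝ) : ℂ) ^ k := by
  obtain ⟨a, ha⟩ := exists_smul_unitVec L p e
  have ha0 : a ≠ 0 := by
    rintro rfl
    exact he (by rw [← ha, zero_smul])
  have hn : ‖e‖ = ‖a‖ := by rw [← ha, norm_smul, norm_unitVec, mul_one]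
  rw [hn, ← ha, τ.2.2.2.2.1 p _ v a ha0, τ'.2.2.2.2.1 p _ v a ha0, pairing, map_mul, map_inv₀,
    map_pow]
  push_cast
  rw [← Complex.conj_mul', mul_pow]
  have h1 : (starRingEnd ℂ a) ^ k ≠ 0 := pow_ne_zero _ (by simpa using ha0)
  have h2 : a ^ k ≠ 0 := pow_ne_zero _ ha0
  field_simp

theorem continuous_pairing (τ τ' : S.FiberSpace k b) {c : S.Chart} (hb : b ∈ c.V) :
    Continuous fun θ ↦ pairing (τ.1 (c.pt b θ)) (τ'.1 (c.pt b θ)) (c.frame b θ) := by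
  rw [continuous_iff_continuousAt]
  intro θ₀
  obtain ⟨s, hs⟩ := exists_localSection (n := n) L (c.pt b θ₀)
  have hpt : ContinuousAt (c.pt b) θ₀ := (continuous_pt c hb).continuousAt
  have hev := hpt.eventually hs
  have hs₀ := hs.self_of_nhds
  obtain ⟨D, hD, -⟩ := τ.2.2.2.2.2.2 c hb θ₀ s hs₀.1 hs₀.2
  obtain ⟨D', hD', -⟩ := τ'.2.2.2.2.2.2 c hb θ₀ s hs₀.1 hs₀.2
  have hnorm : ContinuousAt (fun θ ↦ ‖s (c.pt b θ)‖ ^ 2) θ₀ := by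
    have h := (S.prequantum.smooth_metric s s _ hs₀.1 hs₀.1).continuousAt
    have h' := Complex.continuous_re.continuousAt.comp (ContinuousAt.comp (f := c.pt b) h hpt)
    refine h'.congr (Filter.Eventually.of_forall fun θ ↦ ?_)
    exact inner_self_eq_norm_sq (𝕜 := ℂ) (s (c.pt b θ))
  have hmain := ((Complex.continuous_conj.continuousAt.comp hD.continuousAt).mul
    hD'.continuousAt).mul ((Complex.continuous_ofReal.continuousAt.comp hnorm).pow k)
  refine hmain.congr ?_
  filter_upwards [hev] with θ hθ
  exact (pairing_eq τ τ' hθ.2 _).symm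

theorem integrableOn_pairing (τ τ' : S.FiberSpace k b) {c : S.Chart} (hb : b ∈ c.V) :
    MeasureTheory.IntegrableOn
      (fun θ ↦ pairing (τ.1 (c.pt b θ)) (τ'.1 (c.pt b θ)) (c.frame b θ)) (box n) :=
  (continuous_pairing τ τ' hb).continuousOn.integrableOn_compact isCompact_box

theorem eq_zero_of_frame {τ : S.FiberSpace k b} {c : S.Chart} (hb : b ∈ c.V)
    (h : ∀ θ ∈ box n, τ.1 (c.pt b θ) (unitVec L _) (c.frame b θ) = 0) : τ = 0 := by
  refine Subtype.ext (funext fun p ↦ funext fun e ↦ funext fun v ↦ ?_)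
  change τ.1 p e v = 0
  by_cases hp : S.μ p = b
  swap
  · exact τ.2.1 p hp e v
  by_cases hv : ∃ i, dproj n S.μ p (v i) ≠ 0
  · exact τ.2.2.2.1 p e v hv
  push Not at hv
  by_cases he : e = 0
  · rw [he]; exact τ.2.2.1 p v
  obtain ⟨θ, hθ, rfl⟩ := exists_box_pt hb hp
  obtain ⟨a, rfl⟩ := exists_smul_unitVec L _ e
  have ha0 : a ≠ 0 := by
    rintro rfl
    exact he (zero_smul _ _)
  rw [τ.2.2.2.2.1 _ _ _ a ha0]
  choose w hw using fun i ↦ exists_vert hb θ (v i) (hv i)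
  have hvA : v = fun i ↦ ∑ j, (Matrix.of fun i j ↦ w i j) i j • c.frame b θ j := by
    funext i
    rw [← hw i]
    have : w i = ∑ j, w i j • EuclideanSpace.single j (1 : ℝ) := by
      ext l; simp [Finset.sum_apply, Pi.single_apply]
    have hlin : ∀ z, c.vert b θ z = ((c.dΨ (c.x b) θ).comp
      (ContinuousLinearMap.inr ℝ (Euc n) (Euc n))) z := fun _ ↦ rfl
    rw [hlin, this, map_sum]
    exact Finset.sum_congr rfl fun j _ ↦ map_smul _ _ _
  rw [hvA, τ.2.2.2.2.2.1 _ _ _ _ (fun i ↦ dproj_vert hb θ _), h θ hθ, mul_zero, mul_zero]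

theorem pairing_self {p : X} (τ : L p → (Fin n → TangentSpace (𝓡 (2 * n)) p) → ℂ)
    (v : Fin n → TangentSpace (𝓡 (2 * n)) p) :
    pairing τ τ v = ((Complex.normSq (τ (unitVec L p) v) : ℝ) : ℂ) :=
  (Complex.normSq_eq_conj_mul_self).symm

/-- The inner product of two elements of `H⁰(X_b; L^{⊗k} ⊗ |Λ|^{1/2} X_b)`: the integral over the
fibre of their pointwise hermitian product, computed in angle coordinates. -/
def fiberInner (τ τ' : S.FiberSpace k b) : ℂ :=
  ∫ θ in box n, pairing (τ.1 ((S.chartAt b).pt b θ)) (τ'.1 ((S.chartAt b).pt b θ))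
    ((S.chartAt b).frame b θ)

theorem fiberInner_self (τ : S.FiberSpace k b) :
    fiberInner τ τ = ((∫ θ in box n, Complex.normSq (τ.1 ((S.chartAt b).pt b θ) (unitVec L _)
      ((S.chartAt b).frame b θ)) : ℝ) : ℂ) := by
  simp only [fiberInner, pairing_self]
  exact integral_ofReal

/-- `H⁰(X_b; L^{⊗k} ⊗ |Λ|^{1/2} X_b)` is an inner product space. -/
abbrev fiberCore (S : Setting n X B L) (k : ℕ) (b : B) :
    InnerProductSpace.Core ℂ (S.FiberSpace k b) where
  inner := fiberInner
  conj_inner_symm τ τ' := by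
    simp only [fiberInner]
    rw [← integral_conj]
    congr 1
    funext θ
    simp [pairing, mul_comm]
  re_inner_nonneg τ := by
    rw [fiberInner_self]
    exact MeasureTheory.integral_nonneg fun θ ↦ Complex.normSq_nonneg _
  add_left τ τ' σ := by
    simp only [fiberInner]
    rw [← MeasureTheory.integral_add (integrableOn_pairing τ σ (S.mem_chartAt b))
      (integrableOn_pairing τ' σ (S.mem_chartAt b))]
    congr 1
    funext θ
    change starRingEnd ℂ (τ.1 _ _ _ + τ'.1 _ _ _) * _ = _
    simp only [pairing, map_add, add_mul]
  smul_left τ σ a := by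
    simp only [fiberInner]
    rw [← MeasureTheory.integral_const_mul]
    congr 1
    funext θ
    change starRingEnd ℂ (a * τ.1 _ _ _) * _ = _
    simp only [pairing, map_mul, mul_assoc]
  definite τ h := by
    have h' := (fiberInner_self τ).symm.trans h
    have hb := S.mem_chartAt b
    have hcont : Continuous fun θ ↦ Complex.normSq (τ.1 ((S.chartAt b).pt b θ) (unitVec L _)
        ((S.chartAt b).frame b θ)) := by
      have := Complex.continuous_re.comp (continuous_pairing τ τ hb)
      refine this.congr fun θ ↦ ?_
      simp only [Function.comp_apply, pairing_self, Complex.ofReal_re]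
    rw [Complex.ofReal_eq_zero, MeasureTheory.setIntegral_eq_zero_iff_of_nonneg_ae
      (Filter.Eventually.of_forall fun θ ↦ Complex.normSq_nonneg _)
      (hcont.continuousOn.integrableOn_compact isCompact_box)] at h'
    have hz := MeasureTheory.Measure.eqOn_of_ae_eq h' hcont.continuousOn continuousOn_const
      box_subset_closure_interior
    exact eq_zero_of_frame hb fun θ hθ ↦ Complex.normSq_eq_zero.1 (hz hθ)

instance (S : Setting n X B L) (k : ℕ) (b : B) : NormedAddCommGroup (S.FiberSpace k b) :=
  (fiberCore S k b).toNormedAddCommGroup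

instance (S : Setting n X B L) (k : ℕ) (b : B) : InnerProductSpace ℂ (S.FiberSpace k b) :=
  InnerProductSpace.ofCore (fiberCore S k b).toCore

/-- The quantum Hilbert space `⨁_{b ∈ B_k} H⁰(X_b; L^{⊗k} ⊗ |Λ|^{1/2} X_b)` (orthogonal Hilbert
direct sum). -/
abbrev QuantumSpace (S : Setting n X B L) (k : ℕ) : Type _ :=
  lp (fun b : S.bohrSommerfeld k ↦ S.FiberSpace k b) 2

end Hilbert

/-! ### Parallel transport and the quantization map -/

/-- The velocity at time `t` of a curve `ℓ : [0, 1] → X`. -/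
abbrev velocity (ℓ : ℝ → X) (t : ℝ) : TangentSpace (𝓡 (2 * n)) (ℓ t) :=
  mfderivWithin 𝓘(ℝ, ℝ) (𝓡 (2 * n)) ℓ (Icc 0 1) t (1 : ℝ)

/-- A member `U` of the covering that contains both `c` and `b`, with an affine embedding `χ` of `U`
onto a convex set. The points `c` and `b` are close if there is such a `U`. -/
structure CommonNbhd (c b : B) where
  U : Set B
  mem : U ∈ S.𝒰
  left_mem : c ∈ U
  right_mem : b ∈ U
  χ : B → Euc n
  affine : IsAffineEmbedding S.Ω S.μ U χ
  convex : Convex ℝ (χ '' U)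

variable {S} in
/-- The affine linear path `γ : [0, 1] → U` with `γ(0) = c` and `γ(1) = b`. -/
def CommonNbhd.path {c b : B} (N : S.CommonNbhd c b) (t : ℝ) : B :=
  haveI : Nonempty B := ⟨c⟩
  Function.invFunOn N.χ N.U (AffineMap.lineMap (N.χ c) (N.χ b) t)

variable {S} in
/-- Parallel transport along the path `γ` from `c` to `b` of a point `q` of the fibre over `c`, of a
vertical frame `v₀` at `q` and of a unit vector of `L_q`: `ℓ` is the `H`-horizontal lift of `γ`
that starts at `q`, `e` is a `∇`-parallel section of `L` along `ℓ`, and `v` is a frame of `ker dμ`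
along `ℓ` that is parallel for the canonical flat connection, under which the vector fields `Yⱼ`
with `Ω(·, Yⱼ) = d(χⱼ ∘ μ)` are parallel (`χ = (χ₁, …, χₙ)` being affine coordinates; these are
the vector fields `∂/∂θⱼ` if `χ` are action coordinates). -/
structure ParallelTransport {c b : B} (N : S.CommonNbhd c b) (q : X)
    (v₀ : Fin n → TangentSpace (𝓡 (2 * n)) q) where
  ℓ : ℝ → X
  smooth : ContMDiffOn 𝓘(ℝ, ℝ) (𝓡 (2 * n)) ∞ ℓ (Icc 0 1)
  proj : ∀ t ∈ Icc (0 : ℝ) 1, S.μ (ℓ t) = N.path t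
  horizontal : ∀ t ∈ Icc (0 : ℝ) 1, velocity (n := n) ℓ t ∈ S.H (ℓ t)
  start : ℓ 0 = q
  e : ∀ t, L (ℓ t)
  norm_e : ‖e 0‖ = 1
  parallel_e : ∀ t ∈ Icc (0 : ℝ) 1, ∀ s : ∀ p, L p,
    SmoothSectionAt n s (ℓ t) → s (ℓ t) ≠ 0 → ∃ (a : ℝ → ℂ) (a' : ℂ),
      (∀ᶠ r in 𝓝[Icc 0 1] t, e r = a r • s (ℓ r)) ∧ HasDerivWithinAt a a' (Icc 0 1) t ∧
      a' • s (ℓ t) + a t • S.conn s (ℓ t) (velocity ℓ t) = 0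
  v : ∀ t, Fin n → TangentSpace (𝓡 (2 * n)) (ℓ t)
  start_v : ∀ i, (⟨ℓ 0, v 0 i⟩ : TangentBundle (𝓡 (2 * n)) X) = ⟨q, v₀ i⟩
  parallel_v : ∃ M : Matrix (Fin n) (Fin n) ℝ, ∀ t ∈ Icc (0 : ℝ) 1, ∀ i,
    ∀ Y : TangentSpace (𝓡 (2 * n)) (ℓ t),
      S.Ω (ℓ t) ![Y, v t i] = ∑ j, M i j * mvfderiv (𝓡 (2 * n)) (fun p ↦ N.χ (S.μ p) j) (ℓ t) Y

section Quantization

variable [VectorBundle ℂ ℂ L] [ContMDiffVectorBundle ∞ ℂ L (𝓡 (2 * n))] {S} {k : ℕ}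

/-- The integrand of `⟨ψ, f ξ⟩_γ` for `ψ`, `ξ` over the fibres `X_b`, `X_c` and `γ` the affine path
from `c` to `b`: at a point `q` of `X_c` it is the hermitian product of the parallel transport of
`ψ` to `X_c` with `f ξ`, where the values of `f` are those on the fibre over the midpoint of `γ`,
also transported to `X_c`; a density on the vertical tangent space, evaluated on `v₀`. -/
def transportPairing (f : X → ℂ) {c b : B} (N : S.CommonNbhd c b) (ψ : S.FiberSpace k b)
    (ξ : S.FiberSpace k c) (q : X) (v₀ : Fin n → TangentSpace (𝓡 (2 * n)) q) : ℂ :=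
  open Classical in
  if h : Nonempty (ParallelTransport N q v₀) then
    let T := Classical.choice h
    starRingEnd ℂ (ψ.1 (T.ℓ 1) (T.e 1) (T.v 1)) *
      (f (T.ℓ (1 / 2)) * ξ.1 (T.ℓ 0) (T.e 0) (T.v 0))
  else 0

/-- `⟨ψ, f|_{X_{(b + c)/2}} ξ⟩_𝒰` if `b` and `c` are close, and `0` otherwise. -/
def matrixCoeff (f : X → ℂ) {c b : B} (ψ : S.FiberSpace k b) (ξ : S.FiberSpace k c) : ℂ :=
  open Classical in
  if h : Nonempty (S.CommonNbhd c b) then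
    ∫ θ in box n, transportPairing f (Classical.choice h) ψ ξ
      ((S.chartAt c).pt c θ) ((S.chartAt c).frame c θ)
  else 0

/-- The bounded operator `T` is `φᵏ(f)`: for `ξ` in the summand of `c ∈ B_k`,
`T ξ = ∑ ⟨ψ_b, f|_{X_{(b + c)/2}} ξ⟩_𝒰 ψ_b`, where the sum is over the `b ∈ B_k` close to `c` and
`ψ_b` is any unit vector of the summand of `b`. -/
def IsQuantization (S : Setting n X B L) (k : ℕ) (f : X → ℂ)
    (T : S.QuantumSpace k →L[ℂ] S.QuantumSpace k) : Prop :=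
  ∀ (c b : S.bohrSommerfeld k) (ξ : S.FiberSpace k c) (ψ : S.FiberSpace k b), ‖ψ‖ = 1 →
    open Classical in
    T (lp.single 2 c ξ) b = matrixCoeff f ψ ξ • ψ

/-- The operator `φᵏ(f) = φᵏ_{H, 𝒰}(f)` on the quantum Hilbert space. -/
def phi (S : Setting n X B L) (k : ℕ) (f : X → ℂ) : S.QuantumSpace k →L[ℂ] S.QuantumSpace k :=
  open Classical in
  if h : ∃ T, S.IsQuantization k f T then h.choose else 0

end Quantization

end Setting

end LagrangianQuantization

end

/-!
The operators are finite matrices whose entries are Fourier coefficients of the observable on tori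
over midpoints, and the product formula is a first order Taylor expansion of a convolution.

**Geometry.** The change of action coordinates is integral affine, and the angles change by the
inverse transpose and a translation (`exists_fiberTransition`). Over a convex set of action
coordinates `ξ` the curvature condition and the Poincaré lemma give a unit section `E` of `L` along
the coordinates `(ξ, θ)` with `∇E = -i ∑ ξⱼ dθⱼ ⊗ E` (`exists_normal`); its translates by the
lattice `(2πℤ)ⁿ` differ from it by constant phases. The distribution `H` is the graph of a linear
map that depends on `ξ` only. Such data are called a gauge (`exists_gauge`). In a gauge a parallel
half-form over the fibre at `ξ` is a multiple of `exp (i k ⟨ξ, θ⟩)`. Hence the spaces of parallel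
half-forms are at most one-dimensional, and the Bohr-Sommerfeld points in the domain of a gauge are
all points of a translate of `k⁻¹ ℤⁿ` (`Gauge.exists_int_of_bohrSommerfeld`,
`Gauge.bohrSommerfeld_of_int`).

**Matrix coefficients.** Parallel transport along an affine segment is unique and commutes with
translations of the fibres (`ParallelTransport.x_eq`, `ParallelTransport.exists_shift`), up to the
phases of the gauge. If `Δ` is the difference of the action coordinates of `b` and `c`, the
integrand of `⟨ψ_b, f ξ⟩` is therefore a constant multiple of `exp (-i k ⟨Δ, θ⟩) f` as a function on
the fibre over `(b + c) / 2`, and the matrix coefficient is a constant times the Fourier coefficient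
of `f` on this fibre at `p = k Δ ∈ ℤⁿ` (`ParallelTransport.integral_transportPairing`,
`exists_matrixCoeff_eq`). For `b` and `c` near each other the constant is computed by integrating
along the segment. If the angles are normalised at the midpoint, the first two orders of the phase
vanish by symmetry: the phase is `O(k ‖Δ‖³) = O(k⁻² ‖p‖³)` (`abs_phase_le`,
`exists_gauge_matrixCoeff`). This is why the midpoint occurs in the definition of `φᵏ`.

**The product formula.** Write `F_p(ξ)` and `G_q(ξ)` for the Fourier coefficients of `f` and `g` on
the fibre at `ξ`. The entry at `(a, c)` of the product of the matrices is, up to phases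
`1 + O(k⁻²)`, the sum over `p + q = s = k (a - c)` of `F_p(m + q / 2k) G_q(m - p / 2k)` with
`m = (a + c) / 2`, because `b = a - p / k` is the intermediate point. By Taylor's formula it is
`∑ F_p G_q + (1 / 2k) ∑ (∂_q F_p G_q - F_p ∂_p G_q)` at `m` up to `O(k⁻²)`, and since multiplication
of the Fourier coefficients by `i p` is differentiation in `θ`, this is the Fourier coefficient at
`s` of `f g + (-i / 2k) {f, g}` (`Family.hasSum_jet`, `Family.exists_product_bound`,
`exists_near_bound`). The rapid decay of the Fourier coefficients makes the bounds summable in `s`.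

**The operator norm.** Only the fibres over a compact set contribute, and there are `O(kⁿ)` of them
(`exists_ncard_bound`), so that `φᵏ(f)` exists as the operator of a finite matrix
(`isQuantization_matOp`) and is determined by it (`IsQuantization.unique`). Away from the diagonal
the entries decay faster than any power of `k` (`exists_far_bound`). Schur's test
(`norm_matOp_le`) then bounds the norm of the remainder by sums of rows and columns, which are
`O(k⁻²)` (`exists_remainder_bound`).
-/

open scoped Manifold ContDiff Topology
open Bundle Set

noncomputable section

set_option linter.unusedSectionVars false

namespace LagrangianQuantization

namespace Setting

variable {n : ℕ} {X : Type*} [TopologicalSpace X] [ChartedSpace (Euc (2 * n)) X]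
  [IsManifold (𝓡 (2 * n)) ∞ X]
  {B : Type*} [TopologicalSpace B] [ChartedSpace (Euc n) B]
  {L : X → Type*} [∀ p, NormedAddCommGroup (L p)] [∀ p, InnerProductSpace ℂ (L p)]
  [TopologicalSpace (TotalSpace ℂ L)] [FiberBundle ℂ L] [VectorBundle ℝ ℂ L]
  {S : Setting n X B L}

/-! ### Action-angle charts as local diffeomorphisms -/

theorem eventually_comp_of_continuousAt {α β : Type*} [TopologicalSpace α] [TopologicalSpace β]
    {f : α → β} {a : α} {b : β} (hf : ContinuousAt f a) (hb : f a = b) {P : β → Prop}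
    (hP : ∀ᶠ z in 𝓝 b, P z) : ∀ᶠ x in 𝓝 a, P (f x) := by
  subst hb
  exact hf.tendsto.eventually hP

theorem isOpen_chartDomain (c : S.Chart) : IsOpen ((c.x '' c.V) ×ˢ (univ : Set (Euc n))) :=
  c.isOpen_image.prod isOpen_univ

theorem contMDiffAt_Ψ (c : S.Chart) {y : Euc n × Euc n} (hy : y.1 ∈ c.x '' c.V) :
    ContMDiffAt 𝓘(ℝ, Euc n × Euc n) (𝓡 (2 * n)) ∞ c.Ψ y :=
  c.smooth.contMDiffAt ((isOpen_chartDomain c).mem_nhds ⟨hy, mem_univ _⟩)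

theorem hasMFDerivAt_Ψ (c : S.Chart) {y : Euc n × Euc n} (hy : y.1 ∈ c.x '' c.V) :
    HasMFDerivAt 𝓘(ℝ, Euc n × Euc n) (𝓡 (2 * n)) c.Ψ y (c.dΨ y.1 y.2) :=
  ((contMDiffAt_Ψ c hy).mdifferentiableAt (by simp)).hasMFDerivAt

theorem eventually_mem_chartDomain (c : S.Chart) {y : Euc n × Euc n} (hy : y.1 ∈ c.x '' c.V) :
    ∀ᶠ z in 𝓝 y, z.1 ∈ c.x '' c.V :=
  continuous_fst.continuousAt.eventually (c.isOpen_image.mem_nhds hy)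

theorem bijective_dΨ (c : S.Chart) {y : Euc n × Euc n} (hy : y.1 ∈ c.x '' c.V) :
    Function.Bijective (c.dΨ y.1 y.2) := by
  have hinj : Function.Injective (c.dΨ y.1 y.2) := by
    rw [injective_iff_map_eq_zero]
    intro v hv
    have key : ∀ w : Euc n × Euc n, ∑ i, (v.1 i * w.2 i - w.1 i * v.2 i) = 0 := by
      intro w
      rw [← c.symplectic _ hy y.2 v w]
      exact (S.Ω _).map_coord_zero 0 hv
    have h1 : v.1 = 0 := by
      ext i
      simpa using key (0, EuclideanSpace.single i 1)
    have h2 : v.2 = 0 := by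
      ext i
      simpa using key (EuclideanSpace.single i 1, 0)
    exact Prod.ext h1 h2
  refine ⟨hinj, ?_⟩
  have hdim : Module.finrank ℝ (Euc n × Euc n) =
      Module.finrank ℝ (TangentSpace (𝓡 (2 * n)) (c.Ψ (y.1, y.2))) := by
    have : Module.finrank ℝ (TangentSpace (𝓡 (2 * n)) (c.Ψ (y.1, y.2))) = 2 * n :=
      finrank_euclideanSpace_fin
    rw [this, Module.finrank_prod, finrank_euclideanSpace_fin, two_mul]
  have : FiniteDimensional ℝ (TangentSpace (𝓡 (2 * n)) (c.Ψ (y.1, y.2))) :=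
    inferInstanceAs (FiniteDimensional ℝ (Euc (2 * n)))
  exact (LinearMap.injective_iff_surjective_of_finrank_eq_finrank
    (f := (c.dΨ y.1 y.2).toLinearMap) hdim).1 hinj

/-- The inverse function theorem for an action-angle chart. -/
theorem exists_localInverse (c : S.Chart) {y : Euc n × Euc n} (hy : y.1 ∈ c.x '' c.V) :
    ∃ Φ : X → Euc n × Euc n,
      (∀ᶠ p in 𝓝 (c.Ψ y), ContMDiffAt (𝓡 (2 * n)) 𝓘(ℝ, Euc n × Euc n) ∞ Φ p) ∧
      (∀ᶠ z in 𝓝 y, Φ (c.Ψ z) = z) ∧ ∀ᶠ p in 𝓝 (c.Ψ y), c.Ψ (Φ p) = p := by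
  let φ : X → Euc (2 * n) := extChartAt (𝓡 (2 * n)) (c.Ψ y)
  let g : Euc n × Euc n → Euc (2 * n) := φ ∘ c.Ψ
  have hsrc : ∀ᶠ p in 𝓝 (c.Ψ y), p ∈ (extChartAt (𝓡 (2 * n)) (c.Ψ y)).source :=
    extChartAt_source_mem_nhds _
  have hφ : ∀ p ∈ (extChartAt (𝓡 (2 * n)) (c.Ψ y)).source,
      ContMDiffAt (𝓡 (2 * n)) 𝓘(ℝ, Euc (2 * n)) ∞ φ p := fun p hp ↦
    contMDiffAt_extChartAt' (by rwa [extChartAt_source] at hp)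
  have hcont : ContinuousAt c.Ψ y := (contMDiffAt_Ψ c hy).continuousAt
  have hg : ∀ z : Euc n × Euc n, z.1 ∈ c.x '' c.V →
      c.Ψ z ∈ (extChartAt (𝓡 (2 * n)) (c.Ψ y)).source →
      ContDiffAt ℝ ∞ g z ∧ ∃ g' : (Euc n × Euc n) ≃L[ℝ] Euc (2 * n),
        HasFDerivAt g (g' : Euc n × Euc n →L[ℝ] Euc (2 * n)) z := by
    intro z hz hzs
    refine ⟨((hφ _ hzs).comp z (contMDiffAt_Ψ c hz)).contDiffAt, ?_⟩
    have hd : HasMFDerivAt 𝓘(ℝ, Euc n × Euc n) 𝓘(ℝ, Euc (2 * n)) g z _ :=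
      (((hφ _ hzs).mdifferentiableAt (by simp)).hasMFDerivAt).comp z (hasMFDerivAt_Ψ c hz)
    obtain ⟨e, he⟩ := isInvertible_mfderiv_extChartAt (I := 𝓡 (2 * n)) hzs
    have hbij : Function.Bijective ((mfderiv (𝓡 (2 * n)) 𝓘(ℝ, Euc (2 * n)) φ (c.Ψ z)).comp
        (c.dΨ z.1 z.2)) := by
      have h1 : Function.Bijective (mfderiv (𝓡 (2 * n)) 𝓘(ℝ, Euc (2 * n)) φ (c.Ψ z)) := by
        rw [show mfderiv (𝓡 (2 * n)) 𝓘(ℝ, Euc (2 * n)) φ (c.Ψ z) = e from he.symm]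
        exact e.bijective
      exact h1.comp (bijective_dΨ c hz)
    let D : (Euc n × Euc n) →L[ℝ] Euc (2 * n) :=
      (mfderiv (𝓡 (2 * n)) 𝓘(ℝ, Euc (2 * n)) φ (c.Ψ z)).comp (c.dΨ z.1 z.2)
    refine ⟨ContinuousLinearEquiv.ofBijective D
      (LinearMap.ker_eq_bot.2 hbij.1) (LinearMap.range_eq_top.2 hbij.2), ?_⟩
    exact hd.hasFDerivAt
  have hy0 := hg y hy hsrc.self_of_nhds
  obtain ⟨hgy, g', hg'⟩ := hy0
  let F := hgy.toOpenPartialHomeomorph g hg' (by simp)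
  have hFy : y ∈ F.source := hgy.mem_toOpenPartialHomeomorph_source hg' (by simp)
  have hcoe : ⇑F = g := rfl
  refine ⟨fun p ↦ F.symm (φ p), ?_, ?_, ?_⟩
  · have hev : ∀ᶠ z in 𝓝 y, z.1 ∈ c.x '' c.V ∧
        c.Ψ z ∈ (extChartAt (𝓡 (2 * n)) (c.Ψ y)).source :=
      (eventually_mem_chartDomain c hy).and (hcont.eventually hsrc)
    have hφc : ContinuousAt φ (c.Ψ y) := (hφ _ hsrc.self_of_nhds).continuousAt
    have hFc : ContinuousAt F.symm (φ (c.Ψ y)) :=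
      F.continuousAt_symm (x := g y) (F.map_source hFy)
    have hFyy : F.symm (φ (c.Ψ y)) = y := F.left_inv hFy
    have hev' : ∀ᶠ p in 𝓝 (c.Ψ y), (F.symm (φ p)).1 ∈ c.x '' c.V ∧
        c.Ψ (F.symm (φ p)) ∈ (extChartAt (𝓡 (2 * n)) (c.Ψ y)).source := by
      have hc2 : ContinuousAt (fun p ↦ F.symm (φ p)) (c.Ψ y) := hFc.comp hφc
      exact eventually_comp_of_continuousAt hc2 hFyy hev
    have htgt : ∀ᶠ p in 𝓝 (c.Ψ y), φ p ∈ F.target :=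
      hφc.eventually (F.open_target.mem_nhds (F.map_source hFy))
    filter_upwards [hev', htgt, hsrc] with p hp hpt hps
    obtain ⟨h1, e, h2⟩ := hg _ hp.1 hp.2
    have h3 : ContDiffAt ℝ ∞ F.symm (φ p) := F.contDiffAt_symm hpt h2 h1
    exact h3.contMDiffAt.comp p (hφ p hps)
  · filter_upwards [F.open_source.mem_nhds hFy] with z hz
    exact F.left_inv hz
  · have hφc : ContinuousAt φ (c.Ψ y) := (hφ _ hsrc.self_of_nhds).continuousAt
    have htgt : ∀ᶠ p in 𝓝 (c.Ψ y), φ p ∈ F.target :=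
      hφc.eventually (F.open_target.mem_nhds (F.map_source hFy))
    have hFc : ContinuousAt (fun p ↦ F.symm (φ p)) (c.Ψ y) :=
      ContinuousAt.comp (g := F.symm) (F.continuousAt_symm (x := g y) (F.map_source hFy)) hφc
    have hFyy : F.symm (φ (c.Ψ y)) = y := F.left_inv hFy
    have hsrc2 : ∀ᶠ p in 𝓝 (c.Ψ y), c.Ψ (F.symm (φ p)) ∈
        (extChartAt (𝓡 (2 * n)) (c.Ψ y)).source :=
      eventually_comp_of_continuousAt hFc hFyy (hcont.eventually hsrc)
    filter_upwards [htgt, hsrc, hsrc2] with p hp hps hps2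
    have h := F.right_inv hp
    exact (extChartAt (𝓡 (2 * n)) (c.Ψ y)).injOn hps2 hps h

/-- The base point with action coordinate `ξ`. -/
def base (c : S.Chart) (ξ : Euc n) : B := S.μ (c.Ψ (ξ, 0))

theorem base_mem {c : S.Chart} {ξ : Euc n} (hξ : ξ ∈ c.x '' c.V) : base c ξ ∈ c.V :=
  c.proj_mem ξ hξ 0

theorem x_base {c : S.Chart} {ξ : Euc n} (hξ : ξ ∈ c.x '' c.V) : c.x (base c ξ) = ξ :=
  c.x_proj ξ hξ 0

theorem base_x {c : S.Chart} {b : B} (hb : b ∈ c.V) : base c (c.x b) = b :=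
  c.injOn_x (base_mem (mem_image_of_mem _ hb)) hb (x_base (mem_image_of_mem _ hb))

theorem proj_Ψ {c : S.Chart} {y : Euc n × Euc n} (hy : y.1 ∈ c.x '' c.V) :
    S.μ (c.Ψ y) = base c y.1 :=
  c.injOn_x (c.proj_mem _ hy y.2) (base_mem hy) ((c.x_proj _ hy y.2).trans (x_base hy).symm)

theorem continuousAt_base {c : S.Chart} {ξ : Euc n} (hξ : ξ ∈ c.x '' c.V) :
    ContinuousAt (base c) ξ := by
  have h1 : ContinuousAt c.Ψ (ξ, 0) := (contMDiffAt_Ψ c (y := (ξ, 0)) hξ).continuousAt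
  have h2 : ContinuousAt S.μ (c.Ψ (ξ, 0)) := S.fibration.smooth.continuous.continuousAt
  have h3 : ContinuousAt (fun ξ : Euc n ↦ c.Ψ (ξ, 0)) ξ :=
    ContinuousAt.comp (f := fun ξ : Euc n ↦ (ξ, (0 : Euc n))) h1 (by fun_prop)
  exact ContinuousAt.comp (g := S.μ) h2 h3

theorem isOpen_of_isOpen_preimage {O : Set B} (h : IsOpen (S.μ ⁻¹' O)) : IsOpen O := by
  have hsurj : Function.Surjective S.μ := fun b ↦ (S.fibration.connected b).nonempty
  have hq := S.fibration.proper.isClosedMap.isQuotientMap S.fibration.smooth.continuous hsurj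
  exact hq.isOpen_preimage.1 h

theorem isOpen_image_Ψ (c : S.Chart) {O : Set (Euc n × Euc n)} (hO : IsOpen O)
    (hsub : ∀ y ∈ O, y.1 ∈ c.x '' c.V) : IsOpen (c.Ψ '' O) := by
  rw [isOpen_iff_mem_nhds]
  rintro _ ⟨y, hy, rfl⟩
  obtain ⟨Φ, h1, h2, h3⟩ := exists_localInverse c (hsub y hy)
  have hc : ContinuousAt Φ (c.Ψ y) := h1.self_of_nhds.continuousAt
  have hy' : Φ (c.Ψ y) = y := h2.self_of_nhds
  have : ∀ᶠ p in 𝓝 (c.Ψ y), Φ p ∈ O := hc.eventually (by rw [hy']; exact hO.mem_nhds hy)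
  filter_upwards [this, h3] with p hp hp'
  exact ⟨Φ p, hp, hp'⟩

/-- The set of points of the chart with action coordinates in an open set is open. -/
theorem isOpen_inter_preimage_x (c : S.Chart) {O : Set (Euc n)} (hO : IsOpen O) :
    IsOpen (c.V ∩ c.x ⁻¹' O) := by
  refine isOpen_of_isOpen_preimage (S := S) ?_
  have : S.μ ⁻¹' (c.V ∩ c.x ⁻¹' O) = c.Ψ '' ((O ∩ c.x '' c.V) ×ˢ univ) := by
    ext p
    constructor
    · rintro ⟨h1, h2⟩
      obtain ⟨θ, hθ⟩ := c.surjective p h1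
      exact ⟨(c.x (S.μ p), θ), ⟨⟨h2, mem_image_of_mem _ h1⟩, mem_univ _⟩, hθ⟩
    · rintro ⟨⟨ξ, θ⟩, ⟨⟨h1, h2⟩, -⟩, rfl⟩
      exact ⟨c.proj_mem ξ h2 θ, by rw [mem_preimage, c.x_proj ξ h2 θ]; exact h1⟩
  rw [this]
  exact isOpen_image_Ψ c ((hO.inter c.isOpen_image).prod isOpen_univ) fun y hy ↦ hy.1.2

theorem continuousAt_x {c : S.Chart} {b : B} (hb : b ∈ c.V) : ContinuousAt c.x b := by
  rw [ContinuousAt, tendsto_nhds]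
  intro O hO hbO
  exact Filter.mem_of_superset ((isOpen_inter_preimage_x c hO).mem_nhds ⟨hb, hbO⟩)
    inter_subset_right

/-- The derivative of an action-angle chart in terms of the action coordinates. -/
theorem hasMFDerivAt_Ψ_eventuallyEq {c c' : S.Chart} {y y' : Euc n × Euc n}
    (hy' : y'.1 ∈ c'.x '' c'.V) {F : Euc n × Euc n → Euc n × Euc n}
    (hF : DifferentiableAt ℝ F y) (hFy : F y = y') (h : ∀ᶠ z in 𝓝 y, c'.Ψ (F z) = c.Ψ z)
    (v : Euc n × Euc n) :
    (c.dΨ y.1 y.2 v : Euc (2 * n)) = c'.dΨ y'.1 y'.2 (fderiv ℝ F y v) := by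
  subst hFy
  have h1 := (hasMFDerivAt_Ψ c' hy').comp y hF.hasFDerivAt.hasMFDerivAt
  have h2 : HasMFDerivAt 𝓘(ℝ, Euc n × Euc n) (𝓡 (2 * n)) c.Ψ y
      ((c'.dΨ (F y).1 (F y).2).comp (fderiv ℝ F y)) :=
    h1.congr_of_eventuallyEq (h.mono fun z hz ↦ hz.symm)
  have h3 := h2.mfderiv
  exact congrArg (fun A : Euc n × Euc n →L[ℝ] Euc (2 * n) ↦ A v) h3

/-! ### Transition between action-angle charts -/

/-- A predicate whose truth value is locally constant on a preconnected set holds everywhere on it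
if it holds at one point. -/
theorem IsPreconnected.of_locally_iff {I : Set ℝ} (hI : IsPreconnected I) {P : ℝ → Prop}
    (h : ∀ t ∈ I, ∀ᶠ s in 𝓝[I] t, (P s ↔ P t)) {a b : ℝ} (ha : a ∈ I) (hb : b ∈ I) (hP : P a) :
    P b := by
  refine (hI.induction₂ (fun x y ↦ P x ↔ P y) (fun t ht ↦ ?_) (fun x y z _ _ _ h1 h2 ↦ h1.trans h2)
    (fun x y _ _ h ↦ h.symm) ha hb).1 hP
  filter_upwards [h t ht] with s hs
  exact hs.symm

theorem sum_symplectic (v w : Euc n × Euc n) :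
    ∑ i, (v.1 i * w.2 i - w.1 i * v.2 i) = inner ℝ v.1 w.2 - inner ℝ w.1 v.2 := by
  simp only [PiLp.inner_apply, RCLike.inner_apply, conj_trivial, Finset.sum_sub_distrib]
  congr 1 <;> exact Finset.sum_congr rfl fun i _ ↦ mul_comm _ _

/-- At a common point of two action-angle charts, one chart is expressed through the other by a
fibre-preserving local symplectomorphism. -/
theorem exists_local_transition {c c' : S.Chart} {y y' : Euc n × Euc n} (hy : y.1 ∈ c.x '' c.V)
    (hy' : y'.1 ∈ c'.x '' c'.V) (h : c.Ψ y = c'.Ψ y') :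
    ∃ F : Euc n × Euc n → Euc n × Euc n, F y = y' ∧ (∀ᶠ z in 𝓝 y, ContDiffAt ℝ ∞ F z) ∧
      (∀ᶠ z in 𝓝 y, (F z).1 ∈ c'.x '' c'.V) ∧
      (∀ᶠ z in 𝓝 y, c'.Ψ (F z) = c.Ψ z) ∧ ∀ᶠ z in 𝓝 y, (F z).1 = c'.x (base c z.1) := by
  obtain ⟨Φ, h1, h2, h3⟩ := exists_localInverse c' hy'
  rw [← h] at h1 h3
  have hc := (contMDiffAt_Ψ c hy).continuousAt
  have hF : Φ (c.Ψ y) = y' := by rw [h]; exact h2.self_of_nhds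
  have hFc : ContinuousAt (fun z ↦ Φ (c.Ψ z)) y :=
    ContinuousAt.comp (g := Φ) h1.self_of_nhds.continuousAt hc
  have hdom := eventually_comp_of_continuousAt hFc hF (eventually_mem_chartDomain c' hy')
  refine ⟨fun z ↦ Φ (c.Ψ z), hF, ?_, hdom, hc.eventually h3, ?_⟩
  · filter_upwards [hc.eventually h1, eventually_mem_chartDomain c hy] with z hz hz'
    exact (hz.comp z (contMDiffAt_Ψ c hz')).contDiffAt
  · filter_upwards [hc.eventually h3, eventually_mem_chartDomain c hy, hdom] with z hz hz' hz''
    rw [← proj_Ψ hz']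
    exact (c'.x_proj _ hz'' _).symm.trans (congrArg (fun p ↦ c'.x (S.μ p)) hz)

/-- The derivative of a transition between action-angle charts is symplectic: both charts pull `Ω`
back to `∑ dxᵢ ∧ dθᵢ`. -/
theorem inner_fderiv_transition {c c' : S.Chart} {y : Euc n × Euc n} (hy : y.1 ∈ c.x '' c.V)
    {F : Euc n × Euc n → Euc n × Euc n} (hF : DifferentiableAt ℝ F y)
    (hFd : (F y).1 ∈ c'.x '' c'.V) (h : ∀ᶠ z in 𝓝 y, c'.Ψ (F z) = c.Ψ z) (v w : Euc n × Euc n) :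
    inner ℝ (fderiv ℝ F y v).1 (fderiv ℝ F y w).2 - inner ℝ (fderiv ℝ F y w).1 (fderiv ℝ F y v).2 =
      inner ℝ v.1 w.2 - inner ℝ w.1 v.2 := by
  have key := hasMFDerivAt_Ψ_eventuallyEq hFd hF rfl h
  have h1 := c.symplectic _ hy y.2 v w
  have h2 := c'.symplectic _ hFd (F y).2 (fderiv ℝ F y v) (fderiv ℝ F y w)
  rw [sum_symplectic] at h1 h2
  rw [← h1, ← h2]
  have hp : c'.Ψ (F y) = c.Ψ y := h.self_of_nhds
  have h3 : ∀ (p q : X) (_ : p = q) (a b : Euc (2 * n)),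
      S.Ω p ![(a : TangentSpace (𝓡 (2 * n)) p), b] = S.Ω q ![(a : TangentSpace (𝓡 (2 * n)) q), b] := by
    rintro p _ rfl a b; rfl
  have h4 := h3 _ _ hp (c.dΨ y.1 y.2 v) (c.dΨ y.1 y.2 w)
  refine Eq.trans ?_ h4
  rw [key v, key w]
  rfl

/-- In terms of the derivative `g'` of the change of action coordinates, `∑ wᵢ ∂/∂θᵢ` in the first
chart is `∑ w'ᵢ ∂/∂θ'ᵢ` in the second one if `w = g'ᵀ w'`. -/
theorem vert_eq_of_transpose {c c' : S.Chart} {y y' : Euc n × Euc n} (hy : y.1 ∈ c.x '' c.V)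
    (hy' : y'.1 ∈ c'.x '' c'.V) (h : c.Ψ y = c'.Ψ y') {G : Euc n →L[ℝ] Euc n}
    (hG : HasFDerivAt (fun ξ ↦ c'.x (base c ξ)) G y.1) {w w' : Euc n}
    (hw : ∀ v, inner ℝ (G v) w' = inner ℝ v w) :
    (c.dΨ y.1 y.2 (0, w) : Euc (2 * n)) = c'.dΨ y'.1 y'.2 (0, w') := by
  obtain ⟨F, hFy, hFs, hFd, hFΨ, hF1⟩ := exists_local_transition hy hy' h
  have hd : DifferentiableAt ℝ F y := hFs.self_of_nhds.differentiableAt (by simp)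
  have h1 : ∀ v, (fderiv ℝ F y v).1 = G v.1 := by
    intro v
    have e1 : HasFDerivAt (fun z ↦ (F z).1)
        ((ContinuousLinearMap.fst ℝ (Euc n) (Euc n)).comp (fderiv ℝ F y)) y :=
      hd.hasFDerivAt.fst
    have e2 : HasFDerivAt (fun z : Euc n × Euc n ↦ c'.x (base c z.1))
        (G.comp (ContinuousLinearMap.fst ℝ (Euc n) (Euc n))) y :=
      HasFDerivAt.comp (g := fun ξ ↦ c'.x (base c ξ)) y hG hasFDerivAt_fst
    have e3 := (e2.congr_of_eventuallyEq hF1).unique e1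
    exact (congrArg (fun A : Euc n × Euc n →L[ℝ] Euc n ↦ A v) e3).symm
  have hS := fun v w ↦ inner_fderiv_transition (v := v) (w := w) hy hd hFd.self_of_nhds hFΨ
  have h2 : ∀ v, inner ℝ (G v) (fderiv ℝ F y (0, w)).2 = inner ℝ v w := by
    intro v
    have := hS (v, 0) (0, w)
    simp only [h1] at this
    simpa using this
  have hinj : Function.Injective G := by
    rw [injective_iff_map_eq_zero]
    intro v hv
    have := hS (v, 0) (0, v)
    simp only [h1, hv] at this
    have h0 : (0 : ℝ) = ‖v‖ ^ 2 := by simpa using this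
    simpa using h0.symm
  have hsurj : Function.Surjective G :=
    (LinearMap.injective_iff_surjective (f := G.toLinearMap)).1 hinj
  have h3 : (fderiv ℝ F y (0, w)).2 = w' := by
    refine ext_inner_left ℝ fun z ↦ ?_
    obtain ⟨v, rfl⟩ := hsurj z
    rw [h2, hw]
  have h4 : fderiv ℝ F y (0, w) = (0, w') := Prod.ext (by rw [h1]; simp) h3
  rw [hasMFDerivAt_Ψ_eventuallyEq hy' hd hFy hFΨ, h4]

/-- If vertical coordinate vector fields of two charts agree along a fibre, so do the corresponding
translations. -/
theorem Ψ_add_eq_of_vert [T2Space X] {c c' : S.Chart} {y y' : Euc n × Euc n}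
    (hy : y.1 ∈ c.x '' c.V) (hy' : y'.1 ∈ c'.x '' c'.V) (h : c.Ψ y = c'.Ψ y') {w w' : Euc n}
    (hw : ∀ θ θ', c.Ψ (y.1, θ) = c'.Ψ (y'.1, θ') →
      (c.dΨ y.1 θ (0, w) : Euc (2 * n)) = c'.dΨ y'.1 θ' (0, w')) :
    c.Ψ (y.1, y.2 + w) = c'.Ψ (y'.1, y'.2 + w') := by
  have key : c.Ψ (y.1, y.2 + (1 : ℝ) • w) = c'.Ψ (y'.1, y'.2 + (1 : ℝ) • w') := by
    refine IsPreconnected.of_locally_iff (isPreconnected_univ (α := ℝ))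
      (P := fun t : ℝ ↦ c.Ψ (y.1, y.2 + t • w) = c'.Ψ (y'.1, y'.2 + t • w'))
      (fun t₀ _ ↦ ?_) (mem_univ 0) (mem_univ 1) ?_
    swap
    · simpa using h
    rw [nhdsWithin_univ]
    have hd1 : ∀ t, HasMFDerivAt 𝓘(ℝ, ℝ) (𝓡 (2 * n)) (fun t : ℝ ↦ c.Ψ (y.1, y.2 + t • w)) t
        ((c.dΨ y.1 (y.2 + t • w)).comp (ContinuousLinearMap.toSpanSingleton ℝ ((0, w) :
          Euc n × Euc n))) := by
      intro t
      have e : HasFDerivAt (fun t : ℝ ↦ (y.1, y.2 + t • w))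
          (ContinuousLinearMap.toSpanSingleton ℝ ((0, w) : Euc n × Euc n)) t := by
        have e1 : HasDerivAt (fun t : ℝ ↦ (y.1, y.2 + t • w)) (0, w) t := by
          have e2 : HasDerivAt (fun t : ℝ ↦ y.2 + t • w) w t := by
            simpa using ((hasDerivAt_id t).smul_const w).const_add y.2
          exact (hasDerivAt_const t y.1).prodMk e2
        exact e1.hasFDerivAt
      exact (hasMFDerivAt_Ψ c (y := (y.1, y.2 + t • w)) hy).comp t e.hasMFDerivAt
    have hc1 : ∀ t, ContinuousAt (fun t : ℝ ↦ c.Ψ (y.1, y.2 + t • w)) t :=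
      fun t ↦ (hd1 t).continuousAt
    have hc2 : ∀ t, ContinuousAt (fun t : ℝ ↦ c'.Ψ (y'.1, y'.2 + t • w')) t := by
      intro t
      refine ContinuousAt.comp (g := c'.Ψ) (f := fun t : ℝ ↦ (y'.1, y'.2 + t • w'))
        (contMDiffAt_Ψ c' (y := (y'.1, y'.2 + t • w')) hy').continuousAt (by fun_prop)
    by_cases hP : c.Ψ (y.1, y.2 + t₀ • w) = c'.Ψ (y'.1, y'.2 + t₀ • w')
    swap
    · have hne : {p : X × X | p.1 ≠ p.2} ∈ 𝓝 (c.Ψ (y.1, y.2 + t₀ • w), c'.Ψ (y'.1, y'.2 + t₀ • w')) :=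
        (isOpen_ne_fun continuous_fst continuous_snd).mem_nhds hP
      filter_upwards [((hc1 t₀).prodMk (hc2 t₀)).eventually hne] with t ht
      exact iff_of_false ht hP
    obtain ⟨Φ, h1, h2, h3⟩ := exists_localInverse c' (y := (y'.1, y'.2 + t₀ • w')) hy'
    rw [← hP] at h1 h3
    have hz0 : Φ (c.Ψ (y.1, y.2 + t₀ • w)) = (y'.1, y'.2 + t₀ • w') := by
      rw [hP]; exact h2.self_of_nhds
    let z : ℝ → Euc n × Euc n := fun t ↦ Φ (c.Ψ (y.1, y.2 + t • w))
    have hzc : ContinuousAt z t₀ :=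
      ContinuousAt.comp (g := Φ) h1.self_of_nhds.continuousAt (hc1 t₀)
    have hzdom := eventually_comp_of_continuousAt hzc hz0
      (eventually_mem_chartDomain c' (y := (y'.1, y'.2 + t₀ • w')) hy')
    have hz1 : ∀ t, (z t).1 ∈ c'.x '' c'.V → c'.Ψ (z t) = c.Ψ (y.1, y.2 + t • w) →
        (z t).1 = y'.1 := by
      intro t ht ht'
      have e1 : base c y.1 = base c' y'.1 := by
        rw [← proj_Ψ hy, h, proj_Ψ hy']
      have e2 : base c' (z t).1 = base c y.1 := by
        rw [← proj_Ψ ht, ht', proj_Ψ (y := (y.1, y.2 + t • w)) hy]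
      rw [← x_base ht, e2, e1, x_base hy']
    have hder : ∀ᶠ t in 𝓝 t₀, HasDerivAt z (0, w') t := by
      filter_upwards [hzdom.eventually_nhds, (hc1 t₀).eventually h1,
        ((hc1 t₀).eventually h3).eventually_nhds] with t ht ht1 ht3
      have e1 : HasMFDerivAt 𝓘(ℝ, ℝ) 𝓘(ℝ, Euc n × Euc n) z t _ :=
        (ht1.mdifferentiableAt (by simp)).hasMFDerivAt.comp t (hd1 t)
      have e2 : HasFDerivAt z _ t := e1.hasFDerivAt
      have e3 : HasDerivAt z (deriv z t) t := e2.differentiableAt.hasDerivAt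
      have e4 := (hasMFDerivAt_Ψ c' ht.self_of_nhds).comp t e3.hasFDerivAt.hasMFDerivAt
      have e5 : (fun t : ℝ ↦ c.Ψ (y.1, y.2 + t • w)) =ᶠ[𝓝 t] c'.Ψ ∘ z :=
        ht3.mono fun s hs ↦ hs.symm
      have e6 := hasMFDerivAt_unique (e4.congr_of_eventuallyEq e5) (hd1 t)
      have e7 := congrArg (fun A : ℝ →L[ℝ] Euc (2 * n) ↦ A 1) e6
      have e8 : (c'.dΨ (z t).1 (z t).2 (deriv z t) : Euc (2 * n)) =
          c.dΨ y.1 (y.2 + t • w) (0, w) := by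
        have e8 : (c'.dΨ (z t).1 (z t).2 ((1 : ℝ) • deriv z t) : Euc (2 * n)) =
          c.dΨ y.1 (y.2 + t • w) ((1 : ℝ) • ((0, w) : Euc n × Euc n)) := e7
        rwa [one_smul, one_smul] at e8
      have e9 := hz1 t ht.self_of_nhds ht3.self_of_nhds
      have e10 : c.Ψ (y.1, y.2 + t • w) = c'.Ψ (y'.1, (z t).2) := by
        rw [← e9]; exact ht3.self_of_nhds.symm
      rw [hw _ _ e10, ← e9] at e8
      have e11 := (bijective_dΨ c' ht.self_of_nhds).1 e8
      rwa [e11] at e3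
    obtain ⟨ε, hε, hball⟩ := Metric.eventually_nhds_iff_ball.1 hder
    have hconst : ∀ t ∈ Metric.ball t₀ ε, z t - t • ((0, w') : Euc n × Euc n) =
        z t₀ - t₀ • ((0, w') : Euc n × Euc n) := by
      intro t ht
      refine (convex_ball t₀ ε).is_const_of_fderivWithin_eq_zero (𝕜 := ℝ)
        (f := fun t ↦ z t - t • ((0, w') : Euc n × Euc n)) ?_ ?_ ht (Metric.mem_ball_self hε)
      · intro s hs
        exact ((hball s hs).sub ((hasDerivAt_id s).smul_const _)).differentiableAt
          |>.differentiableWithinAt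
      · intro s hs
        have e := (hball s hs).sub ((hasDerivAt_id s).smul_const ((0, w') : Euc n × Euc n))
        rw [one_smul, sub_self] at e
        rw [fderivWithin_of_isOpen Metric.isOpen_ball hs]
        have e' := e.hasFDerivAt.fderiv
        rw [ContinuousLinearMap.toSpanSingleton_zero] at e'
        exact e'
    filter_upwards [Metric.ball_mem_nhds t₀ hε, (hc1 t₀).eventually h3] with t ht ht3
    refine iff_of_true ?_ hP
    have e := hconst t ht
    have e2 : z t = (y'.1, y'.2 + t • w') := by
      have e3 : z t₀ = (y'.1, y'.2 + t₀ • w') := hz0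
      rw [e3, sub_eq_iff_eq_add] at e
      rw [e]
      ext i <;> simp
    rw [← e2]; exact ht3.symm
  simpa using key

theorem HasFDerivAt.transition_affine {c c' : S.Chart} {ξ : Euc n} {A : Euc n ≃ᵃ[ℝ] Euc n}
    (hA : ∀ᶠ ζ in 𝓝 ξ, c'.x (base c ζ) = A ζ) :
    HasFDerivAt (fun ζ ↦ c'.x (base c ζ)) (LinearMap.toContinuousLinearMap A.linear.toLinearMap) ξ := by
  have h1 : HasFDerivAt (fun ζ : Euc n ↦ A.linear ζ + A 0)
      (LinearMap.toContinuousLinearMap A.linear.toLinearMap) ξ :=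
    (LinearMap.toContinuousLinearMap A.linear.toLinearMap).hasFDerivAt.add_const _
  refine h1.congr_of_eventuallyEq (hA.mono fun ζ hζ ↦ ?_)
  have h2 := A.map_vadd 0 ζ
  change c'.x (base c ζ) = A.linear ζ + A 0
  rw [hζ]
  simpa using h2

theorem eventually_x_base {c : S.Chart} {b : B} (hb : b ∈ c.V) {P : B → Prop}
    (h : ∀ᶠ b' in 𝓝 b, P b') : ∀ᶠ ζ in 𝓝 (c.x b), P (base c ζ) :=
  eventually_comp_of_continuousAt (continuousAt_base (mem_image_of_mem _ hb)) (base_x hb) h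

/-- If the action coordinates are related by the affine map `A`, the angle coordinates on one fibre
are related by the inverse transpose of its linear part, up to a translation. -/
theorem Ψ_add_of_transition [T2Space X] {c c' : S.Chart} {b : B} (hb : b ∈ c.V) (hb' : b ∈ c'.V)
    {A : Euc n ≃ᵃ[ℝ] Euc n} (hA : ∀ᶠ b' in 𝓝 b, c'.x b' = A (c.x b')) {w w' : Euc n}
    (hT : ∀ v, inner ℝ (A.linear v) w' = inner ℝ v w) {θ θ' : Euc n}
    (h : c.pt b θ = c'.pt b θ') :
    c.pt b (θ + w) = c'.pt b (θ' + w') ∧ (c.vert b θ w : Euc (2 * n)) = c'.vert b θ' w' := by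
  have hv : ∀ θ θ', c.Ψ (c.x b, θ) = c'.Ψ (c'.x b, θ') →
      (c.dΨ (c.x b) θ (0, w) : Euc (2 * n)) = c'.dΨ (c'.x b) θ' (0, w') := fun θ θ' hθ ↦
    vert_eq_of_transpose (y := (c.x b, θ)) (y' := (c'.x b, θ')) (mem_image_of_mem _ hb)
      (mem_image_of_mem _ hb') hθ (HasFDerivAt.transition_affine (A := A) (by
        filter_upwards [eventually_x_base hb hA,
          c.isOpen_image.mem_nhds (mem_image_of_mem _ hb)] with ζ hζ hζ'
        rw [hζ, x_base hζ'])) hT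
  exact ⟨Ψ_add_eq_of_vert (y := (c.x b, θ)) (y' := (c'.x b, θ')) (mem_image_of_mem _ hb)
    (mem_image_of_mem _ hb') h hv, hv _ _ h⟩

/-- Action coordinates are unique up to an affine transformation: the derivative of the transition
map is integral because the angle coordinates have the periods `2πℤⁿ`, hence locally constant. -/
theorem exists_transition [T2Space X] (c c' : S.Chart) {b : B} (hb : b ∈ c.V) (hb' : b ∈ c'.V) :
    ∃ A : Euc n ≃ᵃ[ℝ] Euc n, ∀ᶠ b' in 𝓝 b, c'.x b' = A (c.x b') := by
  obtain ⟨θ₀', hθ₀'⟩ := c'.surjective (c.pt b 0) (by rw [proj_pt hb]; exact hb')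
  rw [proj_pt hb] at hθ₀'
  have hy : (c.x b, (0 : Euc n)).1 ∈ c.x '' c.V := mem_image_of_mem _ hb
  have hy' : (c'.x b, θ₀').1 ∈ c'.x '' c'.V := mem_image_of_mem _ hb'
  obtain ⟨F, hFy, hFs, hFd, hFΨ, hF1⟩ := exists_local_transition hy hy' hθ₀'.symm
  let ι : Euc n → Euc n × Euc n := fun ξ ↦ (ξ, 0)
  have hι : ContinuousAt ι (c.x b) := by fun_prop
  -- the matrix of the angle derivative at the point with coordinates `(ξ, 0)`
  let J : Euc n → Euc n → Euc n := fun ξ w ↦ (fderiv ℝ F (ξ, 0) (0, w)).2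
  let g : Euc n → Euc n := fun ξ ↦ c'.x (base c ξ)
  have hgd : ∀ᶠ ξ in 𝓝 (c.x b), HasFDerivAt g ((ContinuousLinearMap.fst ℝ (Euc n) (Euc n)).comp
      ((fderiv ℝ F (ξ, 0)).comp (ContinuousLinearMap.inl ℝ (Euc n) (Euc n)))) ξ := by
    filter_upwards [hι.eventually hFs, hι.eventually hF1.eventually_nhds] with ξ h1 h2
    have e1 : HasFDerivAt (fun ζ ↦ (F (ι ζ)).1) ((ContinuousLinearMap.fst ℝ (Euc n) (Euc n)).comp
      ((fderiv ℝ F (ξ, 0)).comp (ContinuousLinearMap.inl ℝ (Euc n) (Euc n)))) ξ :=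
      ((h1.differentiableAt (by simp)).hasFDerivAt.comp ξ
        (hasFDerivAt_prodMk_left ξ (0 : Euc n))).fst
    refine e1.congr_of_eventuallyEq ?_
    have hι' : ContinuousAt ι ξ := by fun_prop
    filter_upwards [hι'.eventually h2] with ζ hζ
    exact hζ.symm
  have hgJ : ∀ᶠ ξ in 𝓝 (c.x b), ∀ v w, inner ℝ (fderiv ℝ g ξ v) (J ξ w) = inner ℝ v w := by
    filter_upwards [hι.eventually hFs, hι.eventually hFd.eventually_nhds,
      hι.eventually hFΨ.eventually_nhds, hgd, hι.eventually hF1.eventually_nhds,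
      c.isOpen_image.mem_nhds hy] with ξ h1 h2 h3 h4 h5 h6 v w
    have hS := inner_fderiv_transition (c := c) (c' := c') (y := (ξ, 0)) h6
      (h1.differentiableAt (by simp)) h2.self_of_nhds h3 (v, 0) (0, w)
    have e1 : (fderiv ℝ F (ξ, 0) (v, 0)).1 = fderiv ℝ g ξ v := by rw [h4.fderiv]; rfl
    have e2 : (fderiv ℝ F (ξ, 0) (0, w)).1 = 0 := by
      have e3 : HasFDerivAt (fun z ↦ (F z).1)
          ((ContinuousLinearMap.fst ℝ (Euc n) (Euc n)).comp (fderiv ℝ F (ξ, 0))) (ξ, 0) :=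
        (h1.differentiableAt (by simp)).hasFDerivAt.fst
      have e4 : HasFDerivAt (fun z : Euc n × Euc n ↦ g z.1)
          ((fderiv ℝ g ξ).comp (ContinuousLinearMap.fst ℝ (Euc n) (Euc n))) (ξ, (0 : Euc n)) :=
        HasFDerivAt.comp (g := g) _ h4.differentiableAt.hasFDerivAt hasFDerivAt_fst
      have e5 := (e4.congr_of_eventuallyEq h5).unique e3
      have := congrArg (fun A : Euc n × Euc n →L[ℝ] Euc n ↦ A (0, w)) e5
      simpa using this.symm
    simp only [e1, e2] at hS
    simpa using hS
  have hint : ∀ᶠ ξ in 𝓝 (c.x b), ∀ i j, ∃ m : ℤ, J ξ (EuclideanSpace.single i 1) j = m := by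
    filter_upwards [hι.eventually hFd, hι.eventually hFΨ, hgd, hgJ,
      c.isOpen_image.mem_nhds hy, hι.eventually hF1] with ξ h2 h3 h4 h5 h6 h7 i j
    have e1 := Ψ_add_eq_of_vert (c := c) (c' := c') (y := ι ξ) (y' := F (ι ξ)) h6 h2 h3.symm
      (w := (2 * Real.pi) • EuclideanSpace.single i 1)
      (w' := J ξ ((2 * Real.pi) • EuclideanSpace.single i 1)) (fun θ θ' hθ ↦
        vert_eq_of_transpose (y := (ξ, θ)) (y' := ((F (ι ξ)).1, θ')) h6 h2 hθ
          h4.differentiableAt.hasFDerivAt fun v ↦ h5 v _)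
    have e2 : c.Ψ ((ι ξ).1, (ι ξ).2 + (2 * Real.pi) • EuclideanSpace.single i 1) = c.Ψ (ι ξ) := by
      refine (c.periodic ξ h6 _ _).2 ⟨Pi.single i 1, fun l ↦ ?_⟩
      by_cases hl : l = i
      · subst hl; simp [ι]
      · simp [hl, ι]
    rw [e2, ← h3] at e1
    obtain ⟨m, hm⟩ := (c'.periodic (F (ι ξ)).1 h2 _ _).1 e1.symm
    refine ⟨m j, ?_⟩
    have e3 := hm j
    have e4 : J ξ ((2 * Real.pi) • EuclideanSpace.single i 1) =
        (2 * Real.pi) • J ξ (EuclideanSpace.single i 1) := by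
      have : ((0, (2 * Real.pi) • EuclideanSpace.single i 1) : Euc n × Euc n) =
        (2 * Real.pi) • (0, EuclideanSpace.single i 1) := by simp
      simp only [J, this, map_smul, Prod.smul_snd]
    rw [e4] at e3
    simp only [PiLp.add_apply, PiLp.smul_apply, smul_eq_mul, add_sub_cancel_left] at e3
    have hpi : (2 * Real.pi) ≠ 0 := by positivity
    exact mul_left_cancel₀ hpi e3
  have hJc : ∀ w, ContinuousAt (fun ξ ↦ J ξ w) (c.x b) := by
    intro w
    have h1 : ContinuousAt (fderiv ℝ F) (ι (c.x b)) :=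
      (hFs.self_of_nhds.fderiv_right (m := 0) (by simp)).continuousAt
    have h2 : ContinuousAt (fun ξ ↦ fderiv ℝ F (ι ξ)) (c.x b) :=
      ContinuousAt.comp (g := fderiv ℝ F) h1 hι
    exact (h2.clm_apply continuousAt_const).snd
  have hJe : ∀ i j, ∀ᶠ ξ in 𝓝 (c.x b), J ξ (EuclideanSpace.single i 1) j =
      J (c.x b) (EuclideanSpace.single i 1) j := by
    intro i j
    have h1 : ContinuousAt (fun ξ ↦ J ξ (EuclideanSpace.single i 1) j) (c.x b) :=
      ContinuousAt.comp (g := fun z : Euc n ↦ z j) (by fun_prop) (hJc _)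
    have h2 := Metric.tendsto_nhds.1 h1.tendsto 1 one_pos
    filter_upwards [h2, hint] with ξ h3 h4
    obtain ⟨m, hm⟩ := h4 i j
    obtain ⟨m', hm'⟩ := hint.self_of_nhds i j
    rw [hm, hm', Int.dist_cast_real, Int.dist_eq] at h3
    rw [hm, hm']
    have h5 : |m - m'| < 1 := by exact_mod_cast h3
    have h6 : m - m' = 0 := Int.abs_lt_one_iff.1 h5
    exact_mod_cast sub_eq_zero.1 h6
  have hJe' : ∀ᶠ ξ in 𝓝 (c.x b), ∀ w, J ξ w = J (c.x b) w := by
    have h1 : ∀ᶠ ξ in 𝓝 (c.x b), ∀ i j, J ξ (EuclideanSpace.single i 1) j =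
        J (c.x b) (EuclideanSpace.single i 1) j := by
      simp only [Filter.eventually_all]; exact hJe
    filter_upwards [h1] with ξ h2 w
    have hlin : ∀ ζ, J ζ w = ∑ i, w i • J ζ (EuclideanSpace.single i 1) := by
      intro ζ
      have e : w = ∑ i, w i • EuclideanSpace.single i (1 : ℝ) := by
        ext l; simp [Finset.sum_apply, Pi.single_apply]
      have e2 : ∀ w, J ζ w = ((ContinuousLinearMap.snd ℝ (Euc n) (Euc n)).comp
        ((fderiv ℝ F (ζ, 0)).comp (ContinuousLinearMap.inr ℝ (Euc n) (Euc n)))) w := fun _ ↦ rfl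
      rw [e2]
      conv_lhs => rw [e, map_sum]
      exact Finset.sum_congr rfl fun i _ ↦ by rw [map_smul]; rfl
    rw [hlin, hlin]
    refine Finset.sum_congr rfl fun i _ ↦ ?_
    congr 1
    ext j
    exact h2 i j
  -- the derivative of `g` is the inverse transpose of `J`
  have hgJ0 := hgJ.self_of_nhds
  have hJinj : Function.Injective (fderiv ℝ g (c.x b)) := by
    rw [injective_iff_map_eq_zero]
    intro v hv
    have h := hgJ0 v v
    rw [hv, inner_zero_left] at h
    exact inner_self_eq_zero.1 h.symm
  have hGsurj : Function.Surjective (fderiv ℝ g (c.x b)) :=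
    (LinearMap.injective_iff_surjective (f := (fderiv ℝ g (c.x b)).toLinearMap)).1 hJinj
  have hJsurj : Function.Surjective (J (c.x b)) := by
    have h2 : ∀ w, J (c.x b) w = ((ContinuousLinearMap.snd ℝ (Euc n) (Euc n)).comp
        ((fderiv ℝ F (c.x b, 0)).comp (ContinuousLinearMap.inr ℝ (Euc n) (Euc n)))) w :=
      fun _ ↦ rfl
    have h3 : Function.Injective ((ContinuousLinearMap.snd ℝ (Euc n) (Euc n)).comp
        ((fderiv ℝ F (c.x b, 0)).comp (ContinuousLinearMap.inr ℝ (Euc n) (Euc n)))) := by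
      rw [injective_iff_map_eq_zero]
      intro w hw
      have h := hgJ0 w w
      rw [h2, hw, inner_zero_right] at h
      exact inner_self_eq_zero.1 h.symm
    intro z
    obtain ⟨w, hw⟩ := (LinearMap.injective_iff_surjective (f := ((ContinuousLinearMap.snd ℝ (Euc n)
      (Euc n)).comp ((fderiv ℝ F (c.x b, 0)).comp
        (ContinuousLinearMap.inr ℝ (Euc n) (Euc n)))).toLinearMap)).1 h3 z
    exact ⟨w, hw⟩
  have hge : ∀ᶠ ξ in 𝓝 (c.x b), fderiv ℝ g ξ = fderiv ℝ g (c.x b) := by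
    filter_upwards [hJe', hgJ] with ξ h1 h2
    ext1 v
    refine ext_inner_right ℝ fun z ↦ ?_
    obtain ⟨w, rfl⟩ := hJsurj z
    rw [hgJ0, ← h1, h2]
  let G : Euc n ≃ₗ[ℝ] Euc n :=
    LinearEquiv.ofBijective (fderiv ℝ g (c.x b)).toLinearMap ⟨hJinj, hGsurj⟩
  let A : Euc n ≃ᵃ[ℝ] Euc n := AffineEquiv.mk' (fun ξ ↦ g (c.x b) + G (ξ - c.x b)) G (c.x b)
    (fun ξ ↦ by simp [add_comm])
  refine ⟨A, ?_⟩
  obtain ⟨ε, hε, hball⟩ := Metric.eventually_nhds_iff_ball.1 (hge.and hgd)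
  have hconst : ∀ ξ ∈ Metric.ball (c.x b) ε, g ξ = A ξ := by
    intro ξ hξ
    have h := (convex_ball (c.x b) ε).is_const_of_fderivWithin_eq_zero (𝕜 := ℝ)
      (f := fun ξ ↦ g ξ - fderiv ℝ g (c.x b) ξ) (fun ζ hζ ↦
        ((hball ζ hζ).2.differentiableAt.sub
          (fderiv ℝ g (c.x b)).differentiableAt).differentiableWithinAt) (fun ζ hζ ↦ by
        rw [fderivWithin_of_isOpen Metric.isOpen_ball hζ]
        have e := (hball ζ hζ).2.differentiableAt.hasFDerivAt.sub
          (fderiv ℝ g (c.x b)).hasFDerivAt (x := ζ)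
        rw [(hball ζ hζ).1, sub_self] at e
        exact e.fderiv) hξ (Metric.mem_ball_self hε)
    have h' : g ξ = g (c.x b) + (fderiv ℝ g (c.x b) ξ - fderiv ℝ g (c.x b) (c.x b)) := by
      rw [sub_eq_iff_eq_add.1 h]; abel
    rw [h', ← map_sub]
    rfl
  filter_upwards [c.isOpen_image.mem_nhds hy |> (continuousAt_x hb).eventually,
    (continuousAt_x hb).eventually (Metric.ball_mem_nhds (c.x b) hε),
    (isOpen_inter_preimage_x c isOpen_univ).mem_nhds ⟨hb, mem_univ _⟩] with b' h1 h2 h3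
  rw [← hconst _ h2]
  simp only [g, base_x h3.1]

/-! ### The prequantum connection in a local section -/

section Connection

variable [T2Space X] [VectorBundle ℂ ℂ L] [ContMDiffVectorBundle ∞ ℂ L (𝓡 (2 * n))]

theorem ContMDiffAt.cmul {f g : X → ℂ} {p : X} (hf : ContMDiffAt (𝓡 (2 * n)) 𝓘(ℝ, ℂ) ∞ f p)
    (hg : ContMDiffAt (𝓡 (2 * n)) 𝓘(ℝ, ℂ) ∞ g p) :
    ContMDiffAt (𝓡 (2 * n)) 𝓘(ℝ, ℂ) ∞ (fun q ↦ f q * g q) p :=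
  ContMDiffAt.comp (g := fun z : ℂ × ℂ ↦ z.1 * z.2) p
    (contDiff_mul (𝕜 := ℝ) (𝔸 := ℂ)).contMDiff.contMDiffAt (hf.prodMk_space hg)

/-- A bump function times a section that is smooth near `p` is globally smooth. -/
theorem exists_bump_smul_section {F : Type*} [NormedAddCommGroup F] [NormedSpace ℝ F]
    {V : X → Type*} [TopologicalSpace (TotalSpace F V)] [∀ p, AddCommGroup (V p)]
    [∀ p, Module ℝ (V p)] [∀ p, TopologicalSpace (V p)] [FiberBundle F V] [VectorBundle ℝ F V]
    {s : ∀ q, V q} {p : X} (hs : ∀ᶠ q in 𝓝 p,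
      ContMDiffAt (𝓡 (2 * n)) ((𝓡 (2 * n)).prod 𝓘(ℝ, F)) ∞ (fun q ↦ TotalSpace.mk' F q (s q)) q) :
    ∃ t : ∀ q, V q, (ContMDiff (𝓡 (2 * n)) ((𝓡 (2 * n)).prod 𝓘(ℝ, F)) ∞
      fun q ↦ TotalSpace.mk' F q (t q)) ∧ ∀ᶠ q in 𝓝 p, t q = s q := by
  obtain ⟨O, hO, hOo, hpO⟩ := eventually_nhds_iff.1 hs
  obtain ⟨f, hf, -⟩ := (SmoothBumpFunction.nhds_basis_support (I := 𝓡 (2 * n)) (c := p)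
    (hOo.mem_nhds hpO)).mem_iff.1 (hOo.mem_nhds hpO)
  refine ⟨fun q ↦ f q • s q, ?_, ?_⟩
  · exact ContMDiffOn.smul_section_of_tsupport (V := V) (u := O) (ψ := f) (s := s)
      f.contMDiff.contMDiffOn hOo hf fun q hq ↦ (hO q hq).contMDiffWithinAt
  · filter_upwards [f.eventuallyEq_one] with q hq
    rw [hq, Pi.one_apply, one_smul]

variable (L) in
theorem exists_globalSection (p : X) : ∃ s : ∀ q, L q, (∀ q, SmoothSectionAt n s q) ∧
    ∀ᶠ q in 𝓝 p, s q ≠ 0 := by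
  obtain ⟨s, hs⟩ := exists_localSection (n := n) L p
  obtain ⟨t, ht, hts⟩ := exists_bump_smul_section (V := L) (hs.mono fun q h ↦ h.1)
  refine ⟨t, ht, ?_⟩
  filter_upwards [hts, hs] with q h1 h2
  rw [h1]; exact h2.2

theorem exists_smul_of_ne_zero {p : X} {e : L p} (he : e ≠ 0) (e' : L p) : ∃ a : ℂ, a • e = e' :=
  (finrank_eq_one_iff_of_nonzero' _ he).1 (finrank_fiber L p) e'

theorem SmoothSectionAt.csmul {s : ∀ q, L q} {p : X} (hs : SmoothSectionAt n s p) {g : X → ℂ}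
    (hg : ContMDiffAt (𝓡 (2 * n)) 𝓘(ℝ, ℂ) ∞ g p) : SmoothSectionAt n (fun q ↦ g q • s q) p := by
  have hs' := (contMDiffAt_section p).1 hs
  refine (contMDiffAt_section p).2 ?_
  refine (ContMDiffAt.cmul hg hs').congr_of_eventuallyEq ?_
  let e := trivializationAt ℂ L p
  filter_upwards [e.open_baseSet.mem_nhds (mem_baseSet_trivializationAt ℂ L p)] with q hq
  exact (e.linear ℂ hq).2 (g q) (s q)

theorem conn_smul {s : ∀ q, L q} {p : X} (hs : SmoothSectionAt n s p) {g : X → ℂ}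
    (hg : ContMDiffAt (𝓡 (2 * n)) 𝓘(ℝ, ℂ) ∞ g p) (v : TangentSpace (𝓡 (2 * n)) p) :
    S.conn (fun q ↦ g q • s q) p v = dC g p v • s p + g p • S.conn s p v := by
  have hcov := S.conn.isCovariantDerivativeOnUniv
  have hre : MDifferentiableAt (𝓡 (2 * n)) 𝓘(ℝ, ℝ) (fun q ↦ (g q).re) p :=
    (Complex.reCLM.differentiableAt.mdifferentiableAt).comp p (hg.mdifferentiableAt (by simp))
  have him : MDifferentiableAt (𝓡 (2 * n)) 𝓘(ℝ, ℝ) (fun q ↦ (g q).im) p :=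
    (Complex.imCLM.differentiableAt.mdifferentiableAt).comp p (hg.mdifferentiableAt (by simp))
  have hIs : SmoothSectionAt n (fun q ↦ Complex.I • s q) p :=
    SmoothSectionAt.csmul hs contMDiffAt_const
  have hs' := hs.mdifferentiableAt (n := ∞) (by simp)
  have hIs' := hIs.mdifferentiableAt (n := ∞) (by simp)
  have hre' : HasMFDerivAt (𝓡 (2 * n)) 𝓘(ℝ, ℝ) (fun q ↦ (g q).re) p
      (Complex.reCLM.comp (mfderiv (𝓡 (2 * n)) 𝓘(ℝ, ℂ) g p)) :=
    (Complex.reCLM.hasFDerivAt.hasMFDerivAt).comp p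
      (hg.mdifferentiableAt (by simp)).hasMFDerivAt
  have him' : HasMFDerivAt (𝓡 (2 * n)) 𝓘(ℝ, ℝ) (fun q ↦ (g q).im) p
      (Complex.imCLM.comp (mfderiv (𝓡 (2 * n)) 𝓘(ℝ, ℂ) g p)) :=
    (Complex.imCLM.hasFDerivAt.hasMFDerivAt).comp p
      (hg.mdifferentiableAt (by simp)).hasMFDerivAt
  have hsplit : (fun q ↦ g q • s q) = ((fun q ↦ (g q).re) • s : ∀ q, L q) +
      ((fun q ↦ (g q).im) • (fun q ↦ Complex.I • s q) : ∀ q, L q) := by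
    funext q
    change g q • s q = ((g q).re : ℝ) • s q + ((g q).im : ℝ) • (Complex.I • s q)
    rw [← Complex.coe_smul, ← Complex.coe_smul, smul_smul, ← add_smul, Complex.re_add_im]
  have h1 := hcov.leibniz hs' hre
  have h2 := hcov.leibniz hIs' him
  have h3 := hcov.add (σ := ((fun q ↦ (g q).re) • s : ∀ q, L q))
    (σ' := ((fun q ↦ (g q).im) • (fun q ↦ Complex.I • s q) : ∀ q, L q))
    (MDifferentiableAt.smul_section hre hs') (MDifferentiableAt.smul_section him hIs')
  have h4 := S.prequantum.complex_linear s p hs v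
  rw [hsplit]
  have h5 := congrArg (fun A : TangentSpace (𝓡 (2 * n)) p →L[ℝ] L p ↦ A v) h3
  refine h5.trans ?_
  rw [h1, h2]
  have e1 : mvfderiv (𝓡 (2 * n)) (fun q ↦ (g q).re) p v = (dC g p v).re := by
    rw [mvfderiv, hre'.mfderiv]; rfl
  have e2 : mvfderiv (𝓡 (2 * n)) (fun q ↦ (g q).im) p v = (dC g p v).im := by
    rw [mvfderiv, him'.mfderiv]; rfl
  change ((g p).re • S.conn s p v + mvfderiv (𝓡 (2 * n)) (fun q ↦ (g q).re) p v • s p) +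
    ((g p).im • S.conn (fun q ↦ Complex.I • s q) p v +
      mvfderiv (𝓡 (2 * n)) (fun q ↦ (g q).im) p v • (Complex.I • s p)) = _
  rw [e1, e2, h4, ← Complex.coe_smul, ← Complex.coe_smul, ← Complex.coe_smul, ← Complex.coe_smul]
  conv_rhs => rw [← Complex.re_add_im (dC g p v), ← Complex.re_add_im (g p)]
  module

theorem conn_congr {s t : ∀ q, L q} {p : X} (hs : SmoothSectionAt n s p)
    (h : ∀ᶠ q in 𝓝 p, s q = t q) : S.conn s p = S.conn t p := by
  have ht : SmoothSectionAt n t p := hs.congr_of_eventuallyEq (h.mono fun q hq ↦ congrArg (TotalSpace.mk' ℂ q) hq.symm)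
  exact S.conn.isCovariantDerivativeOnUniv.congr_of_eventuallyEq
    (hs.mdifferentiableAt (n := ∞) (by simp)) (ht.mdifferentiableAt (n := ∞) (by simp))
    Filter.univ_mem h

variable (S) in
/-- The connection form of `∇` with respect to the local section `s`: `∇ s = α ⊗ s`. -/
def connForm (s : ∀ q, L q) (q : X) (v : TangentSpace (𝓡 (2 * n)) q) : ℂ :=
  inner ℂ (s q) (S.conn s q v) / inner ℂ (s q) (s q)

theorem conn_eq_connForm {s : ∀ q, L q} {q : X} (hs : s q ≠ 0)
    (v : TangentSpace (𝓡 (2 * n)) q) : S.conn s q v = S.connForm s q v • s q := by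
  obtain ⟨a, ha⟩ := exists_smul_of_ne_zero hs (S.conn s q v)
  rw [connForm, ← ha, inner_smul_right, mul_div_assoc, div_self, mul_one]
  exact inner_self_ne_zero.2 hs

theorem contMDiffAt_conn_apply {s : ∀ q, L q} (hs : ∀ q, SmoothSectionAt n s q)
    {Y : ∀ q : X, TangentSpace (𝓡 (2 * n)) q} {p : X}
    (hY : ContMDiffAt (𝓡 (2 * n)) (𝓡 (2 * n)).tangent ∞
      (fun q ↦ (⟨q, Y q⟩ : TangentBundle (𝓡 (2 * n)) X)) p) :
    SmoothSectionAt n (fun q ↦ S.conn s q (Y q)) p := by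
  have h1 := S.prequantum.smooth_conn.contMDiff.contMDiff (σ := s)
    (fun q _ ↦ (hs q).contMDiffWithinAt) p (mem_univ p)
  exact ContMDiffAt.clm_bundle_apply (contMDiffWithinAt_univ.1 h1) hY

theorem contMDiffAt_connForm {s : ∀ q, L q} (hs : ∀ q, SmoothSectionAt n s q)
    {Y : ∀ q : X, TangentSpace (𝓡 (2 * n)) q} {p : X} (hp : s p ≠ 0)
    (hY : ContMDiffAt (𝓡 (2 * n)) (𝓡 (2 * n)).tangent ∞
      (fun q ↦ (⟨q, Y q⟩ : TangentBundle (𝓡 (2 * n)) X)) p) :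
    ContMDiffAt (𝓡 (2 * n)) 𝓘(ℝ, ℂ) ∞ (fun q ↦ S.connForm s q (Y q)) p := by
  have h1 := S.prequantum.smooth_metric _ _ p (hs p) (contMDiffAt_conn_apply (S := S) hs hY)
  have h2 := S.prequantum.smooth_metric _ _ p (hs p) (hs p)
  have h3 : ContDiffAt ℝ ∞ (fun z : ℂ ↦ z⁻¹) (inner ℂ (s p) (s p)) :=
    contDiffAt_inv ℝ (inner_self_ne_zero.2 hp)
  exact ContMDiffAt.cmul h1 (ContMDiffAt.comp (g := fun z : ℂ ↦ z⁻¹) p h3.contMDiffAt h2)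

end Connection

/-! ### Local normal form of the prequantum connection -/

section Normal

variable [T2Space X] [VectorBundle ℂ ℂ L] [ContMDiffVectorBundle ∞ ℂ L (𝓡 (2 * n))]

theorem hasFDerivAt_comp_Ψ {c : S.Chart} {y : Euc n × Euc n} (hy : y.1 ∈ c.x '' c.V) {g : X → ℂ}
    (hg : MDifferentiableAt (𝓡 (2 * n)) 𝓘(ℝ, ℂ) g (c.Ψ y)) :
    DifferentiableAt ℝ (fun z ↦ g (c.Ψ z)) y ∧
      ∀ v, fderiv ℝ (fun z ↦ g (c.Ψ z)) y v = dC g (c.Ψ y) (c.dΨ y.1 y.2 v) := by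
  let D : Euc n × Euc n →L[ℝ] ℂ := (mfderiv (𝓡 (2 * n)) 𝓘(ℝ, ℂ) g (c.Ψ y)).comp (c.dΨ y.1 y.2)
  have h : HasFDerivAt (fun z ↦ g (c.Ψ z)) D y :=
    (hg.hasMFDerivAt.comp y (hasMFDerivAt_Ψ c hy)).hasFDerivAt
  refine ⟨h.differentiableAt, fun v ↦ ?_⟩
  have h2 : fderiv ℝ (fun z ↦ g (c.Ψ z)) y = D := h.fderiv
  rw [h2]; rfl

theorem two_le_infty : (2 : ℕ∞ω) ≤ ∞ := WithTop.coe_le_coe.2 (le_top : (2 : ℕ∞) ≤ ⊤)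

/-- Extensions to `X` of the coordinate vector fields of a chart near a point. -/
theorem exists_pushforward (c : S.Chart) {y : Euc n × Euc n} (hy : y.1 ∈ c.x '' c.V) :
    ∃ Y : Euc n × Euc n → ∀ q : X, TangentSpace (𝓡 (2 * n)) q,
      (∀ v, ContMDiff (𝓡 (2 * n)) (𝓡 (2 * n)).tangent ∞
        (fun q ↦ (⟨q, Y v q⟩ : TangentBundle (𝓡 (2 * n)) X))) ∧
      (∀ v, ∀ᶠ z in 𝓝 y, Y v (c.Ψ z) = c.dΨ z.1 z.2 v) ∧
      ∀ v w, VectorField.mlieBracket (𝓡 (2 * n)) (Y v) (Y w) (c.Ψ y) = 0 := by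
  obtain ⟨Φ, h1, h2, h3⟩ := exists_localInverse c hy
  have hcont := (contMDiffAt_Ψ c hy).continuousAt
  have hinv : ∀ᶠ z in 𝓝 y, ∃ e : (Euc n × Euc n) ≃L[ℝ] Euc (2 * n),
      (mfderiv (𝓡 (2 * n)) 𝓘(ℝ, Euc n × Euc n) Φ (c.Ψ z) : Euc (2 * n) →L[ℝ] Euc n × Euc n) =
        e.symm.toContinuousLinearMap ∧
      (c.dΨ z.1 z.2 : (Euc n × Euc n) →L[ℝ] Euc (2 * n)) = e.toContinuousLinearMap := by
    filter_upwards [h2.eventually_nhds, hcont.eventually h1, eventually_mem_chartDomain c hy]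
      with z hz hz1 hz2
    let e : (Euc n × Euc n) ≃L[ℝ] Euc (2 * n) :=
      ContinuousLinearEquiv.ofBijective (F := Euc (2 * n)) (c.dΨ z.1 z.2)
        (LinearMap.ker_eq_bot.2 (bijective_dΨ c hz2).1)
        (LinearMap.range_eq_top.2 (bijective_dΨ c hz2).2)
    let D : Euc n × Euc n →L[ℝ] Euc n × Euc n :=
      (mfderiv (𝓡 (2 * n)) 𝓘(ℝ, Euc n × Euc n) Φ (c.Ψ z)).comp (c.dΨ z.1 z.2)
    have e1 : HasFDerivAt (Φ ∘ c.Ψ) D z :=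
      ((hz1.mdifferentiableAt (by simp)).hasMFDerivAt.comp z (hasMFDerivAt_Ψ c hz2)).hasFDerivAt
    have e2 : HasFDerivAt (Φ ∘ c.Ψ) (ContinuousLinearMap.id ℝ (Euc n × Euc n)) z :=
      (hasFDerivAt_id z).congr_of_eventuallyEq hz
    have e3 := e1.unique e2
    refine ⟨e, ?_, rfl⟩
    refine ContinuousLinearMap.ext (M₁ := Euc (2 * n)) fun v ↦ ?_
    obtain ⟨u, rfl⟩ := e.surjective v
    refine Eq.trans ?_ (e.symm_apply_apply u).symm
    exact congrArg (fun A : Euc n × Euc n →L[ℝ] Euc n × Euc n ↦ A u) e3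
  have hinv' : ∀ᶠ q in 𝓝 (c.Ψ y),
      (mfderiv (𝓡 (2 * n)) 𝓘(ℝ, Euc n × Euc n) Φ q).IsInvertible := by
    have hΦy : Φ (c.Ψ y) = y := h2.self_of_nhds
    filter_upwards [eventually_comp_of_continuousAt h1.self_of_nhds.continuousAt hΦy hinv, h3]
      with q hq hq'
    obtain ⟨e, he, -⟩ := hq
    rw [hq'] at he
    exact ⟨e.symm, he.symm⟩
  let Y₀ : Euc n × Euc n → ∀ q : X, TangentSpace (𝓡 (2 * n)) q := fun v ↦
    VectorField.mpullback (𝓡 (2 * n)) 𝓘(ℝ, Euc n × Euc n) Φ (fun _ ↦ v)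
  have hconst : ∀ (v z : Euc n × Euc n), ContMDiffAt 𝓘(ℝ, Euc n × Euc n)
      𝓘(ℝ, Euc n × Euc n).tangent ∞
      (fun z ↦ (⟨z, v⟩ : TangentBundle 𝓘(ℝ, Euc n × Euc n) (Euc n × Euc n))) z := fun v z ↦
    contMDiffAt_vectorSpace_iff_contDiffAt.2 contDiffAt_const
  have hY₀ : ∀ v, ∀ᶠ q in 𝓝 (c.Ψ y), ContMDiffAt (𝓡 (2 * n)) (𝓡 (2 * n)).tangent ∞
      (fun q ↦ (⟨q, Y₀ v q⟩ : TangentBundle (𝓡 (2 * n)) X)) q := by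
    intro v
    filter_upwards [h1, hinv'] with q hq1 hq2
    have : IsManifold (𝓡 (2 * n)) 1 X := IsManifold.of_le (n := ∞) (by simp)
    exact ContMDiffAt.mpullback_vectorField_preimage (hconst v (Φ q)) hq1 hq2 (by simp)
  choose Y hY hYY using fun v ↦ exists_bump_smul_section
    (V := fun q : X ↦ TangentSpace (𝓡 (2 * n)) q) (hY₀ v)
  refine ⟨Y, hY, fun v ↦ ?_, fun v w ↦ ?_⟩
  · filter_upwards [hcont.eventually (hYY v), hinv] with z hz ⟨e, he1, he2⟩
    rw [hz]
    change ContinuousLinearMap.inverse (mfderiv (𝓡 (2 * n)) 𝓘(ℝ, Euc n × Euc n) Φ (c.Ψ z)) v = _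
    rw [he1, he2]
    exact congrArg (fun A : Euc n × Euc n →L[ℝ] Euc (2 * n) ↦ A v)
      (ContinuousLinearMap.inverse_equiv e.symm)
  · rw [Filter.EventuallyEq.mlieBracket_vectorField_eq (hYY v) (hYY w)]
    have : IsManifold (𝓡 (2 * n)) (minSmoothness ℝ 2) X :=
      IsManifold.of_le (n := ∞) (by rw [minSmoothness_of_isRCLikeNormedField]; exact two_le_infty)
    have hb := VectorField.mpullback_mlieBracket (I := 𝓡 (2 * n)) (I' := 𝓘(ℝ, Euc n × Euc n))
      (n := ∞) (f := Φ) (V := fun _ ↦ v) (W := fun _ ↦ w) (x₀ := c.Ψ y)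
      ((hconst v _).mdifferentiableAt (by simp)) ((hconst w _).mdifferentiableAt (by simp))
      h1.self_of_nhds (by rw [minSmoothness_of_isRCLikeNormedField]; exact two_le_infty)
    refine hb.symm.trans ?_
    rw [VectorField.mpullback_apply]
    have hz : VectorField.mlieBracket 𝓘(ℝ, Euc n × Euc n)
        (fun _ : Euc n × Euc n ↦ (v : Euc n × Euc n)) (fun _ ↦ (w : Euc n × Euc n)) (Φ (c.Ψ y)) = 0 := by
      have h0 := VectorField.mlieBracketWithin_eq_lieBracketWithin (𝕜 := ℝ)
        (E := Euc n × Euc n) (V := fun _ ↦ v) (W := fun _ ↦ w) (s := univ)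
      rw [VectorField.lieBracketWithin_univ] at h0
      have h1 := VectorField.mlieBracketWithin_univ (I := 𝓘(ℝ, Euc n × Euc n))
        (V := fun _ : Euc n × Euc n ↦ v) (W := fun _ ↦ w)
      refine (congrFun (h1.symm.trans h0) _).trans ?_
      change fderiv ℝ (fun _ : Euc n × Euc n ↦ w) _ v - fderiv ℝ (fun _ ↦ v) _ w = 0
      simp
    erw [hz]
    exact map_zero _

variable (S) in
/-- The pull-back of the connection form to the coordinates of a chart. -/
def connFormChart (c : S.Chart) (s : ∀ q, L q) (z : Euc n × Euc n) : Euc n × Euc n →L[ℝ] ℂ :=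
  LinearMap.toContinuousLinearMap
    { toFun := fun v ↦ S.connForm s (c.Ψ z) (c.dΨ z.1 z.2 v)
      map_add' := fun v w ↦ by
        rw [connForm, map_add, map_add, inner_add_right, add_div]; rfl
      map_smul' := fun r v ↦ by
        rw [connForm, map_smul, map_smul, inner_smul_right_eq_smul, smul_div_assoc]; rfl }

theorem connFormChart_apply (c : S.Chart) (s : ∀ q, L q) (z v : Euc n × Euc n) :
    S.connFormChart c s z v = S.connForm s (c.Ψ z) (c.dΨ z.1 z.2 v) := rfl

theorem contDiffAt_connFormChart {c : S.Chart} {s : ∀ q, L q} (hs : ∀ q, SmoothSectionAt n s q)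
    {y : Euc n × Euc n} (hy : y.1 ∈ c.x '' c.V) (hsy : s (c.Ψ y) ≠ 0) (v : Euc n × Euc n) :
    ContDiffAt ℝ ∞ (fun z ↦ S.connFormChart c s z v) y := by
  obtain ⟨Y, hY, hYc, -⟩ := exists_pushforward c hy
  have h1 := (contMDiffAt_connForm (S := S) hs hsy (hY v (c.Ψ y))).comp y (contMDiffAt_Ψ c hy)
  refine h1.contDiffAt.congr_of_eventuallyEq ?_
  filter_upwards [hYc v] with z hz
  rw [connFormChart_apply, ← hz]; rfl

/-- The curvature identity `dα = -i ∑ dxᵢ ∧ dθᵢ` in the coordinates of a chart. -/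
theorem curvature_connFormChart {c : S.Chart} {s : ∀ q, L q} (hs : ∀ q, SmoothSectionAt n s q)
    {y : Euc n × Euc n} (hy : y.1 ∈ c.x '' c.V) (hsy : ∀ᶠ q in 𝓝 (c.Ψ y), s q ≠ 0)
    (v w : Euc n × Euc n) :
    fderiv ℝ (fun z ↦ S.connFormChart c s z w) y v -
      fderiv ℝ (fun z ↦ S.connFormChart c s z v) y w =
        -(Complex.I * (inner ℝ v.1 w.2 - inner ℝ w.1 v.2 : ℝ)) := by
  obtain ⟨Y, hY, hYc, hbr⟩ := exists_pushforward c hy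
  have hs0 := hsy.self_of_nhds
  let b : Euc n × Euc n → X → ℂ := fun v q ↦ S.connForm s q (Y v q)
  have hb : ∀ v, ContMDiffAt (𝓡 (2 * n)) 𝓘(ℝ, ℂ) ∞ (b v) (c.Ψ y) := fun v ↦
    contMDiffAt_connForm (S := S) hs hs0 (hY v _)
  have hbd : ∀ v w, fderiv ℝ (fun z ↦ S.connFormChart c s z w) y v =
      dC (b w) (c.Ψ y) (Y v (c.Ψ y)) := by
    intro v w
    have h1 := hasFDerivAt_comp_Ψ hy ((hb w).mdifferentiableAt (by simp))
    have h2 : (fun z ↦ S.connFormChart c s z w) =ᶠ[𝓝 y] fun z ↦ b w (c.Ψ z) := by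
      filter_upwards [hYc w] with z hz
      rw [connFormChart_apply, ← hz]
    rw [h2.fderiv_eq, h1.2, (hYc v).self_of_nhds]
  have hconn : ∀ v w, S.conn (fun q ↦ S.conn s q (Y w q)) (c.Ψ y) (Y v (c.Ψ y)) =
      (dC (b w) (c.Ψ y) (Y v (c.Ψ y)) + b w (c.Ψ y) * b v (c.Ψ y)) • s (c.Ψ y) := by
    intro v w
    have h1 : S.conn (fun q ↦ S.conn s q (Y w q)) (c.Ψ y) = S.conn (fun q ↦ b w q • s q) (c.Ψ y) :=
      conn_congr (contMDiffAt_conn_apply (S := S) hs (hY w _))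
        (hsy.mono fun q hq ↦ conn_eq_connForm hq _)
    rw [h1, conn_smul (hs _) (hb w), conn_eq_connForm hs0, smul_smul, ← add_smul]
  have hcurv := S.prequantum.curvature (Y v) (Y w) s (hY v) (hY w) hs (c.Ψ y)
  rw [hbr, map_zero, sub_zero, hconn, hconn, ← sub_smul] at hcurv
  have h2 := smul_left_injective ℂ hs0 hcurv
  have h3 : S.Ω (c.Ψ y) ![Y v (c.Ψ y), Y w (c.Ψ y)] = inner ℝ v.1 w.2 - inner ℝ w.1 v.2 := by
    rw [(hYc v).self_of_nhds, (hYc w).self_of_nhds, ← sum_symplectic]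
    exact c.symplectic _ hy y.2 v w
  rw [hbd, hbd, ← h3]
  linear_combination h2

/-- The section `E` of `L` along the coordinates of a chart is in normal form at `y`:
`∇E = -i ∑ xⱼ dθⱼ ⊗ E`. -/
def IsNormalAt (c : S.Chart) (E : ∀ y, L (c.Ψ y)) (y : Euc n × Euc n) : Prop :=
  ∀ s : ∀ q, L q, SmoothSectionAt n s (c.Ψ y) → s (c.Ψ y) ≠ 0 →
    ∃ (a : Euc n × Euc n → ℂ) (D : Euc n × Euc n →L[ℝ] ℂ),
      (∀ᶠ z in 𝓝 y, E z = a z • s (c.Ψ z)) ∧ HasFDerivAt a D y ∧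
      ∀ v, D v = -(Complex.I * (inner ℝ y.1 v.2 : ℝ) + S.connFormChart c s y v) * a y

theorem IsNormalAt.of_section {c : S.Chart} {E : ∀ y, L (c.Ψ y)} {y : Euc n × Euc n}
    (hy : y.1 ∈ c.x '' c.V) {s : ∀ q, L q} (hs : SmoothSectionAt n s (c.Ψ y))
    (hsy : ∀ᶠ q in 𝓝 (c.Ψ y), s q ≠ 0)
    {a : Euc n × Euc n → ℂ} {D : Euc n × Euc n →L[ℝ] ℂ}
    (hE : ∀ᶠ z in 𝓝 y, E z = a z • s (c.Ψ z)) (ha : HasFDerivAt a D y)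
    (hD : ∀ v, D v = -(Complex.I * (inner ℝ y.1 v.2 : ℝ) + S.connFormChart c s y v) * a y) :
    IsNormalAt c E y := by
  intro t ht hty
  have hs0 := hsy.self_of_nhds
  let g : X → ℂ := fun q ↦ inner ℂ (s q) (t q) * (inner ℂ (s q) (s q))⁻¹
  have hg : ContMDiffAt (𝓡 (2 * n)) 𝓘(ℝ, ℂ) ∞ g (c.Ψ y) := by
    have h3 : ContDiffAt ℝ ∞ (fun z : ℂ ↦ z⁻¹) (inner ℂ (s (c.Ψ y)) (s (c.Ψ y))) :=
      contDiffAt_inv ℝ (inner_self_ne_zero.2 hs0)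
    exact ContMDiffAt.cmul (S.prequantum.smooth_metric _ _ _ hs ht)
      (ContMDiffAt.comp (g := fun z : ℂ ↦ z⁻¹) _ h3.contMDiffAt
        (S.prequantum.smooth_metric _ _ _ hs hs))
  have hgs : ∀ q, s q ≠ 0 → g q • s q = t q := by
    intro q hq
    obtain ⟨b, hb⟩ := exists_smul_of_ne_zero hq (t q)
    rw [← hb]
    simp only [g, ← hb, inner_smul_right]
    rw [mul_assoc, mul_inv_cancel₀ (inner_self_ne_zero.2 hq), mul_one]
  have hg0 : g (c.Ψ y) ≠ 0 := by
    intro h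
    rw [← hgs _ hs0, h, zero_smul] at hty
    exact hty rfl
  have hcont := (contMDiffAt_Ψ c hy).continuousAt
  obtain ⟨hd, hd'⟩ := hasFDerivAt_comp_Ψ hy (hg.mdifferentiableAt (by simp))
  have hconn : ∀ v, S.connFormChart c t y v * g (c.Ψ y) =
      fderiv ℝ (fun z ↦ g (c.Ψ z)) y v + g (c.Ψ y) * S.connFormChart c s y v := by
    intro v
    have h1 : S.conn t (c.Ψ y) = S.conn (fun q ↦ g q • s q) (c.Ψ y) :=
      conn_congr ht (hsy.mono fun q hq ↦ (hgs q hq).symm)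
    have h2 := conn_eq_connForm (S := S) hty (c.dΨ y.1 y.2 v)
    rw [h1, conn_smul hs hg, conn_eq_connForm hs0, ← hgs _ hs0, smul_smul, smul_smul,
      ← add_smul] at h2
    have h3 := smul_left_injective ℂ hs0 h2
    rw [hd', connFormChart_apply, connFormChart_apply]
    exact h3.symm
  refine ⟨fun z ↦ a z * (g (c.Ψ z))⁻¹, _, ?_, ha.mul (((hasDerivAt_inv hg0).hasFDerivAt.restrictScalars ℝ).comp y hd.hasFDerivAt), fun v ↦ ?_⟩
  · have hgne : ∀ᶠ z in 𝓝 y, g (c.Ψ z) ≠ 0 := hd.continuousAt.eventually_ne hg0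
    filter_upwards [hE, hcont.eventually hsy, hgne] with z h1 h2 h3
    rw [h1, ← hgs _ h2, smul_smul, mul_assoc, inv_mul_cancel₀ h3, mul_one]
  · have h1 := hconn v
    have h2 := hD v
    have h4 : ((ContinuousLinearMap.toSpanSingleton ℂ (-(g (c.Ψ y) ^ 2)⁻¹)).restrictScalars ℝ ∘L
        fderiv ℝ (fun z ↦ g (c.Ψ z)) y) v =
          fderiv ℝ (fun z ↦ g (c.Ψ z)) y v * -(g (c.Ψ y) ^ 2)⁻¹ := rfl
    simp only [add_apply, smul_apply, smul_eq_mul, h2]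
    rw [h4]
    field_simp
    linear_combination (a y) * h1

theorem real_connFormChart {c : S.Chart} {s : ∀ q, L q} (hs : ∀ q, SmoothSectionAt n s q)
    {y : Euc n × Euc n} (hy : y.1 ∈ c.x '' c.V) (hsy : s (c.Ψ y) ≠ 0) :
    HasFDerivAt (fun z ↦ ‖s (c.Ψ z)‖ ^ 2)
      ((2 * ‖s (c.Ψ y)‖ ^ 2) • Complex.reCLM.comp (S.connFormChart c s y)) y := by
  have hg := S.prequantum.smooth_metric _ _ _ (hs (c.Ψ y)) (hs (c.Ψ y))
  obtain ⟨hd, hd'⟩ := hasFDerivAt_comp_Ψ hy (hg.mdifferentiableAt (by simp))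
  have h1 := Complex.reCLM.hasFDerivAt.comp y hd.hasFDerivAt
  have h2 : (fun z ↦ ‖s (c.Ψ z)‖ ^ 2) = Complex.reCLM ∘ fun z ↦ inner ℂ (s (c.Ψ z)) (s (c.Ψ z)) := by
    funext z
    exact (inner_self_eq_norm_sq (𝕜 := ℂ) (s (c.Ψ z))).symm
  rw [h2]
  refine h1.congr_fderiv (ContinuousLinearMap.ext fun v ↦ ?_)
  symm
  have h3 := S.prequantum.unitary s s (c.Ψ y) (hs _) (hs _) (c.dΨ y.1 y.2 v)
  rw [conn_eq_connForm hsy, inner_smul_left, inner_smul_right, inner_self_eq_norm_sq_to_K] at h3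
  change _ = (fderiv ℝ (fun z ↦ inner ℂ (s (c.Ψ z)) (s (c.Ψ z))) y v).re
  rw [hd', h3]
  simp only [smul_apply, ContinuousLinearMap.comp_apply, Complex.reCLM_apply, connFormChart_apply,
    smul_eq_mul]
  rw [← add_mul, add_comm, Complex.add_conj,
    RCLike.ofReal_eq_complex_ofReal, ← Complex.ofReal_pow, ← Complex.ofReal_mul, Complex.ofReal_re]
  ring

/-- Local unit sections in normal form exist, by the Poincaré lemma. -/
theorem exists_local_normal (c : S.Chart) {y : Euc n × Euc n} (hy : y.1 ∈ c.x '' c.V) :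
    ∃ ε > 0, ∃ E : ∀ z, L (c.Ψ z), ∀ z ∈ Metric.ball y ε, ‖E z‖ = 1 ∧ IsNormalAt c E z := by
  obtain ⟨s, hs, hs0⟩ := exists_globalSection (n := n) L (c.Ψ y)
  have hcont := (contMDiffAt_Ψ c hy).continuousAt
  obtain ⟨ε, hε, hball⟩ := Metric.eventually_nhds_iff_ball.1
    ((eventually_mem_chartDomain c hy).and (hcont.eventually hs0.eventually_nhds))
  let om := S.connFormChart c s
  have hom : ContDiffOn ℝ ∞ om (Metric.ball y ε) := contDiffOn_clm_apply.2 fun v z hz ↦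
    (contDiffAt_connFormChart hs (hball z hz).1 (hball z hz).2.self_of_nhds v).contDiffWithinAt
  have homd : ∀ z ∈ Metric.ball y ε, DifferentiableAt ℝ om z := fun z hz ↦
    (hom.contDiffAt (Metric.isOpen_ball.mem_nhds hz)).differentiableAt (by simp)
  let β : Euc n × Euc n →L[ℝ] Euc n × Euc n →L[ℝ] ℝ :=
    (((ContinuousLinearMap.compL ℝ (Euc n × Euc n) (Euc n) ℝ).flip
      (ContinuousLinearMap.snd ℝ (Euc n) (Euc n))).comp (innerSL ℝ)).comp
        (ContinuousLinearMap.fst ℝ (Euc n) (Euc n))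
  have hβ : ∀ z v, β z v = inner ℝ z.1 v.2 := fun z v ↦ rfl
  let η : Euc n × Euc n → Euc n × Euc n →L[ℝ] ℝ := fun z ↦ -(Complex.imCLM.comp (om z) + β z)
  have hηd : ∀ z ∈ Metric.ball y ε, HasFDerivAt η
      (-((ContinuousLinearMap.compL ℝ (Euc n × Euc n) ℂ ℝ Complex.imCLM).comp (fderiv ℝ om z) + β)) z := by
    intro z hz
    exact ((((ContinuousLinearMap.compL ℝ (Euc n × Euc n) ℂ ℝ Complex.imCLM).hasFDerivAt).comp z
      (homd z hz).hasFDerivAt).add β.hasFDerivAt).neg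
  have hap : ∀ z ∈ Metric.ball y ε, ∀ v w, fderiv ℝ om z v w = fderiv ℝ (fun z ↦ om z w) z v := by
    intro z hz v w
    have h := ((homd z hz).hasFDerivAt.clm_apply (hasFDerivAt_const w z)).fderiv
    rw [h]; simp
  obtain ⟨h, hh⟩ := (convex_ball y ε).exists_forall_hasFDerivAt_of_fderiv_symmetric
    Metric.isOpen_ball (show DifferentiableOn ℝ η (Metric.ball y ε) from
      fun z hz ↦ (hηd z hz).differentiableAt.differentiableWithinAt)
    (fun z hz v w ↦ by
      rw [(hηd z hz).fderiv]
      have hc := curvature_connFormChart hs (hball z hz).1 (hball z hz).2 v w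
      rw [← hap z hz, ← hap z hz] at hc
      have hc' := congrArg Complex.im hc
      simp only [Complex.sub_im, Complex.neg_im, Complex.I_mul_im, Complex.ofReal_re] at hc'
      change -((fderiv ℝ om z v w).im + β v w) = -((fderiv ℝ om z w v).im + β w v)
      rw [hβ, hβ]
      linarith)
  refine ⟨ε, hε, fun z ↦ Complex.exp (Complex.I * h z - (1 / 2 : ℝ) * Real.log (‖s (c.Ψ z)‖ ^ 2)) •
    s (c.Ψ z), fun z hz ↦ ⟨?_, ?_⟩⟩
  · have hsz : 0 < ‖s (c.Ψ z)‖ := norm_pos_iff.2 (hball z hz).2.self_of_nhds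
    rw [norm_smul, Complex.norm_exp]
    simp only [Complex.sub_re, Complex.I_mul_re, Complex.ofReal_im, neg_zero, zero_sub]
    rw [← Complex.ofReal_mul, Complex.ofReal_re, Real.log_pow]
    push_cast
    rw [show -(1 / 2 * (2 * Real.log ‖s (c.Ψ z)‖)) = -Real.log ‖s (c.Ψ z)‖ by ring, Real.exp_neg,
      Real.exp_log hsz, inv_mul_cancel₀ hsz.ne']
  · have hsz : 0 < ‖s (c.Ψ z)‖ ^ 2 := pow_pos (norm_pos_iff.2 (hball z hz).2.self_of_nhds) 2
    have h1 := (real_connFormChart hs (hball z hz).1 (hball z hz).2.self_of_nhds).log hsz.ne'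
    have h2 := (Complex.ofRealCLM.hasFDerivAt.comp z (hh z hz)).const_mul Complex.I
    have h3 := (Complex.ofRealCLM.hasFDerivAt.comp z h1).const_mul ((1 / 2 : ℝ) : ℂ)
    refine IsNormalAt.of_section (hball z hz).1 (hs _) (hball z hz).2
      (Filter.Eventually.of_forall fun _ ↦ rfl) ((h2.sub h3).cexp) fun v ↦ ?_
    have h4 : ((S.connFormChart c s z v).re : ℂ) + (S.connFormChart c s z v).im * Complex.I =
      S.connFormChart c s z v := Complex.re_add_im _
    have h5 : (‖s (c.Ψ z)‖ ^ 2)⁻¹ * (2 * ‖s (c.Ψ z)‖ ^ 2 * (S.connFormChart c s z v).re) =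
        2 * (S.connFormChart c s z v).re := by
      rw [mul_comm (2 : ℝ), mul_assoc, ← mul_assoc, inv_mul_cancel₀ hsz.ne', one_mul]
    rw [smul_apply, smul_eq_mul, mul_comm]
    refine congrArg₂ (· * ·) ?_ rfl
    change Complex.I * ((-((S.connFormChart c s z v).im + β z v) : ℝ) : ℂ) - ((1 / 2 : ℝ) : ℂ) *
        (((‖s (c.Ψ z)‖ ^ 2)⁻¹ * (2 * ‖s (c.Ψ z)‖ ^ 2 * (S.connFormChart c s z v).re) : ℝ) : ℂ) =
      -(Complex.I * (inner ℝ z.1 v.2 : ℝ) + S.connFormChart c s z v)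
    rw [h5, hβ]
    push_cast
    linear_combination -h4

end Normal

/-! ### Sections of the line bundle along curves -/

section AlongCurves

variable [T2Space X] [VectorBundle ℂ ℂ L] [ContMDiffVectorBundle ∞ ℂ L (𝓡 (2 * n))]

/-- Multiplication of an element of a fibre of `L` by a scalar, in the total space. -/
def tsmul (a : ℂ) (x : TotalSpace ℂ L) : TotalSpace ℂ L := ⟨x.proj, a • x.snd⟩

@[simp] theorem tsmul_proj (a : ℂ) (x : TotalSpace ℂ L) : (tsmul a x).proj = x.proj := rfl

theorem tsmul_tsmul (a b : ℂ) (x : TotalSpace ℂ L) : tsmul a (tsmul b x) = tsmul (a * b) x := by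
  change (⟨x.proj, a • b • x.snd⟩ : TotalSpace ℂ L) = ⟨x.proj, (a * b) • x.snd⟩
  rw [smul_smul]

theorem tsmul_one (x : TotalSpace ℂ L) : tsmul 1 x = x := by
  simp [tsmul]

theorem norm_tsmul (a : ℂ) (x : TotalSpace ℂ L) : ‖(tsmul a x).snd‖ = ‖a‖ * ‖x.snd‖ :=
  norm_smul a x.snd

theorem tsmul_injective {x : TotalSpace ℂ L} (hx : x.snd ≠ 0) {a b : ℂ}
    (h : tsmul a x = tsmul b x) : a = b := by
  have h1 : a • x.snd = b • x.snd := by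
    have := (TotalSpace.mk.injEq _ _ _ _).mp h
    exact eq_of_heq this.2
  exact smul_left_injective ℂ hx h1

theorem exists_tsmul {x y : TotalSpace ℂ L} (hx : x.snd ≠ 0) (h : y.proj = x.proj) :
    ∃ a, y = tsmul a x := by
  obtain ⟨p, u⟩ := x
  obtain ⟨q, v⟩ := y
  obtain rfl : q = p := h
  obtain ⟨a, ha⟩ := exists_smul_of_ne_zero hx v
  exact ⟨a, by rw [← ha]; rfl⟩

/-- The section `e` of `L` along a curve has covariant derivative `ρ e` at time `t` within the
interval `J`, the velocity of the curve being `v`. -/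
def HasLogDeriv (S : Setting n X B L) (e : ℝ → TotalSpace ℂ L) (J : Set ℝ) (t : ℝ)
    (v : Euc (2 * n)) (ρ : ℂ) : Prop :=
  ∀ s : ∀ p, L p, SmoothSectionAt n s (e t).proj → s (e t).proj ≠ 0 → ∃ (a : ℝ → ℂ) (a' : ℂ),
    (∀ᶠ r in 𝓝[J] t, e r = tsmul (a r) ⟨(e r).proj, s (e r).proj⟩) ∧ HasDerivWithinAt a a' J t ∧
    a' = (ρ - S.connForm s (e t).proj v) * a t

/-- Two sections of `L` along the same curve differ by a factor that satisfies the linear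
differential equation given by the difference of their logarithmic derivatives. -/
theorem HasLogDeriv.ratio {e e' : ℝ → TotalSpace ℂ L} {J : Set ℝ} {t : ℝ} {v : Euc (2 * n)}
    {ρ ρ' : ℂ} (h : HasLogDeriv S e J t v ρ) (h' : HasLogDeriv S e' J t v ρ') (ht : t ∈ J)
    (hp : ∀ᶠ r in 𝓝[J] t, (e' r).proj = (e r).proj) (h0 : (e t).snd ≠ 0) :
    ∃ κ : ℝ → ℂ, (∀ᶠ r in 𝓝[J] t, e' r = tsmul (κ r) (e r)) ∧
      HasDerivWithinAt κ ((ρ' - ρ) * κ t) J t := by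
  obtain ⟨s, hs, hs0⟩ := exists_globalSection (n := n) L (e t).proj
  have hpt := hp.self_of_nhdsWithin ht
  obtain ⟨a, a', h1, h2, h3⟩ := h s (hs _) hs0.self_of_nhds
  obtain ⟨b, b', h4, h5, h6⟩ := h' s (hs _) (by rw [hpt]; exact hs0.self_of_nhds)
  have hat : a t ≠ 0 := by
    intro h7
    have h8 := h1.self_of_nhdsWithin ht
    rw [h7] at h8
    apply h0
    rw [h8]
    exact zero_smul ℂ (s (e t).proj)
  have hane : ∀ᶠ r in 𝓝[J] t, a r ≠ 0 := h2.continuousWithinAt.eventually_ne hat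
  refine ⟨fun r ↦ b r / a r, ?_, (h5.fun_div h2 hat).congr_deriv ?_⟩
  · filter_upwards [h1, h4, hp, hane] with r hr1 hr2 hr3 hr4
    rw [hr2]
    conv_rhs => rw [hr1]
    rw [tsmul_tsmul, div_mul_cancel₀ _ hr4, hr3]
  · rw [h3, h6, hpt]
    field_simp
    ring

/-- Two sections of `L` along the same curve, the logarithmic derivatives of which differ by `g'`,
differ by a constant multiple of `exp g`. -/
theorem HasLogDeriv.exists_eq_exp {e e' : ℝ → TotalSpace ℂ L} {J : Set ℝ} (hJ : Convex ℝ J)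
    {v : ℝ → Euc (2 * n)} {ρ ρ' : ℝ → ℂ} {g : ℝ → ℂ}
    (h : ∀ t ∈ J, HasLogDeriv S e J t (v t) (ρ t)) (h' : ∀ t ∈ J, HasLogDeriv S e' J t (v t) (ρ' t))
    (hp : ∀ t ∈ J, (e' t).proj = (e t).proj) (h0 : ∀ t ∈ J, (e t).snd ≠ 0)
    (hg : ∀ t ∈ J, HasDerivWithinAt g (ρ' t - ρ t) J t) :
    ∃ k : ℂ, ∀ t ∈ J, e' t = tsmul (k * Complex.exp (g t)) (e t) := by
  have hex : ∀ t, ∃ a, t ∈ J → e' t = tsmul a (e t) := fun t ↦ by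
    by_cases ht : t ∈ J
    · obtain ⟨a, ha⟩ := exists_tsmul (h0 t ht) (hp t ht)
      exact ⟨a, fun _ ↦ ha⟩
    · exact ⟨0, fun h ↦ absurd h ht⟩
  choose κ hκ using hex
  have hd : ∀ t ∈ J, HasDerivWithinAt κ ((ρ' t - ρ t) * κ t) J t := by
    intro t ht
    obtain ⟨κ', h1, h2⟩ := (h t ht).ratio (h' t ht) ht
      (Filter.eventually_of_mem self_mem_nhdsWithin hp) (h0 t ht)
    have hEq : κ =ᶠ[𝓝[J] t] κ' := by
      filter_upwards [h1, self_mem_nhdsWithin] with r hr hrJ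
      exact tsmul_injective (h0 r hrJ) ((hκ r hrJ).symm.trans hr)
    rw [hEq.self_of_nhdsWithin ht]
    exact h2.congr_of_eventuallyEq hEq (hEq.self_of_nhdsWithin ht)
  rcases J.eq_empty_or_nonempty with rfl | ⟨t₀, ht₀⟩
  · exact ⟨0, fun t ht ↦ absurd ht (notMem_empty t)⟩
  have hd' : ∀ t ∈ J, HasFDerivWithinAt (fun r ↦ κ r * Complex.exp (-g r)) (0 : ℝ →L[ℝ] ℂ) J t := by
    intro t ht
    have h1 : HasDerivWithinAt (fun r ↦ κ r * Complex.exp (-g r)) 0 J t :=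
      ((hd t ht).fun_mul (hg t ht).fun_neg.cexp).congr_deriv (by ring)
    have := h1.hasFDerivWithinAt
    simpa using this
  refine ⟨κ t₀ * Complex.exp (-g t₀), fun t ht ↦ ?_⟩
  have h1 : κ t * Complex.exp (-g t) = κ t₀ * Complex.exp (-g t₀) := by
    have := hJ.norm_image_sub_le_of_norm_hasFDerivWithin_le (C := 0) hd' (by simp) ht₀ ht
    rw [zero_mul, norm_le_zero_iff, sub_eq_zero] at this
    exact this
  rw [← h1, mul_assoc, ← Complex.exp_add, neg_add_cancel, Complex.exp_zero, mul_one]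
  exact hκ t ht

theorem IsNormalAt.hasLogDeriv {c : S.Chart} {E : ∀ y, L (c.Ψ y)} {z : ℝ → Euc n × Euc n}
    {z' : Euc n × Euc n} {J : Set ℝ} {t : ℝ} (ht : t ∈ J) (h : IsNormalAt c E (z t))
    (hz : HasDerivWithinAt z z' J t) :
    HasLogDeriv S (fun r ↦ ⟨c.Ψ (z r), E (z r)⟩) J t (c.dΨ (z t).1 (z t).2 z')
      (-(Complex.I * (inner ℝ (z t).1 z'.2 : ℝ))) := by
  intro s hs hs0
  obtain ⟨a, D, h1, h2, h3⟩ := h s hs hs0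
  refine ⟨fun r ↦ a (z r), D z', ?_, h2.comp_hasDerivWithinAt t hz, ?_⟩
  · filter_upwards [hz.continuousWithinAt.eventually h1] with r hr
    simp only [hr]; rfl
  · rw [h3, connFormChart_apply]
    ring

theorem hasLogDeriv_of_parallel {ℓ : ℝ → X} {e : ∀ t, L (ℓ t)} {J : Set ℝ} {t : ℝ}
    {v : Euc (2 * n)}
    (h : ∀ s : ∀ p, L p, SmoothSectionAt n s (ℓ t) → s (ℓ t) ≠ 0 → ∃ (a : ℝ → ℂ) (a' : ℂ),
      (∀ᶠ r in 𝓝[J] t, e r = a r • s (ℓ r)) ∧ HasDerivWithinAt a a' J t ∧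
      a' • s (ℓ t) + a t • S.conn s (ℓ t) v = 0) :
    HasLogDeriv S (fun r ↦ ⟨ℓ r, e r⟩) J t v 0 := by
  intro s hs hs0
  obtain ⟨a, a', h1, h2, h3⟩ := h s hs hs0
  refine ⟨a, a', h1.mono fun r hr ↦ by simp only [hr]; rfl, h2, ?_⟩
  have h4 : S.conn s (ℓ t) v = S.connForm s (ℓ t) v • s (ℓ t) := conn_eq_connForm hs0 v
  rw [h4, smul_smul, ← add_smul] at h3
  have h5 := (smul_eq_zero.1 h3).resolve_right hs0
  change a' = (0 - S.connForm s (ℓ t) v) * a t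
  linear_combination h5

theorem parallel_of_hasLogDeriv {ℓ : ℝ → X} {e : ∀ t, L (ℓ t)} {J : Set ℝ} {t : ℝ}
    {v : Euc (2 * n)} (h : HasLogDeriv S (fun r ↦ ⟨ℓ r, e r⟩) J t v 0) (s : ∀ p, L p)
    (hs : SmoothSectionAt n s (ℓ t)) (hs0 : s (ℓ t) ≠ 0) : ∃ (a : ℝ → ℂ) (a' : ℂ),
      (∀ᶠ r in 𝓝[J] t, e r = a r • s (ℓ r)) ∧ HasDerivWithinAt a a' J t ∧
      a' • s (ℓ t) + a t • S.conn s (ℓ t) v = 0 := by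
  obtain ⟨a, a', h1, h2, h3⟩ := h s hs hs0
  refine ⟨a, a', h1.mono fun r hr ↦ ?_, h2, ?_⟩
  · exact eq_of_heq ((TotalSpace.mk.injEq _ _ _ _).mp hr).2
  · have h4 : S.conn s (ℓ t) v = S.connForm s (ℓ t) v • s (ℓ t) := conn_eq_connForm hs0 v
    have h5 : a' = (0 - S.connForm s (ℓ t) v) * a t := h3
    rw [h4, smul_smul, ← add_smul, h5]
    have : (0 - S.connForm s (ℓ t) v) * a t + a t * S.connForm s (ℓ t) v = 0 := by ring
    rw [this, zero_smul]

theorem HasLogDeriv.tsmul {e : ℝ → TotalSpace ℂ L} {J : Set ℝ} {t : ℝ} {v : Euc (2 * n)} {ρ : ℂ}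
    (h : HasLogDeriv S e J t v ρ) {κ : ℝ → ℂ} {r : ℂ} (hκ : HasDerivWithinAt κ (r * κ t) J t) :
    HasLogDeriv S (fun r ↦ Setting.tsmul (κ r) (e r)) J t v (ρ + r) := by
  intro s hs hs0
  obtain ⟨a, a', h1, h2, h3⟩ := h s hs hs0
  refine ⟨fun r ↦ κ r * a r, _, ?_, hκ.fun_mul h2, ?_⟩
  · filter_upwards [h1] with r hr
    conv_lhs => rw [hr]
    rw [tsmul_tsmul]; rfl
  · rw [h3]
    change _ = (ρ + r - S.connForm s (e t).proj v) * _
    ring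

end AlongCurves

/-! ### Gluing of local flat sections over convex sets -/

/-- Local solutions that exist through every point and are unique on convex open sets can be
continued along the segments that issue from a point, and form a global solution. -/
theorem exists_global_of_local {V : Type*} [NormedAddCommGroup V] [NormedSpace ℝ V] {F : V → Type*}
    {D : Set V} (hDo : IsOpen D) (hDc : Convex ℝ D) (P : (∀ z, F z) → V → Prop)
    (germ : ∀ (E E' : ∀ z, F z) (y : V), (∀ᶠ z in 𝓝 y, E z = E' z) → P E y → P E' y)
    (loc : ∀ y ∈ D, ∃ ε > 0, ∀ z ∈ Metric.ball y ε, ∀ e : F z, ∃ E : ∀ z, F z,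
      E z = e ∧ ∀ z' ∈ Metric.ball y ε, P E z')
    (uniq : ∀ (E E' : ∀ z, F z) (N : Set V), IsOpen N → Convex ℝ N → N ⊆ D →
      (∀ z ∈ N, P E z) → (∀ z ∈ N, P E' z) → ∀ z ∈ N, E z = E' z → ∀ z' ∈ N, E z' = E' z')
    {y₀ : V} (hy₀ : y₀ ∈ D) (e₀ : F y₀) : ∃ E : ∀ z, F z, E y₀ = e₀ ∧ ∀ y ∈ D, P E y := by
  let A : V → Prop := fun y ↦ ∃ (δ : ℝ) (E : ∀ z, F z), 0 < δ ∧ E y₀ = e₀ ∧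
    ∀ z ∈ Metric.thickening δ (segment ℝ y₀ y) ∩ D, P E z
  have hopen : ∀ (δ : ℝ) (y : V), IsOpen (Metric.thickening δ (segment ℝ y₀ y) ∩ D) := fun δ y ↦
    Metric.isOpen_thickening.inter hDo
  have hconv : ∀ (δ : ℝ) (y : V), Convex ℝ (Metric.thickening δ (segment ℝ y₀ y) ∩ D) := fun δ y ↦
    ((convex_segment y₀ y).thickening δ).inter hDc
  have hA : ∀ y ∈ D, A y := by
    intro y hy
    let l : ℝ → V := fun t ↦ AffineMap.lineMap y₀ y t
    have hl : Continuous l := AffineMap.lineMap_continuous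
    have hlD : ∀ t ∈ Icc (0 : ℝ) 1, l t ∈ D := fun t ht ↦
      hDc.segment_subset hy₀ hy (lineMap_mem_segment ℝ y₀ y ht)
    have key : ∀ t ∈ Icc (0 : ℝ) 1, ∃ u ∈ 𝓝[Icc 0 1] t, ∀ s ∈ u, ∀ s' ∈ u,
        A (l s) → A (l s') := by
      intro t ht
      obtain ⟨ε, hε, hloc⟩ := loc (l t) (hlD t ht)
      have hb : ∀ᶠ s in 𝓝[Icc 0 1] t, s ∈ Icc (0 : ℝ) 1 ∧ l s ∈ Metric.ball (l t) (ε / 2) :=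
        Filter.Eventually.and self_mem_nhdsWithin (hl.continuousAt.continuousWithinAt.eventually
          (Metric.ball_mem_nhds _ (half_pos hε)))
      refine ⟨_, hb, fun s hs s' hs' ⟨δ, E, hδ, hE0, hE⟩ ↦ ?_⟩
      have hsmem : l s ∈ Metric.ball (l t) ε := Metric.ball_subset_ball (by linarith) hs.2
      obtain ⟨E', hE'1, hE'2⟩ := hloc (l s) hsmem (E (l s))
      have hagree : ∀ z ∈ Metric.ball (l t) ε ∩ (Metric.thickening δ (segment ℝ y₀ (l s)) ∩ D),
          E z = E' z := by
        refine fun z hz ↦ uniq E E' _ (Metric.isOpen_ball.inter (hopen _ _))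
          ((convex_ball _ _).inter (hconv _ _)) (fun z hz ↦ hz.2.2) (fun z hz ↦ hE z hz.2)
          (fun z hz ↦ hE'2 z hz.1) (l s) ⟨hsmem, ?_, hlD s hs.1⟩ hE'1.symm z hz
        exact Metric.self_subset_thickening hδ _ (right_mem_segment ℝ _ _)
      classical
      let N := Metric.thickening δ (segment ℝ y₀ (l s)) ∩ D
      let E'' : ∀ z, F z := fun z ↦ if z ∈ N then E z else E' z
      refine ⟨min δ (ε / 2), E'', lt_min hδ (half_pos hε), ?_, ?_⟩
      · have : y₀ ∈ N := ⟨Metric.self_subset_thickening hδ _ (left_mem_segment ℝ _ _), hy₀⟩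
        simp only [E'', if_pos this, hE0]
      · rintro z ⟨hz, hzD⟩
        by_cases hzN : z ∈ N
        · refine germ E E'' z ?_ (hE z hzN)
          filter_upwards [(hopen δ (l s)).mem_nhds hzN] with z' hz'
          exact (if_pos hz').symm
        · have hzb : z ∈ Metric.ball (l t) ε := by
            obtain ⟨u, hu, hzu⟩ := Metric.mem_thickening_iff.1 hz
            -- a point of the longer segment is in the shorter one or close to `l t`
            have hseg : u ∈ segment ℝ y₀ (l s) ∨ u ∈ Metric.ball (l t) (ε / 2) := by
              obtain ⟨r, hr, rfl⟩ := (segment_eq_image_lineMap ℝ y₀ (l s')).le hu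
              have hr' : AffineMap.lineMap y₀ (l s') r = l (r * s') := by
                simp only [l, AffineMap.lineMap_apply, vsub_eq_sub, vadd_eq_add, add_sub_cancel_right,
                  smul_smul]
              rw [hr']
              rcases le_or_gt (r * s') s with hle | hlt
              · left
                rcases hs.1.1.eq_or_lt with h0 | h0
                · have : r * s' = 0 := le_antisymm (by rw [h0]; exact hle)
                    (mul_nonneg hr.1 hs'.1.1)
                  rw [this]
                  simp only [l, AffineMap.lineMap_apply_zero]
                  exact left_mem_segment ℝ _ _
                · have : l (r * s') = AffineMap.lineMap y₀ (l s) (r * s' / s) := by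
                    simp only [l, AffineMap.lineMap_apply, vsub_eq_sub, vadd_eq_add,
                      add_sub_cancel_right, smul_smul, div_mul_cancel₀ _ h0.ne']
                  rw [this]
                  exact lineMap_mem_segment ℝ _ _ ⟨div_nonneg (mul_nonneg hr.1 hs'.1.1) h0.le,
                    (div_le_one h0).2 hle⟩
              · right
                have hmem : l (r * s') ∈ segment ℝ (l s) (l s') := by
                  have h1 : r * s' ∈ segment ℝ s s' := by
                    rw [segment_eq_Icc (by nlinarith [hr.2, hs'.1.1])]
                    exact ⟨hlt.le, by nlinarith [hr.2, hs'.1.1]⟩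
                  have := mem_image_of_mem (AffineMap.lineMap (k := ℝ) y₀ y) h1
                  rwa [image_segment] at this
                exact (convex_ball (l t) (ε / 2)).segment_subset hs.2 hs'.2 hmem
            rcases hseg with h1 | h1
            · exact absurd ⟨Metric.mem_thickening_iff.2
                ⟨u, h1, hzu.trans_le (min_le_left _ _)⟩, hzD⟩ hzN
            · rw [Metric.mem_ball] at h1 ⊢
              have := hzu.trans_le (min_le_right _ _)
              linarith [dist_triangle z u (l t)]
          refine germ E' E'' z ?_ (hE'2 z hzb)
          filter_upwards [Metric.isOpen_ball.mem_nhds hzb] with z' hz'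
          by_cases hz'N : z' ∈ N
          · simp only [E'', if_pos hz'N]
            exact (hagree z' ⟨hz', hz'N⟩).symm
          · simp only [E'', if_neg hz'N]
    have h0 : A (l 0) := by
      obtain ⟨ε, hε, hloc⟩ := loc y₀ hy₀
      obtain ⟨E, hE1, hE2⟩ := hloc y₀ (Metric.mem_ball_self hε) e₀
      refine ⟨ε, E, hε, hE1, fun z hz ↦ hE2 z ?_⟩
      simpa [l] using hz.1
    have key' : ∀ t ∈ Icc (0 : ℝ) 1, ∀ᶠ s in 𝓝[Icc 0 1] t, (A (l s) ↔ A (l t)) := by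
      intro t ht
      obtain ⟨u, hu, h⟩ := key t ht
      have htu := mem_of_mem_nhdsWithin ht hu
      filter_upwards [hu] with s hs
      exact ⟨h s hs t htu, h t htu s hs⟩
    have := IsPreconnected.of_locally_iff (isPreconnected_Icc (a := (0 : ℝ)) (b := 1)) key'
      (left_mem_Icc.2 zero_le_one) (right_mem_Icc.2 zero_le_one) h0
    simpa [l] using this
  have : Nonempty (∀ z, F z) := ⟨(hA y₀ hy₀).choose_spec.choose⟩
  choose! δ E hδ hE0 hE using hA
  have hmem : ∀ y ∈ D, y₀ ∈ Metric.thickening (δ y) (segment ℝ y₀ y) := fun y hy ↦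
    Metric.self_subset_thickening (hδ y hy) _ (left_mem_segment ℝ _ _)
  refine ⟨fun y ↦ E y y, hE0 _ hy₀, fun y hy ↦ germ (E y) _ y ?_
    (hE y hy y ⟨Metric.self_subset_thickening (hδ y hy) _ (right_mem_segment ℝ _ _), hy⟩)⟩
  filter_upwards [(hopen (δ y) y).mem_nhds
    ⟨Metric.self_subset_thickening (hδ y hy) _ (right_mem_segment ℝ _ _), hy⟩] with z hz
  refine uniq (E y) (E z) ((Metric.thickening (δ y) (segment ℝ y₀ y) ∩ D) ∩
    (Metric.thickening (δ z) (segment ℝ y₀ z) ∩ D)) ((hopen _ _).inter (hopen _ _))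
    ((hconv _ _).inter (hconv _ _)) (fun u hu ↦ hu.2.2) (fun u hu ↦ hE y hy u hu.1)
    (fun u hu ↦ hE z hz.2 u hu.2) y₀ ⟨⟨hmem y hy, hy₀⟩, hmem z hz.2, hy₀⟩
    ((hE0 y hy).trans (hE0 z hz.2).symm) z
    ⟨hz, Metric.self_subset_thickening (hδ z hz.2) _ (right_mem_segment ℝ _ _), hz.2⟩

/-! ### Gauges -/

section Gauges

variable [T2Space X] [VectorBundle ℂ ℂ L] [ContMDiffVectorBundle ∞ ℂ L (𝓡 (2 * n))]

theorem IsNormalAt.congr {c : S.Chart} {E E' : ∀ y, L (c.Ψ y)} {y : Euc n × Euc n}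
    (h : IsNormalAt c E y) (hE : ∀ᶠ z in 𝓝 y, E z = E' z) : IsNormalAt c E' y := by
  intro s hs hs0
  obtain ⟨a, D, h1, h2, h3⟩ := h s hs hs0
  refine ⟨a, D, ?_, h2, h3⟩
  filter_upwards [h1, hE] with z hz hz'
  rw [← hz', hz]

theorem IsNormalAt.const_smul {c : S.Chart} {E : ∀ y, L (c.Ψ y)} {y : Euc n × Euc n}
    (h : IsNormalAt c E y) (r : ℂ) : IsNormalAt c (fun z ↦ r • E z) y := by
  intro s hs hs0
  obtain ⟨a, D, h1, h2, h3⟩ := h s hs hs0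
  refine ⟨fun z ↦ r * a z, r • D, ?_, h2.const_mul r, fun v ↦ ?_⟩
  · filter_upwards [h1] with z hz
    rw [hz, smul_smul]
  · rw [smul_apply, smul_eq_mul, h3]
    ring

theorem hasDerivAt_lineMap' {V : Type*} [NormedAddCommGroup V] [NormedSpace ℝ V] (a b : V) (t : ℝ) :
    HasDerivAt (fun r : ℝ ↦ AffineMap.lineMap a b r) (b - a) t :=
  AffineMap.hasDerivAt_lineMap

theorem IsNormalAt.unique {c : S.Chart} {E E' : ∀ y, L (c.Ψ y)} {N : Set (Euc n × Euc n)}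
    (hN : Convex ℝ N) (h : ∀ z ∈ N, IsNormalAt c E z) (h' : ∀ z ∈ N, IsNormalAt c E' z)
    (h0 : ∀ z ∈ N, E z ≠ 0) {z z' : Euc n × Euc n} (hz : z ∈ N) (hz' : z' ∈ N) (hzz : E z = E' z) :
    E z' = E' z' := by
  have hmem : ∀ t ∈ Icc (0 : ℝ) 1, AffineMap.lineMap z z' t ∈ N := fun t ht ↦
    hN.segment_subset hz hz' (lineMap_mem_segment ℝ z z' ht)
  have hd : ∀ t ∈ Icc (0 : ℝ) 1, HasDerivWithinAt (fun r : ℝ ↦ AffineMap.lineMap z z' r) (z' - z)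
      (Icc 0 1) t := fun t _ ↦ (hasDerivAt_lineMap' z z' t).hasDerivWithinAt
  obtain ⟨k, hk⟩ := HasLogDeriv.exists_eq_exp (S := S) (g := fun _ ↦ 0) (convex_Icc (0 : ℝ) 1)
    (fun t ht ↦ (h _ (hmem t ht)).hasLogDeriv ht (hd t ht))
    (fun t ht ↦ (h' _ (hmem t ht)).hasLogDeriv ht (hd t ht)) (fun t ht ↦ rfl)
    (fun t ht ↦ h0 _ (hmem t ht))
    (fun t ht ↦ by rw [sub_self]; exact hasDerivWithinAt_const _ _ _)
  simp only [Complex.exp_zero, mul_one] at hk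
  have e0 : (fun w ↦ (⟨c.Ψ w, E' w⟩ : TotalSpace ℂ L)) (AffineMap.lineMap z z' (0 : ℝ)) =
      tsmul k ((fun w ↦ (⟨c.Ψ w, E w⟩ : TotalSpace ℂ L)) (AffineMap.lineMap z z' (0 : ℝ))) :=
    hk 0 (left_mem_Icc.2 zero_le_one)
  have e1 : (fun w ↦ (⟨c.Ψ w, E' w⟩ : TotalSpace ℂ L)) (AffineMap.lineMap z z' (1 : ℝ)) =
      tsmul k ((fun w ↦ (⟨c.Ψ w, E w⟩ : TotalSpace ℂ L)) (AffineMap.lineMap z z' (1 : ℝ))) :=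
    hk 1 (right_mem_Icc.2 zero_le_one)
  rw [AffineMap.lineMap_apply_zero] at e0
  rw [AffineMap.lineMap_apply_one] at e1
  beta_reduce at e0 e1
  rw [← hzz] at e0
  have hk1 : k = 1 := by
    refine (tsmul_injective (x := (⟨c.Ψ z, E z⟩ : TotalSpace ℂ L)) (h0 z hz) ?_).symm
    rw [tsmul_one]
    exact e0
  rw [hk1, tsmul_one] at e1
  exact (eq_of_heq ((TotalSpace.mk.injEq _ _ _ _).mp e1).2).symm

/-- Unit sections in normal form exist over products of convex sets with `ℝⁿ`. -/
theorem exists_normal (c : S.Chart) {W : Set (Euc n)} (hW : IsOpen W) (hWc : Convex ℝ W)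
    (hWV : W ⊆ c.x '' c.V) :
    ∃ E : ∀ y, L (c.Ψ y), ∀ y : Euc n × Euc n, y.1 ∈ W → ‖E y‖ = 1 ∧ IsNormalAt c E y := by
  -- Local unit sections in normal form are unique up to a constant, hence glue over the simply
  -- connected set `W × ℝⁿ`.
  rcases W.eq_empty_or_nonempty with rfl | ⟨ξ₀, hξ₀⟩
  · exact ⟨fun _ ↦ 0, fun y hy ↦ absurd hy (notMem_empty _)⟩
  let F : Euc n × Euc n → Type _ := fun z ↦ {e : L (c.Ψ z) // ‖e‖ = 1}
  let P : (∀ z, F z) → Euc n × Euc n → Prop := fun E y ↦ IsNormalAt c (fun z ↦ (E z).1) y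
  obtain ⟨E, -, hE⟩ := exists_global_of_local (F := F) (D := W ×ˢ univ) (hW.prod isOpen_univ)
    (hWc.prod convex_univ) P
    (fun E E' y h hP ↦ hP.congr (h.mono fun z hz ↦ congrArg Subtype.val hz))
    (fun y hy ↦ by
      obtain ⟨ε, hε, E, hE⟩ := exists_local_normal (S := S) c (hWV hy.1)
      refine ⟨ε, hε, fun z hz e ↦ ?_⟩
      have hEz : E z ≠ 0 := by
        intro h0
        have := (hE z hz).1
        rw [h0, norm_zero] at this
        exact zero_ne_one this
      obtain ⟨r, hr⟩ := exists_smul_of_ne_zero hEz e.1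
      have hrn : ‖r‖ = 1 := by
        have := congrArg norm hr
        rwa [norm_smul, (hE z hz).1, mul_one, e.2] at this
      classical
      refine ⟨fun z' ↦ if h : z' ∈ Metric.ball y ε then ⟨r • E z', by
        rw [norm_smul, hrn, one_mul, (hE z' h).1]⟩ else ⟨unitVec L _, norm_unitVec L _⟩, ?_, ?_⟩
      · exact (dif_pos hz).trans (Subtype.ext hr)
      · intro z' hz'
        refine ((hE z' hz').2.const_smul r).congr ?_
        filter_upwards [Metric.isOpen_ball.mem_nhds hz'] with z'' hz''
        rw [dif_pos hz''])
    (fun E E' N hNo hNc hND hE hE' z hz hzz z' hz' ↦ Subtype.ext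
      (IsNormalAt.unique hNc hE hE' (fun z _ h0 ↦ by
        have := (E z).2
        rw [h0, norm_zero] at this
        exact zero_ne_one this) hz hz' (congrArg Subtype.val hzz)))
    (y₀ := (ξ₀, 0)) ⟨hξ₀, mem_univ _⟩ ⟨unitVec L _, norm_unitVec L _⟩
  exact ⟨fun z ↦ (E z).1, fun y hy ↦ ⟨(E y).2, hE y ⟨hy, mem_univ _⟩⟩⟩

/-- The horizontal distribution in the coordinates of a chart: the vector `v` is horizontal if
and only if `v.2` is the value at `v.1` of a linear map that depends on the base point only. -/
theorem exists_slope (c : S.Chart) : ∃ A : Euc n → Euc n →L[ℝ] Euc n,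
    ContDiffOn ℝ ∞ A (c.x '' c.V) ∧ ∀ y : Euc n × Euc n, y.1 ∈ c.x '' c.V → ∀ v,
      c.dΨ y.1 y.2 v ∈ S.H (c.Ψ y) ↔ v.2 = A y.1 v.1 := by
  have hker : ∀ y : Euc n × Euc n, y.1 ∈ c.x '' c.V → ∀ v,
      dproj n S.μ (c.Ψ y) (c.dΨ y.1 y.2 v) = 0 ↔ v.1 = 0 := by
    rintro ⟨_, θ⟩ ⟨b, hb, rfl⟩ v
    constructor
    · intro h
      obtain ⟨w, hw⟩ := exists_vert hb θ _ h
      have := (bijective_dΨ c (y := (c.x b, θ)) (mem_image_of_mem _ hb)).1 hw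
      rw [← this]
    · intro h
      have : v = (0, v.2) := Prod.ext h rfl
      rw [this]
      exact dproj_vert hb θ v.2
  -- the horizontal lift of a vector of the base
  have hlift : ∀ y : Euc n × Euc n, y.1 ∈ c.x '' c.V → ∀ u : Euc n, ∃ w : Euc n,
      c.dΨ y.1 y.2 (u, w) ∈ S.H (c.Ψ y) := by
    intro y hy u
    have hc := S.horizontal.isCompl (c.Ψ y)
    obtain ⟨h, hh, k, hk, hsum⟩ := Submodule.mem_sup.1
      (hc.sup_eq_top.ge (Submodule.mem_top (x := c.dΨ y.1 y.2 (u, 0))))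
    obtain ⟨⟨a, w⟩, hv⟩ := (bijective_dΨ c hy).2 k
    have ha : a = 0 := (hker y hy (a, w)).1 (by rw [hv]; exact hk)
    refine ⟨-w, ?_⟩
    have : ((u, -w) : Euc n × Euc n) = (u, 0) - (a, w) := by simp [ha]
    rw [this, map_sub, hv, ← hsum, add_sub_cancel_right]
    exact hh
  have huniq : ∀ y : Euc n × Euc n, y.1 ∈ c.x '' c.V → ∀ v w : Euc n × Euc n, v.1 = w.1 →
      c.dΨ y.1 y.2 v ∈ S.H (c.Ψ y) → c.dΨ y.1 y.2 w ∈ S.H (c.Ψ y) → v = w := by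
    intro y hy v w hvw hv hw
    have hc := S.horizontal.isCompl (c.Ψ y)
    have h1 : c.dΨ y.1 y.2 (v - w) ∈ S.H (c.Ψ y) := by
      rw [map_sub]; exact Submodule.sub_mem _ hv hw
    have h2 : c.dΨ y.1 y.2 (v - w) = 0 := (Submodule.disjoint_def.1 hc.disjoint) _ h1
      ((hker y hy (v - w)).2 (by simp [hvw]))
    have h3 := (bijective_dΨ c hy).1 (h2.trans (map_zero _).symm)
    exact sub_eq_zero.1 h3
  -- a linear solution at a point, from a spanning set of horizontal vectors
  have hloc : ∀ ξ ∈ c.x '' c.V, ∃ A : Euc n → Euc n →L[ℝ] Euc n, ContDiffAt ℝ ∞ A ξ ∧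
      ∀ᶠ ζ in 𝓝 ξ, ∀ u, c.dΨ ζ 0 (u, A ζ u) ∈ S.H (c.Ψ (ζ, 0)) := by
    intro ξ hξ
    obtain ⟨Y, hY, hspan⟩ := S.horizontal.smooth (c.Ψ (ξ, 0))
    let y : Fin n → Euc n × Euc n → Euc n × Euc n := fun j ↦
      VectorField.mpullback 𝓘(ℝ, Euc n × Euc n) (𝓡 (2 * n)) c.Ψ (Y j)
    have hcont : ContinuousAt (fun ζ : Euc n ↦ c.Ψ (ζ, 0)) ξ :=
      ContinuousAt.comp (f := fun ζ : Euc n ↦ (ζ, (0 : Euc n)))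
        (contMDiffAt_Ψ c (y := (ξ, 0)) hξ).continuousAt (by fun_prop)
    have hinv : ∀ z : Euc n × Euc n, z.1 ∈ c.x '' c.V →
        (mfderiv 𝓘(ℝ, Euc n × Euc n) (𝓡 (2 * n)) c.Ψ z).IsInvertible := fun z hz ↦
      ⟨ContinuousLinearEquiv.ofBijective (F := Euc (2 * n)) (c.dΨ z.1 z.2)
        (LinearMap.ker_eq_bot.2 (bijective_dΨ c hz).1)
        (LinearMap.range_eq_top.2 (bijective_dΨ c hz).2), rfl⟩
    have hdy : ∀ j (z : Euc n × Euc n), z.1 ∈ c.x '' c.V → c.dΨ z.1 z.2 (y j z) = Y j (c.Ψ z) := by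
      intro j z hz
      obtain ⟨e, he⟩ := hinv z hz
      change mfderiv 𝓘(ℝ, Euc n × Euc n) (𝓡 (2 * n)) c.Ψ z
        ((mfderiv 𝓘(ℝ, Euc n × Euc n) (𝓡 (2 * n)) c.Ψ z).inverse (Y j (c.Ψ z))) = _
      rw [← he, ContinuousLinearMap.inverse_equiv]
      exact e.apply_symm_apply _
    have hys : ∀ j, ContDiffAt ℝ ∞ (y j) (ξ, 0) := by
      intro j
      have h1 : ContMDiffAt 𝓘(ℝ, Euc n × Euc n) 𝓘(ℝ, Euc n × Euc n).tangent ∞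
          (fun z ↦ (⟨z, y j z⟩ : TangentBundle 𝓘(ℝ, Euc n × Euc n) (Euc n × Euc n))) (ξ, 0) := by
        have : IsManifold (𝓡 (2 * n)) 1 X := IsManifold.of_le (n := ∞) (by simp)
        exact ContMDiffAt.mpullback_vectorField_preimage (hY j).self_of_nhds
          (contMDiffAt_Ψ c (y := (ξ, 0)) hξ) (hinv _ hξ) (by simp)
      exact contMDiffAt_vectorSpace_iff_contDiffAt.1 h1
    let U : Euc n → Euc n →L[ℝ] Euc n := fun ζ ↦
      ∑ j, (EuclideanSpace.proj j : Euc n →L[ℝ] ℝ).smulRight (y j (ζ, 0)).1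
    let Wm : Euc n → Euc n →L[ℝ] Euc n := fun ζ ↦
      ∑ j, (EuclideanSpace.proj j : Euc n →L[ℝ] ℝ).smulRight (y j (ζ, 0)).2
    have hyc : ∀ j, ContDiffAt ℝ ∞ (fun ζ : Euc n ↦ y j (ζ, 0)) ξ := fun j ↦
      ContDiffAt.comp (f := fun ζ : Euc n ↦ (ζ, (0 : Euc n))) ξ (hys j)
        (contDiffAt_id.prodMk contDiffAt_const)
    have hU : ContDiffAt ℝ ∞ U ξ := by
      refine ContDiffAt.sum fun j _ ↦ ?_
      exact ((ContinuousLinearMap.smulRightL ℝ (Euc n) (Euc n)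
        (EuclideanSpace.proj j)).contDiff.contDiffAt).comp ξ (hyc j).fst
    have hWm : ContDiffAt ℝ ∞ Wm ξ := by
      refine ContDiffAt.sum fun j _ ↦ ?_
      exact ((ContinuousLinearMap.smulRightL ℝ (Euc n) (Euc n)
        (EuclideanSpace.proj j)).contDiff.contDiffAt).comp ξ (hyc j).snd
    have hUW : ∀ ζ ∈ c.x '' c.V, ∀ a : Euc n, c.dΨ ζ 0 (U ζ a, Wm ζ a) =
        (∑ j, a j • (Y j (c.Ψ (ζ, 0)) : Euc (2 * n)) : Euc (2 * n)) := by
      intro ζ hζ a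
      have h1 : ((U ζ a, Wm ζ a) : Euc n × Euc n) = ∑ j, a j • y j (ζ, 0) := by
        ext1 <;> simp [U, Wm, ContinuousLinearMap.sum_apply, Prod.fst_sum, Prod.snd_sum]
      rw [h1, map_sum]
      refine Finset.sum_congr rfl fun j _ ↦ ?_
      rw [map_smul, hdy j (ζ, 0) hζ]
    have hnear : ∀ᶠ ζ in 𝓝 ξ, ζ ∈ c.x '' c.V ∧
        Submodule.span ℝ (range fun j ↦ Y j (c.Ψ (ζ, 0))) = S.H (c.Ψ (ζ, 0)) :=
      Filter.Eventually.and (c.isOpen_image.mem_nhds hξ) (hcont.eventually hspan)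
    have hUsurj : ∀ᶠ ζ in 𝓝 ξ, (U ζ).IsInvertible := by
      filter_upwards [hnear] with ζ hζ
      have hs : Function.Surjective (U ζ) := by
        intro u
        obtain ⟨w, hw⟩ := hlift (ζ, 0) hζ.1 u
        rw [← hζ.2] at hw
        obtain ⟨a, ha⟩ := (Submodule.mem_span_range_iff_exists_fun ℝ).1 hw
        refine ⟨WithLp.toLp 2 a, ?_⟩
        have h1 := hUW ζ hζ.1 (WithLp.toLp 2 a)
        have h2 := (bijective_dΨ c (y := (ζ, 0)) hζ.1).1 (h1.trans ha)
        exact congrArg Prod.fst h2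
      have hi : Function.Injective (U ζ) :=
        (LinearMap.injective_iff_surjective (f := (U ζ).toLinearMap)).2 hs
      exact ⟨ContinuousLinearEquiv.ofBijective (U ζ) (LinearMap.ker_eq_bot.2 hi)
        (LinearMap.range_eq_top.2 hs), rfl⟩
    refine ⟨fun ζ ↦ (Wm ζ).comp (U ζ).inverse, ?_, ?_⟩
    · obtain ⟨e, he⟩ := hUsurj.self_of_nhds
      have h1 : ContDiffAt ℝ ∞ ContinuousLinearMap.inverse (U ξ) := by
        rw [← he]; exact contDiffAt_map_inverse e
      exact hWm.clm_comp (h1.comp ξ hU)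
    · filter_upwards [hnear, hUsurj] with ζ hζ ⟨e, he⟩ u
      have h1 := hUW ζ hζ.1 ((U ζ).inverse u)
      have h2 : U ζ ((U ζ).inverse u) = u := by
        rw [← he, ContinuousLinearMap.inverse_equiv]
        exact e.apply_symm_apply u
      rw [h2] at h1
      rw [ContinuousLinearMap.comp_apply, h1, ← hζ.2]
      exact Submodule.sum_mem _ fun j _ ↦ Submodule.smul_mem _ _
        (Submodule.subset_span (mem_range_self j))
  choose! A hA hA' using hloc
  refine ⟨fun ξ ↦ A ξ ξ, fun ξ hξ ↦ ?_, fun y hy v ↦ ?_⟩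
  · refine ((hA ξ hξ).congr_of_eventuallyEq ?_).contDiffWithinAt
    filter_upwards [hA' ξ hξ, c.isOpen_image.mem_nhds hξ] with ζ hζ hζV
    ext1 u
    have := huniq (ζ, 0) hζV (u, A ζ ζ u) (u, A ξ ζ u) rfl ((hA' ζ hζV).self_of_nhds u) (hζ u)
    exact congrArg Prod.snd this
  · have hinv : c.dΨ y.1 y.2 (v.1, A y.1 y.1 v.1) ∈ S.H (c.Ψ y) := by
      have h1 := S.horizontal.invariant c y.1 hy y.2 0
      have h2 : (v.1, A y.1 y.1 v.1) ∈ (S.H (c.Ψ (y.1, 0))).comap (c.dΨ y.1 0).toLinearMap :=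
        (hA' y.1 hy).self_of_nhds v.1
      rw [← h1] at h2
      exact h2
    constructor
    · intro h
      have := huniq y hy v (v.1, A y.1 y.1 v.1) rfl h hinv
      exact congrArg Prod.snd this
    · intro h
      have : v = (v.1, A y.1 y.1 v.1) := Prod.ext rfl h
      rw [this]
      exact hinv

variable (S) in
/-- A gauge over a convex set `W` of values of the action coordinates of a chart `c`: a unit section
`E` of `L` along the universal covering of the part of `X` over `W`, with
`∇E = -i ∑ xⱼ dθⱼ ⊗ E`, and the slope of the horizontal distribution. -/
structure Gauge where
  c : S.Chart
  W : Set (Euc n)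
  isOpen_W : IsOpen W
  convex_W : Convex ℝ W
  subset : W ⊆ c.x '' c.V
  E : ∀ y, L (c.Ψ y)
  norm_E : ∀ y : Euc n × Euc n, y.1 ∈ W → ‖E y‖ = 1
  normal : ∀ y : Euc n × Euc n, y.1 ∈ W → IsNormalAt c E y
  slope : Euc n → Euc n →L[ℝ] Euc n
  smooth_slope : ContDiffOn ℝ ∞ slope W
  mem_H : ∀ y : Euc n × Euc n, y.1 ∈ W → ∀ v, c.dΨ y.1 y.2 v ∈ S.H (c.Ψ y) ↔ v.2 = slope y.1 v.1

theorem exists_gauge (c : S.Chart) {W : Set (Euc n)} (hW : IsOpen W) (hWc : Convex ℝ W)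
    (hWV : W ⊆ c.x '' c.V) : ∃ G : S.Gauge, G.c = c ∧ G.W = W := by
  obtain ⟨E, hE⟩ := exists_normal (S := S) c hW hWc hWV
  obtain ⟨A, hA, hA'⟩ := exists_slope (S := S) c
  exact ⟨⟨c, W, hW, hWc, hWV, E, fun y hy ↦ (hE y hy).1, fun y hy ↦ (hE y hy).2, A,
    hA.mono hWV, fun y hy ↦ hA' y (hWV hy)⟩, rfl, rfl⟩

end Gauges

/-! ### Lattices and transitions between angle coordinates -/

/-- The vector `2π m` of the lattice `(2πℤ)ⁿ`. -/
def latt {n : ℕ} (m : Fin n → ℤ) : Euc n := WithLp.toLp 2 fun i ↦ 2 * Real.pi * m i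

@[simp] theorem latt_apply {n : ℕ} (m : Fin n → ℤ) (i : Fin n) : latt m i = 2 * Real.pi * m i := rfl

theorem latt_injective {n : ℕ} : Function.Injective (latt (n := n)) := by
  intro m m' h
  funext i
  have h1 := congrArg (fun v : Euc n ↦ v i) h
  simp only [latt_apply] at h1
  have h2 := mul_left_cancel₀ Real.two_pi_pos.ne' h1
  exact_mod_cast h2

theorem latt_eq_sum {n : ℕ} (m : Fin n → ℤ) :
    latt m = ∑ i, m i • latt (Pi.single i (1 : ℤ)) := by
  ext j
  rw [WithLp.ofLp_sum, Finset.sum_apply]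
  simp [Pi.single_apply, mul_comm]

theorem pt_add_latt {c : S.Chart} {b : B} (hb : b ∈ c.V) (θ : Euc n) (m : Fin n → ℤ) :
    c.pt b (θ + latt m) = c.pt b θ :=
  (c.periodic _ (mem_image_of_mem _ hb) _ _).2 ⟨m, fun i ↦ by simp⟩

theorem exists_latt {c : S.Chart} {b : B} (hb : b ∈ c.V) {θ θ' : Euc n}
    (h : c.pt b θ = c.pt b θ') : ∃ m, θ = θ' + latt m := by
  obtain ⟨m, hm⟩ := (c.periodic _ (mem_image_of_mem _ hb) _ _).1 h
  refine ⟨m, ?_⟩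
  ext i
  have := hm i
  simp only [PiLp.add_apply, latt_apply]
  linarith

theorem exists_pt {c : S.Chart} {p : X} (hp : S.μ p ∈ c.V) : ∃ θ, c.pt (S.μ p) θ = p :=
  c.surjective p hp

theorem exists_pt_eq {c : S.Chart} {b : B} (hb : b ∈ c.V) {p : X} (hp : S.μ p = b) :
    ∃ θ, c.pt b θ = p := by
  subst hp; exact exists_pt hb

/-- The inverse transpose of an invertible linear map. -/
theorem exists_dual {n : ℕ} (A : Euc n ≃ₗ[ℝ] Euc n) :
    ∃ T : Euc n ≃L[ℝ] Euc n, ∀ v w, inner ℝ (A v) (T w) = inner ℝ v w := by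
  refine ⟨(LinearEquiv.ofLinear (LinearMap.adjoint A.symm.toLinearMap)
    (LinearMap.adjoint A.toLinearMap) ?_ ?_).toContinuousLinearEquiv, fun v w ↦ ?_⟩
  · rw [← LinearMap.adjoint_comp]; simp
  · rw [← LinearMap.adjoint_comp]; simp
  · change inner ℝ (A v) (LinearMap.adjoint A.symm.toLinearMap w) = _
    rw [LinearMap.adjoint_inner_right]; simp

/-- A linear automorphism of `ℝⁿ` that preserves the lattice has an integral matrix of determinant
`± 1`. -/
theorem exists_intMatrix {n : ℕ} (T : Euc n ≃L[ℝ] Euc n)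
    (h : ∀ m : Fin n → ℤ, ∃ m', T (latt m) = latt m')
    (h' : ∀ m : Fin n → ℤ, ∃ m', T.symm (latt m) = latt m') :
    ∃ P : Matrix (Fin n) (Fin n) ℝ, |P.det| = 1 ∧
      ∀ i, T (EuclideanSpace.single i 1) = ∑ j, P i j • EuclideanSpace.single j 1 := by
  choose f hf using h
  choose g hg using h'
  let P : Matrix (Fin n) (Fin n) ℤ := Matrix.of fun i j ↦ f (Pi.single i 1) j
  let Q : Matrix (Fin n) (Fin n) ℤ := Matrix.of fun i j ↦ g (Pi.single i 1) j
  have hPQ : Q * P = 1 := by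
    ext i j
    have h1 : T (T.symm (latt (Pi.single i 1))) = latt (Pi.single i 1) := T.apply_symm_apply _
    rw [hg, latt_eq_sum, map_sum] at h1
    simp only [map_zsmul, hf] at h1
    have h2 : latt (fun j ↦ ∑ l, g (Pi.single i 1) l * f (Pi.single l 1) j) =
        latt (Pi.single i (1 : ℤ)) := by
      rw [← h1]
      ext j
      rw [WithLp.ofLp_sum, Finset.sum_apply]
      simp only [latt_apply, Int.cast_sum, Int.cast_mul, Finset.mul_sum, PiLp.smul_apply,
        zsmul_eq_mul]
      exact Finset.sum_congr rfl fun l _ ↦ by ring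
    have h3 := congrFun (latt_injective h2) j
    rw [Matrix.mul_apply, Matrix.one_apply]
    refine h3.trans ?_
    simp [Pi.single_apply, eq_comm]
  have hdet : Q.det * P.det = 1 := by rw [← Matrix.det_mul, hPQ, Matrix.det_one]
  have hP : IsUnit P.det := IsUnit.of_mul_eq_one Q.det (by rw [mul_comm]; exact hdet)
  refine ⟨P.map (Int.cast : ℤ → ℝ), ?_, fun i ↦ ?_⟩
  · have h1 : (P.map (Int.cast : ℤ → ℝ)).det = ((P.det : ℤ) : ℝ) :=
      ((Int.castRingHom ℝ).map_det P).symm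
    rw [h1]
    rcases Int.isUnit_iff.1 hP with h2 | h2 <;> rw [h2] <;> simp
  · have h1 : latt (Pi.single i (1 : ℤ)) = (2 * Real.pi) • EuclideanSpace.single i (1 : ℝ) := by
      ext j; simp [Pi.single_apply]
    have h2 := hf (Pi.single i 1)
    rw [h1, map_smul] at h2
    refine smul_right_injective _ Real.two_pi_pos.ne' ?_
    change (2 * Real.pi) • T _ = (2 * Real.pi) • _
    rw [h2]
    ext j
    simp [P, WithLp.ofLp_sum, Finset.sum_apply, Pi.single_apply, Matrix.map_apply]

section Transitions

variable [T2Space X]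

/-- The passage from the angle coordinates of a chart `c` to those of `c'` on the fibre over `b`. -/
structure IsFiberTransition (c c' : S.Chart) (b : B) (A : Euc n ≃ᵃ[ℝ] Euc n)
    (T : Euc n ≃L[ℝ] Euc n) : Prop where
  affine : ∀ᶠ b' in 𝓝 b, c'.x b' = A (c.x b')
  dual : ∀ v w, inner ℝ (A.linear v) (T w) = inner ℝ v w
  pt_add : ∀ θ θ', c.pt b θ = c'.pt b θ' → ∀ w, c.pt b (θ + w) = c'.pt b (θ' + T w)
  vert : ∀ θ θ', c.pt b θ = c'.pt b θ' → ∀ w,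
    (c.vert b θ w : Euc (2 * n)) = c'.vert b θ' (T w)

theorem isFiberTransition {c c' : S.Chart} {b : B} (hb : b ∈ c.V) (hb' : b ∈ c'.V)
    {A : Euc n ≃ᵃ[ℝ] Euc n} {T : Euc n ≃L[ℝ] Euc n} (hA : ∀ᶠ b' in 𝓝 b, c'.x b' = A (c.x b'))
    (hT : ∀ v w, inner ℝ (A.linear v) (T w) = inner ℝ v w) : IsFiberTransition c c' b A T :=
  ⟨hA, hT, fun _ _ h w ↦ (Ψ_add_of_transition hb hb' hA (fun v ↦ hT v w) h).1,
    fun _ _ h w ↦ (Ψ_add_of_transition hb hb' hA (fun v ↦ hT v w) h).2⟩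

/-- The change of action coordinates at a common point is affine, and the angle coordinates on the
fibre change by the inverse transpose of its linear part and a translation. -/
theorem exists_fiberTransition (c c' : S.Chart) {b : B} (hb : b ∈ c.V) (hb' : b ∈ c'.V) :
    ∃ A T, IsFiberTransition c c' b A T := by
  obtain ⟨A, hA⟩ := exists_transition c c' hb hb'
  obtain ⟨T, hT⟩ := exists_dual A.linear
  exact ⟨A, T, isFiberTransition hb hb' hA hT⟩

theorem IsFiberTransition.apply_latt {c c' : S.Chart} {b : B} {A : Euc n ≃ᵃ[ℝ] Euc n}
    {T : Euc n ≃L[ℝ] Euc n} (h : IsFiberTransition c c' b A T) (hb : b ∈ c.V) (hb' : b ∈ c'.V)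
    (m : Fin n → ℤ) : ∃ m', T (latt m) = latt m' := by
  obtain ⟨θ', hθ'⟩ := exists_pt_eq hb' (proj_pt hb 0)
  have h1 := h.pt_add 0 θ' hθ'.symm (latt m)
  rw [pt_add_latt hb, ← hθ'] at h1
  obtain ⟨m', hm'⟩ := exists_latt hb' h1.symm
  exact ⟨m', add_left_cancel hm'⟩

theorem IsFiberTransition.symm_apply_latt {c c' : S.Chart} {b : B} {A : Euc n ≃ᵃ[ℝ] Euc n}
    {T : Euc n ≃L[ℝ] Euc n} (h : IsFiberTransition c c' b A T) (hb : b ∈ c.V) (hb' : b ∈ c'.V)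
    (m : Fin n → ℤ) : ∃ m', T.symm (latt m) = latt m' := by
  obtain ⟨θ', hθ'⟩ := exists_pt_eq hb' (proj_pt hb 0)
  have h1 := h.pt_add 0 θ' hθ'.symm (T.symm (latt m))
  rw [T.apply_symm_apply, pt_add_latt hb', hθ'] at h1
  obtain ⟨m', hm'⟩ := exists_latt hb h1
  exact ⟨m', add_left_cancel hm'⟩

theorem IsFiberTransition.exists_matrix {c c' : S.Chart} {b : B} {A : Euc n ≃ᵃ[ℝ] Euc n}
    {T : Euc n ≃L[ℝ] Euc n} (h : IsFiberTransition c c' b A T) (hb : b ∈ c.V) (hb' : b ∈ c'.V) :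
    ∃ P : Matrix (Fin n) (Fin n) ℝ, |P.det| = 1 ∧
      ∀ i, T (EuclideanSpace.single i 1) = ∑ j, P i j • EuclideanSpace.single j 1 :=
  exists_intMatrix T (h.apply_latt hb hb') (h.symm_apply_latt hb hb')

theorem vert_sum {c : S.Chart} {b : B} {θ : Euc n} (a : Fin n → ℝ) :
    (c.vert b θ (∑ j, a j • EuclideanSpace.single j 1) : Euc (2 * n)) =
      ∑ j, a j • (c.frame b θ j : Euc (2 * n)) := by
  have hlin : ∀ z, (c.vert b θ z : Euc (2 * n)) = ((c.dΨ (c.x b) θ).comp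
      (ContinuousLinearMap.inr ℝ (Euc n) (Euc n)) : Euc n →L[ℝ] Euc (2 * n)) z := fun _ ↦ rfl
  rw [hlin, map_sum]
  exact Finset.sum_congr rfl fun j _ ↦ map_smul _ _ _

/-- Over one fibre, the frames of two charts are related by a matrix of determinant `± 1`. -/
theorem exists_frame_eq (c c' : S.Chart) {b : B} (hb : b ∈ c.V) (hb' : b ∈ c'.V) :
    ∃ P : Matrix (Fin n) (Fin n) ℝ, |P.det| = 1 ∧ ∀ θ θ', c.pt b θ = c'.pt b θ' → ∀ i,
      (c.frame b θ i : Euc (2 * n)) = ∑ j, P i j • (c'.frame b θ' j : Euc (2 * n)) := by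
  obtain ⟨A, T, h⟩ := exists_fiberTransition c c' hb hb'
  obtain ⟨P, hP, hPT⟩ := h.exists_matrix hb hb'
  refine ⟨P, hP, fun θ θ' hθ i ↦ ?_⟩
  rw [← vert_sum, ← hPT]
  exact h.vert θ θ' hθ _

/-- A parallel half-form takes values of the same modulus on the frames of all charts; the value
`τ` of a half-density on a unimodular transform of a frame is `τ`. -/
theorem halfForm_frame_eq [VectorBundle ℂ ℂ L] [ContMDiffVectorBundle ∞ ℂ L (𝓡 (2 * n))] {k : ℕ}
    {b : B} (τ : S.FiberSpace k b) {c c' : S.Chart} (hb : b ∈ c.V) (hb' : b ∈ c'.V) {θ θ' : Euc n}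
    (h : c.pt b θ = c'.pt b θ') (e : L (c'.pt b θ')) :
    τ.1 (c'.pt b θ') e (fun i ↦ (c.frame b θ i : Euc (2 * n))) =
      τ.1 (c'.pt b θ') e (c'.frame b θ') := by
  obtain ⟨P, hP, hPf⟩ := exists_frame_eq c c' hb hb'
  have h1 : (fun i ↦ (c.frame b θ i : Euc (2 * n))) = fun i ↦ ∑ j, P i j • c'.frame b θ' j :=
    funext fun i ↦ hPf θ θ' h i
  have h2 := τ.2.2.2.2.2.1 (c'.pt b θ') e (c'.frame b θ') P (fun i ↦ dproj_vert hb' _ _)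
  rw [hP, Real.sqrt_one, Complex.ofReal_one, one_mul] at h2
  rw [← h2]
  exact congrArg _ h1

end Transitions

/-! ### Parallel half-forms in a gauge -/

section HalfForms

variable [T2Space X] [VectorBundle ℂ ℂ L] [ContMDiffVectorBundle ∞ ℂ L (𝓡 (2 * n))]

theorem connForm_congr (s : ∀ p, L p) {p q : X} (h : p = q) {v w : Euc (2 * n)} (hv : v = w) :
    S.connForm s p v = S.connForm s q w := by
  subst h hv; rfl

namespace Gauge

/-- The unit section of a gauge, with values in the total space of `L`. -/
def sec (G : S.Gauge) (y : Euc n × Euc n) : TotalSpace ℂ L := ⟨G.c.Ψ y, G.E y⟩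

/-- The open set of the base over which a gauge is defined. -/
def dom (G : S.Gauge) : Set B := G.c.V ∩ G.c.x ⁻¹' G.W

theorem isOpen_dom (G : S.Gauge) : IsOpen G.dom := isOpen_inter_preimage_x G.c G.isOpen_W

theorem sec_ne_zero (G : S.Gauge) {y : Euc n × Euc n} (hy : y.1 ∈ G.W) : (G.sec y).snd ≠ 0 := by
  intro h
  have h1 := G.norm_E y hy
  have h2 : G.E y = 0 := h
  rw [h2, norm_zero] at h1
  exact zero_ne_one h1

theorem base_mem_dom (G : S.Gauge) {ξ : Euc n} (hξ : ξ ∈ G.W) : base G.c ξ ∈ G.dom :=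
  ⟨base_mem (G.subset hξ), by rw [mem_preimage, x_base (G.subset hξ)]; exact hξ⟩

end Gauge

/-- The velocity of a curve does not depend on the coordinates in which it is computed. -/
theorem dΨ_eq_of_curve {c c' : S.Chart} {z z' : ℝ → Euc n × Euc n} {v v' : Euc n × Euc n}
    {J : Set ℝ} {t : ℝ} (hJ : UniqueDiffWithinAt ℝ J t) (ht : t ∈ J) (hz : HasDerivWithinAt z v J t)
    (hz' : HasDerivWithinAt z' v' J t) (hy : (z t).1 ∈ c.x '' c.V) (hy' : (z' t).1 ∈ c'.x '' c'.V)
    (h : ∀ᶠ r in 𝓝[J] t, c'.Ψ (z' r) = c.Ψ (z r)) :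
    (c'.dΨ (z' t).1 (z' t).2 v' : Euc (2 * n)) = c.dΨ (z t).1 (z t).2 v := by
  have h1 := (hasMFDerivAt_Ψ c hy).comp_hasMFDerivWithinAt t hz.hasFDerivWithinAt.hasMFDerivWithinAt
  have h2 := (hasMFDerivAt_Ψ c' hy').comp_hasMFDerivWithinAt t
    hz'.hasFDerivWithinAt.hasMFDerivWithinAt
  have h3 := h1.congr_of_eventuallyEq h (h.self_of_nhdsWithin ht)
  have h4 := UniqueMDiffWithinAt.eq hJ.uniqueMDiffWithinAt h2 h3
  have h5 := congrArg (fun A : ℝ →L[ℝ] Euc (2 * n) ↦ A 1) h4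
  have e1 : (ContinuousLinearMap.toSpanSingleton ℝ v' : ℝ →L[ℝ] _) 1 = v' := by simp
  have e2 : (ContinuousLinearMap.toSpanSingleton ℝ v : ℝ →L[ℝ] _) 1 = v := by simp
  rw [← e1, ← e2]
  exact h5

/-- The unit sections of two gauges along one curve. -/
theorem Gauge.sec_curve {G G' : S.Gauge} {J : Set ℝ} (hJ : Convex ℝ J) (hJu : UniqueDiffOn ℝ J)
    {z z' v v' : ℝ → Euc n × Euc n} (hz : ∀ t ∈ J, HasDerivWithinAt z (v t) J t)
    (hz' : ∀ t ∈ J, HasDerivWithinAt z' (v' t) J t) (hW : ∀ t ∈ J, (z t).1 ∈ G.W)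
    (hW' : ∀ t ∈ J, (z' t).1 ∈ G'.W) (h : ∀ t ∈ J, G'.c.Ψ (z' t) = G.c.Ψ (z t)) {g : ℝ → ℂ}
    (hg : ∀ t ∈ J, HasDerivWithinAt g
      (Complex.I * (inner ℝ (z t).1 (v t).2 - inner ℝ (z' t).1 (v' t).2 : ℝ)) J t) :
    ∃ a : ℂ, ∀ t ∈ J, G'.sec (z' t) = tsmul (a * Complex.exp (g t)) (G.sec (z t)) := by
  refine HasLogDeriv.exists_eq_exp (S := S) (e := fun t ↦ G.sec (z t)) (e' := fun t ↦ G'.sec (z' t))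
    hJ (fun t ht ↦ (G.normal _ (hW t ht)).hasLogDeriv ht (hz t ht)) (fun t ht ↦ ?_) h
    (fun t ht ↦ G.sec_ne_zero (hW t ht)) (ρ' := fun t ↦ -(Complex.I * (inner ℝ (z' t).1 (v' t).2 : ℝ)))
    (fun t ht ↦ (hg t ht).congr_deriv ?_)
  · have h1 := (G'.normal _ (hW' t ht)).hasLogDeriv ht (hz' t ht)
    have h2 := dΨ_eq_of_curve (hJu t ht) ht (hz t ht) (hz' t ht) (G.subset (hW t ht))
      (G'.subset (hW' t ht)) (Filter.eventually_of_mem self_mem_nhdsWithin h)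
    rw [h2] at h1
    exact h1
  · push_cast
    ring

namespace Gauge

theorem exists_hol (G : S.Gauge) (m : Fin n → ℤ) : ∃ a : ℂ, ∀ y : Euc n × Euc n, y.1 ∈ G.W →
    G.sec (y.1, y.2 + latt m) = tsmul a (G.sec y) := by
  rcases G.W.eq_empty_or_nonempty with h | ⟨ξ₀, hξ₀⟩
  · exact ⟨0, fun y hy ↦ absurd hy (by rw [h]; exact notMem_empty _)⟩
  have hΨ : ∀ y : Euc n × Euc n, y.1 ∈ G.W → G.c.Ψ (y.1, y.2 + latt m) = G.c.Ψ y := by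
    rintro ⟨ξ, θ⟩ hy
    obtain ⟨b, hb, rfl⟩ := G.subset hy
    exact pt_add_latt hb θ m
  obtain ⟨a, ha⟩ := exists_tsmul (x := G.sec (ξ₀, 0)) (y := G.sec (ξ₀, 0 + latt m))
    (G.sec_ne_zero hξ₀) (hΨ (ξ₀, 0) hξ₀)
  refine ⟨a, fun y hy ↦ ?_⟩
  let z : ℝ → Euc n × Euc n := fun t ↦ AffineMap.lineMap (ξ₀, 0) y t
  have hzW : ∀ t ∈ Icc (0 : ℝ) 1, (z t).1 ∈ G.W := fun t ht ↦
    ((G.convex_W.prod convex_univ).segment_subset (x := (ξ₀, (0 : Euc n))) (y := y)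
      ⟨hξ₀, mem_univ _⟩ ⟨hy, mem_univ _⟩ (lineMap_mem_segment ℝ _ y ht)).1
  have hz : ∀ t ∈ Icc (0 : ℝ) 1, HasDerivWithinAt z (y - (ξ₀, 0)) (Icc 0 1) t := fun t _ ↦
    (hasDerivAt_lineMap' _ y t).hasDerivWithinAt
  obtain ⟨r, hr⟩ := sec_curve (G := G) (G' := G) (z := z) (z' := fun t ↦ z t + (0, latt m))
    (v := fun _ ↦ y - (ξ₀, 0)) (v' := fun _ ↦ y - (ξ₀, 0)) (g := fun _ ↦ 0) (convex_Icc 0 1)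
    (uniqueDiffOn_Icc zero_lt_one) hz (fun t ht ↦ (hz t ht).add_const _) hzW
    (fun t ht ↦ by simpa using hzW t ht)
    (fun t ht ↦ by
      rw [← hΨ (z t) (hzW t ht)]
      congr 1
      ext1 <;> simp)
    (fun t _ ↦ by simpa using hasDerivWithinAt_const (c := (0 : ℂ)) ..)
  have h0 := hr 0 (left_mem_Icc.2 zero_le_one)
  have h1 := hr 1 (right_mem_Icc.2 zero_le_one)
  have e0 : z 0 = (ξ₀, 0) := AffineMap.lineMap_apply_zero _ _
  have e1 : z 1 = y := AffineMap.lineMap_apply_one _ _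
  rw [e0, Complex.exp_zero, mul_one] at h0
  rw [e1, Complex.exp_zero, mul_one] at h1
  have h2 : ∀ y : Euc n × Euc n, y + (0, latt m) = (y.1, y.2 + latt m) := fun y ↦ by
    ext1 <;> simp
  rw [h2] at h0 h1
  rw [h1, tsmul_injective (G.sec_ne_zero (y := (ξ₀, 0)) hξ₀) (h0.symm.trans ha)]

/-- The holonomy of the flat connection of a gauge along the loops of the torus. -/
def hol (G : S.Gauge) (m : Fin n → ℤ) : ℂ := (G.exists_hol m).choose

theorem sec_add_latt (G : S.Gauge) (m : Fin n → ℤ) {y : Euc n × Euc n} (hy : y.1 ∈ G.W) :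
    G.sec (y.1, y.2 + latt m) = tsmul (G.hol m) (G.sec y) := (G.exists_hol m).choose_spec y hy

end Gauge

theorem mul_pow_pred (k : ℕ) (a : ℂ) : (k : ℂ) * a ^ (k - 1) * a = k * a ^ k := by
  rcases k with _ | k
  · simp
  · rw [Nat.add_sub_cancel, mul_assoc, ← pow_succ]

theorem Gauge.parallel_eq (G : S.Gauge) {k : ℕ} {b : B} (hb : b ∈ G.dom)
    {u : ∀ θ : Euc n, L (G.c.pt b θ) → ℂ}
    (hhom : ∀ θ e (a : ℂ), a ≠ 0 → u θ (a • e) = (a ^ k)⁻¹ * u θ e)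
    (hu : S.IsParallelOnFiber k G.c b u) (θ : Euc n) :
    u θ (G.E (G.c.x b, θ)) =
      Complex.exp (Complex.I * k * (inner ℝ (G.c.x b) θ : ℝ)) * u 0 (G.E (G.c.x b, 0)) := by
  let f : Euc n → ℂ := fun θ ↦
    Complex.exp (-(Complex.I * k * (inner ℝ (G.c.x b) θ : ℝ))) * u θ (G.E (G.c.x b, θ))
  have hf : ∀ θ, HasFDerivAt f (0 : Euc n →L[ℝ] ℂ) θ := by
    intro θ₀
    obtain ⟨s, hs, hs0⟩ := exists_globalSection (n := n) L (G.c.pt b θ₀)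
    obtain ⟨a, D, ha1, ha2, ha3⟩ := G.normal (G.c.x b, θ₀) hb.2 s (hs _) hs0.self_of_nhds
    obtain ⟨Du, hDu, hDu'⟩ := hu θ₀ s (hs _) hs0.self_of_nhds
    have ha0 : a (G.c.x b, θ₀) ≠ 0 := by
      intro h
      have h1 := ha1.self_of_nhds
      rw [h, zero_smul] at h1
      exact G.sec_ne_zero (y := (G.c.x b, θ₀)) hb.2 h1
    have hι : ContinuousAt (fun θ : Euc n ↦ (G.c.x b, θ)) θ₀ := by fun_prop
    let a₁ : Euc n → ℂ := fun θ ↦ a (G.c.x b, θ)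
    have had : HasFDerivAt a₁ (D.comp (ContinuousLinearMap.inr ℝ (Euc n) (Euc n))) θ₀ :=
      HasFDerivAt.comp (f := fun θ : Euc n ↦ (G.c.x b, θ)) θ₀ ha2 (hasFDerivAt_prodMk_right _ _)
    have hane : ∀ᶠ θ in 𝓝 θ₀, a₁ θ ≠ 0 := had.continuousAt.eventually_ne ha0
    have hpow := HasFDerivAt.comp (g := fun z : ℂ ↦ z⁻¹) (f := fun θ ↦ a₁ θ ^ k) θ₀
      ((hasDerivAt_inv (pow_ne_zero k ha0)).hasFDerivAt.restrictScalars ℝ)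
        (had.pow k)
    have hlin : HasFDerivAt (fun θ : Euc n ↦ -(Complex.I * k * (inner ℝ (G.c.x b) θ : ℝ)))
        (-((Complex.I * k) • Complex.ofRealCLM.comp (innerSL ℝ (G.c.x b)))) θ₀ :=
      ((Complex.ofRealCLM.comp (innerSL ℝ (G.c.x b))).hasFDerivAt.const_mul _).neg
    have hfeq : f =ᶠ[𝓝 θ₀] fun θ ↦ Complex.exp (-(Complex.I * k * (inner ℝ (G.c.x b) θ : ℝ))) *
        ((a₁ θ ^ k)⁻¹ * u θ (s (G.c.pt b θ))) := by
      filter_upwards [hι.eventually ha1, hane] with θ h1 h2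
      simp only [f]
      rw [h1, hhom _ _ _ h2]
    refine HasFDerivAt.congr_of_eventuallyEq ?_ hfeq
    refine (hlin.cexp.fun_mul (hpow.fun_mul hDu)).congr_fderiv (ContinuousLinearMap.ext fun w ↦ ?_)
    have h1 := hDu' w
    have h2 : S.conn s (G.c.pt b θ₀) (G.c.vert b θ₀ w) = S.connForm s _ _ • s _ :=
      conn_eq_connForm hs0.self_of_nhds _
    rw [h2, smul_smul, ← add_smul] at h1
    have h3 := (smul_eq_zero.1 h1).resolve_right hs0.self_of_nhds
    have h4 := ha3 (0, w)
    rw [connFormChart_apply] at h4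
    have h5 := mul_pow_pred k (a₁ θ₀)
    have h6 : Du w = -(k * u θ₀ (s (G.c.pt b θ₀)) *
        S.connForm s (G.c.pt b θ₀) (G.c.vert b θ₀ w)) := by linear_combination h3
    simp only [add_apply, smul_apply, smul_eq_mul, neg_apply, zero_apply]
    rw [h6]
    change _ * ((a₁ θ₀ ^ k)⁻¹ * _ + _ * ((k • a₁ θ₀ ^ (k - 1) * D (0, w)) * -((a₁ θ₀ ^ k) ^ 2)⁻¹)) +
      _ * (_ * -(Complex.I * k * (inner ℝ (G.c.x b) w : ℝ))) = 0
    rw [h4, nsmul_eq_mul]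
    have h7 : (k : ℂ) * a₁ θ₀ ^ (k - 1) * (-(Complex.I * (inner ℝ (G.c.x b) w : ℝ) +
        S.connForm s (G.c.pt b θ₀) (G.c.vert b θ₀ w)) * a₁ θ₀) * -((a₁ θ₀ ^ k) ^ 2)⁻¹ =
        k * (Complex.I * (inner ℝ (G.c.x b) w : ℝ) +
        S.connForm s (G.c.pt b θ₀) (G.c.vert b θ₀ w)) * (a₁ θ₀ ^ k)⁻¹ := by
      have h8 : a₁ θ₀ ^ k ≠ 0 := pow_ne_zero k ha0
      field_simp
      linear_combination (Complex.I * (inner ℝ (G.c.x b) w : ℝ) +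
        S.connForm s (G.c.pt b θ₀) (G.c.vert b θ₀ w)) * h5
    refine Eq.trans (congrArg₂ _ (congrArg₂ _ rfl (congrArg₂ _ rfl (congrArg₂ _ rfl h7))) rfl) ?_
    simp only [Function.comp_apply]
    ring
  have hconst : f θ = f 0 := is_const_of_fderiv_eq_zero (𝕜 := ℝ)
    (fun θ ↦ (hf θ).differentiableAt) (fun θ ↦ (hf θ).fderiv) θ 0
  simp only [f, inner_zero_right, Complex.ofReal_zero, mul_zero, neg_zero, Complex.exp_zero,
    one_mul] at hconst
  rw [← hconst, ← mul_assoc, ← Complex.exp_add, add_neg_cancel, Complex.exp_zero, one_mul]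

namespace Gauge

variable {k : ℕ} {b : B}

/-- The amplitude of a parallel half-form `τ` in a gauge: in the frame `∂/∂θ` and with respect to
`E`, the coefficient of `τ` is the amplitude times `exp (i k ⟨x, θ⟩)`. -/
def amp (G : S.Gauge) (τ : S.FiberSpace k b) : ℂ :=
  τ.1 (G.c.pt b 0) (G.E (G.c.x b, 0)) (G.c.frame b 0)

theorem apply_E (G : S.Gauge) (hb : b ∈ G.dom) (τ : S.FiberSpace k b) (θ : Euc n) :
    τ.1 (G.c.pt b θ) (G.E (G.c.x b, θ)) (G.c.frame b θ) =
      Complex.exp (Complex.I * k * (inner ℝ (G.c.x b) θ : ℝ)) * G.amp τ :=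
  G.parallel_eq hb (u := fun θ e ↦ τ.1 (G.c.pt b θ) e (G.c.frame b θ))
    (fun θ e a ha ↦ τ.2.2.2.2.1 _ _ _ a ha) (τ.2.2.2.2.2.2 G.c hb.1) θ

theorem amp_smul (G : S.Gauge) (a : ℂ) (τ : S.FiberSpace k b) : G.amp (a • τ) = a * G.amp τ := rfl

theorem amp_sub (G : S.Gauge) (τ τ' : S.FiberSpace k b) : G.amp (τ - τ') = G.amp τ - G.amp τ' := by
  have h : τ - τ' = τ + (-1 : ℂ) • τ' := by rw [neg_one_smul, sub_eq_add_neg]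
  rw [h]
  change G.amp τ + -1 * G.amp τ' = _
  ring

theorem normSq_unitVec (G : S.Gauge) (hb : b ∈ G.dom) (τ : S.FiberSpace k b) (θ : Euc n) :
    Complex.normSq (τ.1 (G.c.pt b θ) (unitVec L _) (G.c.frame b θ)) = ‖G.amp τ‖ ^ 2 := by
  have hE0 : G.E (G.c.x b, θ) ≠ 0 := G.sec_ne_zero (y := (G.c.x b, θ)) hb.2
  have h1 := pairing_eq τ τ hE0 (G.c.frame b θ)
  rw [pairing_self, G.norm_E (G.c.x b, θ) hb.2, G.apply_E hb, ← Complex.normSq_eq_conj_mul_self] at h1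
  simp only [one_pow, Complex.ofReal_one, mul_one] at h1
  have h2 := Complex.ofReal_injective h1
  rw [h2, Complex.normSq_eq_norm_sq, norm_mul]
  have : ‖Complex.exp (Complex.I * k * (inner ℝ (G.c.x b) θ : ℝ))‖ = 1 := by
    rw [Complex.norm_exp]; simp
  rw [this, one_mul]

theorem eq_of_amp (G : S.Gauge) (hb : b ∈ G.dom) {τ τ' : S.FiberSpace k b}
    (h : G.amp τ = G.amp τ') : τ = τ' := by
  rw [← sub_eq_zero]
  refine eq_zero_of_frame hb.1 fun θ _ ↦ ?_
  have h1 := G.normSq_unitVec hb (τ - τ') θ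
  rw [G.amp_sub, h, sub_self, norm_zero, zero_pow two_ne_zero] at h1
  exact Complex.normSq_eq_zero.1 h1

end Gauge

theorem volume_box : (MeasureTheory.volume (box n)).toReal = (2 * Real.pi) ^ n := by
  have h : box n = (WithLp.ofLp : Euc n → Fin n → ℝ) ⁻¹'
      (Set.pi univ fun _ ↦ Icc 0 (2 * Real.pi)) := by
    ext θ; simp [box, Pi.le_def, forall_and]
  rw [h, (PiLp.volume_preserving_ofLp (Fin n)).measure_preimage
    (MeasurableSet.univ_pi fun _ ↦ measurableSet_Icc).nullMeasurableSet, MeasureTheory.volume_pi_pi]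
  simp [Real.volume_Icc, Real.pi_pos.le]

/-- The density of a parallel half-form is constant on the fibre, hence its norm is given by its
amplitude in a gauge and the volume `(2π)ⁿ` of the torus. -/
theorem Gauge.norm_sq (G : S.Gauge) {k : ℕ} {b : B} (hb : b ∈ G.dom) (τ : S.FiberSpace k b) :
    ‖τ‖ ^ 2 = (2 * Real.pi) ^ n * ‖G.amp τ‖ ^ 2 := by
  have h1 : ∀ θ, Complex.normSq (τ.1 ((S.chartAt b).pt b θ) (unitVec L _)
      ((S.chartAt b).frame b θ)) = ‖G.amp τ‖ ^ 2 := by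
    intro θ
    obtain ⟨θ', hθ'⟩ := exists_pt_eq hb.1 (proj_pt (S.mem_chartAt b) θ)
    have h2 := halfForm_frame_eq τ hb.1 (S.mem_chartAt b) hθ' (unitVec L _)
    rw [← h2, ← G.normSq_unitVec hb τ θ']
    congr 1
    have h3 : ∀ (p q : X) (v : Fin n → Euc (2 * n)), p = q →
        τ.1 q (unitVec L q) v = τ.1 p (unitVec L p) v := by
      rintro p _ v rfl; rfl
    exact h3 _ _ _ hθ'
  have h2 : ‖τ‖ ^ 2 = RCLike.re (fiberInner τ τ) := by
    rw [← @inner_self_eq_norm_sq ℂ]; rfl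
  rw [h2, fiberInner_self]
  simp only [h1]
  rw [MeasureTheory.setIntegral_const, MeasureTheory.measureReal_def, volume_box, smul_eq_mul]
  exact Complex.ofReal_re _

end HalfForms

/-! ### Bohr-Sommerfeld points -/

section BohrSommerfeld

variable [T2Space X] [VectorBundle ℂ ℂ L] [ContMDiffVectorBundle ∞ ℂ L (𝓡 (2 * n))] {k : ℕ} {b : B}

/-- The value at a vertical frame `v` at a point of the fibre over `b` of the half-density
`|dθ|^{1/2}` of the chosen chart around `b`. -/
def dens (S : Setting n X B L) (b : B) (p : X) (v : Fin n → TangentSpace (𝓡 (2 * n)) p) : ℝ :=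
  open Classical in
  if h : ∃ w : Fin n → Euc n, ∃ θ, (S.chartAt b).pt b θ = p ∧
      ∀ i, ((S.chartAt b).vert b θ (w i) : Euc (2 * n)) = v i then
    Real.sqrt |(Matrix.of fun i j ↦ h.choose i j).det|
  else 0

theorem vert_injective {c : S.Chart} (hb : b ∈ c.V) (θ : Euc n) :
    Function.Injective fun w ↦ (c.vert b θ w : Euc (2 * n)) := fun w w' h ↦
  congrArg Prod.snd ((bijective_dΨ c (y := (c.x b, θ)) (mem_image_of_mem _ hb)).1 h)

theorem vert_add_latt {c : S.Chart} (hb : b ∈ c.V) {θ θ' : Euc n} (h : c.pt b θ = c.pt b θ')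
    (w : Euc n) : (c.vert b θ w : Euc (2 * n)) = c.vert b θ' w :=
  (isFiberTransition (A := AffineEquiv.refl ℝ _) (T := ContinuousLinearEquiv.refl ℝ _) hb hb
    (Filter.Eventually.of_forall fun _ ↦ rfl) fun _ _ ↦ rfl).vert θ θ' h w

theorem dens_eq {p : X} {θ : Euc n} (hθ : (S.chartAt b).pt b θ = p) {w : Fin n → Euc n}
    {v : Fin n → TangentSpace (𝓡 (2 * n)) p}
    (hv : ∀ i, ((S.chartAt b).vert b θ (w i) : Euc (2 * n)) = v i) :
    S.dens b p v = Real.sqrt |(Matrix.of fun i j ↦ w i j).det| := by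
  have h : ∃ w : Fin n → Euc n, ∃ θ, (S.chartAt b).pt b θ = p ∧
      ∀ i, ((S.chartAt b).vert b θ (w i) : Euc (2 * n)) = v i := ⟨w, θ, hθ, hv⟩
  rw [dens, dif_pos h]
  obtain ⟨θ', hθ', hv'⟩ := h.choose_spec
  have : h.choose = w := by
    funext i
    refine vert_injective (S.mem_chartAt b) θ' ?_
    change ((S.chartAt b).vert b θ' (h.choose i) : Euc (2 * n)) = (S.chartAt b).vert b θ' (w i)
    rw [hv' i, ← hv i]
    exact vert_add_latt (S.mem_chartAt b) (hθ.trans hθ'.symm) _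
  rw [this]

theorem vert_sum_smul {c : S.Chart} {θ : Euc n} (a : Fin n → ℝ) (w : Fin n → Euc n) :
    (c.vert b θ (∑ j, a j • w j) : Euc (2 * n)) = ∑ j, a j • (c.vert b θ (w j) : Euc (2 * n)) := by
  have hlin : ∀ z, (c.vert b θ z : Euc (2 * n)) = ((c.dΨ (c.x b) θ).comp
      (ContinuousLinearMap.inr ℝ (Euc n) (Euc n)) : Euc n →L[ℝ] Euc (2 * n)) z := fun _ ↦ rfl
  rw [hlin, map_sum]
  exact Finset.sum_congr rfl fun j _ ↦ map_smul _ _ _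

theorem exists_vert_coords {p : X} (hp : S.μ p = b) {v : Fin n → TangentSpace (𝓡 (2 * n)) p}
    (hv : ∀ i, dproj n S.μ p (v i) = 0) : ∃ w : Fin n → Euc n, ∃ θ, (S.chartAt b).pt b θ = p ∧
      ∀ i, ((S.chartAt b).vert b θ (w i) : Euc (2 * n)) = v i := by
  obtain ⟨θ, rfl⟩ := exists_pt_eq (S.mem_chartAt b) hp
  choose w hw using fun i ↦ exists_vert (S.mem_chartAt b) θ (v i) (hv i)
  exact ⟨w, θ, rfl, hw⟩

theorem dens_frame {c : S.Chart} (hb : b ∈ c.V) (θ : Euc n) :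
    S.dens b (c.pt b θ) (c.frame b θ) = 1 := by
  obtain ⟨P, hP, hPf⟩ := exists_frame_eq c (S.chartAt b) hb (S.mem_chartAt b)
  obtain ⟨θ', hθ'⟩ := exists_pt_eq (S.mem_chartAt b) (proj_pt hb θ)
  rw [dens_eq (w := fun i ↦ ∑ j, P i j • EuclideanSpace.single j 1) hθ' fun i ↦ ?_]
  · have : (Matrix.of fun i j ↦ (∑ l, P i l • EuclideanSpace.single l (1 : ℝ) : Euc n) j) = P := by
      ext i j
      simp [WithLp.ofLp_sum, Finset.sum_apply, Pi.single_apply]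
    rw [this, hP, Real.sqrt_one]
  · rw [vert_sum]
    exact (hPf θ θ' hθ'.symm i).symm

/-- A parallel section of `L^k` over a fibre, tensored with `|dθ|^{1/2}`. -/
theorem mul_dens_mem {σ : ∀ p : X, L p → ℂ} (h : σ ∈ S.parallelSections k b) :
    (fun p e v ↦ σ p e * S.dens b p v) ∈ S.parallelHalfForms k b := by
  obtain ⟨h1, h2, h3, h4⟩ := h
  refine ⟨fun p hp e v ↦ ?_, fun p v ↦ ?_, fun p e v hv ↦ ?_, fun p e v a ha ↦ ?_,
    fun p e v A hv ↦ ?_, fun c hc ↦ ?_⟩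
  · change σ p e * _ = 0
    rw [h1 p hp, zero_mul]
  · change σ p 0 * _ = 0
    rw [h2, zero_mul]
  · change σ p e * (S.dens b p v : ℂ) = 0
    rw [dens, dif_neg, Complex.ofReal_zero, mul_zero]
    rintro ⟨w, θ, rfl, hw⟩
    obtain ⟨i, hi⟩ := hv
    refine hi ?_
    rw [← dproj_vert (S.mem_chartAt b) θ (w i)]
    exact congrArg _ (hw i).symm
  · change σ p (a • e) * _ = _
    rw [h3 p e a ha, mul_assoc]
  · change σ p e * (S.dens b p _ : ℂ) = _ * (σ p e * (S.dens b p v : ℂ))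
    by_cases hp : S.μ p = b
    swap
    · rw [h1 p hp, zero_mul, zero_mul, mul_zero]
    obtain ⟨w, θ, hθ, hw⟩ := exists_vert_coords hp hv
    rw [dens_eq hθ hw, dens_eq (w := fun i ↦ ∑ j, A i j • w j) hθ fun i ↦ ?_]
    · have : (Matrix.of fun i j ↦ (∑ l, A i l • w l : Euc n) j) = A * Matrix.of fun i j ↦ w i j := by
        ext i j
        simp [WithLp.ofLp_sum, Finset.sum_apply, Matrix.mul_apply]
      rw [this, Matrix.det_mul, abs_mul, Real.sqrt_mul (abs_nonneg _)]
      push_cast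
      ring
    · rw [vert_sum_smul]
      exact Finset.sum_congr rfl fun j _ ↦ congrArg _ (hw j)
  · have := h4 c hc
    refine cast (congrArg _ ?_) this
    funext θ e
    change σ _ e = σ _ e * (S.dens b _ _ : ℂ)
    rw [dens_frame hc, Complex.ofReal_one, mul_one]

/-- The fibre over a Bohr-Sommerfeld point carries a parallel half-form of norm one. -/
theorem exists_norm_eq_one (hb : b ∈ S.bohrSommerfeld k) : ∃ ψ : S.FiberSpace k b, ‖ψ‖ = 1 := by
  obtain ⟨σ, hσ, hσ0⟩ := (Submodule.ne_bot_iff _).1 hb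
  let τ : S.FiberSpace k b := ⟨_, mul_dens_mem hσ⟩
  have hτ : τ ≠ 0 := by
    intro h
    refine hσ0 (funext fun p ↦ funext fun e ↦ ?_)
    change σ p e = 0
    by_cases hp : S.μ p = b
    swap
    · exact hσ.1 p hp e
    obtain ⟨θ, rfl⟩ := exists_pt_eq (S.mem_chartAt b) hp
    have h1 : τ.1 ((S.chartAt b).pt b θ) e ((S.chartAt b).frame b θ) = 0 := by rw [h]; rfl
    change σ _ e * (S.dens b _ _ : ℂ) = 0 at h1
    rwa [dens_frame (S.mem_chartAt b), Complex.ofReal_one, mul_one] at h1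
  refine ⟨(‖τ‖⁻¹ : ℂ) • τ, ?_⟩
  rw [norm_smul, norm_inv, Complex.norm_real, norm_norm, inv_mul_cancel₀ (norm_ne_zero_iff.2 hτ)]

namespace Gauge

/-- A non-zero parallel section over the fibre is `exp (i k ⟨x, θ⟩)` times the gauge section, and
this is periodic only if the holonomies satisfy the Bohr-Sommerfeld condition. -/
theorem hol_of_parallel (G : S.Gauge) (hb : b ∈ G.dom) {σ : ∀ p : X, L p → ℂ}
    (hσ : σ ∈ S.parallelSections k b) (hσ0 : σ ≠ 0) (m : Fin n → ℤ) :
    G.hol m ^ k * Complex.exp (Complex.I * k * (inner ℝ (G.c.x b) (latt m) : ℝ)) = 1 := by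
  have hval := G.parallel_eq hb (u := fun θ e ↦ σ (G.c.pt b θ) e)
    (fun θ e a ha ↦ hσ.2.2.1 _ _ _ ha) (hσ.2.2.2 G.c hb.1)
  let F : TotalSpace ℂ L → ℂ := fun x ↦ σ x.proj x.snd
  have hF : ∀ a : ℂ, a ≠ 0 → ∀ x, F (tsmul a x) = (a ^ k)⁻¹ * F x := fun a ha x ↦
    hσ.2.2.1 _ _ _ ha
  have hsec : ∀ θ, F (G.sec (G.c.x b, θ)) =
    Complex.exp (Complex.I * k * (inner ℝ (G.c.x b) θ : ℝ)) * F (G.sec (G.c.x b, 0)) := hval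
  have hne : F (G.sec (G.c.x b, 0)) ≠ 0 := by
    intro h0
    refine hσ0 (funext fun p ↦ funext fun e ↦ ?_)
    change F ⟨p, e⟩ = 0
    by_cases hp : S.μ p = b
    swap
    · exact hσ.1 p hp e
    by_cases he : e = 0
    · rw [he]; exact hσ.2.1 p
    obtain ⟨θ, rfl⟩ := exists_pt_eq hb.1 hp
    obtain ⟨a, ha⟩ := exists_tsmul (x := G.sec (G.c.x b, θ)) (y := ⟨_, e⟩)
      (G.sec_ne_zero (y := (G.c.x b, θ)) hb.2) rfl
    have ha0 : a ≠ 0 := by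
      rintro rfl
      refine he ?_
      have := eq_of_heq ((TotalSpace.mk.injEq _ _ _ _).mp ha).2
      rw [this]
      exact zero_smul ℂ (G.E (G.c.x b, θ))
    rw [ha, hF a ha0, hsec, h0, mul_zero, mul_zero]
  have hh := G.sec_add_latt m (y := (G.c.x b, 0)) hb.2
  have hh0 : G.hol m ≠ 0 := by
    intro h0
    rw [h0] at hh
    refine G.sec_ne_zero (y := (G.c.x b, 0 + latt m)) hb.2 ?_
    rw [hh]
    exact zero_smul ℂ (G.E (G.c.x b, 0))
  have h1 := hsec (0 + latt m)
  rw [hh, hF _ hh0, zero_add] at h1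
  have h2 := mul_right_cancel₀ hne h1
  rw [← h2]
  exact mul_inv_cancel₀ (pow_ne_zero k hh0)

theorem hol_of_bohrSommerfeld (G : S.Gauge) (hb : b ∈ G.dom) (hbk : b ∈ S.bohrSommerfeld k)
    (m : Fin n → ℤ) :
    G.hol m ^ k * Complex.exp (Complex.I * k * (inner ℝ (G.c.x b) (latt m) : ℝ)) = 1 := by
  obtain ⟨σ, hσ, hσ0⟩ := (Submodule.ne_bot_iff _).1 hbk
  exact G.hol_of_parallel hb hσ hσ0 m

/-- The parallel section of `L^k` over the fibre over `b` whose coefficient with respect to `E` is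
`exp (i k ⟨x, θ⟩)`, provided that this is well defined. -/
def stdSection (G : S.Gauge) (k : ℕ) (b : B) (x : TotalSpace ℂ L) : ℂ :=
  open Classical in
  if h : ∃ (a : ℂ) (θ : Euc n), a ≠ 0 ∧ x = tsmul a (G.sec (G.c.x b, θ)) then
    (h.choose ^ k)⁻¹ * Complex.exp (Complex.I * k * (inner ℝ (G.c.x b) h.choose_spec.choose : ℝ))
  else 0

theorem stdSection_eq (G : S.Gauge) (hb : b ∈ G.dom) (hk : ∀ m, G.hol m ^ k *
      Complex.exp (Complex.I * k * (inner ℝ (G.c.x b) (latt m) : ℝ)) = 1) {a : ℂ} (ha : a ≠ 0)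
    (θ : Euc n) : G.stdSection k b (tsmul a (G.sec (G.c.x b, θ))) =
      (a ^ k)⁻¹ * Complex.exp (Complex.I * k * (inner ℝ (G.c.x b) θ : ℝ)) := by
  have h : ∃ (a' : ℂ) (θ' : Euc n), a' ≠ 0 ∧
    tsmul a (G.sec (G.c.x b, θ)) = tsmul a' (G.sec (G.c.x b, θ')) := ⟨a, θ, ha, rfl⟩
  have key : ∀ (a' : ℂ) (θ' : Euc n), a' ≠ 0 →
      tsmul a (G.sec (G.c.x b, θ)) = tsmul a' (G.sec (G.c.x b, θ')) →
      (a' ^ k)⁻¹ * Complex.exp (Complex.I * k * (inner ℝ (G.c.x b) θ' : ℝ)) =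
        (a ^ k)⁻¹ * Complex.exp (Complex.I * k * (inner ℝ (G.c.x b) θ : ℝ)) := by
    intro a' θ' ha' h3
    obtain ⟨m, rfl⟩ := exists_latt hb.1 (congrArg TotalSpace.proj h3)
    rw [G.sec_add_latt m (y := (G.c.x b, θ')) hb.2, tsmul_tsmul] at h3
    have h4 := tsmul_injective (G.sec_ne_zero (y := (G.c.x b, θ')) hb.2) h3
    have h5 : Complex.exp (Complex.I * k * (inner ℝ (G.c.x b) (latt m) : ℝ)) = (G.hol m ^ k)⁻¹ :=
      eq_inv_of_mul_eq_one_right (hk m)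
    have hh0 : G.hol m ^ k ≠ 0 := left_ne_zero_of_mul_eq_one (hk m)
    rw [inner_add_right, Complex.ofReal_add, mul_add, Complex.exp_add, ← h4, mul_pow, h5, mul_inv]
    ring
  rw [stdSection, dif_pos h]
  exact key _ _ h.choose_spec.choose_spec.1 h.choose_spec.choose_spec.2

theorem exists_eq_tsmul_sec (G : S.Gauge) (hb : b ∈ G.dom) {x : TotalSpace ℂ L} (hx : S.μ x.proj = b)
    (hx0 : x.snd ≠ 0) : ∃ (a : ℂ) (θ : Euc n), a ≠ 0 ∧ x = tsmul a (G.sec (G.c.x b, θ)) := by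
  obtain ⟨θ, hθ⟩ := exists_pt_eq hb.1 hx
  obtain ⟨a, ha⟩ := exists_tsmul (x := G.sec (G.c.x b, θ)) (y := x)
    (G.sec_ne_zero (y := (G.c.x b, θ)) hb.2) hθ.symm
  refine ⟨a, θ, ?_, ha⟩
  rintro rfl
  refine hx0 ?_
  rw [ha]
  exact zero_smul ℂ (G.E (G.c.x b, θ))

theorem bohrSommerfeld_of_hol (G : S.Gauge) (hb : b ∈ G.dom) (hk : ∀ m, G.hol m ^ k *
      Complex.exp (Complex.I * k * (inner ℝ (G.c.x b) (latt m) : ℝ)) = 1) :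
    b ∈ S.bohrSommerfeld k := by
  refine (Submodule.ne_bot_iff _).2 ⟨fun p e ↦ G.stdSection k b ⟨p, e⟩, ⟨fun p hp e ↦ ?_, fun p ↦ ?_,
    fun p e a ha ↦ ?_, fun c hc ↦ ?_⟩, fun h ↦ ?_⟩
  · refine dif_neg ?_
    rintro ⟨a, θ, -, h⟩
    refine hp ?_
    have h1 : p = G.c.pt b θ := congrArg TotalSpace.proj h
    rw [h1, proj_pt hb.1]
  · refine dif_neg ?_
    rintro ⟨a, θ, ha, h⟩
    obtain rfl : p = G.c.pt b θ := congrArg TotalSpace.proj h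
    have h2 := eq_of_heq ((TotalSpace.mk.injEq _ _ _ _).mp h).2
    exact (smul_ne_zero ha (G.sec_ne_zero (y := (G.c.x b, θ)) hb.2)) h2.symm
  · change G.stdSection k b (tsmul a ⟨p, e⟩) = _ * G.stdSection k b ⟨p, e⟩
    by_cases h : ∃ (a : ℂ) (θ : Euc n), a ≠ 0 ∧
      (⟨p, e⟩ : TotalSpace ℂ L) = tsmul a (G.sec (G.c.x b, θ))
    · obtain ⟨a', θ, ha', h⟩ := h
      rw [h, tsmul_tsmul, G.stdSection_eq hb hk (mul_ne_zero ha ha'), G.stdSection_eq hb hk ha',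
        mul_pow, mul_inv, mul_assoc]
    · rw [stdSection, stdSection, dif_neg h, dif_neg, mul_zero]
      rintro ⟨a', θ, ha', h'⟩
      refine h ⟨a⁻¹ * a', θ, mul_ne_zero (inv_ne_zero ha) ha', ?_⟩
      rw [← tsmul_tsmul, ← h', tsmul_tsmul, inv_mul_cancel₀ ha, tsmul_one]
  · intro θ₁ s hs hs0
    obtain ⟨A, T, hT⟩ := exists_fiberTransition c G.c hc hb.1
    obtain ⟨θ', hθ'⟩ := exists_pt_eq hb.1 (proj_pt hc θ₁)
    have hpt : ∀ θ, c.pt b θ = G.c.pt b (θ' + T (θ - θ₁)) := fun θ ↦ by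
      have := hT.pt_add θ₁ θ' hθ'.symm (θ - θ₁)
      rwa [add_sub_cancel] at this
    have hΨ : G.c.Ψ (G.c.x b, θ') = c.pt b θ₁ := hθ'
    obtain ⟨a, D, ha1, ha2, ha3⟩ := G.normal (G.c.x b, θ') hb.2 s (by rw [hΨ]; exact hs)
      (by rw [hΨ]; exact hs0)
    let ι : Euc n → Euc n × Euc n := fun θ ↦ (G.c.x b, θ' + T (θ - θ₁))
    have hι : HasFDerivAt ι ((ContinuousLinearMap.inr ℝ (Euc n) (Euc n)).comp
        (T : Euc n →L[ℝ] Euc n)) θ₁ := by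
      have h1 : HasFDerivAt (fun θ : Euc n ↦ θ' + T (θ - θ₁)) (T : Euc n →L[ℝ] Euc n) θ₁ :=
        (((T : Euc n →L[ℝ] Euc n).hasFDerivAt).comp θ₁ ((hasFDerivAt_id θ₁).sub_const θ₁)).const_add θ'
      exact (hasFDerivAt_prodMk_right (G.c.x b) _).comp θ₁ h1
    have hι1 : ι θ₁ = (G.c.x b, θ') := by simp [ι]
    have ha0 : a (ι θ₁) ≠ 0 := by
      intro h
      have h1 := ha1.self_of_nhds
      rw [hι1] at h
      rw [h, zero_smul] at h1
      exact G.sec_ne_zero (y := (G.c.x b, θ')) hb.2 h1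
    have ha2' : HasFDerivAt a D (ι θ₁) := by rw [hι1]; exact ha2
    have had := HasFDerivAt.comp θ₁ ha2' hι
    have hev : ∀ᶠ θ in 𝓝 θ₁, G.E (ι θ) = a (ι θ) • s (G.c.Ψ (ι θ)) :=
      eventually_comp_of_continuousAt hι.continuousAt hι1 ha1
    have hane : ∀ᶠ θ in 𝓝 θ₁, a (ι θ) ≠ 0 := had.continuousAt.eventually_ne ha0
    have hval : (fun θ ↦ G.stdSection k b ⟨c.pt b θ, s (c.pt b θ)⟩) =ᶠ[𝓝 θ₁] fun θ ↦
        (a ∘ ι) θ ^ k * Complex.exp (Complex.I * k * (inner ℝ (G.c.x b) (ι θ).2 : ℝ)) := by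
      filter_upwards [hev, hane] with θ h1 h2
      have h3 : (⟨c.pt b θ, s (c.pt b θ)⟩ : TotalSpace ℂ L) = tsmul (a (ι θ))⁻¹ (G.sec (ι θ)) := by
        have h4 : G.sec (ι θ) = tsmul (a (ι θ)) ⟨G.c.Ψ (ι θ), s (G.c.Ψ (ι θ))⟩ := by
          rw [sec, h1]; rfl
        rw [h4, tsmul_tsmul, inv_mul_cancel₀ h2, tsmul_one]
        exact congrArg (fun p ↦ (⟨p, s p⟩ : TotalSpace ℂ L)) (hpt θ)
      rw [h3, G.stdSection_eq hb hk (inv_ne_zero h2), inv_pow, inv_inv]; rfl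
    have hlin : HasFDerivAt (fun θ : Euc n ↦ Complex.I * k * (inner ℝ (G.c.x b) (ι θ).2 : ℝ))
        ((Complex.I * k) • (Complex.ofRealCLM.comp (innerSL ℝ (G.c.x b))).comp
          (T : Euc n →L[ℝ] Euc n)) θ₁ :=
      (((Complex.ofRealCLM.comp (innerSL ℝ (G.c.x b))).hasFDerivAt).comp θ₁ hι.snd).const_mul _
    refine ⟨_, ((had.pow k).fun_mul hlin.cexp).congr_of_eventuallyEq hval, fun w ↦ ?_⟩
    have h2 : S.conn s (c.pt b θ₁) (c.vert b θ₁ w) = S.connForm s _ _ • s _ :=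
      conn_eq_connForm hs0 _
    have h3 : S.connForm s (c.pt b θ₁) (c.vert b θ₁ w) =
        S.connForm s (G.c.pt b θ') (G.c.vert b θ' (T w)) :=
      connForm_congr s hθ'.symm (hT.vert θ₁ θ' hθ'.symm w)
    have h4 := ha3 (0, T w)
    rw [connFormChart_apply] at h4
    have h5 := mul_pow_pred k (a (ι θ₁))
    have h6 := hval.self_of_nhds
    beta_reduce at h6 ⊢
    rw [h2, h6, h3]
    have h7 : ∀ u z r : ℂ, u + z * r = 0 → u • s (c.pt b θ₁) + z • r • s (c.pt b θ₁) = 0 :=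
      fun u z r h ↦ by rw [smul_smul, ← add_smul, h, zero_smul]
    refine h7 _ _ _ ?_
    change ((a (ι θ₁) ^ k) * (Complex.exp (Complex.I * k * (inner ℝ (G.c.x b) (ι θ₁).2 : ℝ)) *
      (Complex.I * k * (inner ℝ (G.c.x b) (T w) : ℝ))) +
      Complex.exp (Complex.I * k * (inner ℝ (G.c.x b) (ι θ₁).2 : ℝ)) *
      (k • a (ι θ₁) ^ (k - 1) * D (0, T w))) + k * (a (ι θ₁) ^ k *
      Complex.exp (Complex.I * k * (inner ℝ (G.c.x b) (ι θ₁).2 : ℝ))) *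
      S.connForm s (G.c.pt b θ') (G.c.vert b θ' (T w)) = 0
    rw [hι1] at h5 ⊢
    rw [h4, nsmul_eq_mul]
    linear_combination (-Complex.exp (Complex.I * k * (inner ℝ (G.c.x b) θ' : ℝ)) *
      (Complex.I * (inner ℝ (G.c.x b) (T w) : ℝ) +
        S.connForm s (G.c.pt b θ') (G.c.vert b θ' (T w)))) * h5
  · have h1 := G.stdSection_eq hb hk one_ne_zero 0
    rw [tsmul_one] at h1
    have h2 : G.stdSection k b (G.sec (G.c.x b, 0)) = 0 :=
      congrFun (congrFun h (G.c.pt b 0)) (G.E (G.c.x b, 0))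
    rw [h2] at h1
    simp at h1

/-- The Bohr-Sommerfeld points in the domain of a gauge form a translate of `k⁻¹ ℤⁿ`. -/
theorem exists_int_of_bohrSommerfeld (G : S.Gauge) {b' : B} (hb : b ∈ G.dom)
    (hbk : b ∈ S.bohrSommerfeld k) (hb' : b' ∈ G.dom) (hbk' : b' ∈ S.bohrSommerfeld k) :
    ∃ p : Fin n → ℤ, ∀ i, k * (G.c.x b i - G.c.x b' i) = p i := by
  have h : ∀ i, ∃ p : ℤ, k * (G.c.x b i - G.c.x b' i) = p := by
    intro i
    have h1 := G.hol_of_bohrSommerfeld hb hbk (Pi.single i 1)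
    have h2 := G.hol_of_bohrSommerfeld hb' hbk' (Pi.single i 1)
    have h0 : G.hol (Pi.single i 1) ^ k ≠ 0 := left_ne_zero_of_mul_eq_one h1
    have h3 := mul_left_cancel₀ h0 (h1.trans h2.symm)
    have h4 : ∀ x : Euc n, (inner ℝ x (latt (Pi.single i (1 : ℤ))) : ℝ) = 2 * Real.pi * x i := by
      intro x
      simp [PiLp.inner_apply, Pi.single_apply]
    rw [h4, h4] at h3
    obtain ⟨p, hp⟩ := Complex.exp_eq_exp_iff_exists_int.1 h3
    refine ⟨p, ?_⟩
    have h5 : (2 * Real.pi * Complex.I : ℂ) ≠ 0 := by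
      simp [Real.pi_ne_zero]
    have h6 : ((k * (G.c.x b i - G.c.x b' i) : ℝ) : ℂ) = ((p : ℝ) : ℂ) := by
      refine mul_left_cancel₀ h5 ?_
      push_cast at hp ⊢
      linear_combination hp
    exact_mod_cast Complex.ofReal_injective h6
  choose p hp using h
  exact ⟨p, hp⟩

/-- In a gauge, the translates of a Bohr-Sommerfeld point by `k⁻¹ ℤⁿ` are Bohr-Sommerfeld points. -/
theorem bohrSommerfeld_of_int (G : S.Gauge) {b' : B} (hb : b ∈ G.dom)
    (hbk : b ∈ S.bohrSommerfeld k) (hb' : b' ∈ G.dom) (p : Fin n → ℤ)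
    (hp : ∀ i, k * (G.c.x b' i - G.c.x b i) = p i) : b' ∈ S.bohrSommerfeld k := by
  refine G.bohrSommerfeld_of_hol hb' fun m ↦ ?_
  rw [← G.hol_of_bohrSommerfeld hb hbk m]
  congr 1
  refine Complex.exp_eq_exp_iff_exists_int.2 ⟨∑ i, p i * m i, ?_⟩
  have h1 : (k : ℝ) * inner ℝ (G.c.x b') (latt m) =
      k * inner ℝ (G.c.x b) (latt m) + (∑ i, p i * m i : ℤ) * (2 * Real.pi) := by
    simp only [PiLp.inner_apply, latt_apply, RCLike.inner_apply, conj_trivial, Finset.mul_sum]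
    push_cast
    rw [Finset.sum_mul, ← Finset.sum_add_distrib]
    exact Finset.sum_congr rfl fun i _ ↦ by rw [← hp i]; ring
  have h2 := congrArg (fun r : ℝ ↦ (r : ℂ)) h1
  push_cast at h2 ⊢
  linear_combination Complex.I * h2

end Gauge

end BohrSommerfeld

/-! ### Affine paths in the base -/

theorem eq_of_eventually_affine {E : Type*} [NormedAddCommGroup E] [NormedSpace ℝ E] {t : ℝ}
    (ht : t ∈ Icc (0 : ℝ) 1) {u v u' v' : E}
    (h : ∀ᶠ s in 𝓝[Icc 0 1] t, u + s • v = u' + s • v') : u = u' ∧ v = v' := by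
  have hd : ∀ u v : E, HasDerivWithinAt (fun s : ℝ ↦ u + s • v) v (Icc 0 1) t := fun u v ↦ by
    simpa using (((hasDerivAt_id t).smul_const v).const_add u).hasDerivWithinAt
  have h1 := (hd u v).congr_of_eventuallyEq (f₁ := fun s ↦ u' + s • v') (h.mono fun s hs ↦ hs.symm)
    (h.self_of_nhdsWithin ht).symm
  have hv : v = v' := (uniqueDiffOn_Icc zero_lt_one t ht).eq_deriv _ h1 (hd u' v')
  refine ⟨?_, hv⟩
  have := h.self_of_nhdsWithin ht
  rw [hv] at this
  exact add_right_cancel this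

theorem eq_lineMap_of_locally_affine {E : Type*} [NormedAddCommGroup E] [NormedSpace ℝ E]
    {f : ℝ → E} (hf : ∀ t ∈ Icc (0 : ℝ) 1, ∃ u v : E, ∀ᶠ s in 𝓝[Icc 0 1] t, f s = u + s • v) :
    ∀ t ∈ Icc (0 : ℝ) 1, f t = AffineMap.lineMap (f 0) (f 1) t := by
  obtain ⟨u, v, h0⟩ := hf 0 (left_mem_Icc.2 zero_le_one)
  have key : ∀ t ∈ Icc (0 : ℝ) 1, ∀ᶠ s in 𝓝[Icc 0 1] t, f s = u + s • v := by
    intro t ht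
    refine IsPreconnected.of_locally_iff isPreconnected_Icc (a := 0) (b := t)
      (P := fun t ↦ ∀ᶠ s in 𝓝[Icc 0 1] t, f s = u + s • v) (fun t ht ↦ ?_)
      (left_mem_Icc.2 zero_le_one) ht h0
    obtain ⟨u', v', h'⟩ := hf t ht
    have hiff : ∀ s ∈ Icc (0 : ℝ) 1, (∀ᶠ r in 𝓝[Icc 0 1] s, f r = u' + r • v') →
        ((∀ᶠ r in 𝓝[Icc 0 1] s, f r = u + r • v) ↔ (u' = u ∧ v' = v)) := by
      intro s hs h1
      constructor
      · intro h2
        refine eq_of_eventually_affine hs ?_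
        filter_upwards [h1, h2] with r hr1 hr2
        rw [← hr1, hr2]
      · rintro ⟨rfl, rfl⟩
        exact h1
    filter_upwards [eventually_eventually_nhdsWithin.2 h', self_mem_nhdsWithin] with s hs hs'
    rw [hiff s hs' hs, hiff t ht h']
  have hall : ∀ t ∈ Icc (0 : ℝ) 1, f t = u + t • v := fun t ht ↦ (key t ht).self_of_nhdsWithin ht
  intro t ht
  rw [hall t ht, hall 0 (left_mem_Icc.2 zero_le_one), hall 1 (right_mem_Icc.2 zero_le_one),
    AffineMap.lineMap_apply]
  simp [add_comm]

section AffinePaths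

variable [T2Space X]

theorem affineEquiv_add_smul (A : Euc n ≃ᵃ[ℝ] Euc n) (u v : Euc n) (s : ℝ) :
    A (u + s • v) = A u + s • A.linear v := by
  have := A.map_vadd u (s • v)
  rw [vadd_eq_add, vadd_eq_add, map_smul] at this
  rw [add_comm u, this, add_comm]

/-- In every action-angle chart, an affine embedding is locally an affine map of the action
coordinates. -/
theorem affine_near {U : Set B} {χ : B → Euc n} (hχ : IsAffineEmbedding S.Ω S.μ U χ) {b : B}
    (hb : b ∈ U) {c : S.Chart} (hc : b ∈ c.V) :
    ∃ A : Euc n ≃ᵃ[ℝ] Euc n, ∀ᶠ b' in 𝓝 b, χ b' = A (c.x b') := by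
  obtain ⟨c₀, hc₀, A₀, hA₀⟩ := hχ.affine b hb
  obtain ⟨A₁, hA₁⟩ := exists_transition c c₀ hc hc₀
  refine ⟨A₁.trans A₀, ?_⟩
  filter_upwards [hA₀, hA₁] with b' h1 h2
  rw [h1, h2, AffineEquiv.trans_apply]

/-- The curve `γ : [0, 1] → B` is affine in action coordinates, locally. -/
def LocAffine (S : Setting n X B L) (γ : ℝ → B) : Prop :=
  ∀ t ∈ Icc (0 : ℝ) 1, ∃ c : S.Chart, γ t ∈ c.V ∧ ∃ u v : Euc n,
    ∀ᶠ s in 𝓝[Icc 0 1] t, u + s • v ∈ c.x '' c.V ∧ γ s = base c (u + s • v)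

theorem LocAffine.continuousWithinAt {γ : ℝ → B} (h : S.LocAffine γ) {t : ℝ}
    (ht : t ∈ Icc (0 : ℝ) 1) : ContinuousWithinAt γ (Icc 0 1) t := by
  obtain ⟨c, hc, u, v, huv⟩ := h t ht
  have h1 := huv.self_of_nhdsWithin ht
  have h2 : ContinuousAt (fun s : ℝ ↦ base c (u + s • v)) t :=
    ContinuousAt.comp (g := base c) (continuousAt_base h1.1) (by fun_prop)
  exact h2.continuousWithinAt.congr_of_eventuallyEq (huv.mono fun s hs ↦ hs.2) h1.2

theorem LocAffine.in_chart {γ : ℝ → B} (h : S.LocAffine γ) {t : ℝ} (ht : t ∈ Icc (0 : ℝ) 1)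
    {c : S.Chart} (hc : γ t ∈ c.V) : ∃ u v : Euc n,
      ∀ᶠ s in 𝓝[Icc 0 1] t, γ s ∈ c.V ∧ c.x (γ s) = u + s • v := by
  obtain ⟨c₀, hc₀, u, v, huv⟩ := h t ht
  obtain ⟨A, hA⟩ := exists_transition c₀ c hc₀ hc
  have hcont := h.continuousWithinAt ht
  refine ⟨A u, A.linear v, ?_⟩
  filter_upwards [hcont.eventually hA, hcont.eventually (c.isOpen_V.mem_nhds hc), huv]
    with s h1 h2 h3
  refine ⟨h2, ?_⟩
  rw [h1, h3.2, x_base h3.1, affineEquiv_add_smul]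

theorem LocAffine.eq_lineMap {γ : ℝ → B} (h : S.LocAffine γ) {U : Set B} {χ : B → Euc n}
    (hχ : IsAffineEmbedding S.Ω S.μ U χ) (hU : ∀ t ∈ Icc (0 : ℝ) 1, γ t ∈ U) {t : ℝ}
    (ht : t ∈ Icc (0 : ℝ) 1) : χ (γ t) = AffineMap.lineMap (χ (γ 0)) (χ (γ 1)) t := by
  refine eq_lineMap_of_locally_affine (f := χ ∘ γ) (fun t ht ↦ ?_) t ht
  obtain ⟨c, hc, -⟩ := hχ.affine _ (hU t ht)
  obtain ⟨A, hA⟩ := affine_near hχ (hU t ht) hc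
  obtain ⟨u, v, huv⟩ := h.in_chart ht hc
  refine ⟨A u, A.linear v, ?_⟩
  filter_upwards [(h.continuousWithinAt ht).eventually hA, huv] with s h1 h2
  rw [Function.comp_apply, h1, h2.2, affineEquiv_add_smul]

/-- Unique continuation of affine curves. -/
theorem LocAffine.eq_of_eventuallyEq [T2Space B] {γ γ' : ℝ → B} (h : S.LocAffine γ)
    (h' : S.LocAffine γ') {t₀ : ℝ} (ht₀ : t₀ ∈ Icc (0 : ℝ) 1)
    (h0 : ∀ᶠ s in 𝓝[Icc 0 1] t₀, γ s = γ' s) {t : ℝ} (ht : t ∈ Icc (0 : ℝ) 1) : γ t = γ' t := by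
  have key : ∀ᶠ s in 𝓝[Icc 0 1] t, γ s = γ' s := by
    refine IsPreconnected.of_locally_iff isPreconnected_Icc (a := t₀) (b := t)
      (P := fun t ↦ ∀ᶠ s in 𝓝[Icc 0 1] t, γ s = γ' s) (fun t ht ↦ ?_) ht₀ ht h0
    by_cases heq : γ t = γ' t
    · obtain ⟨c, hc, -⟩ := h t ht
      obtain ⟨u, v, huv⟩ := h.in_chart ht hc
      obtain ⟨u', v', huv'⟩ := h'.in_chart ht (c := c) (by rw [← heq]; exact hc)
      have hiff : ∀ s ∈ Icc (0 : ℝ) 1,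
          (∀ᶠ r in 𝓝[Icc 0 1] s, γ r ∈ c.V ∧ c.x (γ r) = u + r • v) →
          (∀ᶠ r in 𝓝[Icc 0 1] s, γ' r ∈ c.V ∧ c.x (γ' r) = u' + r • v') →
          ((∀ᶠ r in 𝓝[Icc 0 1] s, γ r = γ' r) ↔ (u = u' ∧ v = v')) := by
        intro s hs h1 h2
        constructor
        · intro h3
          refine eq_of_eventually_affine hs ?_
          filter_upwards [h1, h2, h3] with r hr1 hr2 hr3
          rw [← hr1.2, ← hr2.2, hr3]
        · rintro ⟨rfl, rfl⟩
          filter_upwards [h1, h2] with r hr1 hr2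
          exact c.injOn_x hr1.1 hr2.1 (hr1.2.trans hr2.2.symm)
      filter_upwards [eventually_eventually_nhdsWithin.2 huv,
        eventually_eventually_nhdsWithin.2 huv', self_mem_nhdsWithin] with s hs1 hs2 hs'
      rw [hiff s hs' hs1 hs2, hiff t ht huv huv']
    · obtain ⟨O, O', hO, hO', hmem, hmem', hdisj⟩ := t2_separation heq
      have hne : ∀ᶠ s in 𝓝[Icc 0 1] t, γ s ≠ γ' s := by
        filter_upwards [(h.continuousWithinAt ht).eventually (hO.mem_nhds hmem),
          (h'.continuousWithinAt ht).eventually (hO'.mem_nhds hmem')] with s h1 h2 h3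
        exact disjoint_left.1 hdisj h1 (by rw [h3]; exact h2)
      filter_upwards [hne, self_mem_nhdsWithin] with s hs hs'
      exact ⟨fun h ↦ absurd (h.self_of_nhdsWithin hs') hs,
        fun h ↦ absurd (h.self_of_nhdsWithin ht) heq⟩
  exact key.self_of_nhdsWithin ht

theorem locAffine_base {c : S.Chart} {ξ ξ' : Euc n}
    (h : ∀ t ∈ Icc (0 : ℝ) 1, AffineMap.lineMap ξ ξ' t ∈ c.x '' c.V) :
    S.LocAffine fun t ↦ base c (AffineMap.lineMap ξ ξ' t) := by
  refine fun t ht ↦ ⟨c, base_mem (h t ht), ξ, ξ' - ξ, ?_⟩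
  have h1 : ∀ s : ℝ, ξ + s • (ξ' - ξ) = AffineMap.lineMap ξ ξ' s := fun s ↦ by
    rw [AffineMap.lineMap_apply, vsub_eq_sub, vadd_eq_add, add_comm]
  filter_upwards [self_mem_nhdsWithin] with s hs
  rw [h1]
  exact ⟨h s hs, rfl⟩

/-- The points of `U` that are mapped to the segment between `χ c` and `χ b` by an embedding `χ`
with convex image. -/
def affPath (U : Set B) (χ : B → Euc n) (c b : B) (t : ℝ) : B :=
  haveI : Nonempty B := ⟨c⟩
  Function.invFunOn χ U (AffineMap.lineMap (χ c) (χ b) t)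

theorem affPath_spec {U : Set B} {χ : B → Euc n} (hconv : Convex ℝ (χ '' U)) {c b : B}
    (hc : c ∈ U) (hb : b ∈ U) {t : ℝ} (ht : t ∈ Icc (0 : ℝ) 1) :
    affPath U χ c b t ∈ U ∧ χ (affPath U χ c b t) = AffineMap.lineMap (χ c) (χ b) t := by
  have : AffineMap.lineMap (χ c) (χ b) t ∈ χ '' U :=
    hconv.segment_subset (mem_image_of_mem _ hc) (mem_image_of_mem _ hb)
      (lineMap_mem_segment ℝ _ _ ht)
  have : Nonempty B := ⟨c⟩
  exact ⟨Function.invFunOn_mem ‹_›, Function.invFunOn_eq ‹_›⟩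

theorem affPath_eventually {U : Set B} {χ : B → Euc n} (hχ : IsAffineEmbedding S.Ω S.μ U χ)
    (hconv : Convex ℝ (χ '' U)) {c b : B} (hc : c ∈ U) (hb : b ∈ U) {t : ℝ} (ht : t ∈ Icc (0 : ℝ) 1)
    {c₀ : S.Chart} (hc₀ : affPath U χ c b t ∈ c₀.V) {A : Euc n ≃ᵃ[ℝ] Euc n}
    (hA : ∀ᶠ b' in 𝓝 (affPath U χ c b t), χ b' = A (c₀.x b')) :
    ∀ᶠ s in 𝓝[Icc 0 1] t, A.symm (AffineMap.lineMap (χ c) (χ b) s) ∈ c₀.x '' c₀.V ∧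
      affPath U χ c b s = base c₀ (A.symm (AffineMap.lineMap (χ c) (χ b) s)) := by
  obtain ⟨h1, h2⟩ := affPath_spec hconv hc hb ht
  have hx : A.symm (AffineMap.lineMap (χ c) (χ b) t) = c₀.x (affPath U χ c b t) := by
    rw [← h2, hA.self_of_nhds, A.symm_apply_apply]
  have hcont : Continuous fun s : ℝ ↦ A.symm (AffineMap.lineMap (χ c) (χ b) s) :=
    A.symm.toAffineMap.continuous_of_finiteDimensional.comp AffineMap.lineMap_continuous
  have h3 : ∀ᶠ s in 𝓝 t, A.symm (AffineMap.lineMap (χ c) (χ b) s) ∈ c₀.x '' c₀.V ∧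
      base c₀ (A.symm (AffineMap.lineMap (χ c) (χ b) s)) ∈ U ∧
      χ (base c₀ (A.symm (AffineMap.lineMap (χ c) (χ b) s))) =
        A (c₀.x (base c₀ (A.symm (AffineMap.lineMap (χ c) (χ b) s)))) := by
    refine eventually_comp_of_continuousAt (P := fun ζ ↦ ζ ∈ c₀.x '' c₀.V ∧ base c₀ ζ ∈ U ∧
      χ (base c₀ ζ) = A (c₀.x (base c₀ ζ))) hcont.continuousAt hx ?_
    filter_upwards [c₀.isOpen_image.mem_nhds (mem_image_of_mem _ hc₀),
      eventually_x_base hc₀ (hχ.isOpen.mem_nhds h1), eventually_x_base hc₀ hA] with ζ h4 h5 h6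
    exact ⟨h4, h5, h6⟩
  filter_upwards [h3.filter_mono nhdsWithin_le_nhds, self_mem_nhdsWithin] with s h4 hs
  refine ⟨h4.1, ?_⟩
  obtain ⟨h5, h6⟩ := affPath_spec hconv hc hb hs
  refine hχ.injOn h5 h4.2.1 ?_
  rw [h6, h4.2.2, x_base h4.1, A.apply_symm_apply]

theorem locAffine_affPath {U : Set B} {χ : B → Euc n} (hχ : IsAffineEmbedding S.Ω S.μ U χ)
    (hconv : Convex ℝ (χ '' U)) {c b : B} (hc : c ∈ U) (hb : b ∈ U) :
    S.LocAffine (affPath U χ c b) := by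
  intro t ht
  obtain ⟨c₀, hc₀, A, hA⟩ := hχ.affine _ (affPath_spec hconv hc hb ht).1
  refine ⟨c₀, hc₀, A.symm (χ c), A.symm.linear (χ b - χ c), ?_⟩
  filter_upwards [affPath_eventually hχ hconv hc hb ht hc₀ hA] with s hs
  have : AffineMap.lineMap (χ c) (χ b) s = χ c + s • (χ b - χ c) := by
    rw [AffineMap.lineMap_apply, vsub_eq_sub, vadd_eq_add, add_comm]
  rw [this, affineEquiv_add_smul] at hs
  exact hs

namespace CommonNbhd

variable {c b : B} (N : S.CommonNbhd c b)

theorem path_spec {t : ℝ} (ht : t ∈ Icc (0 : ℝ) 1) :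
    N.path t ∈ N.U ∧ N.χ (N.path t) = AffineMap.lineMap (N.χ c) (N.χ b) t :=
  affPath_spec N.convex N.left_mem N.right_mem ht

theorem locAffine_path : S.LocAffine N.path :=
  locAffine_affPath N.affine N.convex N.left_mem N.right_mem

theorem path_zero : N.path 0 = c := by
  obtain ⟨h1, h2⟩ := N.path_spec (left_mem_Icc.2 zero_le_one)
  rw [AffineMap.lineMap_apply_zero] at h2
  exact N.affine.injOn h1 N.left_mem h2

theorem path_one : N.path 1 = b := by
  obtain ⟨h1, h2⟩ := N.path_spec (right_mem_Icc.2 zero_le_one)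
  rw [AffineMap.lineMap_apply_one] at h2
  exact N.affine.injOn h1 N.right_mem h2

/-- If the end points are in a chart domain with convex image that is contained in a member of the
covering, the path is the segment between them in this chart. -/
theorem path_eq_segment {U' : Set B} (hU' : U' ∈ S.𝒰) {c₀ : S.Chart} {W : Set (Euc n)}
    (hW : Convex ℝ W) (hWV : W ⊆ c₀.x '' c₀.V) (hWU : ∀ ξ ∈ W, base c₀ ξ ∈ U') (hc : c ∈ c₀.V)
    (hcW : c₀.x c ∈ W) (hb : b ∈ c₀.V) (hbW : c₀.x b ∈ W) {t : ℝ} (ht : t ∈ Icc (0 : ℝ) 1) :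
    N.path t = base c₀ (AffineMap.lineMap (c₀.x c) (c₀.x b) t) := by
  obtain ⟨χ', hχ', hconv'⟩ := S.cover.convex U' hU'
  obtain ⟨χ, hχ, hconv⟩ := S.cover.convex_inter N.U N.mem U' hU'
  have hcU : c ∈ N.U ∩ U' := ⟨N.left_mem, by rw [← base_x hc]; exact hWU _ hcW⟩
  have hbU : b ∈ N.U ∩ U' := ⟨N.right_mem, by rw [← base_x hb]; exact hWU _ hbW⟩
  have hseg : ∀ t ∈ Icc (0 : ℝ) 1, AffineMap.lineMap (c₀.x c) (c₀.x b) t ∈ W := fun t ht ↦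
    hW.segment_subset hcW hbW (lineMap_mem_segment ℝ _ _ ht)
  have h0 : affPath (N.U ∩ U') χ c b 0 = c := by
    obtain ⟨h1, h2⟩ := affPath_spec hconv hcU hbU (left_mem_Icc.2 zero_le_one)
    rw [AffineMap.lineMap_apply_zero] at h2
    exact hχ.injOn h1 hcU h2
  have h1 : affPath (N.U ∩ U') χ c b 1 = b := by
    obtain ⟨h1, h2⟩ := affPath_spec hconv hcU hbU (right_mem_Icc.2 zero_le_one)
    rw [AffineMap.lineMap_apply_one] at h2
    exact hχ.injOn h1 hbU h2
  have hloc := locAffine_affPath hχ hconv hcU hbU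
  have hmem := fun t ht ↦ (affPath_spec hconv hcU hbU (t := t) ht).1
  have e1 := hloc.eq_lineMap N.affine (fun t ht ↦ (hmem t ht).1) ht
  have e2 := hloc.eq_lineMap hχ' (fun t ht ↦ (hmem t ht).2) ht
  have e3 := (locAffine_base (c := c₀) fun t ht ↦ hWV (hseg t ht)).eq_lineMap hχ'
    (fun t ht ↦ hWU _ (hseg t ht)) ht
  rw [h0, h1] at e1 e2
  simp only [AffineMap.lineMap_apply_zero, AffineMap.lineMap_apply_one, base_x hc, base_x hb] at e3
  have e4 : N.path t = affPath (N.U ∩ U') χ c b t :=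
    N.affine.injOn (N.path_spec ht).1 (hmem t ht).1 ((N.path_spec ht).2.trans e1.symm)
  rw [e4]
  exact hχ'.injOn (hmem t ht).2 (hWU _ (hseg t ht)) (e2.trans e3.symm)

/-- The path is determined by its germ at the midpoint, in an action-angle chart. -/
theorem path_eq_of_mid [T2Space B] {c₀ : S.Chart} {t₀ : ℝ} (ht₀ : t₀ ∈ Icc (0 : ℝ) 1)
    (hm : N.path t₀ ∈ c₀.V) {A : Euc n ≃ᵃ[ℝ] Euc n}
    (hA : ∀ᶠ b' in 𝓝 (N.path t₀), N.χ b' = A (c₀.x b'))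
    (hW : ∀ t ∈ Icc (0 : ℝ) 1,
      AffineMap.lineMap (A.symm (N.χ c)) (A.symm (N.χ b)) t ∈ c₀.x '' c₀.V)
    {t : ℝ} (ht : t ∈ Icc (0 : ℝ) 1) :
    N.path t = base c₀ (AffineMap.lineMap (A.symm (N.χ c)) (A.symm (N.χ b)) t) := by
  refine N.locAffine_path.eq_of_eventuallyEq (locAffine_base hW) ht₀ ?_ ht
  filter_upwards [affPath_eventually N.affine N.convex N.left_mem N.right_mem ht₀ hm hA] with s hs
  have : A.symm (AffineMap.lineMap (N.χ c) (N.χ b) s) =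
      AffineMap.lineMap (A.symm (N.χ c)) (A.symm (N.χ b)) s :=
    A.symm.toAffineMap.apply_lineMap _ _ _
  rw [this] at hs
  exact hs.2

end CommonNbhd

end AffinePaths

/-! ### Parallel transport in a gauge -/

section Transport

variable [T2Space X] [VectorBundle ℂ ℂ L] [ContMDiffVectorBundle ∞ ℂ L (𝓡 (2 * n))]

/-- The adjoint of the linear part of an affine automorphism. -/
def adj {n : ℕ} (A : Euc n ≃ᵃ[ℝ] Euc n) : Euc n ≃L[ℝ] Euc n := (exists_dual A.linear).choose.symm

theorem inner_adj {n : ℕ} (A : Euc n ≃ᵃ[ℝ] Euc n) (v w : Euc n) :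
    inner ℝ v (adj A w) = inner ℝ (A.linear v) w := by
  rw [← (exists_dual A.linear).choose_spec v (adj A w), adj, ContinuousLinearEquiv.apply_symm_apply]

theorem hasFDerivAt_comp_Ψ_real {c : S.Chart} {y : Euc n × Euc n} (hy : y.1 ∈ c.x '' c.V) {g : X → ℝ}
    (hg : MDifferentiableAt (𝓡 (2 * n)) 𝓘(ℝ, ℝ) g (c.Ψ y)) (v : Euc n × Euc n) :
    fderiv ℝ (fun z ↦ g (c.Ψ z)) y v = mvfderiv (𝓡 (2 * n)) g (c.Ψ y) (c.dΨ y.1 y.2 v) := by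
  let D : Euc n × Euc n →L[ℝ] ℝ := (mfderiv (𝓡 (2 * n)) 𝓘(ℝ, ℝ) g (c.Ψ y)).comp (c.dΨ y.1 y.2)
  have h : HasFDerivAt (fun z ↦ g (c.Ψ z)) D y :=
    (hg.hasMFDerivAt.comp y (hasMFDerivAt_Ψ c hy)).hasFDerivAt
  rw [h.fderiv]; rfl

/-- The differential of affine coordinates, in an action-angle chart. -/
theorem mvfderiv_affine {c : S.Chart} {b : B} (hb : b ∈ c.V) {χ : B → Euc n} {A : Euc n ≃ᵃ[ℝ] Euc n}
    (hA : ∀ᶠ b' in 𝓝 b, χ b' = A (c.x b')) (θ : Euc n) (u : Euc n × Euc n) (j : Fin n) :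
    mvfderiv (𝓡 (2 * n)) (fun p ↦ χ (S.μ p) j) (c.pt b θ) (c.dΨ (c.x b) θ u) = A.linear u.1 j := by
  have hy : (c.x b, θ).1 ∈ c.x '' c.V := mem_image_of_mem _ hb
  obtain ⟨Φ, h1, h2, h3⟩ := exists_localInverse c hy
  have hΦ : Φ (c.Ψ (c.x b, θ)) = (c.x b, θ) := h2.self_of_nhds
  let Al : Euc n →L[ℝ] Euc n := LinearMap.toContinuousLinearMap A.linear.toLinearMap
  have hAl : ∀ ζ, A ζ = Al ζ + A 0 := fun ζ ↦ by
    have := A.map_vadd 0 ζ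
    simp only [vadd_eq_add, add_zero] at this
    exact this
  have hAc : ContDiff ℝ ∞ fun z : Euc n × Euc n ↦ A z.1 j := by
    have : (fun z : Euc n × Euc n ↦ A z.1 j) = fun z ↦
        (EuclideanSpace.proj j : Euc n →L[ℝ] ℝ) (Al z.1 + A 0) := by
      funext z; rw [hAl]; rfl
    rw [this]
    exact (EuclideanSpace.proj j : Euc n →L[ℝ] ℝ).contDiff.comp ((Al.contDiff.comp contDiff_fst).add contDiff_const)
  have h0 : ∀ᶠ z : Euc n × Euc n in 𝓝 (c.x b, θ), χ (base c z.1) = A (c.x (base c z.1)) :=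
    continuous_fst.continuousAt.eventually
      (p := fun ζ ↦ χ (base c ζ) = A (c.x (base c ζ))) (eventually_x_base hb hA)
  have hg : MDifferentiableAt (𝓡 (2 * n)) 𝓘(ℝ, ℝ) (fun p ↦ χ (S.μ p) j) (c.Ψ (c.x b, θ)) := by
    have h4 : ContMDiffAt (𝓡 (2 * n)) 𝓘(ℝ, ℝ) ∞ (fun p ↦ A (Φ p).1 j) (c.Ψ (c.x b, θ)) :=
      ContMDiffAt.comp (g := fun z : Euc n × Euc n ↦ A z.1 j) (c.Ψ (c.x b, θ))
        hAc.contMDiff.contMDiffAt h1.self_of_nhds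
    refine (h4.congr_of_eventuallyEq ?_).mdifferentiableAt (by simp)
    have h5 : ∀ᶠ z in 𝓝 (c.x b, θ), z.1 ∈ c.x '' c.V ∧ χ (base c z.1) = A (c.x (base c z.1)) :=
      (eventually_mem_chartDomain c hy).and h0
    filter_upwards [h3, eventually_comp_of_continuousAt h1.self_of_nhds.continuousAt hΦ h5]
      with p hp ⟨h6, h7⟩
    have h8 : S.μ p = base c (Φ p).1 := by
      conv_lhs => rw [← hp]
      exact proj_Ψ h6
    rw [h8, h7, x_base h6]
  have h9 := hasFDerivAt_comp_Ψ_real hy hg u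
  refine h9.symm.trans ?_
  have h10 : (fun z : Euc n × Euc n ↦ χ (S.μ (c.Ψ z)) j) =ᶠ[𝓝 (c.x b, θ)] fun z ↦
      (EuclideanSpace.proj j : Euc n →L[ℝ] ℝ) (Al z.1 + A 0) := by
    filter_upwards [eventually_mem_chartDomain c hy, h0] with z h6 h7
    rw [proj_Ψ h6, h7, x_base h6, hAl]; rfl
  rw [h10.fderiv_eq]
  have h11 : HasFDerivAt (fun z : Euc n × Euc n ↦
      (EuclideanSpace.proj j : Euc n →L[ℝ] ℝ) (Al z.1 + A 0))
      ((EuclideanSpace.proj j : Euc n →L[ℝ] ℝ).comp (Al.comp (ContinuousLinearMap.fst ℝ _ _)))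
      (c.x b, θ) :=
    (EuclideanSpace.proj j : Euc n →L[ℝ] ℝ).hasFDerivAt.comp _
      (((Al.hasFDerivAt).comp _ hasFDerivAt_fst).add_const _)
  rw [h11.fderiv]; rfl

/-- The vector `Y` with `Ω(·, Y) = d⟨a, χ ∘ μ⟩`. -/
theorem dual_vector_iff {c : S.Chart} {b : B} (hb : b ∈ c.V) {χ : B → Euc n}
    {A : Euc n ≃ᵃ[ℝ] Euc n} (hA : ∀ᶠ b' in 𝓝 b, χ b' = A (c.x b')) (θ : Euc n) (a : Fin n → ℝ)
    (V : TangentSpace (𝓡 (2 * n)) (c.pt b θ)) :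
    (∀ Y : TangentSpace (𝓡 (2 * n)) (c.pt b θ), S.Ω (c.pt b θ) ![Y, V] =
      ∑ j, a j * mvfderiv (𝓡 (2 * n)) (fun p ↦ χ (S.μ p) j) (c.pt b θ) Y) ↔
      V = c.vert b θ (adj A (WithLp.toLp 2 a)) := by
  have hy : (c.x b, θ).1 ∈ c.x '' c.V := mem_image_of_mem _ hb
  obtain ⟨v, rfl⟩ := (bijective_dΨ c hy).2 V
  have hsurj : ∀ P : TangentSpace (𝓡 (2 * n)) (c.pt b θ) → Prop,
      (∀ Y, P Y) ↔ ∀ u, P (c.dΨ (c.x b) θ u) := fun P ↦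
    ⟨fun h u ↦ h _, fun h Y ↦ by obtain ⟨u, rfl⟩ := (bijective_dΨ c hy).2 Y; exact h u⟩
  have hsum : ∀ x : Euc n, ∑ j, a j * x j = inner ℝ x (WithLp.toLp 2 a) := fun x ↦ by
    simp [PiLp.inner_apply]
  rw [hsurj]
  have h1 : ∀ u : Euc n × Euc n, S.Ω (c.pt b θ) ![c.dΨ (c.x b) θ u, c.dΨ (c.x b) θ v] =
      inner ℝ u.1 v.2 - inner ℝ v.1 u.2 := fun u ↦ by
    rw [← sum_symplectic]
    exact c.symplectic _ hy θ u v
  have h2 : ∀ u : Euc n × Euc n, ∑ j, a j * mvfderiv (𝓡 (2 * n)) (fun p ↦ χ (S.μ p) j) (c.pt b θ)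
      (c.dΨ (c.x b) θ u) = inner ℝ u.1 (adj A (WithLp.toLp 2 a)) := fun u ↦ by
    rw [inner_adj, ← hsum]
    exact Finset.sum_congr rfl fun j _ ↦ by rw [mvfderiv_affine hb hA]
  have h3 : (c.dΨ (c.x b) θ v = c.vert b θ (adj A (WithLp.toLp 2 a))) ↔
      v = (0, adj A (WithLp.toLp 2 a)) := (bijective_dΨ c hy).1.eq_iff
  constructor
  · intro h
    refine h3.2 (Prod.ext (ext_inner_right ℝ fun u ↦ ?_) (ext_inner_left ℝ fun u ↦ ?_))
    · have := h (0, u)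
      rw [h1, h2] at this
      simpa using this
    · have := h (u, 0)
      rw [h1, h2] at this
      simpa using this
  · intro h u
    rw [h1, h2, h3.1 h]
    simp

theorem velocity_eq {ℓ : ℝ → X} {c : S.Chart} {z : ℝ → Euc n × Euc n} {v : Euc n × Euc n} {t : ℝ}
    (ht : t ∈ Icc (0 : ℝ) 1) (hz : HasDerivWithinAt z v (Icc 0 1) t) (hy : (z t).1 ∈ c.x '' c.V)
    (h : ∀ᶠ r in 𝓝[Icc 0 1] t, ℓ r = c.Ψ (z r)) :
    (velocity (n := n) ℓ t : Euc (2 * n)) = c.dΨ (z t).1 (z t).2 v := by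
  have h1 := (hasMFDerivAt_Ψ c hy).comp_hasMFDerivWithinAt t hz.hasFDerivWithinAt.hasMFDerivWithinAt
  have h3 := h1.congr_of_eventuallyEq h (h.self_of_nhdsWithin ht)
  have h4 := h3.mfderivWithin (uniqueDiffOn_Icc zero_lt_one t ht).uniqueMDiffWithinAt
  have h5 := congrArg (fun A : ℝ →L[ℝ] Euc (2 * n) ↦ A 1) h4
  have e2 : (ContinuousLinearMap.toSpanSingleton ℝ v : ℝ →L[ℝ] _) 1 = v := by simp
  rw [← e2]
  exact h5

theorem mem_H_congr {p q : X} (h : p = q) {v w : Euc (2 * n)} (hv : v = w)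
    (hp : (v : TangentSpace (𝓡 (2 * n)) p) ∈ S.H p) : (w : TangentSpace (𝓡 (2 * n)) q) ∈ S.H q := by
  subst h hv; exact hp

namespace ParallelTransport

variable {c b : B} {N : S.CommonNbhd c b} {q : X} {v₀ : Fin n → TangentSpace (𝓡 (2 * n)) q}

/-- The transported element of `L`, in the total space. -/
def x (T : ParallelTransport N q v₀) (t : ℝ) : TotalSpace ℂ L := ⟨T.ℓ t, T.e t⟩

/-- Parallel transport in a gauge `G`, near a point of the path. -/
theorem exists_local (T : ParallelTransport N q v₀) {t₀ : ℝ} (ht₀ : t₀ ∈ Icc (0 : ℝ) 1)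
    {G : S.Gauge} (hG : N.path t₀ ∈ G.dom) {A : Euc n ≃ᵃ[ℝ] Euc n}
    (hA : ∀ᶠ b' in 𝓝 (N.path t₀), N.χ b' = A (G.c.x b')) {θ₀ : Euc n}
    (hθ₀ : G.c.pt (N.path t₀) θ₀ = T.ℓ t₀) :
    ∃ (ϑ : ℝ → Euc n) (κ : ℝ → ℂ), ϑ t₀ = θ₀ ∧ ContDiffWithinAt ℝ ∞ ϑ (Icc 0 1) t₀ ∧
      (∀ᶠ r in 𝓝[Icc 0 1] t₀, N.path r ∈ G.dom ∧
        (∀ᶠ b' in 𝓝 (N.path r), N.χ b' = A (G.c.x b')) ∧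
        G.c.x (N.path r) = AffineMap.lineMap (A.symm (N.χ c)) (A.symm (N.χ b)) r ∧
        T.ℓ r = G.c.Ψ (AffineMap.lineMap (A.symm (N.χ c)) (A.symm (N.χ b)) r, ϑ r) ∧
        T.x r = tsmul (κ r)
          (G.sec (AffineMap.lineMap (A.symm (N.χ c)) (A.symm (N.χ b)) r, ϑ r)) ∧
        HasDerivWithinAt ϑ (G.slope (G.c.x (N.path r)) (A.symm (N.χ b) - A.symm (N.χ c)))
          (Icc 0 1) r) ∧
      HasDerivWithinAt κ (Complex.I * (inner ℝ (G.c.x (N.path t₀)) (G.slope (G.c.x (N.path t₀))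
        (A.symm (N.χ b) - A.symm (N.χ c))) : ℝ) * κ t₀) (Icc 0 1) t₀ := by
  set η₀ := A.symm (N.χ c)
  set η₁ := A.symm (N.χ b)
  have hy : (G.c.x (N.path t₀), θ₀).1 ∈ G.c.x '' G.c.V := mem_image_of_mem _ hG.1
  obtain ⟨Φ, h1, h2, h3⟩ := exists_localInverse G.c hy
  have hΦ : Φ (T.ℓ t₀) = (G.c.x (N.path t₀), θ₀) := by rw [← hθ₀]; exact h2.self_of_nhds
  have hθ₀' : G.c.Ψ (G.c.x (N.path t₀), θ₀) = T.ℓ t₀ := hθ₀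
  rw [hθ₀'] at h1 h3
  have hℓ := (T.smooth t₀ ht₀).continuousWithinAt
  have hpath := N.locAffine_path.continuousWithinAt ht₀
  have hΦc : ContinuousWithinAt (fun r ↦ Φ (T.ℓ r)) (Icc 0 1) t₀ :=
    ContinuousAt.comp_continuousWithinAt h1.self_of_nhds.continuousAt hℓ
  have hline : ∀ s : ℝ, A.symm (AffineMap.lineMap (N.χ c) (N.χ b) s) =
      AffineMap.lineMap η₀ η₁ s := fun s ↦ A.symm.toAffineMap.apply_lineMap _ _ _
  have hpath' : ∀ᶠ r in 𝓝[Icc 0 1] t₀, G.c.x (N.path r) = AffineMap.lineMap η₀ η₁ r := by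
    filter_upwards [affPath_eventually N.affine N.convex N.left_mem N.right_mem ht₀ hG.1 hA] with r hr
    have h4 : N.path r = base G.c (A.symm (AffineMap.lineMap (N.χ c) (N.χ b) r)) := hr.2
    rw [h4, x_base hr.1, hline]
  let ϑ : ℝ → Euc n := fun r ↦ (Φ (T.ℓ r)).2
  have hsm : ∀ r ∈ Icc (0 : ℝ) 1, ContMDiffAt (𝓡 (2 * n)) 𝓘(ℝ, Euc n × Euc n) ∞ Φ (T.ℓ r) →
      ContDiffWithinAt ℝ ∞ ϑ (Icc 0 1) r := by
    intro r hr h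
    have h4 : ContMDiffWithinAt 𝓘(ℝ, ℝ) 𝓘(ℝ, Euc n × Euc n) ∞ (fun r ↦ Φ (T.ℓ r)) (Icc 0 1) r :=
      ContMDiffAt.comp_contMDiffWithinAt r h (T.smooth r hr)
    exact (contMDiffWithinAt_iff_contDiffWithinAt.1 h4).snd
  have hev : ∀ᶠ r in 𝓝[Icc 0 1] t₀, T.ℓ r = G.c.Ψ (AffineMap.lineMap η₀ η₁ r, ϑ r) := by
    have h5 : ∀ᶠ z in 𝓝 (Φ (T.ℓ t₀)), z.1 ∈ G.c.x '' G.c.V := by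
      rw [hΦ]; exact eventually_mem_chartDomain G.c hy
    filter_upwards [hℓ.eventually h3, hΦc.eventually h5, hpath', self_mem_nhdsWithin]
      with r h6 h7 h8 hr
    have h9 : S.μ (T.ℓ r) = base G.c (Φ (T.ℓ r)).1 := by
      conv_lhs => rw [← h6]
      exact proj_Ψ h7
    have h10 : (Φ (T.ℓ r)).1 = AffineMap.lineMap η₀ η₁ r := by
      rw [← h8, ← T.proj r hr, h9, x_base h7]
    rw [← h10]
    exact h6.symm
  have hdline : ∀ r, HasDerivWithinAt (fun r : ℝ ↦ AffineMap.lineMap η₀ η₁ r) (η₁ - η₀)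
      (Icc 0 1) r := fun r ↦ (hasDerivAt_lineMap' η₀ η₁ r).hasDerivWithinAt
  have hgood : ∀ᶠ r in 𝓝[Icc 0 1] t₀, r ∈ Icc (0 : ℝ) 1 ∧ N.path r ∈ G.dom ∧
        (∀ᶠ b' in 𝓝 (N.path r), N.χ b' = A (G.c.x b')) ∧
        G.c.x (N.path r) = AffineMap.lineMap η₀ η₁ r ∧
        T.ℓ r = G.c.Ψ (AffineMap.lineMap η₀ η₁ r, ϑ r) ∧
        HasDerivWithinAt ϑ (G.slope (G.c.x (N.path r)) (η₁ - η₀)) (Icc 0 1) r := by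
    filter_upwards [self_mem_nhdsWithin, hpath.eventually (G.isOpen_dom.mem_nhds hG),
      hpath.eventually hA.eventually_nhds, hpath', hev, eventually_eventually_nhdsWithin.2 hev,
      hℓ.eventually h1] with r hr h4 h5 h6 h7 h8 h9
    refine ⟨hr, h4, h5, h6, h7, ?_⟩
    have h10 := ((hsm r hr h9).differentiableWithinAt (by simp)).hasDerivWithinAt
    have hW : AffineMap.lineMap η₀ η₁ r ∈ G.W := by rw [← h6]; exact h4.2
    have h11 := velocity_eq (z := fun r ↦ (AffineMap.lineMap η₀ η₁ r, ϑ r)) hr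
      ((hdline r).prodMk h10) (G.subset hW) h8
    have h12 := (G.mem_H (AffineMap.lineMap η₀ η₁ r, ϑ r) hW _).1
      (mem_H_congr h7 h11 (T.horizontal r hr))
    rw [h6]
    exact h10.congr_deriv h12
  obtain ⟨hg1, hg2, hg3, hg4, hg5, hg6⟩ := hgood.self_of_nhdsWithin ht₀
  have hW : AffineMap.lineMap η₀ η₁ t₀ ∈ G.W := by rw [← hg4]; exact hg2.2
  have hzd := (hdline t₀).prodMk hg6
  have hlog := (G.normal (AffineMap.lineMap η₀ η₁ t₀, ϑ t₀) hW).hasLogDeriv ht₀ hzd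
  have hlogT : HasLogDeriv S T.x (Icc 0 1) t₀ (velocity (n := n) T.ℓ t₀) 0 :=
    hasLogDeriv_of_parallel (T.parallel_e t₀ ht₀)
  rw [velocity_eq ht₀ hzd (G.subset hW) hev] at hlogT
  obtain ⟨κ, hκ1, hκ2⟩ := hlog.ratio hlogT ht₀ hev (G.sec_ne_zero hW)
  refine ⟨ϑ, κ, congrArg Prod.snd hΦ, hsm t₀ ht₀ h1.self_of_nhds, ?_, hκ2.congr_deriv ?_⟩
  · filter_upwards [hgood, hκ1] with r hr1 hr2
    exact ⟨hr1.2.1, hr1.2.2.1, hr1.2.2.2.1, hr1.2.2.2.2.1, hr2, hr1.2.2.2.2.2⟩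
  · rw [hg4]
    ring

end ParallelTransport

end Transport

/-! ### Translations of the fibres -/

section Shift

variable [T2Space X] [VectorBundle ℂ ℂ L] [ContMDiffVectorBundle ∞ ℂ L (𝓡 (2 * n))]

theorem affineEquiv_apply {n : ℕ} (A : Euc n ≃ᵃ[ℝ] Euc n) (ζ : Euc n) : A ζ = A.linear ζ + A 0 := by
  have := A.map_vadd 0 ζ
  simp only [vadd_eq_add, add_zero] at this
  exact this

theorem inner_adj_eq {n : ℕ} (A : Euc n ≃ᵃ[ℝ] Euc n) (ζ w : Euc n) :
    inner ℝ ζ (adj A w) = inner ℝ (A ζ) w - inner ℝ (A 0) w := by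
  rw [inner_adj, affineEquiv_apply A ζ, inner_add_left, add_sub_cancel_right]

theorem exists_gauge_at (b : B) : ∃ G : S.Gauge, b ∈ G.dom := by
  have hb := S.mem_chartAt b
  obtain ⟨r, hr, hsub⟩ := Metric.isOpen_iff.1 (S.chartAt b).isOpen_image _ (mem_image_of_mem _ hb)
  obtain ⟨G, h1, h2⟩ := exists_gauge (S := S) (S.chartAt b) Metric.isOpen_ball
    (convex_ball ((S.chartAt b).x b) r) hsub
  refine ⟨G, ?_, ?_⟩
  · rw [h1]; exact hb
  · rw [mem_preimage, h1, h2]; exact Metric.mem_ball_self hr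

/-- Two charts with given affine coordinate changes. -/
theorem isFiberTransition_adj {c c' : S.Chart} {b : B} (hb : b ∈ c.V) (hb' : b ∈ c'.V)
    {χ : B → Euc n} {A A' : Euc n ≃ᵃ[ℝ] Euc n} (hA : ∀ᶠ b' in 𝓝 b, χ b' = A (c.x b'))
    (hA' : ∀ᶠ b' in 𝓝 b, χ b' = A' (c'.x b')) :
    IsFiberTransition c c' b (A.trans A'.symm) ((adj A).symm.trans (adj A')) := by
  refine isFiberTransition hb hb' ?_ fun v w ↦ ?_
  · filter_upwards [hA, hA'] with b' h h'
    rw [AffineEquiv.trans_apply, ← h, h', AffineEquiv.symm_apply_apply]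
  · rw [ContinuousLinearEquiv.trans_apply, inner_adj]
    have : A'.linear ((A.trans A'.symm).linear v) = A.linear v := by
      change A'.linear (A'.linear.symm (A.linear v)) = _
      rw [LinearEquiv.apply_symm_apply]
    rw [this, ← inner_adj, ContinuousLinearEquiv.apply_symm_apply]

theorem shift_indep {G G' : S.Gauge} {b : B} (hb : b ∈ G.dom) (hb' : b ∈ G'.dom)
    {χ : B → Euc n} {A A' : Euc n ≃ᵃ[ℝ] Euc n} (hA : ∀ᶠ b' in 𝓝 b, χ b' = A (G.c.x b'))
    (hA' : ∀ᶠ b' in 𝓝 b, χ b' = A' (G'.c.x b')) {α α' : ℂ} {θ θ' : Euc n}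
    (h : tsmul α (G.sec (G.c.x b, θ)) = tsmul α' (G'.sec (G'.c.x b, θ'))) (w : Euc n) :
    tsmul (α * Complex.exp (-(Complex.I * (inner ℝ (A 0) w : ℝ)))) (G.sec (G.c.x b, θ + adj A w)) =
      tsmul (α' * Complex.exp (-(Complex.I * (inner ℝ (A' 0) w : ℝ))))
        (G'.sec (G'.c.x b, θ' + adj A' w)) := by
  have hT := isFiberTransition_adj hb.1 hb'.1 hA hA'
  have h0 : G.c.pt b θ = G'.c.pt b θ' := congrArg TotalSpace.proj h
  have hz : ∀ (ξ φ u : Euc n), ∀ t ∈ Icc (0 : ℝ) 1,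
      HasDerivWithinAt (fun t : ℝ ↦ (ξ, φ + t • u)) (0, u) (Icc 0 1) t := fun ξ φ u t _ ↦ by
    have h1 : HasDerivAt (fun t : ℝ ↦ φ + t • u) u t := by
      simpa using ((hasDerivAt_id t).smul_const u).const_add φ
    exact ((hasDerivAt_const t ξ).prodMk h1).hasDerivWithinAt
  set d : ℝ := inner ℝ (G.c.x b) (adj A w) - inner ℝ (G'.c.x b) (adj A' w) with hd
  have hd' : d = inner ℝ (A' 0) w - inner ℝ (A 0) w := by
    rw [hd, inner_adj_eq, inner_adj_eq, ← hA.self_of_nhds, ← hA'.self_of_nhds]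
    ring
  obtain ⟨a, ha⟩ := Gauge.sec_curve (G := G) (G' := G') (convex_Icc (0 : ℝ) 1)
    (uniqueDiffOn_Icc zero_lt_one) (hz (G.c.x b) θ (adj A w)) (hz (G'.c.x b) θ' (adj A' w))
    (fun t _ ↦ hb.2) (fun t _ ↦ hb'.2) (fun t _ ↦ by
      have := hT.pt_add θ θ' h0 (t • adj A w)
      rw [ContinuousLinearEquiv.trans_apply, map_smul, map_smul,
        ContinuousLinearEquiv.symm_apply_apply] at this
      exact this.symm)
    (g := fun t ↦ Complex.I * d * t) (fun t _ ↦ by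
      have := ((Complex.ofRealCLM.hasDerivAt (x := t)).const_mul (Complex.I * d)).hasDerivWithinAt
        (s := Icc 0 1)
      have h1 : HasDerivWithinAt (fun t : ℝ ↦ Complex.I * d * t) (Complex.I * d) (Icc 0 1) t := by
        simpa using this
      exact h1)
  have ha0 := ha 0 (left_mem_Icc.2 zero_le_one)
  have ha1 := ha 1 (right_mem_Icc.2 zero_le_one)
  simp only [zero_smul, add_zero, one_smul, Complex.ofReal_zero, mul_zero, Complex.exp_zero,
    mul_one, Complex.ofReal_one] at ha0 ha1
  rw [ha0, tsmul_tsmul] at h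
  have h2 := tsmul_injective (G.sec_ne_zero (y := (G.c.x b, θ)) hb.2) h
  rw [ha1, tsmul_tsmul, h2]
  congr 1
  have h3 : Complex.exp (-(Complex.I * (inner ℝ (A 0) w : ℝ))) =
      Complex.exp (-(Complex.I * (inner ℝ (A' 0) w : ℝ))) * Complex.exp (Complex.I * d) := by
    rw [← Complex.exp_add, hd']
    congr 1
    push_cast
    ring
  rw [h3]
  ring

/-- `y` is obtained from `x ∈ L` by the translation `w` of the fibre, with respect to the affine
coordinates `χ`: the flow of the vector fields dual to `d(χ ∘ μ)`, lifted to `L`. The lift is the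
`∇`-parallel one, up to the factor `exp(-i⟨χ, w⟩)`; it then preserves `∇`. -/
def IsShift (S : Setting n X B L) (χ : B → Euc n) (w : Euc n) (x y : TotalSpace ℂ L) : Prop :=
  ∀ (G : S.Gauge) (b : B), b ∈ G.dom → ∀ A : Euc n ≃ᵃ[ℝ] Euc n,
    (∀ᶠ b' in 𝓝 b, χ b' = A (G.c.x b')) → ∀ (α : ℂ) (θ : Euc n),
    x = tsmul α (G.sec (G.c.x b, θ)) →
    y = tsmul (α * Complex.exp (-(Complex.I * (inner ℝ (A 0) w : ℝ)))) (G.sec (G.c.x b, θ + adj A w))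

theorem proj_sec {G : S.Gauge} {b : B} (hb : b ∈ G.dom) (a : ℂ) (θ : Euc n) :
    S.μ (tsmul a (G.sec (G.c.x b, θ))).proj = b := proj_pt hb.1 θ

theorem exists_isShift {U : Set B} {χ : B → Euc n} (hχ : IsAffineEmbedding S.Ω S.μ U χ) (w : Euc n)
    (x : TotalSpace ℂ L) (hx : S.μ x.proj ∈ U) (hx0 : x.snd ≠ 0) : ∃ y, S.IsShift χ w x y := by
  obtain ⟨G, hG⟩ := exists_gauge_at (S := S) (S.μ x.proj)
  obtain ⟨A, hA⟩ := affine_near hχ hx hG.1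
  obtain ⟨α, θ, -, hα⟩ := G.exists_eq_tsmul_sec hG rfl hx0
  refine ⟨tsmul (α * Complex.exp (-(Complex.I * (inner ℝ (A 0) w : ℝ))))
    (G.sec (G.c.x (S.μ x.proj), θ + adj A w)), fun G' b hb A' hA' α' θ' h ↦ ?_⟩
  obtain rfl : S.μ x.proj = b := by rw [h, proj_sec hb]
  exact shift_indep hG hb hA hA' (hα.symm.trans h) w

/-- The vertical vector `V` at `p` with `Ω(·, V) = d⟨a, χ ∘ μ⟩`. -/
def vform (S : Setting n X B L) (χ : B → Euc n) (p : X) (a : Fin n → ℝ) :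
    TangentSpace (𝓡 (2 * n)) p :=
  open Classical in
  if h : ∃ V : TangentSpace (𝓡 (2 * n)) p, ∀ Y : TangentSpace (𝓡 (2 * n)) p, S.Ω p ![Y, V] =
      ∑ j, a j * mvfderiv (𝓡 (2 * n)) (fun q ↦ χ (S.μ q) j) p Y then h.choose else 0

theorem vform_eq {c : S.Chart} {b : B} (hb : b ∈ c.V) {χ : B → Euc n}
    {A : Euc n ≃ᵃ[ℝ] Euc n} (hA : ∀ᶠ b' in 𝓝 b, χ b' = A (c.x b')) (θ : Euc n) (a : Fin n → ℝ) :
    (S.vform χ (c.pt b θ) a : Euc (2 * n)) = c.vert b θ (adj A (WithLp.toLp 2 a)) := by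
  have h : ∃ V : TangentSpace (𝓡 (2 * n)) (c.pt b θ), ∀ Y : TangentSpace (𝓡 (2 * n)) (c.pt b θ),
      S.Ω (c.pt b θ) ![Y, V] =
      ∑ j, a j * mvfderiv (𝓡 (2 * n)) (fun q ↦ χ (S.μ q) j) (c.pt b θ) Y :=
    ⟨_, (dual_vector_iff hb hA θ a _).2 rfl⟩
  rw [vform, dif_pos h]
  exact (dual_vector_iff hb hA θ a _).1 h.choose_spec

/-- The value of a half-form on an element of `L` and the vertical frame with coefficients `M` in
the affine coordinates `χ`. -/
def ev {k : ℕ} {b : B} (τ : S.FiberSpace k b) (χ : B → Euc n) (M : Matrix (Fin n) (Fin n) ℝ)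
    (x : TotalSpace ℂ L) : ℂ :=
  τ.1 x.proj x.snd (fun i ↦ S.vform χ x.proj (M i))

theorem ev_tsmul {k : ℕ} {b : B} (τ : S.FiberSpace k b) (χ : B → Euc n)
    (M : Matrix (Fin n) (Fin n) ℝ) (x : TotalSpace ℂ L) {a : ℂ} (ha : a ≠ 0) :
    ev τ χ M (tsmul a x) = (a ^ k)⁻¹ * ev τ χ M x := τ.2.2.2.2.1 _ _ _ a ha

theorem ev_sec {k : ℕ} {b : B} (τ : S.FiberSpace k b) {χ : B → Euc n} {G : S.Gauge}
    (hb : b ∈ G.dom) {A : Euc n ≃ᵃ[ℝ] Euc n} (hA : ∀ᶠ b' in 𝓝 b, χ b' = A (G.c.x b'))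
    (M : Matrix (Fin n) (Fin n) ℝ) (θ : Euc n) :
    ev τ χ M (G.sec (G.c.x b, θ)) =
      Real.sqrt |(Matrix.of fun i j ↦ adj A (WithLp.toLp 2 (M i)) j).det| *
        (Complex.exp (Complex.I * k * (inner ℝ (G.c.x b) θ : ℝ)) * G.amp τ) := by
  have h1 : (fun i ↦ (S.vform χ (G.c.pt b θ) (M i) : Euc (2 * n))) = fun i ↦
      ∑ j, (Matrix.of fun i j ↦ adj A (WithLp.toLp 2 (M i)) j) i j •
        (G.c.frame b θ j : Euc (2 * n)) := by
    funext i
    rw [vform_eq hb.1 hA, ← vert_sum]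
    congr 1
    ext l
    simp [Finset.sum_apply, Pi.single_apply]
  have h2 : ev τ χ M (G.sec (G.c.x b, θ)) =
      τ.1 (G.c.pt b θ) (G.E (G.c.x b, θ)) (fun i ↦ S.vform χ (G.c.pt b θ) (M i)) := rfl
  rw [h2, h1, ← G.apply_E hb]
  exact τ.2.2.2.2.2.1 _ _ _ _ fun i ↦ dproj_vert hb.1 θ _

theorem ev_shift {k : ℕ} {b : B} (τ : S.FiberSpace k b) {U : Set B} {χ : B → Euc n}
    (hχ : IsAffineEmbedding S.Ω S.μ U χ) (hbU : b ∈ U)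
    (M : Matrix (Fin n) (Fin n) ℝ) {w : Euc n} {x y : TotalSpace ℂ L} (hx : S.μ x.proj = b)
    (hx0 : x.snd ≠ 0) (h : S.IsShift χ w x y) :
    ev τ χ M y = Complex.exp (Complex.I * k * (inner ℝ (χ b) w : ℝ)) * ev τ χ M x := by
  obtain ⟨G, hG⟩ := exists_gauge_at (S := S) b
  obtain ⟨A, hA⟩ := affine_near hχ hbU hG.1
  obtain ⟨α, θ, hα0, hα⟩ := G.exists_eq_tsmul_sec hG hx hx0
  rw [h G b hG A hA α θ hα, hα, ev_tsmul _ _ _ _ hα0,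
    ev_tsmul _ _ _ _ (mul_ne_zero hα0 (Complex.exp_ne_zero _)), ev_sec _ hG hA, ev_sec _ hG hA,
    mul_pow, ← Complex.exp_nat_mul, mul_inv, ← Complex.exp_neg, inner_add_right, inner_adj_eq A,
    ← hA.self_of_nhds]
  have h3 : Complex.exp (Complex.I * k * ((inner ℝ (G.c.x b) θ +
      (inner ℝ (χ b) w - inner ℝ (A 0) w) : ℝ) : ℂ)) =
      Complex.exp (Complex.I * k * (inner ℝ (χ b) w : ℝ)) *
      Complex.exp (Complex.I * k * (inner ℝ (G.c.x b) θ : ℝ)) *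
      (Complex.exp (-(k * -(Complex.I * (inner ℝ (A 0) w : ℝ)))))⁻¹ := by
    rw [← Complex.exp_neg, ← Complex.exp_add, ← Complex.exp_add]
    congr 1
    push_cast
    ring
  rw [h3]
  field_simp [Complex.exp_ne_zero]

theorem IsShift.proj_eq {U : Set B} {χ : B → Euc n}
    (hχ : IsAffineEmbedding S.Ω S.μ U χ) {c : S.Chart} {b : B} (hbU : b ∈ U) (hb : b ∈ c.V)
    {A : Euc n ≃ᵃ[ℝ] Euc n} (hA : ∀ᶠ b' in 𝓝 b, χ b' = A (c.x b')) {w θ : Euc n}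
    {x y : TotalSpace ℂ L} (h : S.IsShift χ w x y) (hx0 : x.snd ≠ 0) (hx : x.proj = c.pt b θ) :
    y.proj = c.pt b (θ + adj A w) := by
  obtain ⟨G, hG⟩ := exists_gauge_at (S := S) b
  obtain ⟨A', hA'⟩ := affine_near hχ hbU hG.1
  obtain ⟨α, θ', -, hα⟩ := G.exists_eq_tsmul_sec hG (by rw [hx, proj_pt hb]) hx0
  rw [h G b hG A' hA' α θ' hα]
  have h1 : G.c.pt b θ' = c.pt b θ := by rw [← hx, hα]; rfl
  have h2 := (isFiberTransition_adj hG.1 hb hA' hA).pt_add θ' θ h1 (adj A' w)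
  rw [ContinuousLinearEquiv.trans_apply, ContinuousLinearEquiv.symm_apply_apply] at h2
  exact h2

theorem norm_exp_neg_I (r : ℝ) : ‖Complex.exp (-(Complex.I * r))‖ = 1 := by
  have : -(Complex.I * r) = ((-r : ℝ) : ℂ) * Complex.I := by push_cast; ring
  rw [this, Complex.norm_exp_ofReal_mul_I]

theorem IsShift.norm_eq {U : Set B} {χ : B → Euc n} (hχ : IsAffineEmbedding S.Ω S.μ U χ) {w : Euc n}
    {x y : TotalSpace ℂ L} (h : S.IsShift χ w x y) (hx : S.μ x.proj ∈ U) (hx0 : x.snd ≠ 0) :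
    ‖y.snd‖ = ‖x.snd‖ := by
  obtain ⟨G, hG⟩ := exists_gauge_at (S := S) (S.μ x.proj)
  obtain ⟨A, hA⟩ := affine_near hχ hx hG.1
  obtain ⟨α, θ, -, hα⟩ := G.exists_eq_tsmul_sec hG rfl hx0
  have h1 : ∀ φ, ‖(G.sec (G.c.x (S.μ x.proj), φ)).snd‖ = 1 := fun φ ↦ G.norm_E _ hG.2
  rw [h G _ hG A hA α θ hα, norm_tsmul, norm_mul, norm_exp_neg_I, h1, mul_one, mul_one]
  have h2 := congrArg (fun z : TotalSpace ℂ L ↦ ‖z.snd‖) hα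
  rw [norm_tsmul, h1, mul_one] at h2
  exact h2.symm

end Shift

/-! ### Uniqueness and translation invariance of parallel transport -/

section TransportUnique

variable [T2Space X] [VectorBundle ℂ ℂ L] [ContMDiffVectorBundle ∞ ℂ L (𝓡 (2 * n))]

variable {c b : B} {N : S.CommonNbhd c b}

theorem CommonNbhd.x_path (N : S.CommonNbhd c b) {t : ℝ} (ht : t ∈ Icc (0 : ℝ) 1) {c₀ : S.Chart}
    {A : Euc n ≃ᵃ[ℝ] Euc n} (hA : ∀ᶠ b' in 𝓝 (N.path t), N.χ b' = A (c₀.x b')) :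
    c₀.x (N.path t) = AffineMap.lineMap (A.symm (N.χ c)) (A.symm (N.χ b)) t := by
  have h1 := hA.self_of_nhds
  rw [(CommonNbhd.path_spec (N := N) ht).2] at h1
  have h2 : A.symm (AffineMap.lineMap (N.χ c) (N.χ b) t) =
      AffineMap.lineMap (A.symm (N.χ c)) (A.symm (N.χ b)) t := A.symm.toAffineMap.apply_lineMap _ _ _
  rw [← h2, h1, AffineEquiv.symm_apply_apply]

/-- The curve `x` in `L` is, near `t₀`, parallel over a horizontal lift of the path of `N`. -/
def IsLocalTransport (N : S.CommonNbhd c b) (x : ℝ → TotalSpace ℂ L) (t₀ : ℝ) : Prop :=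
  ∃ (G : S.Gauge) (A : Euc n ≃ᵃ[ℝ] Euc n) (ϑ : ℝ → Euc n) (κ : ℝ → ℂ), N.path t₀ ∈ G.dom ∧
    (∀ᶠ b' in 𝓝 (N.path t₀), N.χ b' = A (G.c.x b')) ∧ ContDiffWithinAt ℝ ∞ ϑ (Icc 0 1) t₀ ∧
    (∀ᶠ r in 𝓝[Icc 0 1] t₀, x r =
      tsmul (κ r) (G.sec (AffineMap.lineMap (A.symm (N.χ c)) (A.symm (N.χ b)) r, ϑ r))) ∧
    HasDerivWithinAt ϑ (G.slope (G.c.x (N.path t₀)) (A.symm (N.χ b) - A.symm (N.χ c)))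
      (Icc 0 1) t₀ ∧
    HasDerivWithinAt κ (Complex.I * (inner ℝ (G.c.x (N.path t₀)) (G.slope (G.c.x (N.path t₀))
        (A.symm (N.χ b) - A.symm (N.χ c))) : ℝ) * κ t₀) (Icc 0 1) t₀

theorem HasLogDeriv.congr {e e' : ℝ → TotalSpace ℂ L} {J : Set ℝ} {t : ℝ} {v : Euc (2 * n)} {ρ : ℂ}
    (h : HasLogDeriv S e J t v ρ) (ht : t ∈ J) (h1 : ∀ᶠ r in 𝓝[J] t, e' r = e r) :
    HasLogDeriv S e' J t v ρ := by
  have h0 := h1.self_of_nhdsWithin ht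
  intro s hs hs0
  rw [h0] at hs hs0 ⊢
  obtain ⟨a, a', h2, h3, h4⟩ := h s hs hs0
  exact ⟨a, a', by filter_upwards [h1, h2] with r e1 e2; rw [e1]; exact e2, h3, h4⟩

theorem IsLocalTransport.spec {x : ℝ → TotalSpace ℂ L} {t : ℝ} (ht : t ∈ Icc (0 : ℝ) 1)
    (h : IsLocalTransport N x t) :
    ContMDiffWithinAt 𝓘(ℝ, ℝ) (𝓡 (2 * n)) ∞ (fun r ↦ (x r).proj) (Icc 0 1) t ∧
      S.μ (x t).proj = N.path t ∧ velocity (n := n) (fun r ↦ (x r).proj) t ∈ S.H (x t).proj ∧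
      HasLogDeriv S x (Icc 0 1) t (velocity (n := n) (fun r ↦ (x r).proj) t) 0 := by
  obtain ⟨G, A, ϑ, κ, hG, hA, hϑ, hx, hϑ', hκ⟩ := h
  set η₀ := A.symm (N.χ c)
  set η₁ := A.symm (N.χ b)
  have hxp : G.c.x (N.path t) = AffineMap.lineMap η₀ η₁ t := N.x_path ht hA
  have hW : AffineMap.lineMap η₀ η₁ t ∈ G.W := by rw [← hxp]; exact hG.2
  have hline : ∀ r, HasDerivWithinAt (fun r : ℝ ↦ AffineMap.lineMap η₀ η₁ r) (η₁ - η₀)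
      (Icc 0 1) r := fun r ↦ (hasDerivAt_lineMap' η₀ η₁ r).hasDerivWithinAt
  rw [hxp] at hϑ' hκ
  have hzd := (hline t).prodMk hϑ'
  have hproj : ∀ᶠ r in 𝓝[Icc 0 1] t, (x r).proj = G.c.Ψ (AffineMap.lineMap η₀ η₁ r, ϑ r) :=
    hx.mono fun r hr ↦ by rw [hr]; rfl
  have hpt : (x t).proj = G.c.Ψ (AffineMap.lineMap η₀ η₁ t, ϑ t) := hproj.self_of_nhdsWithin ht
  have hvel := velocity_eq (z := fun r ↦ (AffineMap.lineMap η₀ η₁ r, ϑ r)) ht hzd (G.subset hW) hproj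
  refine ⟨?_, ?_, ?_, ?_⟩
  · have hl : ContDiff ℝ ∞ fun r : ℝ ↦ AffineMap.lineMap η₀ η₁ r := by
      simp only [AffineMap.lineMap_apply_module]
      fun_prop
    have h1 : ContMDiffWithinAt 𝓘(ℝ, ℝ) 𝓘(ℝ, Euc n × Euc n) ∞
        (fun r ↦ (AffineMap.lineMap η₀ η₁ r, ϑ r)) (Icc 0 1) t :=
      (hl.contDiffWithinAt.prodMk hϑ).contMDiffWithinAt
    have h2 : ContMDiffWithinAt 𝓘(ℝ, ℝ) (𝓡 (2 * n)) ∞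
        (fun r ↦ G.c.Ψ (AffineMap.lineMap η₀ η₁ r, ϑ r)) (Icc 0 1) t :=
      ContMDiffAt.comp_contMDiffWithinAt t (contMDiffAt_Ψ G.c
        (y := (AffineMap.lineMap η₀ η₁ t, ϑ t)) (G.subset hW)) h1
    exact h2.congr_of_eventuallyEq hproj hpt
  · rw [hpt, ← hxp]
    exact proj_pt hG.1 _
  · have h3 := (G.mem_H (AffineMap.lineMap η₀ η₁ t, ϑ t) hW
      (η₁ - η₀, G.slope (AffineMap.lineMap η₀ η₁ t) (η₁ - η₀))).2 rfl
    exact mem_H_congr hpt.symm hvel.symm h3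
  · have hlog := ((G.normal (AffineMap.lineMap η₀ η₁ t, ϑ t) hW).hasLogDeriv ht hzd).tsmul hκ
    rw [neg_add_cancel] at hlog
    have hvel' : (velocity (n := n) (fun r ↦ (x r).proj) t : Euc (2 * n)) = _ := hvel
    rw [hvel']
    exact hlog.congr ht hx

/-- Parallel transports are the curves that are locally parallel transports. -/
theorem exists_parallelTransport {x : ℝ → TotalSpace ℂ L}
    (h : ∀ t ∈ Icc (0 : ℝ) 1, IsLocalTransport N x t) (hn : ‖(x 0).snd‖ = 1)
    (M : Matrix (Fin n) (Fin n) ℝ) {q : X} (hq : (x 0).proj = q)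
    {v₀ : Fin n → TangentSpace (𝓡 (2 * n)) q} (hv : ∀ i, v₀ i = S.vform N.χ q (M i)) :
    ∃ T : ParallelTransport N q v₀, ∀ t, T.x t = x t := by
  subst hq
  refine ⟨{ ℓ := fun t ↦ (x t).proj
            smooth := fun t ht ↦ ((h t ht).spec ht).1
            proj := fun t ht ↦ ((h t ht).spec ht).2.1
            horizontal := fun t ht ↦ ((h t ht).spec ht).2.2.1
            start := rfl
            e := fun t ↦ (x t).snd
            norm_e := hn
            parallel_e := fun t ht s hs hs0 ↦
              parallel_of_hasLogDeriv ((h t ht).spec ht).2.2.2 s hs hs0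
            v := fun t i ↦ S.vform N.χ (x t).proj (M i)
            start_v := fun i ↦ by rw [hv]
            parallel_v := ⟨M, fun t ht i ↦ ?_⟩ }, fun t ↦ rfl⟩
  obtain ⟨-, h2, -, -⟩ := (h t ht).spec ht
  have hb := S.mem_chartAt (N.path t)
  obtain ⟨A, hA⟩ := affine_near N.affine (N.path_spec ht).1 hb
  obtain ⟨θ, hθ⟩ := exists_pt_eq hb h2
  dsimp only
  rw [← hθ]
  exact (dual_vector_iff hb hA θ (M i) _).2 (vform_eq hb hA θ (M i))

namespace ParallelTransport

variable {q q' : X} {v₀ : Fin n → TangentSpace (𝓡 (2 * n)) q}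
  {v₀' : Fin n → TangentSpace (𝓡 (2 * n)) q'}

/-- The coefficients of the transported frame. -/
def M (T : ParallelTransport N q v₀) : Matrix (Fin n) (Fin n) ℝ := T.parallel_v.choose

theorem v_eq (T : ParallelTransport N q v₀) {t : ℝ} (ht : t ∈ Icc (0 : ℝ) 1) (i : Fin n) :
    T.v t i = S.vform N.χ (T.ℓ t) (T.M i) := by
  have hb := S.mem_chartAt (N.path t)
  obtain ⟨A, hA⟩ := affine_near N.affine (N.path_spec ht).1 hb
  obtain ⟨θ, hθ⟩ := exists_pt_eq hb (T.proj t ht)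
  have h1 := T.parallel_v.choose_spec t ht i
  generalize T.v t i = V at *
  generalize T.ℓ t = p at *
  subst hθ
  exact ((dual_vector_iff hb hA θ _ V).1 h1).trans (vform_eq hb hA θ (T.M i)).symm

theorem frame_coeff {c₀ : S.Chart} (hc : c ∈ c₀.V) {A : Euc n ≃ᵃ[ℝ] Euc n}
    (hA : ∀ᶠ b' in 𝓝 c, N.χ b' = A (c₀.x b')) {θ : Euc n}
    (T : ParallelTransport N (c₀.pt c θ) (c₀.frame c θ)) (i : Fin n) :
    adj A (WithLp.toLp 2 (T.M i)) = EuclideanSpace.single i 1 := by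
  refine vert_injective hc θ ?_
  have h1 := T.start_v i
  rw [T.v_eq (left_mem_Icc.2 zero_le_one)] at h1
  have h2 := eq_of_heq ((TotalSpace.mk.injEq _ _ _ _).mp h1).2
  change (c₀.vert c θ (adj A (WithLp.toLp 2 (T.M i))) : Euc (2 * n)) = c₀.frame c θ i
  rw [← h2, T.start, ← vform_eq hc hA θ]

/-- Parallel transport by a unitary connection preserves the norm. -/
theorem norm_eq (T : ParallelTransport N q v₀) {t : ℝ} (ht : t ∈ Icc (0 : ℝ) 1) :
    ‖(T.x t).snd‖ = 1 := by
  have hd : ∀ t ∈ Icc (0 : ℝ) 1, HasDerivWithinAt (fun r ↦ ‖(T.x r).snd‖ ^ 2) 0 (Icc 0 1) t := by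
    intro t ht
    obtain ⟨G, hG⟩ := exists_gauge_at (S := S) (N.path t)
    obtain ⟨A, hA⟩ := affine_near N.affine (N.path_spec ht).1 hG.1
    obtain ⟨θ, hθ⟩ := exists_pt_eq hG.1 (T.proj t ht)
    obtain ⟨ϑ, κ, -, -, h1, h2⟩ := T.exists_local ht hG hA hθ
    have h3 := h2.norm_sq
    have h4 : ∀ᶠ r in 𝓝[Icc 0 1] t, ‖(T.x r).snd‖ ^ 2 = ‖κ r‖ ^ 2 := by
      filter_upwards [h1] with r hr
      have h5 : ‖(G.sec (AffineMap.lineMap (A.symm (N.χ c)) (A.symm (N.χ b)) r, ϑ r)).snd‖ = 1 :=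
        G.norm_E _ (by rw [← hr.2.2.1]; exact hr.1.2)
      rw [hr.2.2.2.2.1, norm_tsmul, h5, mul_one]
    refine (h3.congr_of_eventuallyEq h4 (h4.self_of_nhdsWithin ht)).congr_deriv ?_
    rw [Complex.inner]
    simp [mul_comm, mul_left_comm]
  have h1 := constant_of_derivWithin_zero (f := fun r ↦ ‖(T.x r).snd‖ ^ 2) (a := 0) (b := 1)
    (fun t ht ↦ (hd t ht).differentiableWithinAt) (fun t ht ↦ (hd t (Ico_subset_Icc_self ht)).derivWithin
      (uniqueDiffOn_Icc zero_lt_one t (Ico_subset_Icc_self ht))) t ht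
  have h2 : ‖(T.x 0).snd‖ = 1 := T.norm_e
  rw [h2, one_pow] at h1
  exact (pow_eq_one_iff_of_nonneg (norm_nonneg _) two_ne_zero).1 h1

theorem x_ne_zero (T : ParallelTransport N q v₀) {t : ℝ} (ht : t ∈ Icc (0 : ℝ) 1) :
    (T.x t).snd ≠ 0 := by
  rw [← norm_ne_zero_iff, T.norm_eq ht]; exact one_ne_zero

/-- A horizontal lift is determined by one of its points. -/
theorem ℓ_eq (T : ParallelTransport N q v₀) (T' : ParallelTransport N q' v₀') {a : ℝ}
    (ha : a ∈ Icc (0 : ℝ) 1) (h : T.ℓ a = T'.ℓ a) {t : ℝ} (ht : t ∈ Icc (0 : ℝ) 1) :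
    T.ℓ t = T'.ℓ t := by
  refine IsPreconnected.of_locally_iff isPreconnected_Icc (P := fun t ↦ T.ℓ t = T'.ℓ t)
    (fun t₀ ht₀ ↦ ?_) ha ht h
  by_cases h0 : T.ℓ t₀ = T'.ℓ t₀
  · obtain ⟨G, hG⟩ := exists_gauge_at (S := S) (N.path t₀)
    obtain ⟨A, hA⟩ := affine_near N.affine (N.path_spec ht₀).1 hG.1
    obtain ⟨θ, hθ⟩ := exists_pt_eq hG.1 (T.proj t₀ ht₀)
    obtain ⟨ϑ, κ, h1, -, h2, -⟩ := T.exists_local ht₀ hG hA hθ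
    obtain ⟨ϑ', κ', h1', -, h2', -⟩ := T'.exists_local ht₀ hG hA (hθ.trans h0)
    obtain ⟨ε, hε, hsub⟩ := Metric.mem_nhdsWithin_iff.1 (h2.and h2')
    have hJ : Convex ℝ (Metric.ball t₀ ε ∩ Icc 0 1) := (convex_ball t₀ ε).inter (convex_Icc 0 1)
    have ht₀J : t₀ ∈ Metric.ball t₀ ε ∩ Icc 0 1 := ⟨Metric.mem_ball_self hε, ht₀⟩
    refine Metric.mem_nhdsWithin_iff.2 ⟨ε, hε, fun r hr ↦ ?_⟩
    have h3 := hJ.norm_image_sub_le_of_norm_hasDerivWithin_le (f := fun r ↦ ϑ r - ϑ' r)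
      (f' := fun _ ↦ 0) (C := 0) (fun r hr ↦ by
        have h4 := ((hsub hr).1.2.2.2.2.2.sub (hsub hr).2.2.2.2.2.2).mono
          (inter_subset_right (s := Metric.ball t₀ ε))
        rw [sub_self] at h4
        exact h4) (fun _ _ ↦ by simp) ht₀J hr
    rw [h1, h1', sub_self, sub_zero, zero_mul, norm_le_zero_iff, sub_eq_zero] at h3
    have h5 : T.ℓ r = T'.ℓ r := by rw [(hsub hr).1.2.2.2.1, (hsub hr).2.2.2.2.1, h3]
    exact iff_of_true h5 h0
  · have h1 := (T.smooth t₀ ht₀).continuousWithinAt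
    have h2 := (T'.smooth t₀ ht₀).continuousWithinAt
    filter_upwards [(h1.prodMk h2).eventually (isClosed_diagonal.isOpen_compl.mem_nhds h0)]
      with r hr
    exact iff_of_false hr h0

/-- Two parallel transports with a common point of their lifts differ by a constant phase. -/
theorem x_eq (T : ParallelTransport N q v₀) (T' : ParallelTransport N q' v₀') {a : ℝ}
    (ha : a ∈ Icc (0 : ℝ) 1) (h : T.ℓ a = T'.ℓ a) :
    ∃ k : ℂ, ‖k‖ = 1 ∧ ∀ t ∈ Icc (0 : ℝ) 1, T'.x t = tsmul k (T.x t) := by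
  have hℓ : ∀ t ∈ Icc (0 : ℝ) 1, T'.ℓ t = T.ℓ t := fun t ht ↦ (T.ℓ_eq T' ha h ht).symm
  have hvel : ∀ t ∈ Icc (0 : ℝ) 1,
      (velocity (n := n) T'.ℓ t : Euc (2 * n)) = velocity (n := n) T.ℓ t := fun t ht ↦
    congrArg (fun A : ℝ →L[ℝ] Euc (2 * n) ↦ A 1) (mfderivWithin_congr hℓ (hℓ t ht))
  obtain ⟨k, hk⟩ := HasLogDeriv.exists_eq_exp (S := S) (e := T.x) (e' := T'.x) (convex_Icc 0 1)
    (v := fun t ↦ velocity (n := n) T.ℓ t) (ρ := fun _ ↦ 0) (ρ' := fun _ ↦ 0) (g := fun _ ↦ 0)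
    (fun t ht ↦ hasLogDeriv_of_parallel (T.parallel_e t ht))
    (fun t ht ↦ by
      have := hasLogDeriv_of_parallel (T'.parallel_e t ht)
      rw [hvel t ht] at this
      exact this)
    hℓ (fun t ht ↦ T.x_ne_zero ht) (fun t _ ↦ by simpa using hasDerivWithinAt_const (c := (0 : ℂ)) ..)
  simp only [Complex.exp_zero, mul_one] at hk
  refine ⟨k, ?_, hk⟩
  have h1 := T'.norm_eq ha
  rw [hk a ha, norm_tsmul, T.norm_eq ha, mul_one] at h1
  exact h1

/-- The translates of a parallel transport are parallel transports. -/
theorem exists_shift (T : ParallelTransport N q v₀) (w : Euc n) {q' : X}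
    (hq : ∀ y, S.IsShift N.χ w (T.x 0) y → y.proj = q') {v₀' : Fin n → TangentSpace (𝓡 (2 * n)) q'}
    (hv : ∀ i, v₀' i = S.vform N.χ q' (T.M i)) :
    ∃ T' : ParallelTransport N q' v₀', ∀ t ∈ Icc (0 : ℝ) 1, S.IsShift N.χ w (T.x t) (T'.x t) := by
  have hU : ∀ t ∈ Icc (0 : ℝ) 1, S.μ (T.x t).proj ∈ N.U := fun t ht ↦ by
    have h1 : S.μ (T.x t).proj = N.path t := T.proj t ht
    rw [h1]; exact (N.path_spec ht).1
  have hex : ∀ t : ℝ, ∃ y, t ∈ Icc (0 : ℝ) 1 → S.IsShift N.χ w (T.x t) y := fun t ↦ by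
    by_cases ht : t ∈ Icc (0 : ℝ) 1
    · obtain ⟨y, hy⟩ := exists_isShift N.affine w (T.x t) (hU t ht) (T.x_ne_zero ht)
      exact ⟨y, fun _ ↦ hy⟩
    · exact ⟨T.x t, fun h ↦ absurd h ht⟩
  choose y hy using hex
  have h0 : (0 : ℝ) ∈ Icc (0 : ℝ) 1 := left_mem_Icc.2 zero_le_one
  suffices hloc : ∀ t ∈ Icc (0 : ℝ) 1, IsLocalTransport N y t by
    obtain ⟨T', hT'⟩ := exists_parallelTransport (N := N) (x := y) hloc
      (by rw [(hy 0 h0).norm_eq N.affine (hU 0 h0) (T.x_ne_zero h0), T.norm_eq h0]) T.M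
      (hq _ (hy 0 h0)) hv
    exact ⟨T', fun t ht ↦ by rw [hT']; exact hy t ht⟩
  · intro t ht
    obtain ⟨G, hG⟩ := exists_gauge_at (S := S) (N.path t)
    obtain ⟨A, hA⟩ := affine_near N.affine (N.path_spec ht).1 hG.1
    obtain ⟨θ, hθ⟩ := exists_pt_eq hG.1 (T.proj t ht)
    obtain ⟨ϑ, κ, -, h1, h2, h3⟩ := T.exists_local ht hG hA hθ
    refine ⟨G, A, fun r ↦ ϑ r + adj A w,
      fun r ↦ κ r * Complex.exp (-(Complex.I * (inner ℝ (A 0) w : ℝ))), hG, hA,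
      h1.add contDiffWithinAt_const, ?_, ?_, ?_⟩
    · filter_upwards [h2, self_mem_nhdsWithin] with r hr hrI
      have h4 := hr.2.2.2.2.1
      rw [← hr.2.2.1] at h4 ⊢
      exact hy r hrI G _ hr.1 A hr.2.1 _ _ h4
    · exact (h2.self_of_nhdsWithin ht).2.2.2.2.2.add_const _
    · exact (h3.mul_const _).congr_deriv (by ring)

end ParallelTransport

end TransportUnique

/-! ### Integrals of periodic functions over the cube -/

section Box

open MeasureTheory
open scoped Pointwise

theorem abs_det_eq_one {n : ℕ} (R : Euc n ≃L[ℝ] Euc n) (h : ∀ m : Fin n → ℤ, ∃ m', R (latt m) = latt m')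
    (h' : ∀ m : Fin n → ℤ, ∃ m', R.symm (latt m) = latt m') :
    |LinearMap.det (R.toLinearEquiv.toLinearMap)| = 1 := by
  obtain ⟨P, hP, hP'⟩ := exists_intMatrix R h h'
  let e := (EuclideanSpace.basisFun (Fin n) ℝ).toBasis
  rw [← LinearMap.det_toMatrix e, ← hP, ← Matrix.det_transpose]
  congr 2
  ext i j
  have h1 := congrArg (fun v : Euc n ↦ v i) (hP' i)
  simp only [Matrix.transpose_apply, LinearMap.toMatrix_apply]
  have h2 : R (EuclideanSpace.single i 1) j = P i j := by
    rw [hP']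
    simp [WithLp.ofLp_sum, Finset.sum_apply, Pi.single_apply]
  rw [← h2]
  simp [e]

/-- The standard basis of the lattice `(2πℤ)ⁿ`. -/
def lattBasis (n : ℕ) : Module.Basis (Fin n) ℝ (Euc n) :=
  (EuclideanSpace.basisFun (Fin n) ℝ).toBasis.unitsSMul fun _ ↦ Units.mk0 _ Real.two_pi_pos.ne'

theorem lattBasis_apply {n : ℕ} (i : Fin n) : lattBasis n i = latt (Pi.single i (1 : ℤ)) := by
  ext j
  simp [lattBasis, Module.Basis.unitsSMul_apply, latt_apply, Pi.single_apply, Units.smul_def]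

theorem mem_span_lattBasis {n : ℕ} {x : Euc n} :
    x ∈ Submodule.span ℤ (Set.range (lattBasis n)) ↔ ∃ m, x = latt m := by
  rw [Submodule.mem_span_range_iff_exists_fun]
  refine exists_congr fun m ↦ ?_
  simp only [lattBasis_apply, ← latt_eq_sum]
  exact eq_comm

theorem fundamentalDomain_ae_eq_box (n : ℕ) :
    ZSpan.fundamentalDomain (lattBasis n) =ᵐ[volume] box n := by
  have h1 : ZSpan.fundamentalDomain (lattBasis n) = (WithLp.ofLp : Euc n → Fin n → ℝ) ⁻¹'
      (Set.pi univ fun _ ↦ Ico 0 (2 * Real.pi)) := by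
    ext θ
    have : ∀ i, (lattBasis n).repr θ i = (2 * Real.pi)⁻¹ * θ i := fun i ↦ by
      simp [lattBasis, Module.Basis.repr_unitsSMul, Units.smul_def]
    simp only [ZSpan.mem_fundamentalDomain, this, mem_preimage, mem_univ_pi, mem_Ico]
    refine forall_congr' fun i ↦ and_congr ?_ ?_
    · rw [mul_nonneg_iff_of_pos_left (inv_pos.2 Real.two_pi_pos)]
    · rw [inv_mul_lt_iff₀ Real.two_pi_pos, mul_one]
  have h2 : box n = (WithLp.ofLp : Euc n → Fin n → ℝ) ⁻¹'
      (Icc (fun _ ↦ 0) (fun _ ↦ 2 * Real.pi)) := by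
    ext θ; simp [box, Pi.le_def, forall_and]
  rw [h1, h2]
  exact (PiLp.volume_preserving_ofLp (Fin n)).quasiMeasurePreserving.preimage_ae_eq
    Measure.univ_pi_Ico_ae_eq_Icc

/-- The integral over the torus is invariant under affine automorphisms of the torus. -/
theorem setIntegral_box_comp {n : ℕ} (R : Euc n ≃L[ℝ] Euc n)
    (h : ∀ m : Fin n → ℤ, ∃ m', R (latt m) = latt m')
    (h' : ∀ m : Fin n → ℤ, ∃ m', R.symm (latt m) = latt m') (v : Euc n) {F : Euc n → ℂ}
    (hF : ∀ θ m, F (θ + latt m) = F θ) :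
    ∫ θ in box n, F (v + R θ) = ∫ θ in box n, F θ := by
  rw [← setIntegral_congr_set (fundamentalDomain_ae_eq_box n),
    ← setIntegral_congr_set (fundamentalDomain_ae_eq_box n)]
  have hR : MeasurePreserving R volume volume := by
    refine ⟨R.continuous.measurable, ?_⟩
    have h1 := Measure.map_linearMap_addHaar_eq_smul_addHaar (μ := (volume : Measure (Euc n)))
      (f := R.toLinearEquiv.toLinearMap) (LinearEquiv.isUnit_det' _).ne_zero
    rw [abs_inv, abs_det_eq_one R h h', inv_one, ENNReal.ofReal_one, one_smul] at h1
    exact h1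
  have hspan : Submodule.span ℤ (Set.range ((lattBasis n).map R.toLinearEquiv)) =
      Submodule.span ℤ (Set.range (lattBasis n)) := by
    have h1 : Set.range ((lattBasis n).map R.toLinearEquiv) =
        (R.toLinearEquiv.toLinearMap.restrictScalars ℤ) '' Set.range (lattBasis n) := by
      rw [← Set.range_comp]; rfl
    rw [h1, ← Submodule.map_span]
    ext x
    simp only [Submodule.mem_map, mem_span_lattBasis]
    constructor
    · rintro ⟨-, ⟨m, rfl⟩, rfl⟩
      exact h m
    · rintro ⟨m, rfl⟩
      obtain ⟨m', hm'⟩ := h' m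
      exact ⟨_, ⟨m', rfl⟩, by rw [← hm']; exact R.apply_symm_apply _⟩
  have hfd := ZSpan.isAddFundamentalDomain ((lattBasis n).map R.toLinearEquiv) volume
  rw [hspan, ← ZSpan.map_fundamentalDomain] at hfd
  have hfd' := hfd.vadd_of_comm v
  have h0 := ZSpan.isAddFundamentalDomain (lattBasis n) volume
  have h1 : ∫ θ in ZSpan.fundamentalDomain (lattBasis n), F (v + R θ) =
      ∫ y in R '' ZSpan.fundamentalDomain (lattBasis n), F (v + y) :=
    (hR.setIntegral_image_emb R.toHomeomorph.measurableEmbedding (fun y ↦ F (v + y)) _).symm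
  have h2 : ∫ y in R '' ZSpan.fundamentalDomain (lattBasis n), F (v + y) =
      ∫ y in v +ᵥ (R '' ZSpan.fundamentalDomain (lattBasis n)), F y :=
    ((measurePreserving_vadd v volume).setIntegral_image_emb (measurableEmbedding_const_vadd v) F _).symm
  rw [h1, h2]
  haveI : VAddInvariantMeasure (Submodule.span ℤ (Set.range (lattBasis n))) (Euc n) volume :=
    inferInstanceAs (VAddInvariantMeasure
      (Submodule.span ℤ (Set.range (lattBasis n))).toAddSubgroup (Euc n) volume)
  refine hfd'.setIntegral_eq h0 fun g θ ↦ ?_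
  obtain ⟨m, hm⟩ := mem_span_lattBasis.1 g.2
  change F (g.1 + θ) = F θ
  rw [hm, add_comm, hF]

end Box

/-! ### Integration of the transport pairing over a fibre -/

section MatrixCoeff

variable [T2Space X] [VectorBundle ℂ ℂ L] [ContMDiffVectorBundle ∞ ℂ L (𝓡 (2 * n))]

namespace ParallelTransport

variable {c b : B} {N : S.CommonNbhd c b} {q q' : X} {v₀ : Fin n → TangentSpace (𝓡 (2 * n)) q}
  {v₀' : Fin n → TangentSpace (𝓡 (2 * n)) q'} {k : ℕ}

theorem ev_eq (T : ParallelTransport N q v₀) {t : ℝ} (ht : t ∈ Icc (0 : ℝ) 1) {b' : B}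
    (τ : S.FiberSpace k b') : τ.1 (T.ℓ t) (T.e t) (T.v t) = ev τ N.χ T.M (T.x t) := by
  have h : T.v t = fun i ↦ S.vform N.χ (T.ℓ t) (T.M i) := funext fun i ↦ T.v_eq ht i
  rw [h]; rfl

/-- The product of the values of two half-forms at the ends of a parallel transport. -/
def ends (T : ParallelTransport N q v₀) (M : Matrix (Fin n) (Fin n) ℝ) (ψ : S.FiberSpace k b)
    (ξ : S.FiberSpace k c) : ℂ :=
  starRingEnd ℂ (ev ψ N.χ M (T.x 1)) * ev ξ N.χ M (T.x 0)

theorem ends_eq (T : ParallelTransport N q v₀) (T' : ParallelTransport N q' v₀') {a : ℝ}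
    (ha : a ∈ Icc (0 : ℝ) 1) (h : T.ℓ a = T'.ℓ a) (M : Matrix (Fin n) (Fin n) ℝ)
    (ψ : S.FiberSpace k b) (ξ : S.FiberSpace k c) : T'.ends M ψ ξ = T.ends M ψ ξ := by
  obtain ⟨κ, hκ, h1⟩ := T.x_eq T' ha h
  have hκ0 : κ ≠ 0 := norm_ne_zero_iff.1 (by rw [hκ]; exact one_ne_zero)
  rw [ends, ends, h1 1 (right_mem_Icc.2 zero_le_one), h1 0 (left_mem_Icc.2 zero_le_one),
    ev_tsmul _ _ _ _ hκ0, ev_tsmul _ _ _ _ hκ0, map_mul]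
  have h2 : starRingEnd ℂ (κ ^ k)⁻¹ * (κ ^ k)⁻¹ = 1 := by
    rw [Complex.conj_mul', norm_inv, norm_pow, hκ]
    simp
  calc _ = (starRingEnd ℂ (κ ^ k)⁻¹ * (κ ^ k)⁻¹) * (starRingEnd ℂ (ev ψ N.χ M (T.x 1)) *
      ev ξ N.χ M (T.x 0)) := by ring
    _ = _ := by rw [h2, one_mul]

theorem M_eq {c₀ : S.Chart} (hc : c ∈ c₀.V) {θ θ' : Euc n}
    (T : ParallelTransport N (c₀.pt c θ) (c₀.frame c θ))
    (T' : ParallelTransport N (c₀.pt c θ') (c₀.frame c θ')) : T'.M = T.M := by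
  obtain ⟨A, hA⟩ := affine_near N.affine N.left_mem hc
  funext i
  have h := (adj A).injective ((T'.frame_coeff hc hA i).trans (T.frame_coeff hc hA i).symm)
  exact congrArg (WithLp.ofLp) h

theorem transportPairing_eq {c₀ : S.Chart} (hc : c ∈ c₀.V) {θ : Euc n}
    (T : ParallelTransport N (c₀.pt c θ) (c₀.frame c θ)) (f : X → ℂ) (ψ : S.FiberSpace k b)
    (ξ : S.FiberSpace k c) :
    transportPairing f N ψ ξ (c₀.pt c θ) (c₀.frame c θ) = T.ends T.M ψ ξ * f (T.ℓ (1 / 2)) := by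
  have hne : Nonempty (ParallelTransport N (c₀.pt c θ) (c₀.frame c θ)) := ⟨T⟩
  have h0 : (0 : ℝ) ∈ Icc (0 : ℝ) 1 := left_mem_Icc.2 zero_le_one
  have hst : T.ℓ 0 = (Classical.choice hne).ℓ 0 := T.start.trans (Classical.choice hne).start.symm
  rw [transportPairing, dif_pos hne]
  dsimp only
  rw [ev_eq _ (right_mem_Icc.2 zero_le_one), ev_eq _ h0, ← T.ends_eq (Classical.choice hne) h0 hst,
    T.ℓ_eq (Classical.choice hne) h0 hst (t := 1 / 2) (by norm_num [mem_Icc]),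
    T.M_eq hc (Classical.choice hne), ends]
  ring

/-- A translate of a parallel transport, in coordinates. -/
theorem exists_shift' (T : ParallelTransport N q v₀) (w : Euc n) :
    ∃ (q' : X) (v₀' : Fin n → TangentSpace (𝓡 (2 * n)) q') (T' : ParallelTransport N q' v₀'),
      ∀ t ∈ Icc (0 : ℝ) 1, S.IsShift N.χ w (T.x t) (T'.x t) := by
  have h0 : (0 : ℝ) ∈ Icc (0 : ℝ) 1 := left_mem_Icc.2 zero_le_one
  have hU : S.μ (T.x 0).proj ∈ N.U := by
    have h1 : S.μ (T.x 0).proj = N.path 0 := T.proj 0 h0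
    rw [h1]; exact (N.path_spec h0).1
  obtain ⟨y, hy⟩ := exists_isShift N.affine w (T.x 0) hU (T.x_ne_zero h0)
  obtain ⟨G, hG⟩ := exists_gauge_at (S := S) (N.path 0)
  obtain ⟨A, hA⟩ := affine_near N.affine (N.path_spec h0).1 hG.1
  obtain ⟨θ, hθ⟩ := exists_pt_eq hG.1 (T.proj 0 h0)
  obtain ⟨T', hT'⟩ := T.exists_shift w (q' := G.c.pt (N.path 0) (θ + adj A w))
    (v₀' := fun i ↦ S.vform N.χ _ (T.M i))
    (fun y hy ↦ hy.proj_eq N.affine (N.path_spec h0).1 hG.1 hA (T.x_ne_zero h0) hθ.symm)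
    (fun i ↦ rfl)
  exact ⟨_, _, T', hT'⟩

theorem shift_ℓ {T : ParallelTransport N q v₀} {T' : ParallelTransport N q' v₀'} {w : Euc n}
    {t : ℝ} (ht : t ∈ Icc (0 : ℝ) 1) (h : S.IsShift N.χ w (T.x t) (T'.x t)) {c₁ : S.Chart}
    (hc : N.path t ∈ c₁.V) {A : Euc n ≃ᵃ[ℝ] Euc n}
    (hA : ∀ᶠ b' in 𝓝 (N.path t), N.χ b' = A (c₁.x b')) {θ : Euc n}
    (hθ : c₁.pt (N.path t) θ = T.ℓ t) : T'.ℓ t = c₁.pt (N.path t) (θ + adj A w) :=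
  h.proj_eq N.affine (N.path_spec ht).1 hc hA (T.x_ne_zero ht) hθ.symm

theorem ends_shift {T : ParallelTransport N q v₀} {T' : ParallelTransport N q' v₀'} {w : Euc n}
    (h : ∀ t ∈ Icc (0 : ℝ) 1, S.IsShift N.χ w (T.x t) (T'.x t)) (M : Matrix (Fin n) (Fin n) ℝ)
    (ψ : S.FiberSpace k b) (ξ : S.FiberSpace k c) :
    T'.ends M ψ ξ =
      Complex.exp (-(Complex.I * k * (inner ℝ (N.χ b - N.χ c) w : ℝ))) * T.ends M ψ ξ := by
  have h0 : (0 : ℝ) ∈ Icc (0 : ℝ) 1 := left_mem_Icc.2 zero_le_one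
  have h1 : (1 : ℝ) ∈ Icc (0 : ℝ) 1 := right_mem_Icc.2 zero_le_one
  have e0 : S.μ (T.x 0).proj = c := (T.proj 0 h0).trans N.path_zero
  have e1 : S.μ (T.x 1).proj = b := (T.proj 1 h1).trans N.path_one
  rw [ends, ends, ev_shift ψ N.affine N.right_mem M e1 (T.x_ne_zero h1) (h 1 h1),
    ev_shift ξ N.affine N.left_mem M e0 (T.x_ne_zero h0) (h 0 h0), map_mul, ← Complex.exp_conj]
  have h3 : Complex.exp (-(Complex.I * k * (inner ℝ (N.χ b - N.χ c) w : ℝ))) =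
      Complex.exp ((starRingEnd ℂ) (Complex.I * k * (inner ℝ (N.χ b) w : ℝ))) *
      Complex.exp (Complex.I * k * (inner ℝ (N.χ c) w : ℝ)) := by
    rw [← Complex.exp_add, inner_sub_left]
    congr 1
    simp only [map_mul, Complex.conj_I, Complex.conj_ofReal, Complex.conj_natCast]
    push_cast
    ring
  rw [h3]
  ring

/-- The holonomy of parallel transport preserves the period lattices of the fibres. -/
theorem apply_latt (T : ParallelTransport N q v₀) {s t : ℝ} (hs : s ∈ Icc (0 : ℝ) 1)
    (ht : t ∈ Icc (0 : ℝ) 1) {c₁ c₂ : S.Chart} (hc₁ : N.path s ∈ c₁.V) (hc₂ : N.path t ∈ c₂.V)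
    {A₁ A₂ : Euc n ≃ᵃ[ℝ] Euc n} (hA₁ : ∀ᶠ b' in 𝓝 (N.path s), N.χ b' = A₁ (c₁.x b'))
    (hA₂ : ∀ᶠ b' in 𝓝 (N.path t), N.χ b' = A₂ (c₂.x b')) (m : Fin n → ℤ) :
    (∃ m', adj A₂ ((adj A₁).symm (latt m)) = latt m') ∧
      ∀ (M : Matrix (Fin n) (Fin n) ℝ) (ψ : S.FiberSpace k b) (ξ : S.FiberSpace k c),
        Complex.exp (-(Complex.I * k * (inner ℝ (N.χ b - N.χ c) ((adj A₁).symm (latt m)) : ℝ))) *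
          T.ends M ψ ξ = T.ends M ψ ξ := by
  obtain ⟨q', v₀', T', hT'⟩ := T.exists_shift' ((adj A₁).symm (latt m))
  obtain ⟨θ₁, hθ₁⟩ := exists_pt_eq hc₁ (T.proj s hs)
  obtain ⟨θ₂, hθ₂⟩ := exists_pt_eq hc₂ (T.proj t ht)
  have h1 := shift_ℓ hs (hT' s hs) hc₁ hA₁ hθ₁
  rw [ContinuousLinearEquiv.apply_symm_apply, pt_add_latt hc₁, hθ₁] at h1
  have h2 := shift_ℓ ht (hT' t ht) hc₂ hA₂ hθ₂
  rw [← T.ℓ_eq T' hs h1.symm ht, ← hθ₂] at h2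
  obtain ⟨m', hm'⟩ := exists_latt hc₂ h2.symm
  refine ⟨⟨m', by simpa using hm'⟩, fun M ψ ξ ↦ ?_⟩
  rw [← ends_shift hT', T.ends_eq T' hs h1.symm]

/-- The transported frames are lattice bases. -/
theorem abs_det_coeff {c₀ : S.Chart} (hc : c ∈ c₀.V) {θ : Euc n}
    (T : ParallelTransport N (c₀.pt c θ) (c₀.frame c θ)) {t : ℝ} (ht : t ∈ Icc (0 : ℝ) 1)
    {c₁ : S.Chart} (hc₁ : N.path t ∈ c₁.V) {A : Euc n ≃ᵃ[ℝ] Euc n}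
    (hA : ∀ᶠ b' in 𝓝 (N.path t), N.χ b' = A (c₁.x b')) :
    |(Matrix.of fun i j ↦ adj A (WithLp.toLp 2 (T.M i)) j).det| = 1 := by
  obtain ⟨A₀, hA₀⟩ := affine_near N.affine N.left_mem hc
  have h0 : (0 : ℝ) ∈ Icc (0 : ℝ) 1 := left_mem_Icc.2 zero_le_one
  have hc' : N.path 0 ∈ c₀.V := by rw [N.path_zero]; exact hc
  have hA₀' : ∀ᶠ b' in 𝓝 (N.path 0), N.χ b' = A₀ (c₀.x b') := by rw [N.path_zero]; exact hA₀
  obtain ⟨P, hP, hP'⟩ := exists_intMatrix ((adj A₀).symm.trans (adj A))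
    (fun m ↦ (T.apply_latt (k := 0) h0 ht hc' hc₁ hA₀' hA m).1)
    (fun m ↦ (T.apply_latt (k := 0) ht h0 hc₁ hc' hA hA₀' m).1)
  rw [← hP]
  congr 2
  ext i j
  have h1 : adj A (WithLp.toLp 2 (T.M i)) = ∑ j, P i j • EuclideanSpace.single j (1 : ℝ) := by
    rw [← hP', ← T.frame_coeff hc hA₀ i, ContinuousLinearEquiv.trans_apply,
      ContinuousLinearEquiv.symm_apply_apply]
  rw [Matrix.of_apply, h1]
  simp [WithLp.ofLp_sum, Finset.sum_apply, Pi.single_apply]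

theorem norm_ev {c₀ : S.Chart} (hc : c ∈ c₀.V) {θ : Euc n}
    (T : ParallelTransport N (c₀.pt c θ) (c₀.frame c θ)) {t : ℝ} (ht : t ∈ Icc (0 : ℝ) 1) {b' : B}
    (hb' : N.path t = b') (τ : S.FiberSpace k b') :
    (2 * Real.pi) ^ n * ‖ev τ N.χ T.M (T.x t)‖ ^ 2 = ‖τ‖ ^ 2 := by
  subst hb'
  obtain ⟨G, hG⟩ := exists_gauge_at (S := S) (N.path t)
  obtain ⟨A, hA⟩ := affine_near N.affine (N.path_spec ht).1 hG.1
  obtain ⟨α, φ, hα0, hα⟩ := G.exists_eq_tsmul_sec hG (T.proj t ht) (T.x_ne_zero ht)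
  have h1 : ‖α‖ = 1 := by
    have h2 := T.norm_eq ht
    rw [hα, norm_tsmul] at h2
    have h3 : ‖(G.sec (G.c.x (N.path t), φ)).snd‖ = 1 := G.norm_E _ hG.2
    rwa [h3, mul_one] at h2
  have h4 : ∀ r : ℝ, ‖Complex.exp (Complex.I * k * r)‖ = 1 := fun r ↦ by
    have : Complex.I * k * r = ((k * r : ℝ) : ℂ) * Complex.I := by push_cast; ring
    rw [this, Complex.norm_exp_ofReal_mul_I]
  rw [G.norm_sq hG, hα, ev_tsmul _ _ _ _ hα0, ev_sec _ hG hA, T.abs_det_coeff hc ht hG.1 hA]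
  simp only [norm_mul, norm_inv, norm_pow, h1, h4, Real.sqrt_one, Complex.ofReal_one, norm_one,
    one_pow, inv_one, one_mul]

/-- Parallel transport is isometric for half-forms, so the pairing of the transported half-forms has
the same absolute value at all points of the fibre. -/
theorem norm_ends {c₀ : S.Chart} (hc : c ∈ c₀.V) {θ : Euc n}
    (T : ParallelTransport N (c₀.pt c θ) (c₀.frame c θ)) (ψ : S.FiberSpace k b)
    (ξ : S.FiberSpace k c) : (2 * Real.pi) ^ n * ‖T.ends T.M ψ ξ‖ = ‖ψ‖ * ‖ξ‖ := by
  have h1 := T.norm_ev hc (right_mem_Icc.2 zero_le_one) N.path_one ψ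
  have h2 := T.norm_ev hc (left_mem_Icc.2 zero_le_one) N.path_zero ξ
  have hpi : (0 : ℝ) ≤ (2 * Real.pi) ^ n := by positivity
  refine (pow_left_inj₀ (by positivity) (by positivity) two_ne_zero).1 ?_
  rw [mul_pow (‖ψ‖), ← h1, ← h2, ends, norm_mul, RCLike.norm_conj]
  ring

/-- The matrix coefficients are Fourier coefficients of the restriction of `f` to the fibre over the
midpoint, up to a factor that does not depend on `f`. -/
theorem integral_transportPairing {c₀ : S.Chart} (hc : c ∈ c₀.V) {θ₀ : Euc n}
    (T : ParallelTransport N (c₀.pt c θ₀) (c₀.frame c θ₀)) {c₁ : S.Chart}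
    (hm : N.path (1 / 2) ∈ c₁.V) {A : Euc n ≃ᵃ[ℝ] Euc n}
    (hA : ∀ᶠ b' in 𝓝 (N.path (1 / 2)), N.χ b' = A (c₁.x b')) {θ : Euc n}
    (hθ : c₁.pt (N.path (1 / 2)) θ = T.ℓ (1 / 2)) (f : X → ℂ) (ψ : S.FiberSpace k b)
    (ξ : S.FiberSpace k c) :
    (T.ends T.M ψ ξ ≠ 0 → ∃ p : Fin n → ℤ, ∀ i, k * (A.symm (N.χ b) - A.symm (N.χ c)) i = p i) ∧
    ∫ φ in box n, transportPairing f N ψ ξ (c₀.pt c φ) (c₀.frame c φ) =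
      T.ends T.M ψ ξ *
        Complex.exp (Complex.I * k * (inner ℝ (A.symm (N.χ b) - A.symm (N.χ c)) θ : ℝ)) *
        ∫ φ in box n, Complex.exp (-(Complex.I * k *
          (inner ℝ (A.symm (N.χ b) - A.symm (N.χ c)) φ : ℝ))) * f (c₁.pt (N.path (1 / 2)) φ) := by
  obtain ⟨A₀, hA₀⟩ := affine_near N.affine N.left_mem hc
  have h0 : (0 : ℝ) ∈ Icc (0 : ℝ) 1 := left_mem_Icc.2 zero_le_one
  have hh : (1 / 2 : ℝ) ∈ Icc (0 : ℝ) 1 := by norm_num [mem_Icc]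
  have hc' : N.path 0 ∈ c₀.V := by rw [N.path_zero]; exact hc
  have hA₀' : ∀ᶠ b' in 𝓝 (N.path 0), N.χ b' = A₀ (c₀.x b') := by rw [N.path_zero]; exact hA₀
  set Δ := A.symm (N.χ b) - A.symm (N.χ c) with hΔ
  have hΔ' : A.linear Δ = N.χ b - N.χ c := by
    have h1 := affineEquiv_apply A (A.symm (N.χ b))
    have h2 := affineEquiv_apply A (A.symm (N.χ c))
    rw [AffineEquiv.apply_symm_apply] at h1 h2
    have h3 : N.χ b - N.χ c = A.linear (A.symm (N.χ b)) - A.linear (A.symm (N.χ c)) := by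
      conv_lhs => rw [h1, h2]
      exact add_sub_add_right_eq_sub _ _ _
    rw [hΔ, map_sub, h3]
  have hper : ∀ m, Complex.exp (-(Complex.I * k * (inner ℝ Δ (latt m) : ℝ))) * T.ends T.M ψ ξ =
      T.ends T.M ψ ξ := fun m ↦ by
    have h1 := (T.apply_latt (k := k) hh h0 hm hc' hA hA₀' m).2 T.M ψ ξ
    rw [← hΔ', ← inner_adj, ContinuousLinearEquiv.apply_symm_apply] at h1
    exact h1
  let R := (adj A₀).symm.trans (adj A)
  have hval : ∀ φ, transportPairing f N ψ ξ (c₀.pt c φ) (c₀.frame c φ) =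
      Complex.exp (-(Complex.I * k * (inner ℝ Δ (R (φ - θ₀)) : ℝ))) * T.ends T.M ψ ξ *
        f (c₁.pt (N.path (1 / 2)) (θ + R (φ - θ₀))) := by
    intro φ
    obtain ⟨T', hT'⟩ := T.exists_shift ((adj A₀).symm (φ - θ₀)) (q' := c₀.pt c φ)
      (v₀' := c₀.frame c φ)
      (fun y hy ↦ by
        rw [hy.proj_eq N.affine N.left_mem hc hA₀ (T.x_ne_zero h0) T.start,
          ContinuousLinearEquiv.apply_symm_apply, add_sub_cancel])
      (fun i ↦ by
        refine Eq.trans ?_ (vform_eq hc hA₀ φ (T.M i)).symm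
        rw [T.frame_coeff hc hA₀])
    rw [T'.transportPairing_eq hc, T.M_eq hc T', ends_shift hT', ← hΔ', ← inner_adj,
      shift_ℓ hh (hT' _ hh) hm hA hθ]
    rfl
  have hint : T.ends T.M ψ ξ ≠ 0 → ∃ p : Fin n → ℤ, ∀ i, k * Δ i = p i := by
    intro hne
    have h1 : ∀ i, ∃ p : ℤ, k * Δ i = p := fun i ↦ by
      have h2 := mul_right_cancel₀ hne ((hper (Pi.single i 1)).trans (one_mul _).symm)
      obtain ⟨p, hp⟩ := Complex.exp_eq_one_iff.1 h2
      have h3 : inner ℝ Δ (latt (Pi.single i (1 : ℤ))) = 2 * Real.pi * Δ i := by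
        rw [← lattBasis_apply]
        simp [lattBasis, Module.Basis.unitsSMul_apply, Units.smul_def, inner_smul_right,
          EuclideanSpace.inner_single_right]
      rw [h3] at hp
      refine ⟨-p, ?_⟩
      have h4 : ((k * Δ i : ℝ) : ℂ) = ((-p : ℤ) : ℝ) := by
        have h5 : (2 * Real.pi * Complex.I : ℂ) ≠ 0 := Complex.two_pi_I_ne_zero
        refine mul_left_cancel₀ h5 ?_
        push_cast at hp ⊢
        linear_combination -hp
      exact_mod_cast h4
    choose p hp using h1
    exact ⟨p, hp⟩
  refine ⟨hint, ?_⟩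
  simp only [hval]
  by_cases hne : T.ends T.M ψ ξ = 0
  · simp [hne]
  have h1 : ∀ m, Complex.exp (-(Complex.I * k * (inner ℝ Δ (latt m) : ℝ))) = 1 := fun m ↦
    mul_right_cancel₀ hne ((hper m).trans (one_mul _).symm)
  have h2 := setIntegral_box_comp R
    (fun m ↦ (T.apply_latt (k := k) h0 hh hc' hm hA₀' hA m).1)
    (fun m ↦ (T.apply_latt (k := k) hh h0 hm hc' hA hA₀' m).1) (θ - R θ₀)
    (F := fun φ ↦ Complex.exp (-(Complex.I * k * (inner ℝ Δ φ : ℝ))) *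
      f (c₁.pt (N.path (1 / 2)) φ)) (fun φ m ↦ by
        rw [pt_add_latt hm, inner_add_right]
        push_cast
        rw [mul_add, neg_add, Complex.exp_add, h1, mul_one])
  rw [← h2, ← MeasureTheory.integral_const_mul]
  congr 1
  funext φ
  have h3 : θ - R θ₀ + R φ = θ + R (φ - θ₀) := by rw [map_sub]; abel
  rw [h3]
  have h4 : Complex.exp (-(Complex.I * k * (inner ℝ Δ (R (φ - θ₀)) : ℝ))) =
      Complex.exp (Complex.I * k * (inner ℝ Δ θ : ℝ)) *
      Complex.exp (-(Complex.I * k * (inner ℝ Δ (θ + R (φ - θ₀)) : ℝ))) := by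
    rw [← Complex.exp_add, inner_add_right]
    congr 1
    push_cast
    ring
  rw [h4]
  ring

end ParallelTransport

end MatrixCoeff

/-! ### Parallel transport along short segments -/

section Near

variable [T2Space X] [VectorBundle ℂ ℂ L] [ContMDiffVectorBundle ∞ ℂ L (𝓡 (2 * n))]

theorem hasDerivAt_primitive {E : Type*} [NormedAddCommGroup E] [NormedSpace ℝ E] [CompleteSpace E]
    {O : Set ℝ} (hO : IsOpen O) (hO' : O.OrdConnected) {f : ℝ → E} (hf : ContinuousOn f O) {a t : ℝ}
    (ha : a ∈ O) (ht : t ∈ O) : HasDerivAt (fun t ↦ ∫ r in a..t, f r) (f t) t :=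
  intervalIntegral.integral_hasDerivAt_right
    ((hf.mono (hO'.uIcc_subset ha ht)).intervalIntegrable)
    (hf.stronglyMeasurableAtFilter hO t ht) (hf.continuousAt (hO.mem_nhds ht))

/-- The phase of parallel transport along a segment is of third order in the length of the segment,
if the angles are normalised at the midpoint. -/
theorem abs_phase_le {ξ₀ ξ₁ : Euc n} {s ϑ : ℝ → Euc n} {K : ℝ → ℝ} {s₀ : Euc n} {C : ℝ}
    (hϑ : ∀ t ∈ Icc (0 : ℝ) 1, HasDerivWithinAt ϑ (s t) (Icc 0 1) t) (hϑ₀ : ϑ (1 / 2) = 0)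
    (hK : ∀ t ∈ Icc (0 : ℝ) 1,
      HasDerivWithinAt K (inner ℝ (AffineMap.lineMap ξ₀ ξ₁ t) (s t)) (Icc 0 1) t)
    (hs : ∀ t ∈ Icc (0 : ℝ) 1, ‖s t - s₀‖ ≤ C * ‖ξ₁ - ξ₀‖ ^ 2) :
    |K 1 - K 0 - inner ℝ ξ₁ (ϑ 1) + inner ℝ ξ₀ (ϑ 0)| ≤ C * ‖ξ₁ - ξ₀‖ ^ 3 := by
  have h0 : (0 : ℝ) ∈ Icc (0 : ℝ) 1 := left_mem_Icc.2 zero_le_one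
  have h1 : (1 : ℝ) ∈ Icc (0 : ℝ) 1 := right_mem_Icc.2 zero_le_one
  have hh : (1 / 2 : ℝ) ∈ Icc (0 : ℝ) 1 := by norm_num [mem_Icc]
  have hC : 0 ≤ C * ‖ξ₁ - ξ₀‖ ^ 2 := (norm_nonneg _).trans (hs 0 h0)
  have hb : ∀ t ∈ Icc (0 : ℝ) 1, ‖ϑ t - (t - 1 / 2) • s₀‖ ≤ C * ‖ξ₁ - ξ₀‖ ^ 2 := by
    intro t ht
    have h2 := (convex_Icc (0 : ℝ) 1).norm_image_sub_le_of_norm_hasDerivWithin_le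
      (f := fun t ↦ ϑ t - (t - 1 / 2) • s₀) (f' := fun t ↦ s t - s₀)
      (fun r hr ↦ by
        have h3 : HasDerivWithinAt (fun t : ℝ ↦ (t - 1 / 2) • s₀) s₀ (Icc 0 1) r := by
          have h4 := (((hasDerivAt_id r).sub_const (1 / 2)).smul_const s₀).hasDerivWithinAt
            (s := Icc 0 1)
          rwa [one_smul] at h4
        exact (hϑ r hr).fun_sub h3) hs hh ht
    simp only [hϑ₀, sub_self, zero_smul, sub_zero] at h2
    refine h2.trans (mul_le_of_le_one_right hC ?_)
    rw [Real.norm_eq_abs, abs_le]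
    constructor <;> linarith [ht.1, ht.2]
  -- The contribution of the constant slope `s₀` is a multiple of `(t - 1/2)²`, which takes the same
  -- value at both ends; it is removed before the mean value inequality is applied.
  have h2 := (convex_Icc (0 : ℝ) 1).norm_image_sub_le_of_norm_hasDerivWithin_le
    (f := fun t ↦ K t - inner ℝ (AffineMap.lineMap ξ₀ ξ₁ t) (ϑ t) +
      (t - 1 / 2) ^ 2 * (inner ℝ (ξ₁ - ξ₀) s₀ / 2))
    (f' := fun t ↦ -inner ℝ (ξ₁ - ξ₀) (ϑ t - (t - 1 / 2) • s₀)) (C := C * ‖ξ₁ - ξ₀‖ ^ 3)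
    (fun r hr ↦ by
      have h3 : HasDerivWithinAt (fun t : ℝ ↦ AffineMap.lineMap ξ₀ ξ₁ t) (ξ₁ - ξ₀) (Icc 0 1) r :=
        (hasDerivAt_lineMap' ξ₀ ξ₁ r).hasDerivWithinAt
      have h4 : HasDerivWithinAt (fun t : ℝ ↦ (t - 1 / 2) ^ 2 * (inner ℝ (ξ₁ - ξ₀) s₀ / 2))
          ((r - 1 / 2) * inner ℝ (ξ₁ - ξ₀) s₀) (Icc 0 1) r := by
        have := ((((hasDerivAt_id r).sub_const (1 / 2)).pow 2).mul_const
          (inner ℝ (ξ₁ - ξ₀) s₀ / 2)).hasDerivWithinAt (s := Icc 0 1)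
        refine this.congr_deriv ?_
        simp
        ring
      refine (((hK r hr).fun_sub (h3.inner ℝ (hϑ r hr))).fun_add h4).congr_deriv ?_
      rw [inner_sub_right, inner_smul_right]
      ring) (fun r hr ↦ by
      rw [norm_neg]
      refine (norm_inner_le_norm _ _).trans ?_
      calc ‖ξ₁ - ξ₀‖ * ‖ϑ r - (r - 1 / 2) • s₀‖ ≤ ‖ξ₁ - ξ₀‖ * (C * ‖ξ₁ - ξ₀‖ ^ 2) := by
            gcongr; exact hb r hr
        _ = C * ‖ξ₁ - ξ₀‖ ^ 3 := by ring) h0 h1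
  simp only [AffineMap.lineMap_apply_one, AffineMap.lineMap_apply_zero, sub_zero, norm_one,
    mul_one] at h2
  rw [Real.norm_eq_abs] at h2
  refine le_of_eq_of_le ?_ h2
  congr 1
  ring

variable {c b : B} {N : S.CommonNbhd c b}

/-- Parallel transport along a segment in a gauge. -/
theorem CommonNbhd.exists_transport_of_gauge {G : S.Gauge} (hc : c ∈ G.dom) (hb : b ∈ G.dom)
    (hpath : ∀ t ∈ Icc (0 : ℝ) 1, N.path t = base G.c (AffineMap.lineMap (G.c.x c) (G.c.x b) t))
    {C : ℝ} (hC : ∀ t ∈ Icc (0 : ℝ) 1, ‖G.slope (AffineMap.lineMap (G.c.x c) (G.c.x b) t) -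
      G.slope (AffineMap.lineMap (G.c.x c) (G.c.x b) (1 / 2 : ℝ))‖ ≤ C * ‖G.c.x b - G.c.x c‖)
    {c₀ : S.Chart} (hc₀ : c ∈ c₀.V) :
    ∃ (θ₀ : Euc n) (T : ParallelTransport N (c₀.pt c θ₀) (c₀.frame c θ₀)) (r : ℝ),
      |r| ≤ C * ‖G.c.x b - G.c.x c‖ ^ 3 ∧ T.ℓ (1 / 2) = G.c.pt (N.path (1 / 2)) 0 ∧
      ∀ (k : ℕ) (ψ : S.FiberSpace k b) (ξ : S.FiberSpace k c), T.ends T.M ψ ξ =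
        Complex.exp (Complex.I * k * r) * (starRingEnd ℂ (G.amp ψ) * G.amp ξ) := by
  set ξ₀ := G.c.x c
  set ξ₁ := G.c.x b
  have h0 : (0 : ℝ) ∈ Icc (0 : ℝ) 1 := left_mem_Icc.2 zero_le_one
  have h1 : (1 : ℝ) ∈ Icc (0 : ℝ) 1 := right_mem_Icc.2 zero_le_one
  have hh : (1 / 2 : ℝ) ∈ Icc (0 : ℝ) 1 := by norm_num [mem_Icc]
  let O : Set ℝ := (fun t : ℝ ↦ AffineMap.lineMap ξ₀ ξ₁ t) ⁻¹' G.W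
  have hl : ContDiff ℝ ∞ fun r : ℝ ↦ AffineMap.lineMap ξ₀ ξ₁ r := by
    simp only [AffineMap.lineMap_apply_module]
    fun_prop
  have hO : IsOpen O := G.isOpen_W.preimage hl.continuous
  have hOc : O.OrdConnected := (G.convex_W.affine_preimage
    (AffineMap.lineMap ξ₀ ξ₁ : ℝ →ᵃ[ℝ] Euc n)).ordConnected
  have hIccO : Icc (0 : ℝ) 1 ⊆ O := fun t ht ↦
    G.convex_W.segment_subset hc.2 hb.2 (lineMap_mem_segment ℝ _ _ ht)
  let s : ℝ → Euc n := fun t ↦ G.slope (AffineMap.lineMap ξ₀ ξ₁ t) (ξ₁ - ξ₀)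
  have hs : ContDiffOn ℝ ∞ s O :=
    (G.smooth_slope.comp hl.contDiffOn fun t ht ↦ ht).clm_apply contDiffOn_const
  let ϑ : ℝ → Euc n := fun t ↦ ∫ r in (1 / 2 : ℝ)..t, s r
  let K : ℝ → ℝ := fun t ↦ ∫ r in (0 : ℝ)..t, inner ℝ (AffineMap.lineMap ξ₀ ξ₁ r) (s r)
  have hϑ : ∀ t ∈ O, HasDerivAt ϑ (s t) t := fun t ht ↦
    hasDerivAt_primitive hO hOc hs.continuousOn (hIccO hh) ht
  have hK : ∀ t ∈ O, HasDerivAt K (inner ℝ (AffineMap.lineMap ξ₀ ξ₁ t) (s t)) t := fun t ht ↦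
    hasDerivAt_primitive hO hOc (hl.continuous.continuousOn.inner hs.continuousOn) (hIccO h0) ht
  have hϑsm : ContDiffOn ℝ ∞ ϑ O := (contDiffOn_infty_iff_deriv_of_isOpen hO).2
    ⟨fun t ht ↦ (hϑ t ht).differentiableAt.differentiableWithinAt,
      hs.congr fun t ht ↦ (hϑ t ht).deriv⟩
  have hK0 : K 0 = 0 := intervalIntegral.integral_same
  have hϑ₀ : ϑ (1 / 2) = 0 := intervalIntegral.integral_same
  have hxp : ∀ t ∈ Icc (0 : ℝ) 1, N.path t ∈ G.dom ∧
      G.c.x (N.path t) = AffineMap.lineMap ξ₀ ξ₁ t := fun t ht ↦ by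
    rw [hpath t ht]
    exact ⟨G.base_mem_dom (hIccO ht), x_base (G.subset (hIccO ht))⟩
  let x : ℝ → TotalSpace ℂ L := fun t ↦
    tsmul (Complex.exp (Complex.I * K t)) (G.sec (AffineMap.lineMap ξ₀ ξ₁ t, ϑ t))
  have hloc : ∀ t ∈ Icc (0 : ℝ) 1, IsLocalTransport N x t := by
    intro t ht
    obtain ⟨A, hA⟩ := affine_near N.affine (N.path_spec ht).1 (hxp t ht).1.1
    have h2 : ∀ᶠ r in 𝓝[Icc 0 1] t, ξ₀ + r • (ξ₁ - ξ₀) =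
        A.symm (N.χ c) + r • (A.symm (N.χ b) - A.symm (N.χ c)) := by
      filter_upwards [(N.locAffine_path.continuousWithinAt ht).eventually hA.eventually_nhds,
        self_mem_nhdsWithin] with r hr hrI
      have h3 := N.x_path hrI hr
      rw [(hxp r hrI).2, AffineMap.lineMap_apply_module', AffineMap.lineMap_apply_module'] at h3
      rw [add_comm, h3, add_comm]
    obtain ⟨h4, h5⟩ := eq_of_eventually_affine ht h2
    have h6 : A.symm (N.χ b) = ξ₁ := by
      rw [← h4] at h5
      exact (sub_left_inj.1 h5).symm
    refine ⟨G, A, ϑ, fun t ↦ Complex.exp (Complex.I * K t), (hxp t ht).1, hA,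
      (hϑsm.contDiffAt (hO.mem_nhds (hIccO ht))).contDiffWithinAt, ?_, ?_, ?_⟩
    · rw [h6, ← h4]
      exact Filter.Eventually.of_forall fun r ↦ rfl
    · rw [h6, ← h4, (hxp t ht).2]
      exact (hϑ t (hIccO ht)).hasDerivWithinAt
    · rw [h6, ← h4, (hxp t ht).2]
      have h7 := ((hK t (hIccO ht)).ofReal_comp.const_mul Complex.I).cexp.hasDerivWithinAt
        (s := Icc 0 1)
      exact h7.congr_deriv (by ring)
  have hnorm : ∀ t, ‖Complex.exp (Complex.I * K t)‖ = 1 := fun t ↦ by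
    rw [mul_comm, Complex.norm_exp_ofReal_mul_I]
  have hn : ‖(x 0).snd‖ = 1 := by
    have h2 : ‖(G.sec (AffineMap.lineMap ξ₀ ξ₁ (0 : ℝ), ϑ 0)).snd‖ = 1 := G.norm_E _ (hIccO h0)
    rw [norm_tsmul, h2, hnorm, mul_one]
  obtain ⟨A₀, hA₀⟩ := affine_near N.affine N.left_mem hc₀
  have hμ : S.μ (x 0).proj = c := by
    have h2 : (x 0).proj = G.c.pt c (ϑ 0) := by
      change G.c.Ψ (AffineMap.lineMap ξ₀ ξ₁ (0 : ℝ), ϑ 0) = _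
      rw [AffineMap.lineMap_apply_zero]
    rw [h2, proj_pt hc.1]
  obtain ⟨θ₀, hθ₀⟩ := exists_pt_eq hc₀ hμ
  obtain ⟨T, hT⟩ := exists_parallelTransport hloc hn
    (fun i ↦ WithLp.ofLp ((adj A₀).symm (EuclideanSpace.single i 1))) hθ₀.symm
    (v₀ := c₀.frame c θ₀) (fun i ↦ by
      refine Eq.trans ?_ (vform_eq hc₀ hA₀ θ₀ _).symm
      rw [WithLp.toLp_ofLp, ContinuousLinearEquiv.apply_symm_apply])
  have hsC : ∀ t ∈ Icc (0 : ℝ) 1, ‖s t - s (1 / 2)‖ ≤ C * ‖ξ₁ - ξ₀‖ ^ 2 := fun t ht ↦ by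
    have h2 : s t - s (1 / 2) = (G.slope (AffineMap.lineMap ξ₀ ξ₁ t) -
      G.slope (AffineMap.lineMap ξ₀ ξ₁ (1 / 2 : ℝ))) (ξ₁ - ξ₀) := rfl
    rw [h2, pow_two, ← mul_assoc]
    exact ContinuousLinearMap.le_of_opNorm_le _ (hC t ht) _
  refine ⟨θ₀, T, K 1 - K 0 - inner ℝ ξ₁ (ϑ 1) + inner ℝ ξ₀ (ϑ 0),
    abs_phase_le (fun t ht ↦ (hϑ t (hIccO ht)).hasDerivWithinAt) hϑ₀
      (fun t ht ↦ (hK t (hIccO ht)).hasDerivWithinAt) hsC, ?_, fun k ψ ξ ↦ ?_⟩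
  · have h2 : T.ℓ (1 / 2) = (T.x (1 / 2)).proj := rfl
    rw [h2, hT]
    change G.c.Ψ (AffineMap.lineMap ξ₀ ξ₁ (1 / 2 : ℝ), ϑ (1 / 2)) = _
    rw [hϑ₀, ActionAngleChart.pt, (hxp _ hh).2]
  have hev : ∀ {t : ℝ} (ht : t ∈ Icc (0 : ℝ) 1) {b' : B} (hb' : N.path t = b')
      (τ : S.FiberSpace k b'), ev τ N.χ T.M (T.x t) = (Complex.exp (Complex.I * K t) ^ k)⁻¹ *
        (Complex.exp (Complex.I * k * (inner ℝ (AffineMap.lineMap ξ₀ ξ₁ t) (ϑ t) : ℝ)) *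
          G.amp τ) := by
    intro t ht b' hb' τ
    subst hb'
    obtain ⟨A, hA⟩ := affine_near N.affine (N.path_spec ht).1 (hxp t ht).1.1
    have h2 : T.x t = tsmul (Complex.exp (Complex.I * K t)) (G.sec (G.c.x (N.path t), ϑ t)) := by
      rw [hT, (hxp t ht).2]
    rw [h2, ev_tsmul _ _ _ _ (Complex.exp_ne_zero _), ev_sec _ (hxp t ht).1 hA,
      T.abs_det_coeff hc₀ ht (hxp t ht).1.1 hA, (hxp t ht).2, Real.sqrt_one, Complex.ofReal_one,
      one_mul]
  rw [ParallelTransport.ends, hev h1 N.path_one ψ, hev h0 N.path_zero ξ, hK0,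
    AffineMap.lineMap_apply_zero, AffineMap.lineMap_apply_one, map_mul, map_mul, map_inv₀, map_pow,
    ← Complex.exp_conj, ← Complex.exp_conj, ← Complex.exp_nat_mul, ← Complex.exp_neg]
  simp only [map_mul, Complex.conj_I, Complex.conj_ofReal, Complex.conj_natCast]
  have h2 : Complex.exp (Complex.I * k *
      ((K 1 - 0 - inner ℝ ξ₁ (ϑ 1) + inner ℝ ξ₀ (ϑ 0) : ℝ) : ℂ)) =
      Complex.exp (-(k * (-Complex.I * K 1))) *
      Complex.exp (-Complex.I * k * (inner ℝ ξ₁ (ϑ 1) : ℝ)) *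
      Complex.exp (Complex.I * k * (inner ℝ ξ₀ (ϑ 0) : ℝ)) := by
    rw [← Complex.exp_add, ← Complex.exp_add]
    congr 1
    push_cast
    ring
  rw [h2]
  simp only [Complex.ofReal_zero, mul_zero, Complex.exp_zero, one_pow, inv_one, one_mul]
  ring

end Near

/-! ### Fourier series of periodic functions -/

section Fourier

open MeasureTheory

variable {n : ℕ}

/-- The vector `p ∈ ℤⁿ ⊆ ℝⁿ`. -/
def zvec (p : Fin n → ℤ) : Euc n := WithLp.toLp 2 fun i ↦ (p i : ℝ)

@[simp] theorem zvec_apply (p : Fin n → ℤ) (i : Fin n) : zvec p i = p i := rfl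

theorem zvec_add (p q : Fin n → ℤ) : zvec (p + q) = zvec p + zvec q := by
  ext i; simp

theorem zvec_sub (p q : Fin n → ℤ) : zvec (p - q) = zvec p - zvec q := by
  ext i; simp

theorem latt_eq_smul_zvec (p : Fin n → ℤ) : latt p = (2 * Real.pi) • zvec p := by
  ext i; simp

/-- The weight `1 + |p|²`. -/
def wt (p : Fin n → ℤ) : ℝ := 1 + ‖zvec p‖ ^ 2

theorem one_le_wt (p : Fin n → ℤ) : 1 ≤ wt p := by
  rw [wt]; nlinarith [sq_nonneg ‖zvec p‖]

theorem wt_pos (p : Fin n → ℤ) : 0 < wt p := zero_lt_one.trans_le (one_le_wt p)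

theorem norm_zvec_le_wt (p : Fin n → ℤ) : ‖zvec p‖ ≤ wt p := by
  rw [wt]; nlinarith [sq_nonneg (‖zvec p‖ - 1)]

theorem summable_inv_wt {M : ℕ} (hM : n < M) : Summable fun p : Fin n → ℤ ↦ (wt p)⁻¹ ^ M := by
  let L := Submodule.span ℤ (Set.range (lattBasis n))
  have hfin : Module.finrank ℤ L = n := by
    rw [Module.finrank_eq_card_basis ((lattBasis n).restrictScalars ℤ), Fintype.card_fin]
  have h1 : Summable fun z : L ↦ ‖z‖⁻¹ ^ M :=
    ZLattice.summable_norm_pow_inv (L := L) M (by rw [hfin]; exact hM)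
  let e : (Fin n → ℤ) → L := fun p ↦ ⟨latt p, mem_span_lattBasis.2 ⟨p, rfl⟩⟩
  have he : Function.Injective e := fun p q h ↦ latt_injective (congrArg Subtype.val h)
  have h2 := (h1.comp_injective he).mul_left ((2 * Real.pi) ^ M)
  refine Summable.of_norm_bounded_eventually h2 ?_
  filter_upwards [Filter.eventually_cofinite_ne (0 : Fin n → ℤ)] with p hp
  have hne : 0 < ‖zvec p‖ := norm_pos_iff.2 fun h ↦ hp (funext fun i ↦ by
    have := congrArg (fun v : Euc n ↦ v i) h
    simpa using this)
  have h3 : ‖e p‖ = 2 * Real.pi * ‖zvec p‖ := by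
    change ‖latt p‖ = _
    rw [latt_eq_smul_zvec, norm_smul, Real.norm_of_nonneg Real.two_pi_pos.le]
  rw [Real.norm_of_nonneg (by have := wt_pos p; positivity)]
  change _ ≤ (2 * Real.pi) ^ M * ‖e p‖⁻¹ ^ M
  rw [h3, ← mul_pow, mul_inv, ← mul_assoc, mul_inv_cancel₀ Real.two_pi_pos.ne', one_mul]
  exact pow_le_pow_left₀ (inv_nonneg.2 (wt_pos p).le)
    (inv_anti₀ hne (norm_zvec_le_wt p)) M

/-- The character `exp(i⟨p, θ⟩)` of the torus. -/
def char (p : Fin n → ℤ) (θ : Euc n) : ℂ := Complex.exp (Complex.I * (inner ℝ (zvec p) θ : ℝ))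

theorem continuous_char (p : Fin n → ℤ) : Continuous (char p) := by
  unfold char; fun_prop

theorem norm_char (p : Fin n → ℤ) (θ : Euc n) : ‖char p θ‖ = 1 := by
  rw [char, mul_comm, Complex.norm_exp_ofReal_mul_I]

theorem char_add (p q : Fin n → ℤ) (θ : Euc n) : char (p + q) θ = char p θ * char q θ := by
  rw [char, char, char, ← Complex.exp_add, zvec_add, inner_add_left]
  push_cast
  rw [mul_add]

theorem char_zero (θ : Euc n) : char 0 θ = 1 := by
  have : zvec (0 : Fin n → ℤ) = 0 := by ext i; simp
  simp [char, this]

theorem char_add_right (p : Fin n → ℤ) (θ θ' : Euc n) :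
    char p (θ + θ') = char p θ * char p θ' := by
  rw [char, char, char, ← Complex.exp_add, inner_add_right]
  push_cast
  rw [mul_add]

theorem char_latt (p m : Fin n → ℤ) : char p (latt m) = 1 := by
  rw [char, Complex.exp_eq_one_iff]
  refine ⟨∑ i, p i * m i, ?_⟩
  have : (inner ℝ (zvec p) (latt m) : ℝ) = 2 * Real.pi * ∑ i, (p i : ℝ) * m i := by
    rw [PiLp.inner_apply, Finset.mul_sum]
    exact Finset.sum_congr rfl fun i _ ↦ by simp; ring
  rw [this]
  push_cast
  ring

/-- The Fourier coefficients of a `(2πℤ)ⁿ`-periodic function. -/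
def fc (F : Euc n → ℂ) (p : Fin n → ℤ) : ℂ :=
  ((2 * Real.pi : ℂ) ^ n)⁻¹ * ∫ θ in box n, char (-p) θ * F θ

theorem norm_fc_le {F : Euc n → ℂ} {C : ℝ} (hC : ∀ θ ∈ box n, ‖F θ‖ ≤ C) (p : Fin n → ℤ) :
    ‖fc F p‖ ≤ C := by
  have h1 : ‖∫ θ in box n, char (-p) θ * F θ‖ ≤ C * (volume (box n)).toReal :=
    norm_setIntegral_le_of_norm_le_const isCompact_box.measure_lt_top
      (fun θ hθ ↦ by rw [norm_mul, norm_char, one_mul]; exact hC θ hθ)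
  have h2 : (0 : ℝ) < (2 * Real.pi) ^ n := by positivity
  rw [volume_box] at h1
  have h3 : ‖((2 * Real.pi : ℂ) ^ n)⁻¹‖ = ((2 * Real.pi) ^ n)⁻¹ := by
    rw [norm_inv, norm_pow, norm_mul, Complex.norm_ofNat, Complex.norm_real,
      Real.norm_of_nonneg Real.pi_pos.le]
  rw [fc, norm_mul, h3, inv_mul_le_iff₀ h2, mul_comm]
  exact h1

theorem integrableOn_box {F : Euc n → ℂ} (hF : Continuous F) : IntegrableOn F (box n) :=
  hF.continuousOn.integrableOn_compact isCompact_box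

open scoped Pointwise in
theorem integral_unitCube (H : Euc n → ℂ) :
    ∫ x in {x : Fin n → ℝ | ∀ i, x i ∈ Ioc ((0 : Fin n → ℝ) i) ((0 : Fin n → ℝ) i + 1)},
      H ((2 * Real.pi) • WithLp.toLp 2 x) = ((2 * Real.pi : ℂ) ^ n)⁻¹ * ∫ θ in box n, H θ := by
  let s : Set (Euc n) := {v | ∀ i, v i ∈ Ioc (0 : ℝ) 1}
  have h1 := (PiLp.volume_preserving_toLp (Fin n)).setIntegral_preimage_emb
    (MeasurableEquiv.toLp 2 (Fin n → ℝ)).measurableEmbedding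
    (fun v : Euc n ↦ H ((2 * Real.pi) • v)) s
  have h2 : {x : Fin n → ℝ | ∀ i, x i ∈ Ioc ((0 : Fin n → ℝ) i) ((0 : Fin n → ℝ) i + 1)} =
      WithLp.toLp 2 ⁻¹' s := by
    ext x; simp [s]
  have h3 : (2 * Real.pi) • s = (WithLp.ofLp : Euc n → Fin n → ℝ) ⁻¹'
      (Set.pi univ fun _ ↦ Ioc 0 (2 * Real.pi)) := by
    ext v
    rw [Set.mem_smul_set_iff_inv_smul_mem₀ Real.two_pi_pos.ne']
    simp only [s, mem_ofPred_eq, mem_preimage, mem_univ_pi, mem_Ioc, PiLp.smul_apply, smul_eq_mul]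
    refine forall_congr' fun i ↦ and_congr ?_ ?_
    · rw [mul_pos_iff_of_pos_left (inv_pos.2 Real.two_pi_pos)]
    · rw [inv_mul_le_iff₀ Real.two_pi_pos, mul_one]
  have h4 : box n = (WithLp.ofLp : Euc n → Fin n → ℝ) ⁻¹'
      (Icc (fun _ ↦ 0) (fun _ ↦ 2 * Real.pi)) := by
    ext θ; simp [box, Pi.le_def, forall_and]
  have h5 : (2 * Real.pi) • s =ᵐ[volume] box n := by
    rw [h3, h4]
    exact (PiLp.volume_preserving_ofLp (Fin n)).quasiMeasurePreserving.preimage_ae_eq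
      Measure.univ_pi_Ioc_ae_eq_Icc
  rw [h2, h1, Measure.setIntegral_comp_smul_of_pos _ _ _ Real.two_pi_pos,
    setIntegral_congr_set h5, finrank_euclideanSpace_fin, Complex.real_smul]
  push_cast
  rfl

/-- A continuous periodic function with summable Fourier coefficients is the sum of its Fourier series. -/
theorem hasSum_fc {F : Euc n → ℂ} (hF : Continuous F) (hp : ∀ θ m, F (θ + latt m) = F θ)
    (hs : Summable fun p ↦ fc F p) (θ : Euc n) : HasSum (fun p ↦ fc F p * char p θ) (F θ) := by
  let q : C(Fin n → ℝ, UnitAddTorus (Fin n)) := ⟨fun x i ↦ (x i : UnitAddCircle), by fun_prop⟩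
  have hq : Topology.IsQuotientMap q :=
    (IsOpenQuotientMap.piMap fun _ : Fin n ↦ QuotientAddGroup.isOpenQuotientMap_mk).isQuotientMap
  let F₁ : C(Fin n → ℝ, ℂ) := ⟨fun x ↦ F ((2 * Real.pi) • WithLp.toLp 2 x), by fun_prop⟩
  have hfac : Function.FactorsThrough F₁ q := fun x y h ↦ by
    have h1 : ∀ i, ∃ m : ℤ, x i = y i + m := fun i ↦ by
      have h2 : ((x i : ℝ) : UnitAddCircle) = (y i : ℝ) := congrFun h i
      rw [← sub_eq_zero, ← AddCircle.coe_sub, AddCircle.coe_eq_zero_iff] at h2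
      obtain ⟨m, hm⟩ := h2
      exact ⟨m, by rw [zsmul_one] at hm; linarith⟩
    choose m hm using h1
    change F _ = F _
    rw [← hp ((2 * Real.pi) • WithLp.toLp 2 y) m]
    congr 1
    ext i
    simp [hm i]
    ring
  let Ft : C(UnitAddTorus (Fin n), ℂ) := hq.lift F₁ hfac
  have hFt : ∀ x : Fin n → ℝ, Ft (q x) = F ((2 * Real.pi) • WithLp.toLp 2 x) := fun x ↦
    congrFun (congrArg DFunLike.coe (hq.lift_comp F₁ hfac)) x
  have hchar : ∀ (p : Fin n → ℤ) (x : Fin n → ℝ), UnitAddTorus.mFourier p (q x) =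
      char p ((2 * Real.pi) • WithLp.toLp 2 x) := fun p x ↦ by
    change ∏ i, fourier (p i) ((x i : ℝ) : UnitAddCircle) = _
    simp only [fourier_coe_apply]
    rw [← Complex.exp_sum, char]
    congr 1
    rw [PiLp.inner_apply, Complex.ofReal_sum, Finset.mul_sum]
    refine Finset.sum_congr rfl fun i _ ↦ ?_
    simp
    ring
  have hcoef : ∀ p, UnitAddTorus.mFourierCoeff Ft p = fc F p := fun p ↦ by
    rw [UnitAddTorus.mFourierCoeff_eq_integral _ _ 0]
    have h1 : ∀ x : Fin n → ℝ, (UnitAddTorus.mFourier (-p) fun i ↦ ((x i : ℝ) : UnitAddCircle)) •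
        Ft (fun i ↦ ((x i : ℝ) : UnitAddCircle)) =
        char (-p) ((2 * Real.pi) • WithLp.toLp 2 x) * F ((2 * Real.pi) • WithLp.toLp 2 x) := fun x ↦ by
      rw [smul_eq_mul]
      exact congrArg₂ _ (hchar (-p) x) (hFt x)
    simp only [h1]
    exact integral_unitCube fun θ ↦ char (-p) θ * F θ
  have hs' : Summable (UnitAddTorus.mFourierCoeff Ft) := hs.congr fun p ↦ (hcoef p).symm
  have h2 := UnitAddTorus.hasSum_mFourier_series_apply_of_summable hs'
    (q ((2 * Real.pi)⁻¹ • WithLp.ofLp θ))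
  have h3 : (2 * Real.pi) • WithLp.toLp 2 ((2 * Real.pi)⁻¹ • WithLp.ofLp θ) = θ := by
    rw [WithLp.toLp_smul, smul_smul, mul_inv_cancel₀ Real.two_pi_pos.ne', one_smul, WithLp.toLp_ofLp]
  rw [hFt, h3] at h2
  refine h2.congr_fun fun p ↦ ?_
  rw [smul_eq_mul, hcoef, hchar, h3]

/-- The Fourier coefficients of a product are the convolution of those of the factors; summability
of the coefficients is needed for one factor only. -/
theorem hasSum_fc_mul {F G : Euc n → ℂ} (hF : Continuous F) (hp : ∀ θ m, F (θ + latt m) = F θ)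
    (hs : Summable fun p ↦ fc F p) (hG : Continuous G) (s : Fin n → ℤ) :
    HasSum (fun p ↦ fc F p * fc G (s - p)) (fc (fun θ ↦ F θ * G θ) s) := by
  obtain ⟨C, hC⟩ := isCompact_box.exists_bound_of_continuousOn (hG.continuousOn (s := box n))
  have hint : ∀ p, Integrable (fun θ ↦ fc F p * (char (p - s) θ * G θ)) (volume.restrict (box n)) :=
    fun p ↦ (integrableOn_box ((continuous_char _).mul hG)).const_mul _
  have hb : ∀ p, ∫ θ in box n, ‖fc F p * (char (p - s) θ * G θ)‖ ≤
      ‖fc F p‖ * (C * (volume (box n)).toReal) := fun p ↦ by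
    simp only [norm_mul, norm_char, one_mul]
    rw [integral_const_mul]
    gcongr
    have h1 := norm_setIntegral_le_of_norm_le_const (f := fun θ ↦ ‖G θ‖)
      (isCompact_box (n := n)).measure_lt_top (μ := volume)
      (C := C) (fun θ hθ ↦ by rw [norm_norm]; exact hC θ hθ)
    exact (le_abs_self _).trans h1
  have h1 := hasSum_integral_of_summable_integral_norm hint
    (Summable.of_nonneg_of_le (fun p ↦ integral_nonneg fun θ ↦ norm_nonneg _) hb
      (hs.norm.mul_right _))
  have h2 : ∀ θ, ∑' p, fc F p * (char (p - s) θ * G θ) = char (-s) θ * (F θ * G θ) := fun θ ↦ by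
    have h3 := ((hasSum_fc hF hp hs θ).mul_right (char (-s) θ * G θ)).tsum_eq
    rw [mul_left_comm, ← h3]
    refine tsum_congr fun p ↦ ?_
    rw [sub_eq_add_neg, char_add]
    ring
  simp only [h2] at h1
  have h3 := h1.mul_left (((2 * Real.pi : ℂ) ^ n)⁻¹)
  refine h3.congr_fun fun p ↦ ?_
  rw [integral_const_mul, fc, fc, neg_sub]
  ring

end Fourier

/-! ### Smooth families of periodic functions -/

section Families

open MeasureTheory

variable {n : ℕ} {W : Set (Euc n)} {F G : Euc n × Euc n → ℂ}

/-- A smooth function on `W × Tⁿ`. -/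
structure Family (W : Set (Euc n)) (F : Euc n × Euc n → ℂ) : Prop where
  smooth : ContDiffOn ℝ ∞ F (W ×ˢ univ)
  periodic : ∀ ξ ∈ W, ∀ θ m, F (ξ, θ + latt m) = F (ξ, θ)

/-- The directional derivative of `F` along the constant vector field `V`. -/
def pd (V : Euc n × Euc n) (F : Euc n × Euc n → ℂ) (y : Euc n × Euc n) : ℂ := fderiv ℝ F y V

/-- The Fourier coefficients of `F(ξ, ·)`. -/
def fcf (F : Euc n × Euc n → ℂ) (ξ : Euc n) (p : Fin n → ℤ) : ℂ := fc (fun θ ↦ F (ξ, θ)) p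

namespace Family

theorem mul (hF : Family W F) (hG : Family W G) : Family W fun y ↦ F y * G y :=
  ⟨hF.smooth.mul hG.smooth, fun ξ hξ θ m ↦ by rw [hF.periodic ξ hξ, hG.periodic ξ hξ]⟩

theorem sub (hF : Family W F) (hG : Family W G) : Family W fun y ↦ F y - G y :=
  ⟨hF.smooth.sub hG.smooth, fun ξ hξ θ m ↦ by rw [hF.periodic ξ hξ, hG.periodic ξ hξ]⟩

theorem sum {ι : Type*} {s : Finset ι} {F : ι → Euc n × Euc n → ℂ} (h : ∀ i, Family W (F i)) :
    Family W fun y ↦ ∑ i ∈ s, F i y :=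
  ⟨ContDiffOn.sum fun i _ ↦ (h i).smooth, fun ξ hξ θ m ↦
    Finset.sum_congr rfl fun i _ ↦ (h i).periodic ξ hξ θ m⟩

theorem mono {W' : Set (Euc n)} (hF : Family W F) (h : W' ⊆ W) : Family W' F :=
  ⟨hF.smooth.mono (prod_mono h Subset.rfl), fun ξ hξ ↦ hF.periodic ξ (h hξ)⟩

theorem congr (hF : Family W F) (h : ∀ ξ ∈ W, ∀ θ, G (ξ, θ) = F (ξ, θ)) : Family W G :=
  ⟨hF.smooth.congr fun y hy ↦ h y.1 hy.1 y.2, fun ξ hξ θ m ↦ by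
    rw [h ξ hξ, h ξ hξ, hF.periodic ξ hξ]⟩

theorem contDiffAt (hF : Family W F) (hW : IsOpen W) {y : Euc n × Euc n} (hy : y.1 ∈ W) :
    ContDiffAt ℝ ∞ F y :=
  hF.smooth.contDiffAt ((hW.prod isOpen_univ).mem_nhds ⟨hy, mem_univ _⟩)

theorem differentiableAt (hF : Family W F) (hW : IsOpen W) {y : Euc n × Euc n} (hy : y.1 ∈ W) :
    DifferentiableAt ℝ F y := (hF.contDiffAt hW hy).differentiableAt (by simp)

theorem continuous (hF : Family W F) {ξ : Euc n} (hξ : ξ ∈ W) : Continuous fun θ ↦ F (ξ, θ) :=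
  hF.smooth.continuousOn.comp_continuous (by fun_prop) fun _ ↦ ⟨hξ, mem_univ _⟩

theorem pd (hF : Family W F) (hW : IsOpen W) (V : Euc n × Euc n) : Family W (pd V F) := by
  refine ⟨?_, fun ξ hξ θ m ↦ ?_⟩
  · exact (hF.smooth.fderiv_of_isOpen (hW.prod isOpen_univ) (m := ∞) (by simp)).clm_apply
      contDiffOn_const
  · have h1 : F =ᶠ[𝓝 (ξ, θ)] fun y ↦ F (y + (0, latt m)) := by
      filter_upwards [(hW.prod isOpen_univ).mem_nhds (show (ξ, θ) ∈ W ×ˢ univ from ⟨hξ, mem_univ _⟩)]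
        with y hy
      have h2 : y + (0, latt m) = (y.1, y.2 + latt m) := by ext1 <;> simp
      rw [h2, hF.periodic _ hy.1]
    rw [Setting.pd, Setting.pd, h1.fderiv_eq, fderiv_comp_add_right]
    congr 2
    ext1 <;> simp

theorem hasDerivAt_integral (hF : Family W F) (hW : IsOpen W) {ξ : Euc n} (hξ : ξ ∈ W)
    (V : Euc n × Euc n) (p : Fin n → ℤ) :
    HasDerivAt (fun t : ℝ ↦ ∫ θ in box n, char (-p) θ * F (ξ + t • V.1, θ + t • V.2))
      (∫ θ in box n, char (-p) θ * Setting.pd V F (ξ, θ)) 0 := by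
  have hcont : Continuous fun t : ℝ ↦ ξ + t • V.1 := by fun_prop
  have h0 : ∀ᶠ t in 𝓝 (0 : ℝ), ξ + t • V.1 ∈ W :=
    hcont.continuousAt.eventually (hW.mem_nhds (by simpa using hξ))
  obtain ⟨ε, hε, hεW⟩ := Metric.nhds_basis_closedBall.eventually_iff.1 h0
  have hK : IsCompact ((fun z : ℝ × Euc n ↦ (ξ + z.1 • V.1, z.2 + z.1 • V.2)) ''
      (Metric.closedBall 0 ε ×ˢ box n)) :=
    ((isCompact_closedBall _ _).prod isCompact_box).image (by fun_prop)
  have hKW : (fun z : ℝ × Euc n ↦ (ξ + z.1 • V.1, z.2 + z.1 • V.2)) ''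
      (Metric.closedBall 0 ε ×ˢ box n) ⊆ W ×ˢ univ := by
    rintro - ⟨z, hz, rfl⟩
    exact ⟨hεW hz.1, mem_univ _⟩
  obtain ⟨C, hC⟩ := hK.exists_bound_of_continuousOn ((hF.pd hW V).smooth.continuousOn.mono hKW)
  have hcontF : ∀ t : ℝ, ξ + t • V.1 ∈ W → Continuous fun θ ↦
      char (-p) θ * F (ξ + t • V.1, θ + t • V.2) := fun t ht ↦
    (continuous_char _).mul ((hF.continuous ht).comp (continuous_add_right (t • V.2)))
  have hmain := hasDerivAt_integral_of_dominated_loc_of_deriv_le (μ := volume.restrict (box n))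
    (F := fun t θ ↦ char (-p) θ * F (ξ + t • V.1, θ + t • V.2))
    (F' := fun t θ ↦ char (-p) θ * Setting.pd V F (ξ + t • V.1, θ + t • V.2)) (x₀ := (0 : ℝ))
    (bound := fun _ ↦ C) (Metric.closedBall_mem_nhds 0 hε)
    (h0.mono fun t ht ↦ (hcontF t ht).aestronglyMeasurable)
    (integrableOn_box (hcontF 0 (by simpa using hξ)))
    (((continuous_char _).mul (((hF.pd hW V).continuous (by simpa using hξ)).comp
      (continuous_add_right ((0 : ℝ) • V.2)))).aestronglyMeasurable)
    ?_ ?_ ?_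
  · have h1 := hmain.2
    simp only [zero_smul, add_zero] at h1
    exact h1
  · refine (ae_restrict_mem isCompact_box.isClosed.measurableSet).mono fun θ hθ t ht ↦ ?_
    rw [norm_mul, norm_char, one_mul]
    exact hC _ ⟨(t, θ), ⟨ht, hθ⟩, rfl⟩
  · exact integrableOn_const isCompact_box.measure_lt_top.ne
  · refine Filter.Eventually.of_forall fun θ t ht ↦ ?_
    refine HasDerivAt.const_mul _ ?_
    have h1 : HasDerivAt (fun t : ℝ ↦ (ξ + t • V.1, θ + t • V.2)) V t := by
      have h2 : HasDerivAt (fun t : ℝ ↦ ξ + t • V.1) V.1 t := by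
        simpa using ((hasDerivAt_id t).smul_const V.1).const_add ξ
      have h3 : HasDerivAt (fun t : ℝ ↦ θ + t • V.2) V.2 t := by
        simpa using ((hasDerivAt_id t).smul_const V.2).const_add θ
      exact h2.prodMk h3
    exact (hF.differentiableAt hW (y := (ξ + t • V.1, θ + t • V.2))
      (hεW ht)).hasFDerivAt.comp_hasDerivAt t h1

/-- Fourier coefficients commute with derivatives in the parameter. -/
theorem hasDerivAt_fcf (hF : Family W F) (hW : IsOpen W) {ξ h : Euc n} {t : ℝ} (ht : ξ + t • h ∈ W)
    (p : Fin n → ℤ) : HasDerivAt (fun t : ℝ ↦ fcf F (ξ + t • h) p)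
      (fcf (Setting.pd (h, 0) F) (ξ + t • h) p) t := by
  have h1 := (hF.hasDerivAt_integral hW ht (h, 0) p).const_mul (((2 * Real.pi : ℂ) ^ n)⁻¹)
  have h2 : HasDerivAt (fun r : ℝ ↦ r - t) 1 t := (hasDerivAt_id t).sub_const t
  have h3 := HasDerivAt.scomp t (by rw [sub_self]; exact h1) h2
  rw [one_smul] at h3
  refine h3.congr_of_eventuallyEq (Filter.Eventually.of_forall fun r ↦ ?_)
  simp only [Function.comp_apply, fcf, fc, smul_zero, add_zero]
  have h4 : ξ + t • h + (r - t) • h = ξ + r • h := by rw [add_assoc, ← add_smul]; congr 2; ring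
  rw [h4]

/-- Fourier coefficients of derivatives along the torus. -/
theorem fcf_pd (hF : Family W F) (hW : IsOpen W) {ξ : Euc n} (hξ : ξ ∈ W) (u : Euc n)
    (p : Fin n → ℤ) :
    fcf (Setting.pd (0, u) F) ξ p = Complex.I * (inner ℝ (zvec p) u : ℝ) * fcf F ξ p := by
  have h1 := hF.hasDerivAt_integral hW hξ (0, u) p
  have h2 : ∀ t : ℝ, ∫ θ in box n, char (-p) θ * F (ξ + t • (0 : Euc n), θ + t • u) =
      Complex.exp (Complex.I * (inner ℝ (zvec p) u : ℝ) * t) *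
        ∫ θ in box n, char (-p) θ * F (ξ, θ) := fun t ↦ by
    have h3 := setIntegral_box_comp (ContinuousLinearEquiv.refl ℝ (Euc n)) (fun m ↦ ⟨m, rfl⟩)
      (fun m ↦ ⟨m, rfl⟩) (t • u) (F := fun θ ↦ char (-p) θ * F (ξ, θ)) fun θ m ↦ by
        rw [hF.periodic ξ hξ, char_add_right, char_latt, mul_one]
    rw [← h3, ← integral_const_mul]
    congr 1
    funext θ
    have h4 : Complex.exp (Complex.I * (inner ℝ (zvec p) u : ℝ) * t) = char p (t • u) := by
      rw [char, inner_smul_right]; push_cast; congr 1; ring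
    have h5 : char p (t • u) * char (-p) (t • u) = 1 := by
      rw [← char_add, add_neg_cancel, char_zero]
    rw [h4, smul_zero, add_zero]
    change _ = _ * (char (-p) (t • u + θ) * F (ξ, t • u + θ))
    rw [char_add_right, add_comm (t • u) θ]
    linear_combination (-(char (-p) θ * F (ξ, θ + t • u))) * h5
  simp only [h2] at h1
  have h3 : HasDerivAt (fun t : ℝ ↦ Complex.exp (Complex.I * (inner ℝ (zvec p) u : ℝ) * t))
      (Complex.I * (inner ℝ (zvec p) u : ℝ)) 0 := by
    have := ((Complex.ofRealCLM.hasDerivAt (x := (0 : ℝ))).const_mul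
      (Complex.I * (inner ℝ (zvec p) u : ℝ))).cexp
    simpa using this
  have h4 := h1.unique (h3.mul_const (∫ θ in box n, char (-p) θ * F (ξ, θ)))
  rw [fcf, fcf, fc, fc, h4]
  ring

end Family

/-- The operator `1 - ∑ ∂²/∂θⱼ²`. -/
def lapl (F : Euc n × Euc n → ℂ) (y : Euc n × Euc n) : ℂ :=
  F y - ∑ j, pd (0, EuclideanSpace.single j 1) (pd (0, EuclideanSpace.single j 1) F) y

theorem fcf_congr {ξ : Euc n} (h : ∀ θ, F (ξ, θ) = G (ξ, θ)) (p : Fin n → ℤ) :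
    fcf F ξ p = fcf G ξ p := by
  unfold fcf; congr 1; funext θ; exact h θ

theorem fc_sub {f g : Euc n → ℂ} (hf : Continuous f) (hg : Continuous g) (p : Fin n → ℤ) :
    fc (fun θ ↦ f θ - g θ) p = fc f p - fc g p := by
  have h := integral_sub (integrableOn_box ((continuous_char (-p)).mul hf))
    (integrableOn_box ((continuous_char (-p)).mul hg))
  simp only [Pi.mul_apply] at h
  rw [fc, fc, fc, ← mul_sub, ← h]
  simp only [mul_sub]

theorem fc_const_mul (a : ℂ) (f : Euc n → ℂ) (p : Fin n → ℤ) :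
    fc (fun θ ↦ a * f θ) p = a * fc f p := by
  rw [fc, fc, mul_left_comm a, ← integral_const_mul a]
  congr 2
  funext θ
  ring

theorem fc_sum {ι : Type*} {s : Finset ι} {f : ι → Euc n → ℂ} (hf : ∀ i, Continuous (f i))
    (p : Fin n → ℤ) : fc (fun θ ↦ ∑ i ∈ s, f i θ) p = ∑ i ∈ s, fc (f i) p := by
  simp only [fc, Finset.mul_sum]
  rw [integral_finsetSum s (f := fun i θ ↦ char (-p) θ * f i θ) fun i _ ↦ integrableOn_box ((continuous_char _).mul (hf i)),
    Finset.mul_sum]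

namespace Family

theorem lapl (hF : Family W F) (hW : IsOpen W) : Family W (lapl F) :=
  hF.sub (Family.sum fun _ ↦ (hF.pd hW _).pd hW _)

theorem fcf_lapl (hF : Family W F) (hW : IsOpen W) {ξ : Euc n} (hξ : ξ ∈ W) (p : Fin n → ℤ) :
    fcf (Setting.lapl F) ξ p = wt p * fcf F ξ p := by
  have h1 : ∀ j, Continuous fun θ ↦ Setting.pd (0, EuclideanSpace.single j 1)
      (Setting.pd (0, EuclideanSpace.single j 1) F) (ξ, θ) := fun j ↦
    ((hF.pd hW _).pd hW _).continuous hξ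
  have h2 : fcf (Setting.lapl F) ξ p = fcf F ξ p - ∑ j, fcf (Setting.pd (0, EuclideanSpace.single j 1)
      (Setting.pd (0, EuclideanSpace.single j 1) F)) ξ p := by
    unfold fcf
    rw [← fc_sum h1, ← fc_sub (hF.continuous hξ) (continuous_finset_sum _ fun j _ ↦ h1 j)]
    rfl
  have h3 : (wt p : ℂ) = 1 + ∑ j, (p j : ℂ) ^ 2 := by
    rw [wt, EuclideanSpace.norm_sq_eq]
    simp only [Real.norm_eq_abs, sq_abs, zvec_apply]
    push_cast
    rfl
  rw [h2, h3, add_mul, one_mul, Finset.sum_mul, sub_eq_add_neg, ← Finset.sum_neg_distrib]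
  congr 1
  refine Finset.sum_congr rfl fun j _ ↦ ?_
  rw [(hF.pd hW _).fcf_pd hW hξ, hF.fcf_pd hW hξ]
  have h4 : (inner ℝ (zvec p) (EuclideanSpace.single j (1 : ℝ)) : ℝ) = p j := by
    simp [EuclideanSpace.inner_single_right]
  rw [h4]
  push_cast
  linear_combination (-(p j : ℂ) ^ 2 * fcf F ξ p) * Complex.I_mul_I

/-- The Fourier coefficients of a smooth family decay rapidly, locally uniformly in the
parameter. -/
theorem decay (hF : Family W F) (hW : IsOpen W) {Q : Set (Euc n)} (hQ : IsCompact Q) (hQW : Q ⊆ W)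
    (M : ℕ) : ∃ C, 0 ≤ C ∧ ∀ ξ ∈ Q, ∀ p, ‖fcf F ξ p‖ ≤ C * (wt p)⁻¹ ^ M := by
  induction M generalizing F with
  | zero =>
    obtain ⟨C, hC⟩ := (hQ.prod (isCompact_box (n := n))).exists_bound_of_continuousOn
      (hF.smooth.continuousOn.mono (prod_mono hQW (subset_univ _)))
    refine ⟨max C 0, le_max_right _ _, fun ξ hξ p ↦ ?_⟩
    rw [pow_zero, mul_one]
    exact norm_fc_le (fun θ hθ ↦ (hC (ξ, θ) ⟨hξ, hθ⟩).trans (le_max_left _ _)) p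
  | succ M ih =>
    obtain ⟨C, hC0, hC⟩ := ih (hF.lapl hW)
    refine ⟨C, hC0, fun ξ hξ p ↦ ?_⟩
    have h1 := hC ξ hξ p
    have hw := wt_pos p
    rw [hF.fcf_lapl hW (hQW hξ), norm_mul, Complex.norm_real, Real.norm_of_nonneg hw.le] at h1
    rw [pow_succ, ← mul_assoc, ← div_eq_mul_inv, le_div_iff₀ hw, mul_comm]
    exact h1

theorem pd_eq_sum (h : Euc n) (y : Euc n × Euc n) :
    Setting.pd (h, 0) F y = ∑ j, (h j : ℂ) * Setting.pd (EuclideanSpace.single j 1, 0) F y := by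
  have h1 : ((h, 0) : Euc n × Euc n) =
      ∑ j, h j • ((EuclideanSpace.single j (1 : ℝ), 0) : Euc n × Euc n) := by
    have h2 : h = ∑ j, h j • EuclideanSpace.single j (1 : ℝ) := by
      ext l; simp [WithLp.ofLp_sum, Finset.sum_apply, Pi.single_apply]
    ext1
    · simp only [Prod.fst_sum, Prod.smul_fst]
      exact h2
    · simp [Prod.snd_sum]
  rw [Setting.pd, h1, map_sum]
  refine Finset.sum_congr rfl fun j _ ↦ ?_
  rw [map_smul, Complex.real_smul]
  rfl

theorem fcf_pd_eq_sum (hF : Family W F) (hW : IsOpen W) {ξ : Euc n} (hξ : ξ ∈ W) (h : Euc n)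
    (p : Fin n → ℤ) : fcf (Setting.pd (h, 0) F) ξ p =
      ∑ j, (h j : ℂ) * fcf (Setting.pd (EuclideanSpace.single j 1, 0) F) ξ p := by
  unfold fcf
  simp only [pd_eq_sum (F := F) h, ← fc_const_mul]
  exact fc_sum (fun j ↦ ((hF.pd hW _).continuous hξ).const_mul _) p

theorem decay_pd (hF : Family W F) (hW : IsOpen W) {Q : Set (Euc n)} (hQ : IsCompact Q)
    (hQW : Q ⊆ W) (M : ℕ) :
    ∃ C, 0 ≤ C ∧ ∀ ξ ∈ Q, ∀ h p, ‖fcf (Setting.pd (h, 0) F) ξ p‖ ≤ C * ‖h‖ * (wt p)⁻¹ ^ M := by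
  choose C hC0 hC using fun j : Fin n ↦ (hF.pd hW (EuclideanSpace.single j 1, 0)).decay hW hQ hQW M
  refine ⟨∑ j, C j, Finset.sum_nonneg fun j _ ↦ hC0 j, fun ξ hξ h p ↦ ?_⟩
  rw [hF.fcf_pd_eq_sum hW (hQW hξ), Finset.sum_mul, Finset.sum_mul]
  refine norm_sum_le_of_le _ fun j _ ↦ ?_
  rw [norm_mul, Complex.norm_real]
  calc ‖h j‖ * ‖fcf (Setting.pd (EuclideanSpace.single j 1, 0) F) ξ p‖
      ≤ ‖h‖ * (C j * (wt p)⁻¹ ^ M) := by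
        gcongr
        · exact PiLp.norm_apply_le h j
        · exact hC j ξ hξ p
    _ = C j * ‖h‖ * (wt p)⁻¹ ^ M := by ring

theorem decay_pd_pd (hF : Family W F) (hW : IsOpen W) {Q : Set (Euc n)} (hQ : IsCompact Q)
    (hQW : Q ⊆ W) (M : ℕ) : ∃ C, 0 ≤ C ∧ ∀ ξ ∈ Q, ∀ h p,
      ‖fcf (Setting.pd (h, 0) (Setting.pd (h, 0) F)) ξ p‖ ≤ C * ‖h‖ ^ 2 * (wt p)⁻¹ ^ M := by
  choose C hC0 hC using fun j : Fin n ↦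
    (hF.pd hW (EuclideanSpace.single j 1, 0)).decay_pd hW hQ hQW M
  refine ⟨∑ j, C j, Finset.sum_nonneg fun j _ ↦ hC0 j, fun ξ hξ h p ↦ ?_⟩
  have h1 : ∀ θ, Setting.pd (h, 0) (Setting.pd (h, 0) F) (ξ, θ) =
      ∑ j, (h j : ℂ) * Setting.pd (h, 0) (Setting.pd (EuclideanSpace.single j 1, 0) F) (ξ, θ) :=
    fun θ ↦ by
    have h2 : Setting.pd (h, 0) F = fun y ↦
        ∑ j, (h j : ℂ) * Setting.pd (EuclideanSpace.single j 1, 0) F y := funext fun y ↦ pd_eq_sum h y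
    have h3 : ∀ j, DifferentiableAt ℝ (Setting.pd (EuclideanSpace.single j 1, 0) F) (ξ, θ) :=
      fun j ↦ (hF.pd hW _).differentiableAt hW (hQW hξ)
    rw [Setting.pd, h2, fderiv_fun_sum fun j _ ↦ (h3 j).const_mul _, ContinuousLinearMap.sum_apply]
    refine Finset.sum_congr rfl fun j _ ↦ ?_
    rw [fderiv_const_mul (h3 j)]
    rfl
  have h2 : fcf (Setting.pd (h, 0) (Setting.pd (h, 0) F)) ξ p = ∑ j, (h j : ℂ) *
      fcf (Setting.pd (h, 0) (Setting.pd (EuclideanSpace.single j 1, 0) F)) ξ p := by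
    unfold fcf
    simp only [h1, ← fc_const_mul]
    exact fc_sum (fun j ↦ (((hF.pd hW _).pd hW _).continuous (hQW hξ)).const_mul _) p
  rw [h2, Finset.sum_mul, Finset.sum_mul]
  refine norm_sum_le_of_le _ fun j _ ↦ ?_
  rw [norm_mul, Complex.norm_real]
  calc ‖h j‖ * ‖fcf (Setting.pd (h, 0) (Setting.pd (EuclideanSpace.single j 1, 0) F)) ξ p‖
      ≤ ‖h‖ * (C j * ‖h‖ * (wt p)⁻¹ ^ M) := by
        gcongr
        · exact PiLp.norm_apply_le h j
        · exact hC j ξ hξ h p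
    _ = C j * ‖h‖ ^ 2 * (wt p)⁻¹ ^ M := by ring

/-- The Taylor formula of first order for the Fourier coefficients of a smooth family. -/
theorem taylor (hF : Family W F) (hW : IsOpen W) {Q : Set (Euc n)} (hQ : IsCompact Q)
    (hQc : Convex ℝ Q) (hQW : Q ⊆ W) (M : ℕ) : ∃ C, 0 ≤ C ∧ ∀ ξ ∈ Q, ∀ h, ξ + h ∈ Q → ∀ p,
      ‖fcf F (ξ + h) p - fcf F ξ p - fcf (Setting.pd (h, 0) F) ξ p‖ ≤
        C * ‖h‖ ^ 2 * (wt p)⁻¹ ^ M := by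
  obtain ⟨C, hC0, hC⟩ := hF.decay_pd_pd hW hQ hQW M
  refine ⟨C, hC0, fun ξ hξ h hh p ↦ ?_⟩
  have hseg : ∀ t ∈ Icc (0 : ℝ) 1, ξ + t • h ∈ Q := fun t ht ↦ hQc.add_smul_mem hξ hh ht
  have h0 : (0 : ℝ) ∈ Icc (0 : ℝ) 1 := left_mem_Icc.2 zero_le_one
  have hE : 0 ≤ C * ‖h‖ ^ 2 * (wt p)⁻¹ ^ M := (norm_nonneg _).trans (hC ξ hξ h p)
  have h1 : ∀ t ∈ Icc (0 : ℝ) 1, ‖fcf (Setting.pd (h, 0) F) (ξ + t • h) p -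
      fcf (Setting.pd (h, 0) F) ξ p‖ ≤ C * ‖h‖ ^ 2 * (wt p)⁻¹ ^ M := by
    intro t ht
    have h2 := (convex_Icc (0 : ℝ) 1).norm_image_sub_le_of_norm_hasDerivWithin_le
      (f := fun t : ℝ ↦ fcf (Setting.pd (h, 0) F) (ξ + t • h) p)
      (fun r hr ↦ ((hF.pd hW _).hasDerivAt_fcf hW (hQW (hseg r hr)) p).hasDerivWithinAt)
      (fun r hr ↦ hC _ (hseg r hr) h p) h0 ht
    simp only [zero_smul, add_zero, sub_zero] at h2
    refine h2.trans (mul_le_of_le_one_right hE ?_)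
    rw [Real.norm_eq_abs, abs_of_nonneg ht.1]
    exact ht.2
  have h2 := (convex_Icc (0 : ℝ) 1).norm_image_sub_le_of_norm_hasDerivWithin_le
    (f := fun t : ℝ ↦ fcf F (ξ + t • h) p - t • fcf (Setting.pd (h, 0) F) ξ p)
    (f' := fun t ↦ fcf (Setting.pd (h, 0) F) (ξ + t • h) p - fcf (Setting.pd (h, 0) F) ξ p)
    (fun r hr ↦ by
      have h3 : HasDerivWithinAt (fun t : ℝ ↦ t • fcf (Setting.pd (h, 0) F) ξ p)
          (fcf (Setting.pd (h, 0) F) ξ p) (Icc 0 1) r := by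
        simpa using ((hasDerivAt_id r).smul_const (fcf (Setting.pd (h, 0) F) ξ p)).hasDerivWithinAt
      exact (hF.hasDerivAt_fcf hW (hQW (hseg r hr)) p).hasDerivWithinAt.fun_sub h3)
    h1 h0 (right_mem_Icc.2 zero_le_one)
  simp only [zero_smul, add_zero, sub_zero, one_smul, norm_one, mul_one] at h2
  rw [sub_right_comm]
  exact h2

end Family

end Families

/-! ### The product formula in terms of Fourier coefficients -/

section Product

open MeasureTheory

variable {n : ℕ} {W Q V : Set (Euc n)} {F G : Euc n × Euc n → ℂ}

/-- The Poisson bracket of functions of action and angle coordinates. -/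
def brk (F G : Euc n × Euc n → ℂ) (y : Euc n × Euc n) : ℂ :=
  ∑ j, (pd (EuclideanSpace.single j 1, 0) F y * pd (0, EuclideanSpace.single j 1) G y -
    pd (0, EuclideanSpace.single j 1) F y * pd (EuclideanSpace.single j 1, 0) G y)

theorem Family.brk (hF : Family W F) (hG : Family W G) (hW : IsOpen W) : Family W (brk F G) :=
  Family.sum fun _ ↦ ((hF.pd hW _).mul (hG.pd hW _)).sub ((hF.pd hW _).mul (hG.pd hW _))

theorem Family.summable_fcf (hF : Family W F) (hW : IsOpen W) {ξ : Euc n} (hξ : ξ ∈ W) :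
    Summable fun p ↦ fcf F ξ p := by
  obtain ⟨C, -, hC⟩ := hF.decay hW isCompact_singleton (singleton_subset_iff.2 hξ) (n + 1)
  exact Summable.of_norm_bounded ((summable_inv_wt n.lt_succ_self).mul_left C)
    fun p ↦ hC ξ rfl p

theorem Family.hasSum_fcf_mul (hF : Family W F) (hG : Family W G) (hW : IsOpen W) {ξ : Euc n}
    (hξ : ξ ∈ W) (s : Fin n → ℤ) :
    HasSum (fun p ↦ fcf F ξ p * fcf G ξ (s - p)) (fcf (fun y ↦ F y * G y) ξ s) :=
  hasSum_fc_mul (hF.continuous hξ) (hF.periodic ξ hξ) (hF.summable_fcf hW hξ) (hG.continuous hξ) s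

/-- The first order Taylor polynomial in `ε` of `p ↦ F_p(ξ + ε q) G_q(ξ - ε p)`, `q = s - p`. -/
def jet (F G : Euc n × Euc n → ℂ) (ξ : Euc n) (ε : ℝ) (s p : Fin n → ℤ) : ℂ :=
  fcf F ξ p * fcf G ξ (s - p) + fcf (pd (ε • zvec (s - p), 0) F) ξ p * fcf G ξ (s - p) +
    fcf F ξ p * fcf (pd (-(ε • zvec p), 0) G) ξ (s - p)

theorem Family.hasSum_jet (hF : Family W F) (hG : Family W G) (hW : IsOpen W) {ξ : Euc n}
    (hξ : ξ ∈ W) (ε : ℝ) (s : Fin n → ℤ) :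
    HasSum (jet F G ξ ε s)
      (fcf (fun y ↦ F y * G y) ξ s + -Complex.I * ε * fcf (Setting.brk F G) ξ s) := by
  let e : Fin n → Euc n := fun j ↦ EuclideanSpace.single j 1
  have hx : ∀ {F}, Family W F → ∀ j, Family W (Setting.pd (e j, 0) F) := fun h j ↦ h.pd hW _
  have hθ : ∀ {F}, Family W F → ∀ j, Family W (Setting.pd (0, e j) F) := fun h j ↦ h.pd hW _
  have hfθ : ∀ {F}, Family W F → ∀ j p, fcf (Setting.pd (0, e j) F) ξ p =
      Complex.I * p j * fcf F ξ p := fun {F} h j p ↦ by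
    rw [h.fcf_pd hW hξ]
    have h4 : (inner ℝ (zvec p) (EuclideanSpace.single j (1 : ℝ)) : ℝ) = p j := by
      simp [EuclideanSpace.inner_single_right]
    rw [h4]
    push_cast
    rfl
  have h1 : HasSum (fun p ↦ ∑ j, fcf (Setting.pd (e j, 0) F) ξ p *
      fcf (Setting.pd (0, e j) G) ξ (s - p)) (∑ j, fcf (fun y ↦ Setting.pd (e j, 0) F y *
        Setting.pd (0, e j) G y) ξ s) :=
    hasSum_sum fun j _ ↦ (hx hF j).hasSum_fcf_mul (hθ hG j) hW hξ s
  have h2 : HasSum (fun p ↦ ∑ j, fcf (Setting.pd (0, e j) F) ξ p *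
      fcf (Setting.pd (e j, 0) G) ξ (s - p)) (∑ j, fcf (fun y ↦ Setting.pd (0, e j) F y *
        Setting.pd (e j, 0) G y) ξ s) :=
    hasSum_sum fun j _ ↦ (hθ hF j).hasSum_fcf_mul (hx hG j) hW hξ s
  have h3 : fcf (Setting.brk F G) ξ s = ∑ j, fcf (fun y ↦ Setting.pd (e j, 0) F y *
      Setting.pd (0, e j) G y) ξ s - ∑ j, fcf (fun y ↦ Setting.pd (0, e j) F y *
        Setting.pd (e j, 0) G y) ξ s := by
    rw [← Finset.sum_sub_distrib]
    refine (fc_sum (fun j ↦ (((hx hF j).mul (hθ hG j)).sub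
      ((hθ hF j).mul (hx hG j))).continuous hξ) s).trans (Finset.sum_congr rfl fun j _ ↦ ?_)
    exact fc_sub (((hx hF j).mul (hθ hG j)).continuous hξ)
      (((hθ hF j).mul (hx hG j)).continuous hξ) s
  have h4 := (hF.hasSum_fcf_mul hG hW hξ s).add ((h1.sub h2).mul_left (-Complex.I * ε))
  rw [h3]
  refine h4.congr_fun fun p ↦ ?_
  rw [jet, hF.fcf_pd_eq_sum hW hξ, hG.fcf_pd_eq_sum hW hξ, add_assoc]
  congr 1
  rw [Finset.sum_mul, Finset.mul_sum, ← Finset.sum_add_distrib, ← Finset.sum_sub_distrib,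
    Finset.mul_sum]
  refine Finset.sum_congr rfl fun j _ ↦ ?_
  rw [hfθ hF, hfθ hG]
  simp only [PiLp.smul_apply, PiLp.neg_apply, zvec_apply, smul_eq_mul]
  push_cast
  linear_combination (ε * (s - p) j * fcf (Setting.pd (e j, 0) F) ξ p * fcf G ξ (s - p) -
    (ε : ℂ) * p j * fcf F ξ p * fcf (Setting.pd (e j, 0) G) ξ (s - p)) * Complex.I_mul_I

/-- The convolution of the weights `wt⁻ᴹ` with themselves. -/
def conv (M : ℕ) (s : Fin n → ℤ) : ℝ := ∑' p, (wt p)⁻¹ ^ M * (wt (s - p))⁻¹ ^ M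

theorem summable_conv_aux {M : ℕ} (hM : n < M) :
    Summable fun z : (Fin n → ℤ) × (Fin n → ℤ) ↦ (wt z.2)⁻¹ ^ M * (wt (z.1 - z.2))⁻¹ ^ M := by
  have h0 : ∀ p : Fin n → ℤ, 0 ≤ (wt p)⁻¹ ^ M := fun p ↦
    pow_nonneg (inv_nonneg.2 (wt_pos p).le) M
  have h : Summable fun z : (Fin n → ℤ) × (Fin n → ℤ) ↦ (wt z.1)⁻¹ ^ M * (wt z.2)⁻¹ ^ M :=
    Summable.mul_of_nonneg (f := fun p ↦ (wt p)⁻¹ ^ M) (g := fun p ↦ (wt p)⁻¹ ^ M)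
      (summable_inv_wt hM) (summable_inv_wt hM) h0 h0
  let e : (Fin n → ℤ) × (Fin n → ℤ) → (Fin n → ℤ) × (Fin n → ℤ) := fun z ↦ (z.2, z.1 - z.2)
  have he : Function.Injective e := fun z z' hz ↦ by
    simp only [e, Prod.mk.injEq] at hz
    obtain ⟨h1, h2⟩ := hz
    rw [h1, sub_left_inj] at h2
    exact Prod.ext h2 h1
  exact (h.comp_injective he).congr fun z ↦ rfl

theorem summable_conv {M : ℕ} (hM : n < M) : Summable (conv (n := n) M) :=
  (summable_conv_aux hM).prod

theorem hasSum_conv {M : ℕ} (hM : n < M) (s : Fin n → ℤ) :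
    HasSum (fun p ↦ (wt p)⁻¹ ^ M * (wt (s - p))⁻¹ ^ M) (conv M s) :=
  ((summable_conv_aux hM).prod_factor s).hasSum

theorem Family.exists_bounds (hF : Family W F) (hW : IsOpen W) (hQ : IsCompact Q)
    (hQc : Convex ℝ Q) (hQW : Q ⊆ W) (M : ℕ) : ∃ A, 0 ≤ A ∧ ∀ ξ ∈ Q, ∀ p,
      ‖fcf F ξ p‖ ≤ A * (wt p)⁻¹ ^ M ∧
      (∀ h, ‖fcf (Setting.pd (h, 0) F) ξ p‖ ≤ A * ‖h‖ * (wt p)⁻¹ ^ M) ∧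
      ∀ h, ξ + h ∈ Q → ‖fcf F (ξ + h) p - fcf F ξ p - fcf (Setting.pd (h, 0) F) ξ p‖ ≤
        A * ‖h‖ ^ 2 * (wt p)⁻¹ ^ M := by
  obtain ⟨C₁, h₁, hC₁⟩ := hF.decay hW hQ hQW M
  obtain ⟨C₂, h₂, hC₂⟩ := hF.decay_pd hW hQ hQW M
  obtain ⟨C₃, h₃, hC₃⟩ := hF.taylor hW hQ hQc hQW M
  refine ⟨C₁ + C₂ + C₃, by positivity, fun ξ hξ p ↦ ?_⟩
  have hw : 0 ≤ (wt p)⁻¹ ^ M := pow_nonneg (inv_nonneg.2 (wt_pos p).le) M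
  refine ⟨(hC₁ ξ hξ p).trans ?_, fun h ↦ (hC₂ ξ hξ h p).trans ?_,
    fun h hh ↦ (hC₃ ξ hξ h hh p).trans ?_⟩
  · gcongr; linarith
  · gcongr; linarith
  · gcongr; linarith

/-- If `F₁ = F₀ + F' + O(h²)` and `G₁ = G₀ + G' + O(h'²)`, then
`F₁ G₁ = F₀ G₀ + F' G₀ + F₀ G'` up to terms of second order. -/
theorem norm_product_sub_jet_le {F₀ F₁ F' G₀ G₁ G' : ℂ} {A u v κ α β : ℝ} (hA : 0 ≤ A) (hu : 0 ≤ u)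
    (hv : 0 ≤ v) (hκ : 0 ≤ κ) (hκ1 : κ ≤ 1) (hα : 1 ≤ α) (hβ : 1 ≤ β)
    (hF0 : ‖F₀‖ ≤ A * u) (hF' : ‖F'‖ ≤ A * (κ * β) * u)
    (hF : ‖F₁ - F₀ - F'‖ ≤ A * (κ * β) ^ 2 * u)
    (hG1 : ‖G₁‖ ≤ A * v) (hG' : ‖G'‖ ≤ A * (κ * α) * v)
    (hG : ‖G₁ - G₀ - G'‖ ≤ A * (κ * α) ^ 2 * v) :
    ‖F₁ * G₁ - (F₀ * G₀ + F' * G₀ + F₀ * G')‖ ≤ 4 * A ^ 2 * κ ^ 2 * (α ^ 2 * β ^ 2) * (u * v) := by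
  have h1 : F₁ * G₁ - (F₀ * G₀ + F' * G₀ + F₀ * G') =
      (F₁ - F₀ - F') * G₁ + (F₀ + F') * (G₁ - G₀ - G') + F' * G' := by ring
  have hκβ : 0 ≤ κ * β := by positivity
  have h2 : ‖F₀ + F'‖ ≤ A * (2 * β) * u := by
    refine (norm_add_le _ _).trans ((add_le_add hF0 hF').trans ?_)
    have : κ * β ≤ β := mul_le_of_le_one_left (by positivity) hκ1
    have : 1 + κ * β ≤ 2 * β := by linarith
    calc A * u + A * (κ * β) * u = A * (1 + κ * β) * u := by ring
      _ ≤ _ := by gcongr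
  rw [h1]
  refine (norm_add₃_le).trans ?_
  rw [norm_mul, norm_mul, norm_mul]
  calc _ ≤ (A * (κ * β) ^ 2 * u) * (A * v) + (A * (2 * β) * u) * (A * (κ * α) ^ 2 * v) +
        (A * (κ * β) * u) * (A * (κ * α) * v) := by gcongr
    _ = A ^ 2 * κ ^ 2 * (β ^ 2 + 2 * (α ^ 2 * β) + α * β) * (u * v) := by ring
    _ ≤ A ^ 2 * κ ^ 2 * (4 * (α ^ 2 * β ^ 2)) * (u * v) := by
        gcongr
        have ha : 1 ≤ α ^ 2 := one_le_pow₀ hα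
        have hb : β ≤ β ^ 2 := le_self_pow₀ hβ two_ne_zero
        have ha' : α ≤ α ^ 2 := le_self_pow₀ hα two_ne_zero
        have e1 : β ^ 2 ≤ α ^ 2 * β ^ 2 := le_mul_of_one_le_left (by positivity) ha
        have e2 : α ^ 2 * β ≤ α ^ 2 * β ^ 2 := by gcongr
        have e3 : α * β ≤ α ^ 2 * β ^ 2 := by gcongr
        linarith
    _ = _ := by ring

set_option maxHeartbeats 1000000 in
/-- The sum over the lattice points `b = a - p / k` of `V` of the products of the Fourier
coefficients of `F` at `(a + b) / 2` and of `G` at `(b + c) / 2`, with phases close to `1`, is the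
Fourier coefficient of `F G + (-i / 2k) {F, G}` at `(a + c) / 2` up to `O(k⁻²)`. -/
theorem Family.exists_product_bound (hF : Family W F) (hG : Family W G) (hW : IsOpen W)
    (hQ : IsCompact Q) (hQc : Convex ℝ Q) (hQW : Q ⊆ W) (hVQ : V ⊆ Q) {ρ C₀ : ℝ} (hρ : 0 < ρ)
    (hC₀ : 0 ≤ C₀) : ∃ w : (Fin n → ℤ) → ℝ, Summable w ∧ (∀ s, 0 ≤ w s) ∧
    ∀ k : ℕ, 1 ≤ k → ∀ a ∈ V, ∀ c ∈ V, Metric.ball a ρ ⊆ V → ∀ s : Fin n → ℤ,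
    zvec s = (k : ℝ) • (a - c) → ∀ (P : Finset (Fin n → ℤ)) (e : (Fin n → ℤ) → ℂ) (e₀ : ℂ),
    (∀ p, p ∈ P ↔ a - (k : ℝ)⁻¹ • zvec p ∈ V) →
    (∀ p ∈ P, ‖e p - 1‖ ≤ C₀ * ((k : ℝ)⁻¹) ^ 2 * (wt p ^ 2 * wt (s - p) ^ 2)) →
    ‖e₀ - 1‖ ≤ C₀ * ((k : ℝ)⁻¹) ^ 2 * wt s ^ 2 →
    ‖∑ p ∈ P, e p * (fcf F ((1 / 2 : ℝ) • (a + (a - (k : ℝ)⁻¹ • zvec p))) p *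
        fcf G ((1 / 2 : ℝ) • ((a - (k : ℝ)⁻¹ • zvec p) + c)) (s - p)) -
      e₀ * (fcf (fun y ↦ F y * G y) ((1 / 2 : ℝ) • (a + c)) s +
        -Complex.I / (2 * k) * fcf (Setting.brk F G) ((1 / 2 : ℝ) • (a + c)) s)‖ ≤
      w s * ((k : ℝ)⁻¹) ^ 2 := by
  obtain ⟨A₁, hA₁, hF₁⟩ := hF.exists_bounds hW hQ hQc hQW (n + 4)
  obtain ⟨A₂, hA₂, hG₁⟩ := hG.exists_bounds hW hQ hQc hQW (n + 4)
  obtain ⟨A₃, hA₃, hFG⟩ := (hF.mul hG).decay hW hQ hQW (n + 3)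
  obtain ⟨A₄, hA₄, hbr⟩ := (hF.brk hG hW).decay hW hQ hQW (n + 3)
  set A := A₁ + A₂ with hAdef
  have hA : 0 ≤ A := by positivity
  have hA1 : A₁ ≤ A := by linarith
  have hA2 : A₂ ≤ A := by linarith
  set D := A ^ 2 * (4 + C₀ + 3 * (ρ⁻¹) ^ 2) with hD
  refine ⟨fun s ↦ D * conv (n + 1) s + C₀ * (A₃ + A₄) * (wt s)⁻¹ ^ (n + 1),
    ((summable_conv n.lt_succ_self).mul_left _).add ((summable_inv_wt n.lt_succ_self).mul_left _),
    fun s ↦ ?_, ?_⟩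
  · have h1 : ∀ p : Fin n → ℤ, 0 ≤ (wt p)⁻¹ := fun p ↦ inv_nonneg.2 (wt_pos p).le
    have h2 : 0 ≤ conv (n + 1) s := tsum_nonneg fun p ↦
      mul_nonneg (pow_nonneg (h1 _) _) (pow_nonneg (h1 _) _)
    have := h1 s
    positivity
  intro k hk a ha c hc haV s hs P e e₀ hP he he₀
  have hk0 : (0 : ℝ) < k := by exact_mod_cast hk
  set κ := (k : ℝ)⁻¹ with hκdef
  have hκ : 0 < κ := inv_pos.2 hk0
  have hκ1 : κ ≤ 1 := inv_le_one_of_one_le₀ (by exact_mod_cast hk)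
  set m := (1 / 2 : ℝ) • (a + c) with hm
  have hmid : ∀ x ∈ Q, ∀ y ∈ Q, (1 / 2 : ℝ) • (x + y) ∈ Q := fun x hx y hy ↦ by
    rw [smul_add]; exact hQc hx hy (by norm_num) (by norm_num) (by norm_num)
  have hmQ : m ∈ Q := hmid _ (hVQ ha) _ (hVQ hc)
  have hsum := hF.hasSum_jet hG hW (hQW hmQ) (κ / 2) s
  have hI : -Complex.I * ((κ / 2 : ℝ) : ℂ) = -Complex.I / (2 * k) := by
    rw [hκdef]; push_cast; field_simp
  rw [hI] at hsum
  set R := fcf (fun y ↦ F y * G y) m s + -Complex.I / (2 * k) * fcf (Setting.brk F G) m s with hR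
  classical
  let X : (Fin n → ℤ) → ℂ := fun p ↦ e p * (fcf F ((1 / 2 : ℝ) • (a + (a - κ • zvec p))) p *
        fcf G ((1 / 2 : ℝ) • ((a - κ • zvec p) + c)) (s - p))
  have hX : HasSum (fun p ↦ if p ∈ P then X p else 0) (∑ p ∈ P, X p) := by
    rw [Finset.sum_congr rfl fun p hp ↦ (if_pos hp).symm]
    exact hasSum_sum_of_ne_finset_zero fun p hp ↦ if_neg hp
  have hac : a - c = κ • zvec s := by rw [hs, smul_smul, inv_mul_cancel₀ hk0.ne', one_smul]
  have hnz : ∀ p : Fin n → ℤ, ‖(κ / 2) • zvec p‖ ≤ κ * wt p := fun p ↦ by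
    rw [norm_smul, Real.norm_of_nonneg (by positivity)]
    have := norm_zvec_le_wt p
    have := norm_nonneg (zvec p)
    gcongr
    linarith
  -- the loss of three powers of the weights
  have hω : ∀ p : Fin n → ℤ, wt p ^ 3 * (wt p)⁻¹ ^ (n + 4) = (wt p)⁻¹ ^ (n + 1) := fun p ↦ by
    rw [show n + 4 = 3 + (n + 1) by ring, pow_add _ 3 (n + 1), ← mul_assoc, ← mul_pow,
      mul_inv_cancel₀ (wt_pos p).ne', one_pow, one_mul]
  have hterm : ∀ p, ‖(if p ∈ P then X p else 0) - jet F G m (κ / 2) s p‖ ≤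
      D * κ ^ 2 * ((wt p)⁻¹ ^ (n + 1) * (wt (s - p))⁻¹ ^ (n + 1)) := by
    intro p
    set α := wt p with hα
    set β := wt (s - p) with hβ
    have hα1 : 1 ≤ α := one_le_wt p
    have hβ1 : 1 ≤ β := one_le_wt (s - p)
    have hα0 : 0 < α := wt_pos p
    have hβ0 : 0 < β := wt_pos (s - p)
    set u := α⁻¹ ^ (n + 4) with hu
    set v := β⁻¹ ^ (n + 4) with hv
    have hu0 : 0 ≤ u := by positivity
    have hv0 : 0 ≤ v := by positivity
    have hq : ‖(κ / 2) • zvec (s - p)‖ ≤ κ * β := hnz _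
    have hp' : ‖-((κ / 2) • zvec p)‖ ≤ κ * α := by rw [norm_neg]; exact hnz p
    have bF0 : ∀ ξ ∈ Q, ‖fcf F ξ p‖ ≤ A * u := fun ξ hξ ↦
      ((hF₁ ξ hξ p).1).trans (by gcongr)
    have bG0 : ∀ ξ ∈ Q, ‖fcf G ξ (s - p)‖ ≤ A * v := fun ξ hξ ↦
      ((hG₁ ξ hξ _).1).trans (by gcongr)
    have bF' : ‖fcf (Setting.pd ((κ / 2) • zvec (s - p), 0) F) m p‖ ≤ A * (κ * β) * u :=
      ((hF₁ m hmQ p).2.1 _).trans (by gcongr)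
    have bG' : ‖fcf (Setting.pd (-((κ / 2) • zvec p), 0) G) m (s - p)‖ ≤ A * (κ * α) * v :=
      ((hG₁ m hmQ _).2.1 _).trans (by gcongr)
    have hfin : D * κ ^ 2 * (α⁻¹ ^ (n + 1) * β⁻¹ ^ (n + 1)) =
        D * κ ^ 2 * (α ^ 3 * β ^ 3) * (u * v) := by
      rw [← hω p, ← hω (s - p)]; ring
    have hmono : α ^ 2 * β ^ 2 ≤ α ^ 3 * β ^ 3 := by gcongr <;> first | assumption | norm_num
    rw [hfin]
    by_cases hpP : p ∈ P
    · rw [if_pos hpP]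
      have hb := (hP p).1 hpP
      -- For `b = a - κ p` the midpoints of `a, b` and of `b, c` are shifted from `m = (a + c) / 2` by
      -- `κ (s - p) / 2` and by `-κ p / 2`; their first order terms give the Poisson bracket.
      have e1 : (1 / 2 : ℝ) • (a + (a - κ • zvec p)) = m + (κ / 2) • zvec (s - p) := by
        have : (κ / 2) • zvec (s - p) = (1 / 2 : ℝ) • (a - c) - (1 / 2 : ℝ) • κ • zvec p := by
          rw [zvec_sub, hac, ← smul_sub, ← smul_sub, smul_smul]; congr 1; ring
        rw [this, hm]; module
      have e2 : (1 / 2 : ℝ) • ((a - κ • zvec p) + c) = m + -((κ / 2) • zvec p) := by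
        rw [hm]; module
      have m1 := hmid _ (hVQ ha) _ (hVQ hb)
      have m2 := hmid _ (hVQ hb) _ (hVQ hc)
      have hXe : X p = e p * (fcf F (m + (κ / 2) • zvec (s - p)) p *
        fcf G (m + -((κ / 2) • zvec p)) (s - p)) := by rw [← e1, ← e2]
      rw [e1] at m1
      rw [e2] at m2
      rw [hXe]
      set F₁' := fcf F (m + (κ / 2) • zvec (s - p)) p
      set G₁' := fcf G (m + -((κ / 2) • zvec p)) (s - p)
      have b1 := norm_product_sub_jet_le hA hu0 hv0 hκ.le hκ1 hα1 hβ1 (bF0 m hmQ) bF'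
        (((hF₁ m hmQ p).2.2 _ m1).trans (by gcongr)) (bG0 _ m2) bG'
        (((hG₁ m hmQ _).2.2 _ m2).trans (by gcongr))
      have b2 : ‖(e p - 1) * (F₁' * G₁')‖ ≤ C₀ * κ ^ 2 * (α ^ 2 * β ^ 2) * ((A * u) * (A * v)) := by
        rw [norm_mul, norm_mul]
        have := he p hpP
        have := bF0 _ m1
        have := bG0 _ m2
        gcongr
      have e3 : e p * (F₁' * G₁') - jet F G m (κ / 2) s p =
        (e p - 1) * (F₁' * G₁') + (F₁' * G₁' - jet F G m (κ / 2) s p) := by ring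
      rw [e3]
      refine (norm_add_le _ _).trans ((add_le_add b2 b1).trans ?_)
      calc _ = A ^ 2 * (4 + C₀) * κ ^ 2 * (α ^ 2 * β ^ 2) * (u * v) := by ring
        _ ≤ A ^ 2 * (4 + C₀ + 3 * (ρ⁻¹) ^ 2) * κ ^ 2 * (α ^ 3 * β ^ 3) * (u * v) := by
            have h4 : 4 + C₀ ≤ 4 + C₀ + 3 * (ρ⁻¹) ^ 2 := le_add_of_nonneg_right (by positivity)
            gcongr ?_ * _ * ?_ * _
            exact mul_le_mul_of_nonneg_left h4 (by positivity)
    · rw [if_neg hpP, zero_sub, norm_neg]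
      -- The terms of the full convolution that are missing from the sum have `k⁻¹ ‖p‖ ≥ ρ`, and are
      -- small by the decay of the Fourier coefficients.
      have hfar : ρ ≤ κ * ‖zvec p‖ := by
        by_contra! h
        refine hpP ((hP p).2 (haV ?_))
        rw [mem_ball_iff_norm, sub_sub_cancel_left, norm_neg, norm_smul, Real.norm_of_nonneg hκ.le]
        exact h
      have hone : 1 ≤ (ρ⁻¹) ^ 2 * κ ^ 2 * α := by
        have h1 : 1 ≤ ρ⁻¹ * (κ * ‖zvec p‖) := by
          rw [← inv_mul_cancel₀ hρ.ne']; gcongr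
        have h2 : ‖zvec p‖ ^ 2 ≤ α := by rw [hα, wt]; linarith
        calc (1 : ℝ) ≤ (ρ⁻¹ * (κ * ‖zvec p‖)) ^ 2 := one_le_pow₀ h1
          _ = (ρ⁻¹) ^ 2 * κ ^ 2 * ‖zvec p‖ ^ 2 := by ring
          _ ≤ _ := by gcongr
      have b1 : ‖jet F G m (κ / 2) s p‖ ≤ A ^ 2 * (3 * (α * β)) * (u * v) := by
        rw [jet]
        refine (norm_add₃_le).trans ?_
        rw [norm_mul, norm_mul, norm_mul]
        have := bF0 m hmQ
        have := bG0 m hmQ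
        calc _ ≤ (A * u) * (A * v) + (A * (κ * β) * u) * (A * v) + (A * u) * (A * (κ * α) * v) := by
              gcongr
          _ = A ^ 2 * (1 + κ * β + κ * α) * (u * v) := by ring
          _ ≤ _ := by
              gcongr
              have : κ * β ≤ β := mul_le_of_le_one_left hβ0.le hκ1
              have : κ * α ≤ α := mul_le_of_le_one_left hα0.le hκ1
              have : α ≤ α * β := le_mul_of_one_le_right hα0.le hβ1
              have : β ≤ α * β := le_mul_of_one_le_left hβ0.le hα1
              linarith
      refine b1.trans ?_
      calc A ^ 2 * (3 * (α * β)) * (u * v) = A ^ 2 * (3 * (α * β)) * 1 * (u * v) := by ring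
        _ ≤ A ^ 2 * (3 * (α * β)) * ((ρ⁻¹) ^ 2 * κ ^ 2 * α) * (u * v) := by gcongr
        _ = A ^ 2 * (3 * (ρ⁻¹) ^ 2) * κ ^ 2 * (α ^ 2 * β) * (u * v) := by ring
        _ ≤ A ^ 2 * (4 + C₀ + 3 * (ρ⁻¹) ^ 2) * κ ^ 2 * (α ^ 3 * β ^ 3) * (u * v) := by
            have h4 : 3 * (ρ⁻¹) ^ 2 ≤ 4 + C₀ + 3 * (ρ⁻¹) ^ 2 :=
              le_add_of_nonneg_left (by positivity)
            have h5 : α ^ 2 * β ≤ α ^ 3 * β ^ 3 :=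
              mul_le_mul (pow_le_pow_right₀ hα1 (by norm_num)) (le_self_pow₀ hβ1 (by norm_num))
                hβ0.le (by positivity)
            gcongr ?_ * _ * ?_ * _
            exact mul_le_mul_of_nonneg_left h4 (by positivity)
  have b1 : ‖∑ p ∈ P, X p - R‖ ≤ D * κ ^ 2 * conv (n + 1) s :=
    (hX.sub hsum).norm_le_of_bounded ((hasSum_conv n.lt_succ_self s).mul_left _) hterm
  have b2 : ‖(e₀ - 1) * R‖ ≤ C₀ * (A₃ + A₄) * (wt s)⁻¹ ^ (n + 1) * κ ^ 2 := by
    have h1 : ‖R‖ ≤ (A₃ + A₄) * (wt s)⁻¹ ^ (n + 3) := by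
      refine (norm_add_le _ _).trans ?_
      rw [add_mul, norm_mul]
      have h2 : ‖-Complex.I / (2 * k)‖ ≤ 1 := by
        rw [norm_div, norm_neg, Complex.norm_I, norm_mul, Complex.norm_natCast, Complex.norm_ofNat,
          div_le_one (by positivity)]
        have : (1 : ℝ) ≤ k := by exact_mod_cast hk
        linarith
      exact add_le_add (hFG m hmQ s)
        ((mul_le_of_le_one_left (norm_nonneg _) h2).trans (hbr m hmQ s))
    have h3 : wt s ^ 2 * (wt s)⁻¹ ^ (n + 3) = (wt s)⁻¹ ^ (n + 1) := by
      rw [show n + 3 = 2 + (n + 1) by ring, pow_add _ 2 (n + 1), ← mul_assoc, ← mul_pow,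
        mul_inv_cancel₀ (wt_pos s).ne', one_pow, one_mul]
    rw [norm_mul]
    have := wt_pos s
    calc ‖e₀ - 1‖ * ‖R‖ ≤ (C₀ * κ ^ 2 * wt s ^ 2) * ((A₃ + A₄) * (wt s)⁻¹ ^ (n + 3)) := by gcongr
      _ = C₀ * (A₃ + A₄) * (wt s ^ 2 * (wt s)⁻¹ ^ (n + 3)) * κ ^ 2 := by ring
      _ = _ := by rw [h3]
  have e4 : ∑ p ∈ P, X p - e₀ * R = (∑ p ∈ P, X p - R) - (e₀ - 1) * R := by ring
  change ‖∑ p ∈ P, X p - e₀ * R‖ ≤ _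
  rw [e4]
  refine (norm_sub_le _ _).trans ((add_le_add b1 b2).trans (le_of_eq ?_))
  ring

end Product

/-! ### Observables and their Poisson brackets in action-angle coordinates -/

section Observables

variable [T2Space X] [VectorBundle ℂ ℂ L] [ContMDiffVectorBundle ∞ ℂ L (𝓡 (2 * n))]

variable {f g : X → ℂ}

/-- The function `f` is smooth in all action-angle coordinate systems. -/
def SmoothInCharts (S : Setting n X B L) (f : X → ℂ) : Prop :=
  ∀ c : S.Chart, Family (c.x '' c.V) fun y ↦ f (c.Ψ y)

theorem smoothInCharts (hf : ContMDiff (𝓡 (2 * n)) 𝓘(ℝ, ℂ) ∞ f) : S.SmoothInCharts f := by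
  refine fun c ↦ ⟨?_, fun ξ hξ θ m ↦ congrArg f ((c.periodic ξ hξ _ _).2 ⟨m, fun i ↦ by simp⟩)⟩
  exact (hf.comp_contMDiffOn c.smooth).contDiffOn

theorem SmoothInCharts.mul (hf : S.SmoothInCharts f) (hg : S.SmoothInCharts g) :
    S.SmoothInCharts (f * g) := fun c ↦ (hf c).mul (hg c)

theorem hamVec_Ψ {c : S.Chart} {y : Euc n × Euc n} (hy : y.1 ∈ c.x '' c.V)
    {α : TangentSpace (𝓡 (2 * n)) (c.Ψ y) → ℝ} {D : Euc n × Euc n →L[ℝ] ℝ}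
    (hD : ∀ w, α (c.dΨ y.1 y.2 w) = D w) :
    hamVec S.Ω (c.Ψ y) α = c.dΨ y.1 y.2 (WithLp.toLp 2 fun i ↦ D (0, EuclideanSpace.single i 1),
      WithLp.toLp 2 fun i ↦ -D (EuclideanSpace.single i 1, 0)) := by
  have hsurj := (bijective_dΨ c hy).2
  have hΩ : ∀ u w, S.Ω (c.Ψ y) ![c.dΨ y.1 y.2 u, c.dΨ y.1 y.2 w] =
      ∑ i, (u.1 i * w.2 i - w.1 i * u.2 i) := fun u w ↦ c.symplectic y.1 hy y.2 u w
  have hdec : ∀ w : Euc n × Euc n, D w = ∑ i, (D (0, EuclideanSpace.single i 1) * w.2 i -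
      w.1 i * -D (EuclideanSpace.single i 1, 0)) := fun w ↦ by
    have h1 : w = ∑ i, (w.1 i • ((EuclideanSpace.single i (1 : ℝ), 0) : Euc n × Euc n) +
        w.2 i • ((0, EuclideanSpace.single i (1 : ℝ)) : Euc n × Euc n)) := by
      ext j <;> simp [Prod.fst_sum, Prod.snd_sum, WithLp.ofLp_sum, Finset.sum_apply,
        Pi.single_apply]
    conv_lhs => rw [h1]
    simp only [map_sum, map_add, map_smul, smul_eq_mul]
    exact Finset.sum_congr rfl fun i _ ↦ by ring
  have hex : ∃ Y : TangentSpace (𝓡 (2 * n)) (c.Ψ y), ∀ w, S.Ω (c.Ψ y) ![Y, w] = α w := by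
    refine ⟨c.dΨ y.1 y.2 (WithLp.toLp 2 fun i ↦ D (0, EuclideanSpace.single i 1),
      WithLp.toLp 2 fun i ↦ -D (EuclideanSpace.single i 1, 0)), fun w ↦ ?_⟩
    obtain ⟨w, rfl⟩ := hsurj w
    rw [hΩ, hD, hdec w]
  have hspec : ∀ w, S.Ω (c.Ψ y) ![hamVec S.Ω (c.Ψ y) α, w] = α w := by
    rw [hamVec, dif_pos hex]
    exact hex.choose_spec
  obtain ⟨u, hu⟩ := hsurj (hamVec S.Ω (c.Ψ y) α)
  have hu' : ∀ w : Euc n × Euc n, ∑ i, (u.1 i * w.2 i - w.1 i * u.2 i) = D w := fun w ↦ by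
    rw [← hΩ, hu, hspec, hD]
  rw [← hu]
  congr 1
  ext i
  · have := hu' (0, EuclideanSpace.single i 1)
    simpa using this
  · have := hu' (EuclideanSpace.single i 1, 0)
    have h2 : -u.2 i = D (EuclideanSpace.single i 1, 0) := by simpa using this
    change u.2 i = -D (EuclideanSpace.single i 1, 0)
    rw [← h2, neg_neg]

/-- The Poisson bracket, defined by Hamiltonian vector fields of real and imaginary parts, is the
bracket `∑ (∂f/∂xᵢ ∂g/∂θᵢ - ∂f/∂θᵢ ∂g/∂xᵢ)` in action-angle coordinates. -/
theorem poisson_Ψ (hf : ContMDiff (𝓡 (2 * n)) 𝓘(ℝ, ℂ) ∞ f)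
    (hg : ContMDiff (𝓡 (2 * n)) 𝓘(ℝ, ℂ) ∞ g) {c : S.Chart} {y : Euc n × Euc n}
    (hy : y.1 ∈ c.x '' c.V) :
    poisson S.Ω f g (c.Ψ y) = brk (fun y ↦ f (c.Ψ y)) (fun y ↦ g (c.Ψ y)) y := by
  obtain ⟨-, hF⟩ := hasFDerivAt_comp_Ψ hy ((hf (c.Ψ y)).mdifferentiableAt (n := ∞) (by simp))
  obtain ⟨-, hG⟩ := hasFDerivAt_comp_Ψ hy ((hg (c.Ψ y)).mdifferentiableAt (n := ∞) (by simp))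
  set DF := fderiv ℝ (fun z ↦ f (c.Ψ z)) y
  set DG := fderiv ℝ (fun z ↦ g (c.Ψ z)) y
  have h1 : ∀ u : Euc n × Euc n, DG u = ∑ i, ((u.1 i : ℂ) * DG (EuclideanSpace.single i 1, 0) +
      (u.2 i : ℂ) * DG (0, EuclideanSpace.single i 1)) := fun u ↦ by
    have h1 : u = ∑ i, (u.1 i • ((EuclideanSpace.single i (1 : ℝ), 0) : Euc n × Euc n) +
        u.2 i • ((0, EuclideanSpace.single i (1 : ℝ)) : Euc n × Euc n)) := by
      ext j <;> simp [Prod.fst_sum, Prod.snd_sum, WithLp.ofLp_sum, Finset.sum_apply,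
        Pi.single_apply]
    conv_lhs => rw [h1]
    simp only [map_sum, map_add, map_smul, Complex.real_smul]
  rw [poisson, hamVec_Ψ hy (D := Complex.reCLM.comp DF) fun w ↦ congrArg Complex.re (hF w).symm,
    hamVec_Ψ hy (D := Complex.imCLM.comp DF) fun w ↦ congrArg Complex.im (hF w).symm,
    ← hG, ← hG, h1, h1, brk, Finset.mul_sum, ← Finset.sum_add_distrib, ← Finset.sum_neg_distrib]
  refine Finset.sum_congr rfl fun i _ ↦ ?_
  change _ = DF (EuclideanSpace.single i 1, 0) * DG (0, EuclideanSpace.single i 1) -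
    DF (0, EuclideanSpace.single i 1) * DG (EuclideanSpace.single i 1, 0)
  simp only [ContinuousLinearMap.comp_apply, Complex.reCLM_apply, Complex.imCLM_apply]
  conv_rhs => rw [← Complex.re_add_im (DF (EuclideanSpace.single i 1, 0)),
    ← Complex.re_add_im (DF (0, EuclideanSpace.single i 1))]
  push_cast
  ring

theorem smoothInCharts_poisson (hf : ContMDiff (𝓡 (2 * n)) 𝓘(ℝ, ℂ) ∞ f)
    (hg : ContMDiff (𝓡 (2 * n)) 𝓘(ℝ, ℂ) ∞ g) : S.SmoothInCharts (poisson S.Ω f g) := fun c ↦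
  ((smoothInCharts (S := S) hf c).brk (smoothInCharts (S := S) hg c) c.isOpen_image).congr
    fun ξ hξ θ ↦ poisson_Ψ (y := (ξ, θ)) hf hg hξ

theorem poisson_eq_zero {p : X} (hp : p ∉ tsupport g) : poisson S.Ω f g p = 0 := by
  have h1 : mfderiv (𝓡 (2 * n)) 𝓘(ℝ, ℂ) g p = 0 := by
    rw [(notMem_tsupport_iff_eventuallyEq.1 hp).mfderiv_eq]
    exact mfderiv_const
  have h2 : ∀ v, dC g p v = 0 := fun v ↦ by
    change NormedSpace.fromTangentSpace (g p) (mfderiv (𝓡 (2 * n)) 𝓘(ℝ, ℂ) g p v) = 0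
    rw [h1]
    exact map_zero _
  rw [poisson, h2, h2, mul_zero, add_zero, neg_zero]

end Observables

/-! ### Schur's test -/

section Schur

variable {E ι : Type*} [NormedAddCommGroup E] [InnerProductSpace ℂ E]

/-- Schur's test for an operator that is given by a matrix with respect to an orthonormal family. -/
theorem norm_sum_matrix_le {v : ι → E} (hv : Orthonormal ℂ v) (s : Finset ι) {d : ι → ι → ℂ} {R : ℝ}
    (hR : 0 ≤ R) (hrow : ∀ b ∈ s, ∑ c ∈ s, ‖d b c‖ ≤ R) (hcol : ∀ c ∈ s, ∑ b ∈ s, ‖d b c‖ ≤ R)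
    (x : E) : ‖∑ b ∈ s, (∑ c ∈ s, d b c * inner ℂ (v c) x) • v b‖ ≤ R * ‖x‖ := by
  have h1 : ‖∑ b ∈ s, (∑ c ∈ s, d b c * inner ℂ (v c) x) • v b‖ ^ 2 =
      ∑ b ∈ s, ‖∑ c ∈ s, d b c * inner ℂ (v c) x‖ ^ 2 := by
    rw [← inner_self_eq_norm_sq (𝕜 := ℂ), hv.inner_sum, map_sum]
    refine Finset.sum_congr rfl fun b _ ↦ ?_
    rw [Complex.conj_mul', ← Complex.ofReal_pow]
    exact Complex.ofReal_re _
  refine abs_le_of_sq_le_sq' ?_ (by positivity) |>.2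
  rw [h1, mul_pow]
  calc ∑ b ∈ s, ‖∑ c ∈ s, d b c * inner ℂ (v c) x‖ ^ 2
      ≤ ∑ b ∈ s, R * ∑ c ∈ s, ‖d b c‖ * ‖inner ℂ (v c) x‖ ^ 2 := by
        refine Finset.sum_le_sum fun b hb ↦ ?_
        have h2 : ‖∑ c ∈ s, d b c * inner ℂ (v c) x‖ ≤ ∑ c ∈ s, ‖d b c‖ * ‖inner ℂ (v c) x‖ :=
          norm_sum_le_of_le _ fun c _ ↦ (norm_mul _ _).le
        refine (pow_le_pow_left₀ (norm_nonneg _) h2 2).trans ?_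
        refine (Finset.sum_sq_le_sum_mul_sum_of_sq_eq_mul s (f := fun c ↦ ‖d b c‖)
          (g := fun c ↦ ‖d b c‖ * ‖inner ℂ (v c) x‖ ^ 2) (fun c _ ↦ norm_nonneg _)
          (fun c _ ↦ by positivity) fun c _ ↦ by ring).trans ?_
        exact mul_le_mul_of_nonneg_right (hrow b hb) (Finset.sum_nonneg fun c _ ↦ by positivity)
    _ = R * ∑ c ∈ s, (∑ b ∈ s, ‖d b c‖) * ‖inner ℂ (v c) x‖ ^ 2 := by
        rw [← Finset.mul_sum, Finset.sum_comm]
        simp only [Finset.sum_mul]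
    _ ≤ R * ∑ c ∈ s, R * ‖inner ℂ (v c) x‖ ^ 2 := by
        refine mul_le_mul_of_nonneg_left (Finset.sum_le_sum fun c hc ↦ ?_) hR
        exact mul_le_mul_of_nonneg_right (hcol c hc) (by positivity)
    _ = R ^ 2 * ∑ c ∈ s, ‖inner ℂ (v c) x‖ ^ 2 := by rw [← Finset.mul_sum]; ring
    _ ≤ R ^ 2 * ‖x‖ ^ 2 := by
        gcongr
        exact hv.sum_inner_products_le x

/-- The operator with matrix `d` with respect to the vectors `v b`, `b ∈ s`. -/
def matOp (v : ι → E) (s : Finset ι) (d : ι → ι → ℂ) : E →L[ℂ] E :=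
  ∑ b ∈ s, (∑ c ∈ s, d b c • innerSL ℂ (v c)).smulRight (v b)

theorem matOp_apply (v : ι → E) (s : Finset ι) (d : ι → ι → ℂ) (x : E) :
    matOp v s d x = ∑ b ∈ s, (∑ c ∈ s, d b c * inner ℂ (v c) x) • v b := by
  simp [matOp]

theorem matOp_comp {v : ι → E} (hv : Orthonormal ℂ v) (s : Finset ι) (d d' : ι → ι → ℂ) :
    matOp v s d ∘L matOp v s d' = matOp v s fun a c ↦ ∑ b ∈ s, d a b * d' b c := by
  ext x
  rw [ContinuousLinearMap.comp_apply, matOp_apply, matOp_apply v s d' x, matOp_apply]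
  refine Finset.sum_congr rfl fun a _ ↦ ?_
  congr 1
  rw [Finset.sum_congr rfl fun b hb ↦ by rw [hv.inner_right_sum _ hb]]
  simp only [Finset.mul_sum, Finset.sum_mul]
  rw [Finset.sum_comm]
  exact Finset.sum_congr rfl fun c _ ↦ Finset.sum_congr rfl fun b _ ↦ by ring

theorem matOp_sub (v : ι → E) (s : Finset ι) (d d' : ι → ι → ℂ) :
    matOp v s d - matOp v s d' = matOp v s fun a c ↦ d a c - d' a c := by
  ext x
  simp only [sub_apply, matOp_apply, ← Finset.sum_sub_distrib, sub_mul, ← sub_smul]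

theorem matOp_smul (v : ι → E) (s : Finset ι) (a : ℂ) (d : ι → ι → ℂ) :
    a • matOp v s d = matOp v s fun b c ↦ a * d b c := by
  ext x
  simp only [smul_apply, matOp_apply, Finset.smul_sum, smul_smul, Finset.mul_sum, mul_assoc]

theorem norm_matOp_le {v : ι → E} (hv : Orthonormal ℂ v) (s : Finset ι) {d : ι → ι → ℂ} {R : ℝ}
    (hR : 0 ≤ R) (hrow : ∀ b ∈ s, ∑ c ∈ s, ‖d b c‖ ≤ R) (hcol : ∀ c ∈ s, ∑ b ∈ s, ‖d b c‖ ≤ R) :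
    ‖matOp v s d‖ ≤ R :=
  ContinuousLinearMap.opNorm_le_bound _ hR fun x ↦ by
    rw [matOp_apply]; exact norm_sum_matrix_le hv s hR hrow hcol x

end Schur

/-! ### Matrix coefficients as Fourier coefficients -/

section MatrixCoeff

open MeasureTheory

variable [T2Space X] [VectorBundle ℂ ℂ L] [ContMDiffVectorBundle ∞ ℂ L (𝓡 (2 * n))]

variable {k : ℕ} {c b : B} {N : S.CommonNbhd c b}

theorem matrixCoeff_smul (f : X → ℂ) (ψ : S.FiberSpace k b) (ξ : S.FiberSpace k c) (u v : ℂ) :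
    matrixCoeff f (u • ψ) (v • ξ) = starRingEnd ℂ u * v * matrixCoeff f ψ ξ := by
  by_cases h : Nonempty (S.CommonNbhd c b)
  · rw [matrixCoeff, dif_pos h, matrixCoeff, dif_pos h, ← integral_const_mul]
    congr 1
    funext θ
    by_cases hT : Nonempty (ParallelTransport (Classical.choice h) ((S.chartAt c).pt c θ)
      ((S.chartAt c).frame c θ))
    · rw [transportPairing, dif_pos hT, transportPairing, dif_pos hT]
      change starRingEnd ℂ (u * ψ.1 _ _ _) * (f _ * (v * ξ.1 _ _ _)) = _
      rw [map_mul]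
      ring
    · rw [transportPairing, dif_neg hT, transportPairing, dif_neg hT, mul_zero]
  · rw [matrixCoeff, dif_neg h, matrixCoeff, dif_neg h, mul_zero]

theorem zvec_eq_smul {p : Fin n → ℤ} {Δ : Euc n} (hp : ∀ i, (k : ℝ) * Δ i = p i) :
    zvec p = (k : ℝ) • Δ := by
  ext i
  rw [PiLp.smul_apply, smul_eq_mul, hp, zvec_apply]

theorem integral_eq_fc {p : Fin n → ℤ} {Δ : Euc n} (hp : zvec p = (k : ℝ) • Δ) (F : Euc n → ℂ) :
    ∫ φ in box n, Complex.exp (-(Complex.I * k * (inner ℝ Δ φ : ℝ))) * F φ =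
      (2 * Real.pi) ^ n * fc F p := by
  have h1 : ((2 * Real.pi : ℂ) ^ n) ≠ 0 := by
    have : (Real.pi : ℂ) ≠ 0 := by exact_mod_cast Real.pi_ne_zero
    exact pow_ne_zero _ (mul_ne_zero two_ne_zero this)
  have h2 : zvec (-p) = -((k : ℝ) • Δ) := by rw [← hp]; ext i; simp
  rw [fc, mul_inv_cancel_left₀ h1]
  congr 1
  funext φ
  rw [char, h2, inner_neg_left, inner_smul_left]
  congr 2
  simp only [conj_trivial]
  push_cast
  ring

/-- The matrix coefficients between `X_c` and `X_b` are Fourier coefficients of `f` on the fibre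
over the midpoint. -/
theorem exists_matrixCoeff_eq (h : Nonempty (S.CommonNbhd c b)) {c₁ : S.Chart}
    (hm : (Classical.choice h).path (1 / 2) ∈ c₁.V) {A : Euc n ≃ᵃ[ℝ] Euc n}
    (hA : ∀ᶠ b' in 𝓝 ((Classical.choice h).path (1 / 2)), (Classical.choice h).χ b' = A (c₁.x b'))
    (ψ : S.FiberSpace k b) (ξ : S.FiberSpace k c) :
    ∃ (J : ℂ) (p : Fin n → ℤ), ‖J‖ ≤ ‖ψ‖ * ‖ξ‖ ∧ (J ≠ 0 → zvec p = (k : ℝ) •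
      (A.symm ((Classical.choice h).χ b) - A.symm ((Classical.choice h).χ c))) ∧
      ∀ f : X → ℂ, matrixCoeff f ψ ξ =
        J * fc (fun φ ↦ f (c₁.pt ((Classical.choice h).path (1 / 2)) φ)) p := by
  set N := Classical.choice h with hN
  set c₀ := S.chartAt c
  have hc : c ∈ c₀.V := S.mem_chartAt c
  have h0 : 0 ≤ ‖ψ‖ * ‖ξ‖ := by positivity
  by_cases hT : ∃ θ₀, Nonempty (ParallelTransport N (c₀.pt c θ₀) (c₀.frame c θ₀))
  swap
  · push Not at hT
    refine ⟨0, 0, by rwa [norm_zero], fun h ↦ absurd rfl h, fun f ↦ ?_⟩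
    rw [matrixCoeff, dif_pos h, zero_mul, ← integral_zero (Euc n) ℂ]
    congr 1
    funext θ
    rw [transportPairing, dif_neg (not_nonempty_iff.2 (hT θ))]
  obtain ⟨θ₀, ⟨T⟩⟩ := hT
  have hhalf : (1 / 2 : ℝ) ∈ Icc (0 : ℝ) 1 := by norm_num
  obtain ⟨θ, hθ⟩ := c₁.surjective (T.ℓ (1 / 2)) (by rw [T.proj _ hhalf]; exact hm)
  rw [T.proj _ hhalf] at hθ
  have key := fun f ↦ T.integral_transportPairing hc hm hA hθ f ψ ξ
  have hf : ∀ f : X → ℂ, matrixCoeff f ψ ξ = ∫ φ in box n, transportPairing f N ψ ξ (c₀.pt c φ)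
    (c₀.frame c φ) := fun f ↦ by rw [matrixCoeff, dif_pos h]
  by_cases hE : T.ends T.M ψ ξ = 0
  · refine ⟨0, 0, by rwa [norm_zero], fun h ↦ absurd rfl h, fun f ↦ ?_⟩
    rw [hf, (key f).2, hE]
    simp only [zero_mul]
  obtain ⟨p, hp⟩ := (key 0).1 hE
  have hp' := zvec_eq_smul hp
  refine ⟨(2 * Real.pi) ^ n * (T.ends T.M ψ ξ * Complex.exp (Complex.I * k *
    (inner ℝ (A.symm (N.χ b) - A.symm (N.χ c)) θ : ℝ))), p, ?_, fun _ ↦ hp', fun f ↦ ?_⟩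
  · have h1 : Complex.I * k * (inner ℝ (A.symm (N.χ b) - A.symm (N.χ c)) θ : ℝ) =
        ((k * inner ℝ (A.symm (N.χ b) - A.symm (N.χ c)) θ : ℝ) : ℂ) * Complex.I := by
      push_cast; ring
    rw [h1, norm_mul, norm_mul, Complex.norm_exp_ofReal_mul_I, mul_one, ← T.norm_ends hc]
    simp [abs_of_pos Real.pi_pos]
  · rw [hf, (key f).2, integral_eq_fc hp' fun φ ↦ f (c₁.pt (N.path (1 / 2)) φ)]
    ring

/-- Matrix coefficients between fibres over points of the domain of a gauge. -/
theorem exists_matrixCoeff_eq_of_gauge (h : Nonempty (S.CommonNbhd c b)) {G : S.Gauge}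
    (hc : c ∈ G.dom) (hb : b ∈ G.dom)
    (hpath : ∀ t ∈ Icc (0 : ℝ) 1, (Classical.choice h).path t =
      base G.c (AffineMap.lineMap (G.c.x c) (G.c.x b) t))
    {C : ℝ} (hC : ∀ t ∈ Icc (0 : ℝ) 1, ‖G.slope (AffineMap.lineMap (G.c.x c) (G.c.x b) t) -
      G.slope (AffineMap.lineMap (G.c.x c) (G.c.x b) (1 / 2 : ℝ))‖ ≤ C * ‖G.c.x b - G.c.x c‖) :
    ∃ r : ℝ, |r| ≤ C * ‖G.c.x b - G.c.x c‖ ^ 3 ∧ ∀ (k : ℕ) (p : Fin n → ℤ),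
      zvec p = (k : ℝ) • (G.c.x b - G.c.x c) → ∀ (ψ : S.FiberSpace k b) (ξ : S.FiberSpace k c)
      (f : X → ℂ), matrixCoeff f ψ ξ = Complex.exp (Complex.I * k * r) *
        ((2 * Real.pi) ^ n * (starRingEnd ℂ (G.amp ψ) * G.amp ξ)) *
        fcf (fun y ↦ f (G.c.Ψ y)) ((1 / 2 : ℝ) • (G.c.x b + G.c.x c)) p := by
  set N := Classical.choice h with hN
  obtain ⟨θ₀, T, r, hr, hT, hends⟩ :=
    CommonNbhd.exists_transport_of_gauge hc hb hpath hC (S.mem_chartAt c)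
  refine ⟨r, hr, fun k p hp ψ ξ f ↦ ?_⟩
  have hhalf : (1 / 2 : ℝ) ∈ Icc (0 : ℝ) 1 := by norm_num
  have hseg : ∀ t ∈ Icc (0 : ℝ) 1, AffineMap.lineMap (G.c.x c) (G.c.x b) t ∈ G.W := fun t ht ↦
    G.convex_W.lineMap_mem hc.2 hb.2 ht
  have hpathx : ∀ t ∈ Icc (0 : ℝ) 1, N.path t ∈ G.c.V ∧
      G.c.x (N.path t) = AffineMap.lineMap (G.c.x c) (G.c.x b) t := fun t ht ↦ by
    rw [hpath t ht]
    exact ⟨base_mem (G.subset (hseg t ht)), x_base (G.subset (hseg t ht))⟩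
  obtain ⟨hm, hmx⟩ := hpathx _ hhalf
  obtain ⟨A, hA⟩ := affine_near N.affine (N.path_spec hhalf).1 hm
  have hΔ : A.symm (N.χ b) - A.symm (N.χ c) = G.c.x b - G.c.x c := by
    have hcont : ContinuousAt N.path (1 / 2) := by
      have h1 : ContinuousAt (fun t : ℝ ↦ base G.c (AffineMap.lineMap (G.c.x c) (G.c.x b) t))
          (1 / 2) := ContinuousAt.comp (f := fun t : ℝ ↦ AffineMap.lineMap (G.c.x c) (G.c.x b) t)
        (continuousAt_base (G.subset (hseg _ hhalf))) AffineMap.lineMap_continuous.continuousAt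
      refine h1.congr ?_
      filter_upwards [Icc_mem_nhds (show (0 : ℝ) < 1 / 2 by norm_num)
        (show (1 / 2 : ℝ) < 1 by norm_num)] with t ht
      exact (hpath t ht).symm
    have hev : ∀ᶠ t in 𝓝 (1 / 2 : ℝ), t ∈ Icc (0 : ℝ) 1 ∧
        ∀ᶠ b' in 𝓝 (N.path t), N.χ b' = A (G.c.x b') :=
      Filter.Eventually.and (Icc_mem_nhds (by norm_num) (by norm_num)) (hcont.eventually hA.eventually_nhds)
    obtain ⟨ε, hε, hball⟩ := Metric.eventually_nhds_iff.1 hev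
    have hd : ∀ t : ℝ, dist t (1 / 2) < ε → AffineMap.lineMap (A.symm (N.χ c)) (A.symm (N.χ b)) t =
        AffineMap.lineMap (G.c.x c) (G.c.x b) t := fun t ht ↦ by
      rw [← N.x_path (hball ht).1 (hball ht).2, (hpathx t (hball ht).1).2]
    have h1 := hd (1 / 2) (by simpa using hε)
    have h2 := hd (1 / 2 + ε / 2) (by
      rw [Real.dist_eq, add_sub_cancel_left, abs_of_pos (by positivity)]; linarith)
    simp only [AffineMap.lineMap_apply_module'] at h1 h2
    have h3 : (ε / 2) • (A.symm (N.χ b) - A.symm (N.χ c)) = (ε / 2) • (G.c.x b - G.c.x c) := by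
      rw [add_smul, add_smul, add_assoc, add_assoc, add_comm ((ε / 2) • _) (A.symm _),
        add_comm ((ε / 2) • _) (G.c.x c), ← add_assoc, ← add_assoc, h1] at h2
      exact add_left_cancel h2
    exact smul_right_injective _ (by positivity : ε / 2 ≠ 0) h3
  have hmid : G.c.x (N.path (1 / 2)) = (1 / 2 : ℝ) • (G.c.x b + G.c.x c) := by
    rw [hmx, AffineMap.lineMap_apply_module]; module
  have key := (T.integral_transportPairing (S.mem_chartAt c) hm hA hT.symm f ψ ξ).2
  rw [hΔ, integral_eq_fc hp fun φ ↦ f (G.c.pt (N.path (1 / 2)) φ), hends, inner_zero_right,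
    Complex.ofReal_zero, mul_zero, Complex.exp_zero, mul_one] at key
  rw [matrixCoeff, dif_pos h, key, fcf]
  simp only [ActionAngleChart.pt, hmid]
  ring

end MatrixCoeff

/-! ### Decay of matrix coefficients away from the diagonal -/

section Far

open MeasureTheory

variable [T2Space X] [VectorBundle ℂ ℂ L] [ContMDiffVectorBundle ∞ ℂ L (𝓡 (2 * n))]

variable {f : X → ℂ} {K : Set B}

/-- Only fibres over points of a common member of the covering that meets the support contribute. -/
theorem exists_cover_of_matrixCoeff_ne_zero (hK : ∀ p, S.μ p ∉ K → f p = 0) {k : ℕ} {c b : B}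
    {ψ : S.FiberSpace k b} {ξ : S.FiberSpace k c} (h : matrixCoeff f ψ ξ ≠ 0) :
    ∃ hN : Nonempty (S.CommonNbhd c b), (Classical.choice hN).path (1 / 2) ∈ K ∧
      ∃ U ∈ S.𝒰, b ∈ U ∧ c ∈ U ∧ (U ∩ K).Nonempty := by
  by_cases hN : Nonempty (S.CommonNbhd c b)
  swap
  · exact absurd (by rw [matrixCoeff, dif_neg hN]) h
  have hhalf : (1 / 2 : ℝ) ∈ Icc (0 : ℝ) 1 := by norm_num
  have hU := ((Classical.choice hN).path_spec hhalf).1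
  have hmid : (Classical.choice hN).path (1 / 2) ∈ K := by
    by_contra hmK
    obtain ⟨c₁, hm⟩ := S.exists_chart ((Classical.choice hN).path (1 / 2))
    obtain ⟨A, hA⟩ := affine_near (Classical.choice hN).affine hU hm
    obtain ⟨J, p, -, -, hJ⟩ := exists_matrixCoeff_eq hN hm hA ψ ξ
    refine h ?_
    rw [hJ, fc]
    have h0 : ∀ φ, f (c₁.pt ((Classical.choice hN).path (1 / 2)) φ) = 0 := fun φ ↦
      hK _ (by rwa [proj_pt hm])
    simp only [h0, mul_zero, integral_zero]
  exact ⟨hN, hmid, _, (Classical.choice hN).mem, (Classical.choice hN).right_mem,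
    (Classical.choice hN).left_mem, _, hU, hmid⟩

/-- Matrix coefficients are bounded, and decay rapidly in `k` away from the diagonal. -/
theorem exists_far_bound [T2Space B] (hf : S.SmoothInCharts f) (hK : IsCompact K)
    (hfK : ∀ p, S.μ p ∉ K → f p = 0) {R : Set (B × B)} (hR : IsOpen R) (hdiag : ∀ b, (b, b) ∈ R)
    (M : ℕ) : ∃ C, 0 ≤ C ∧ ∀ (k : ℕ), 1 ≤ k → ∀ (b c : B) (ψ : S.FiberSpace k b)
      (ξ : S.FiberSpace k c), ‖matrixCoeff f ψ ξ‖ ≤ C * (‖ψ‖ * ‖ξ‖) ∧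
        ((b, c) ∉ R → ‖matrixCoeff f ψ ξ‖ ≤ C * ((k : ℝ)⁻¹) ^ (2 * M) * (‖ψ‖ * ‖ξ‖)) := by
  have key : ∃ C, 0 ≤ C ∧ ∀ (k : ℕ), 1 ≤ k → ∀ (b c : B) (hN : Nonempty (S.CommonNbhd c b)),
      (Classical.choice hN).path (1 / 2) ∈ K → ∀ (ψ : S.FiberSpace k b)
      (ξ : S.FiberSpace k c), ‖matrixCoeff f ψ ξ‖ ≤ C * (‖ψ‖ * ‖ξ‖) ∧
        ((b, c) ∉ R → ‖matrixCoeff f ψ ξ‖ ≤ C * ((k : ℝ)⁻¹) ^ (2 * M) * (‖ψ‖ * ‖ξ‖)) := by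
    -- The estimate is local in the midpoint of the segment from `c` to `b`.
    refine hK.induction_on (p := fun K ↦ ∃ C, 0 ≤ C ∧ ∀ (k : ℕ), 1 ≤ k →
      ∀ (b c : B) (hN : Nonempty (S.CommonNbhd c b)), (Classical.choice hN).path (1 / 2) ∈ K →
      ∀ (ψ : S.FiberSpace k b) (ξ : S.FiberSpace k c), ‖matrixCoeff f ψ ξ‖ ≤ C * (‖ψ‖ * ‖ξ‖) ∧
        ((b, c) ∉ R → ‖matrixCoeff f ψ ξ‖ ≤ C * ((k : ℝ)⁻¹) ^ (2 * M) * (‖ψ‖ * ‖ξ‖))) ?_ ?_ ?_ ?_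
    · exact ⟨0, le_rfl, fun k _ b c hN h ↦ absurd h (notMem_empty _)⟩
    · rintro s t hst ⟨C, hC0, hC⟩
      exact ⟨C, hC0, fun k hk b c hN h ↦ hC k hk b c hN (hst h)⟩
    · rintro s t ⟨C, hC0, hC⟩ ⟨C', hC0', hC'⟩
      refine ⟨C + C', by positivity, fun k hk b c hN h ψ ξ ↦ ?_⟩
      have hle : C ≤ C + C' := by linarith
      have hle' : C' ≤ C + C' := by linarith
      rcases h with h | h
      · exact ⟨((hC k hk b c hN h ψ ξ).1).trans (by gcongr),
          fun hb ↦ ((hC k hk b c hN h ψ ξ).2 hb).trans (by gcongr)⟩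
      · exact ⟨((hC' k hk b c hN h ψ ξ).1).trans (by gcongr),
          fun hb ↦ ((hC' k hk b c hN h ψ ξ).2 hb).trans (by gcongr)⟩
    · intro z hz
      obtain ⟨c₁, hzV⟩ := S.exists_chart z
      have hx : c₁.x z ∈ c₁.x '' c₁.V := mem_image_of_mem _ hzV
      have hcb := continuousAt_base hx
      have hRz : ∀ᶠ y : Euc n × Euc n in 𝓝 (c₁.x z, c₁.x z), (base c₁ y.1, base c₁ y.2) ∈ R := by
        have h1 : ContinuousAt (fun y : Euc n × Euc n ↦ (base c₁ y.1, base c₁ y.2))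
            (c₁.x z, c₁.x z) :=
          ContinuousAt.prodMap (p := (c₁.x z, c₁.x z)) hcb hcb
        refine h1.eventually (hR.mem_nhds ?_)
        simp only [base_x hzV]
        exact hdiag z
      obtain ⟨ε₁, hε₁, h₁⟩ := Metric.eventually_nhds_iff.1 hRz
      obtain ⟨ε₂, hε₂, h₂⟩ := Metric.isOpen_iff.1 c₁.isOpen_image _ hx
      set ε := min ε₁ ε₂ / 2 with hε
      have hε0 : 0 < ε := by positivity
      have h2ε : 2 * ε ≤ ε₁ := by rw [hε]; linarith [min_le_left ε₁ ε₂]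
      have h2ε' : 2 * ε ≤ ε₂ := by rw [hε]; linarith [min_le_right ε₁ ε₂]
      have hQW : Metric.closedBall (c₁.x z) ε ⊆ c₁.x '' c₁.V :=
        (Metric.closedBall_subset_ball (by linarith)).trans h₂
      obtain ⟨C, hC0, hC⟩ := (hf c₁).decay c₁.isOpen_image (isCompact_closedBall _ _) hQW 0
      obtain ⟨C', hC0', hC'⟩ := (hf c₁).decay c₁.isOpen_image (isCompact_closedBall _ _) hQW M
      refine ⟨c₁.V ∩ c₁.x ⁻¹' Metric.ball (c₁.x z) ε, mem_nhdsWithin_of_mem_nhds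
        ((isOpen_inter_preimage_x c₁ Metric.isOpen_ball).mem_nhds
          ⟨hzV, Metric.mem_ball_self hε0⟩), C + C' * ((2 * ε)⁻¹) ^ (2 * M), by positivity, ?_⟩
      intro k hk b c hN hm ψ ξ
      have hk0 : (0 : ℝ) < k := by exact_mod_cast hk
      have hhalf : (1 / 2 : ℝ) ∈ Icc (0 : ℝ) 1 := by norm_num
      set N := Classical.choice hN
      obtain ⟨A, hA⟩ := affine_near N.affine (N.path_spec hhalf).1 hm.1
      obtain ⟨J, p, hJ, hp, hM⟩ := exists_matrixCoeff_eq hN hm.1 hA ψ ξ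
      have hfc : ‖matrixCoeff f ψ ξ‖ = ‖J‖ * ‖fcf (fun y ↦ f (c₁.Ψ y)) (c₁.x (N.path (1 / 2))) p‖ := by
        rw [hM, norm_mul]; rfl
      have hmQ := Metric.ball_subset_closedBall hm.2
      have hw0 := wt_pos p
      rw [hfc]
      constructor
      · have h3 := hC _ hmQ p
        rw [pow_zero, mul_one] at h3
        calc _ ≤ (‖ψ‖ * ‖ξ‖) * C := by gcongr
          _ ≤ (‖ψ‖ * ‖ξ‖) * (C + C' * ((2 * ε)⁻¹) ^ (2 * M)) := by
            gcongr
            exact le_add_of_nonneg_right (by positivity)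
          _ = _ := mul_comm _ _
      intro hbR
      by_cases hJ0 : J = 0
      · rw [hJ0, norm_zero, zero_mul]; positivity
      have hp' := hp hJ0
      set u := A.symm (N.χ c) with hu
      set v := A.symm (N.χ b) with hv
      have hmx : c₁.x (N.path (1 / 2)) = AffineMap.lineMap u v (1 / 2 : ℝ) := N.x_path hhalf hA
      -- A segment of length `< 2 ε` with midpoint near `z` stays in the chart, and then its ends are
      -- so close to `z` that they are in `R`. Otherwise `‖p‖ = k ‖v - u‖` is of order `k`.
      have hfar : 2 * ε ≤ ‖v - u‖ := by
        by_contra! hlt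
        have hnear : ∀ t ∈ Icc (0 : ℝ) 1, dist (AffineMap.lineMap u v t) (c₁.x z) < 2 * ε := by
          intro t ht
          have h4 : dist (AffineMap.lineMap u v t) (AffineMap.lineMap u v (1 / 2 : ℝ)) ≤ ε := by
            rw [dist_lineMap_lineMap, dist_comm u v, dist_eq_norm v u, Real.dist_eq]
            have : |t - 1 / 2| ≤ 1 / 2 := abs_le.2 ⟨by linarith [ht.1], by linarith [ht.2]⟩
            nlinarith [norm_nonneg (v - u), abs_nonneg (t - 1 / 2)]
          have h5 : dist (AffineMap.lineMap u v (1 / 2 : ℝ)) (c₁.x z) < ε := by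
            rw [← hmx]; exact hm.2
          linarith [dist_triangle (AffineMap.lineMap u v t) (AffineMap.lineMap u v (1 / 2 : ℝ))
            (c₁.x z)]
        have hW : ∀ t ∈ Icc (0 : ℝ) 1, AffineMap.lineMap u v t ∈ c₁.x '' c₁.V := fun t ht ↦
          h₂ ((hnear t ht).trans_le h2ε')
        have hpath := fun {t : ℝ} (ht : t ∈ Icc (0 : ℝ) 1) ↦ N.path_eq_of_mid hhalf hm.1 hA hW ht
        have h0 := hpath (left_mem_Icc.2 zero_le_one)
        have h1 := hpath (right_mem_Icc.2 zero_le_one)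
        rw [CommonNbhd.path_zero, AffineMap.lineMap_apply_zero] at h0
        rw [CommonNbhd.path_one, AffineMap.lineMap_apply_one] at h1
        have h0' := hnear 0 (left_mem_Icc.2 zero_le_one)
        have h1' := hnear 1 (right_mem_Icc.2 zero_le_one)
        rw [AffineMap.lineMap_apply_zero] at h0'
        rw [AffineMap.lineMap_apply_one] at h1'
        refine hbR ?_
        have := h₁ (y := (v, u)) (max_lt (h1'.trans_le h2ε) (h0'.trans_le h2ε))
        simp only at this
        rwa [← h0, ← h1] at this
      have hwt : (wt p)⁻¹ ^ M ≤ ((2 * ε)⁻¹) ^ (2 * M) * ((k : ℝ)⁻¹) ^ (2 * M) := by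
        have h4 : (k * (2 * ε)) ^ 2 ≤ wt p := by
          have : ‖zvec p‖ = k * ‖v - u‖ := by
            rw [hp', norm_smul, Real.norm_of_nonneg hk0.le]
          rw [wt, this]
          have : (k * (2 * ε)) ^ 2 ≤ (k * ‖v - u‖) ^ 2 := by gcongr
          linarith
        rw [← mul_pow, ← mul_inv, mul_comm (2 * ε), pow_mul, inv_pow _ 2]
        exact pow_le_pow_left₀ (by positivity) (inv_anti₀ (by positivity) h4) M
      have h3 := hC' _ hmQ p
      calc _ ≤ (‖ψ‖ * ‖ξ‖) * (C' * (((2 * ε)⁻¹) ^ (2 * M) * ((k : ℝ)⁻¹) ^ (2 * M))) := by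
            refine mul_le_mul hJ (h3.trans ?_) (norm_nonneg _) (by positivity)
            gcongr
        _ = C' * ((2 * ε)⁻¹) ^ (2 * M) * ((k : ℝ)⁻¹) ^ (2 * M) * (‖ψ‖ * ‖ξ‖) := by ring
        _ ≤ _ := by
          gcongr
          exact le_add_of_nonneg_left hC0
  obtain ⟨C, hC0, hC⟩ := key
  refine ⟨C, hC0, fun k hk b c ψ ξ ↦ ?_⟩
  by_cases h0 : matrixCoeff f ψ ξ = 0
  · rw [h0, norm_zero]
    exact ⟨by positivity, fun _ ↦ by positivity⟩
  obtain ⟨hN, hm, -⟩ := exists_cover_of_matrixCoeff_ne_zero hfK h0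
  exact hC k hk b c hN hm ψ ξ

end Far

/-! ### The product formula near the diagonal -/

section Near

open MeasureTheory

variable [T2Space X] [VectorBundle ℂ ℂ L] [ContMDiffVectorBundle ∞ ℂ L (𝓡 (2 * n))]

/-- The ball with radius `r` around `z` in the coordinates `c.x`. -/
def disc (c : S.Chart) (z : B) (r : ℝ) : Set B := c.V ∩ c.x ⁻¹' Metric.ball (c.x z) r

theorem norm_zvec_pow_le (p : Fin n → ℤ) : ‖zvec p‖ ^ 3 ≤ wt p ^ 2 := by
  have h1 := norm_zvec_le_wt p
  have h2 : ‖zvec p‖ ^ 2 ≤ wt p := by rw [wt]; linarith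
  calc ‖zvec p‖ ^ 3 = ‖zvec p‖ * ‖zvec p‖ ^ 2 := by ring
    _ ≤ wt p * wt p := mul_le_mul h1 h2 (by positivity) (wt_pos p).le
    _ = _ := by ring

/-- A gauge around `z` in which the matrix coefficients are, up to phases `1 + O(k⁻²)`, the
Fourier coefficients at the midpoint. -/
theorem exists_gauge_matrixCoeff (z : B) : ∃ (G : S.Gauge) (ρ C : ℝ), z ∈ G.dom ∧ 0 < ρ ∧ 0 ≤ C ∧
    Metric.closedBall (G.c.x z) (3 * ρ) ⊆ G.W ∧
    ∀ b ∈ disc G.c z (3 * ρ), ∀ c ∈ disc G.c z (3 * ρ), ∀ k : ℕ, 1 ≤ k → ∃ e : ℂ, ‖e‖ = 1 ∧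
      ∀ p : Fin n → ℤ, zvec p = (k : ℝ) • (G.c.x b - G.c.x c) →
        ‖e - 1‖ ≤ C * ((k : ℝ)⁻¹) ^ 2 * wt p ^ 2 ∧
        ∀ (ψ : S.FiberSpace k b) (ξ : S.FiberSpace k c) (f : X → ℂ), matrixCoeff f ψ ξ =
          e * ((2 * Real.pi) ^ n * (starRingEnd ℂ (G.amp ψ) * G.amp ξ)) *
            fcf (fun y ↦ f (G.c.Ψ y)) ((1 / 2 : ℝ) • (G.c.x b + G.c.x c)) p := by
  have hz : z ∈ ⋃₀ S.𝒰 := by rw [S.cover.covers]; trivial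
  obtain ⟨U, hU, hzU⟩ := hz
  obtain ⟨χ, hχ, hχc⟩ := S.cover.convex U hU
  obtain ⟨c₁, hzV⟩ := S.exists_chart z
  have hx : c₁.x z ∈ c₁.x '' c₁.V := mem_image_of_mem _ hzV
  have h1 : ∀ᶠ ξ in 𝓝 (c₁.x z), ξ ∈ c₁.x '' c₁.V ∧ base c₁ ξ ∈ U :=
    Filter.Eventually.and (c₁.isOpen_image.mem_nhds hx)
      ((continuousAt_base hx).eventually (hχ.isOpen.mem_nhds (by rwa [base_x hzV])))
  obtain ⟨ε, hε, hball⟩ := Metric.eventually_nhds_iff_ball.1 h1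
  obtain ⟨G, rfl, hGW⟩ := exists_gauge c₁ (W := Metric.ball (c₁.x z) ε) Metric.isOpen_ball
    (convex_ball _ _) fun ξ hξ ↦ (hball ξ hξ).1
  set Q := Metric.closedBall (G.c.x z) (3 * (ε / 4)) with hQ
  have hQW : Q ⊆ G.W := hGW ▸ Metric.closedBall_subset_ball (by linarith)
  have hWU : ∀ ξ ∈ G.W, base G.c ξ ∈ U := fun ξ hξ ↦ (hball ξ (hGW ▸ hξ)).2
  have hQc : Convex ℝ Q := convex_closedBall _ _
  obtain ⟨C, hC⟩ := (isCompact_closedBall (G.c.x z) (3 * (ε / 4))).exists_bound_of_continuousOn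
    ((G.smooth_slope.continuousOn_fderiv_of_isOpen G.isOpen_W (by simp)).mono hQW)
  have hC0 : 0 ≤ C := (norm_nonneg _).trans (hC _ (Metric.mem_closedBall_self (by positivity)))
  have hLip : ∀ ξ ∈ Q, ∀ η ∈ Q, ‖G.slope ξ - G.slope η‖ ≤ C * ‖ξ - η‖ := fun ξ hξ η hη ↦
    hQc.norm_image_sub_le_of_norm_fderiv_le (fun x hx ↦
      (G.smooth_slope.contDiffAt (G.isOpen_W.mem_nhds (hQW hx))).differentiableAt (by simp)) hC hη hξ
  refine ⟨G, ε / 4, C, ⟨hzV, ?_⟩, by positivity, hC0, hQW, ?_⟩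
  · rw [hGW]; exact Metric.mem_ball_self hε
  rintro b ⟨hbV, hbB⟩ c ⟨hcV, hcB⟩ k hk
  have hbQ := Metric.ball_subset_closedBall hbB
  have hcQ := Metric.ball_subset_closedBall hcB
  have hbU : b ∈ U := by rw [← base_x hbV]; exact hWU _ (hQW hbQ)
  have hcU : c ∈ U := by rw [← base_x hcV]; exact hWU _ (hQW hcQ)
  have hN : Nonempty (S.CommonNbhd c b) := ⟨⟨U, hU, hcU, hbU, χ, hχ, hχc⟩⟩
  have hseg : ∀ t ∈ Icc (0 : ℝ) 1, AffineMap.lineMap (G.c.x c) (G.c.x b) t ∈ Q := fun t ht ↦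
    hQc.lineMap_mem hcQ hbQ ht
  have hhalf : (1 / 2 : ℝ) ∈ Icc (0 : ℝ) 1 := by norm_num
  obtain ⟨r, hr, hM⟩ := exists_matrixCoeff_eq_of_gauge hN (G := G) ⟨hcV, hQW hcQ⟩ ⟨hbV, hQW hbQ⟩
    (fun t ht ↦ (Classical.choice hN).path_eq_segment hU G.convex_W G.subset hWU hcV (hQW hcQ) hbV
      (hQW hbQ) ht) (C := C) fun t ht ↦ by
      refine (hLip _ (hseg t ht) _ (hseg _ hhalf)).trans ?_
      rw [← dist_eq_norm, dist_lineMap_lineMap, dist_comm (G.c.x c), dist_eq_norm (G.c.x b),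
        Real.dist_eq]
      have : |t - 1 / 2| ≤ 1 := abs_le.2 ⟨by linarith [ht.1], by linarith [ht.2]⟩
      gcongr
      exact mul_le_of_le_one_left (norm_nonneg _) this
  have hk0 : (0 : ℝ) < k := by exact_mod_cast hk
  have he : Complex.I * k * r = Complex.I * ((k * r : ℝ) : ℂ) := by push_cast; ring
  refine ⟨Complex.exp (Complex.I * k * r), ?_, fun p hp ↦ ⟨?_, hM k p hp⟩⟩
  · rw [he, mul_comm, Complex.norm_exp_ofReal_mul_I]
  · rw [he]
    refine (Real.norm_exp_I_mul_ofReal_sub_one_le).trans ?_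
    have h2 : ‖G.c.x b - G.c.x c‖ = (k : ℝ)⁻¹ * ‖zvec p‖ := by
      rw [hp, norm_smul, Real.norm_of_nonneg hk0.le, inv_mul_cancel_left₀ hk0.ne']
    rw [h2] at hr
    rw [norm_mul, Real.norm_of_nonneg hk0.le, Real.norm_eq_abs]
    -- `‖x b - x c‖ = k⁻¹ ‖p‖`, so a phase of third order in the distance is `O(k⁻² ‖p‖³)`.
    calc k * |r| ≤ k * (C * ((k : ℝ)⁻¹ * ‖zvec p‖) ^ 3) := by gcongr
      _ = C * ((k : ℝ)⁻¹) ^ 2 * ‖zvec p‖ ^ 3 := by field_simp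
      _ ≤ _ := by
        gcongr
        exact norm_zvec_pow_le p

theorem zvec_injective : Function.Injective (zvec (n := n)) := fun p q h ↦ funext fun i ↦ by
  have := congrArg (fun v : Euc n ↦ v i) h
  simpa using this

/-- The product formula for the matrix coefficients between fibres near `z`, summed over the
intermediate fibres near `z`. -/
theorem exists_near_bound {f g h : X → ℂ} (hf : S.SmoothInCharts f) (hg : S.SmoothInCharts g)
    (hh : ∀ (c : S.Chart) (y : Euc n × Euc n), y.1 ∈ c.x '' c.V →
      h (c.Ψ y) = brk (fun y ↦ f (c.Ψ y)) (fun y ↦ g (c.Ψ y)) y) (z : B) :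
    ∃ (c₁ : S.Chart) (ρ : ℝ) (w : (Fin n → ℤ) → ℝ), z ∈ c₁.V ∧ 0 < ρ ∧
      Metric.closedBall (c₁.x z) (3 * ρ) ⊆ c₁.x '' c₁.V ∧ Summable w ∧ (∀ s, 0 ≤ w s) ∧
      ∀ k : ℕ, 1 ≤ k → ∀ ψ : ∀ b : S.bohrSommerfeld k, S.FiberSpace k b, (∀ b, ‖ψ b‖ = 1) →
      ∀ a c : S.bohrSommerfeld k, (a : B) ∈ disc c₁ z (2 * ρ) → (c : B) ∈ disc c₁ z (3 * ρ) →
      ∃ s, zvec s = (k : ℝ) • (c₁.x a - c₁.x c) ∧ ∀ T : Finset (S.bohrSommerfeld k),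
        (∀ b, b ∈ T ↔ (b : B) ∈ disc c₁ z (3 * ρ)) →
        ‖∑ b ∈ T, matrixCoeff f (ψ a) (ψ b) * matrixCoeff g (ψ b) (ψ c) -
          (matrixCoeff (f * g) (ψ a) (ψ c) + -Complex.I / (2 * k) * matrixCoeff h (ψ a) (ψ c))‖ ≤
        w s * ((k : ℝ)⁻¹) ^ 2 := by
  obtain ⟨G, ρ, C, hz, hρ, hC, hQW, hG⟩ := S.exists_gauge_matrixCoeff z
  set F := fun y ↦ f (G.c.Ψ y) with hF
  set F' := fun y ↦ g (G.c.Ψ y) with hF'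
  obtain ⟨w, hw, hw0, hmain⟩ := ((hf G.c).mono G.subset).exists_product_bound
    ((hg G.c).mono G.subset) G.isOpen_W (isCompact_closedBall _ _) (convex_closedBall _ _) hQW
    (Metric.ball_subset_closedBall (x := G.c.x z) (ε := 3 * ρ)) hρ (C₀ := 2 * C) (by positivity)
  refine ⟨G.c, ρ, w, hz.1, hρ, hQW.trans G.subset, hw, hw0, ?_⟩
  intro k hk ψ hψ a c ha hc
  have hk0 : (0 : ℝ) < k := by exact_mod_cast hk
  have hdom : ∀ {b}, b ∈ disc G.c z (3 * ρ) → b ∈ G.dom := fun hb ↦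
    ⟨hb.1, hQW (Metric.ball_subset_closedBall hb.2)⟩
  have ha3 : (a : B) ∈ disc G.c z (3 * ρ) :=
    ⟨ha.1, Metric.ball_subset_ball (by linarith) ha.2⟩
  have hint : ∀ b b' : S.bohrSommerfeld k, (b : B) ∈ disc G.c z (3 * ρ) →
      (b' : B) ∈ disc G.c z (3 * ρ) → ∃ p, zvec p = (k : ℝ) • (G.c.x b - G.c.x b') :=
    fun b b' hb hb' ↦ by
      obtain ⟨p, hp⟩ := Gauge.exists_int_of_bohrSommerfeld G (hdom hb) b.2 (hdom hb') b'.2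
      exact ⟨p, zvec_eq_smul hp⟩
  obtain ⟨s, hs⟩ := hint a c ha3 hc
  refine ⟨s, hs, fun T hT ↦ ?_⟩
  have hE : ∀ b b' : B, ∃ e : ℂ, b ∈ disc G.c z (3 * ρ) → b' ∈ disc G.c z (3 * ρ) → _ :=
    fun b b' ↦ by
    by_cases hb : b ∈ disc G.c z (3 * ρ) ∧ b' ∈ disc G.c z (3 * ρ)
    · obtain ⟨e, he⟩ := hG b hb.1 b' hb.2 k hk
      exact ⟨e, fun _ _ ↦ he⟩
    · exact ⟨0, fun h1 h2 ↦ absurd ⟨h1, h2⟩ hb⟩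
  choose E hE using hE
  have hν : ∀ b : S.bohrSommerfeld k, ∃ p : Fin n → ℤ, (b : B) ∈ disc G.c z (3 * ρ) →
      zvec p = (k : ℝ) • (G.c.x a - G.c.x b) := fun b ↦ by
    by_cases hb : (b : B) ∈ disc G.c z (3 * ρ)
    · obtain ⟨p, hp⟩ := hint a b ha3 hb
      exact ⟨p, fun _ ↦ hp⟩
    · exact ⟨0, fun h ↦ absurd h hb⟩
  choose ν hν using hν
  classical
  have hxb : ∀ b ∈ T, G.c.x a - (k : ℝ)⁻¹ • zvec (ν b) = G.c.x b := fun b hb ↦ by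
    rw [hν b ((hT b).1 hb), smul_smul, inv_mul_cancel₀ hk0.ne', one_smul, sub_sub_cancel]
  -- `b ↦ ν b` is a bijection of the Bohr-Sommerfeld points of the disc with the lattice points `p`
  -- for which `x a - k⁻¹ p` lies in the ball.
  have hβ : ∀ b ∈ T, base G.c (G.c.x a - (k : ℝ)⁻¹ • zvec (ν b)) = b := fun b hb ↦ by
    rw [hxb b hb, base_x ((hT b).1 hb).1]
  have hinj : Set.InjOn ν T := fun b hb b' hb' h ↦ Subtype.ext (by rw [← hβ b hb, h, hβ b' hb'])
  have hq : ∀ b ∈ T, zvec (s - ν b) = (k : ℝ) • (G.c.x b - G.c.x c) := fun b hb ↦ by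
    rw [zvec_sub, hs, hν b ((hT b).1 hb)]; module
  have hP : ∀ p, p ∈ T.image ν ↔ G.c.x a - (k : ℝ)⁻¹ • zvec p ∈
      Metric.ball (G.c.x z) (3 * ρ) := fun p ↦ by
    rw [Finset.mem_image]
    constructor
    · rintro ⟨b, hb, rfl⟩
      rw [hxb b hb]
      exact ((hT b).1 hb).2
    · intro hp
      have hpV := G.subset (hQW (Metric.ball_subset_closedBall hp))
      have hd : base G.c (G.c.x a - (k : ℝ)⁻¹ • zvec p) ∈ disc G.c z (3 * ρ) :=
        ⟨base_mem hpV, by rw [mem_preimage, x_base hpV]; exact hp⟩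
      have hbs := Gauge.bohrSommerfeld_of_int G (hdom ha3) a.2 (hdom hd) (-p) fun i ↦ by
        rw [x_base hpV, PiLp.sub_apply, sub_sub_cancel_left, PiLp.smul_apply, zvec_apply,
          smul_eq_mul, mul_neg, mul_inv_cancel_left₀ hk0.ne', Pi.neg_apply, Int.cast_neg]
      refine ⟨⟨_, hbs⟩, (hT _).2 hd, zvec_injective ?_⟩
      rw [hν _ hd]
      change (k : ℝ) • (G.c.x a - G.c.x (base G.c (G.c.x a - (k : ℝ)⁻¹ • zvec p))) = _
      rw [x_base hpV, sub_sub_cancel, smul_smul, mul_inv_cancel₀ hk0.ne', one_smul]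
  set e : (Fin n → ℤ) → ℂ := fun p ↦ E a (base G.c (G.c.x a - (k : ℝ)⁻¹ • zvec p)) *
    E (base G.c (G.c.x a - (k : ℝ)⁻¹ • zvec p)) c with he
  have hee : ∀ p ∈ T.image ν, ‖e p - 1‖ ≤
      2 * C * ((k : ℝ)⁻¹) ^ 2 * (wt p ^ 2 * wt (s - p) ^ 2) := fun p hp ↦ by
    obtain ⟨b, hb, rfl⟩ := Finset.mem_image.1 hp
    simp only [he, hβ b hb]
    obtain ⟨hn₁, h₁⟩ := hE a b ha3 ((hT b).1 hb)
    obtain ⟨hn₂, h₂⟩ := hE b c ((hT b).1 hb) hc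
    have h₁ := (h₁ _ (hν b ((hT b).1 hb))).1
    have h₂ := (h₂ _ (hq b hb)).1
    have h3 : E a b * E b c - 1 = (E a b - 1) * E b c + (E b c - 1) := by ring
    rw [h3]
    refine (norm_add_le _ _).trans ?_
    rw [norm_mul, hn₂, mul_one]
    have ha1 : 1 ≤ wt (ν b) ^ 2 := one_le_pow₀ (one_le_wt _)
    have hb1 : 1 ≤ wt (s - ν b) ^ 2 := one_le_pow₀ (one_le_wt _)
    have e1 : wt (ν b) ^ 2 ≤ wt (ν b) ^ 2 * wt (s - ν b) ^ 2 :=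
      le_mul_of_one_le_right (by positivity) hb1
    have e2 : wt (s - ν b) ^ 2 ≤ wt (ν b) ^ 2 * wt (s - ν b) ^ 2 :=
      le_mul_of_one_le_left (by positivity) ha1
    calc _ ≤ C * ((k : ℝ)⁻¹) ^ 2 * wt (ν b) ^ 2 + C * ((k : ℝ)⁻¹) ^ 2 * wt (s - ν b) ^ 2 :=
          add_le_add h₁ h₂
      _ ≤ C * ((k : ℝ)⁻¹) ^ 2 * (wt (ν b) ^ 2 * wt (s - ν b) ^ 2) +
          C * ((k : ℝ)⁻¹) ^ 2 * (wt (ν b) ^ 2 * wt (s - ν b) ^ 2) := by gcongr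
      _ = _ := by ring
  obtain ⟨-, h₀⟩ := hE a c ha3 hc
  obtain ⟨he₀, hM₀⟩ := h₀ s hs
  have key := hmain k hk (G.c.x a) (Metric.ball_subset_ball (by linarith) ha.2) (G.c.x c) hc.2
    (Metric.ball_subset_ball' (by linarith [Metric.mem_ball.1 ha.2])) s hs (T.image ν) e (E a c) hP
    hee (he₀.trans (by gcongr; linarith))
  set u : ℂ := (2 * Real.pi) ^ n * (starRingEnd ℂ (G.amp (ψ a)) * G.amp (ψ c)) with hu
  have hamp : ∀ b : S.bohrSommerfeld k, (b : B) ∈ disc G.c z (3 * ρ) →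
      (2 * Real.pi) ^ n * ‖G.amp (ψ b)‖ ^ 2 = 1 := fun b hb ↦ by
    rw [← G.norm_sq (hdom hb), hψ, one_pow]
  have hu1 : ‖u‖ = 1 := by
    have h1 : ‖u‖ = (2 * Real.pi) ^ n * (‖G.amp (ψ a)‖ * ‖G.amp (ψ c)‖) := by
      simp [hu, abs_of_pos Real.pi_pos]
    have h2 : ‖u‖ ^ 2 = 1 := by
      rw [h1]
      linear_combination ((2 * Real.pi) ^ n * ‖G.amp (ψ c)‖ ^ 2) * hamp a ha3 + hamp c hc
    exact (pow_eq_one_iff_of_nonneg (norm_nonneg u) two_ne_zero).1 h2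
  have hprod : ∀ b ∈ T, matrixCoeff f (ψ a) (ψ b) * matrixCoeff g (ψ b) (ψ c) =
      u * (e (ν b) * (fcf F ((1 / 2 : ℝ) • (G.c.x a + (G.c.x a - (k : ℝ)⁻¹ • zvec (ν b)))) (ν b) *
        fcf F' ((1 / 2 : ℝ) • ((G.c.x a - (k : ℝ)⁻¹ • zvec (ν b)) + G.c.x c)) (s - ν b))) :=
    fun b hb ↦ by
    have hb3 := (hT b).1 hb
    rw [((hE a b ha3 hb3).2 _ (hν b hb3)).2, ((hE b c hb3 hc).2 _ (hq b hb)).2]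
    simp only [he, hβ b hb]
    rw [hxb b hb]
    have h1 : ((2 * Real.pi : ℂ) ^ n) * (starRingEnd ℂ (G.amp (ψ b)) * G.amp (ψ b)) = 1 := by
      rw [Complex.conj_mul']
      exact_mod_cast hamp b hb3
    rw [hu]
    linear_combination (E a b * E b c * fcf F ((1 / 2 : ℝ) • (G.c.x a + G.c.x b)) (ν b) *
      fcf F' ((1 / 2 : ℝ) • (G.c.x b + G.c.x c)) (s - ν b) *
      ((2 * Real.pi) ^ n * (starRingEnd ℂ (G.amp (ψ a)) * G.amp (ψ c)))) * h1
  have hmW : (1 / 2 : ℝ) • (G.c.x a + G.c.x c) ∈ G.W := by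
    rw [smul_add]
    exact G.convex_W (hdom ha3).2 (hdom hc).2 (by norm_num) (by norm_num) (by norm_num)
  have hbrk : fcf (fun y ↦ h (G.c.Ψ y)) ((1 / 2 : ℝ) • (G.c.x a + G.c.x c)) s =
      fcf (brk F F') ((1 / 2 : ℝ) • (G.c.x a + G.c.x c)) s :=
    fcf_congr (fun θ ↦ hh G.c (_, θ) (G.subset hmW)) s
  rw [Finset.sum_image hinj] at key
  rw [Finset.sum_congr rfl hprod, ← Finset.mul_sum, hM₀, hM₀, hbrk]
  refine le_trans (le_of_eq ?_) key
  rw [← one_mul ‖∑ b ∈ T, _ - _‖, ← hu1, ← norm_mul]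
  congr 1
  simp only [hu, hF, hF', Pi.mul_apply]
  ring

end Near

/-! ### Quantization operators given by finite matrices -/

section Operators

variable [T2Space X] [VectorBundle ℂ ℂ L] [ContMDiffVectorBundle ∞ ℂ L (𝓡 (2 * n))]

variable {k : ℕ} {f : X → ℂ}

/-- The spaces of parallel sections have dimension at most one. -/
theorem exists_eq_smul {b : B} {ψ : S.FiberSpace k b} (hψ : ‖ψ‖ = 1) (τ : S.FiberSpace k b) :
    ∃ u : ℂ, τ = u • ψ := by
  obtain ⟨G, hb⟩ := S.exists_gauge_at b
  have h0 : G.amp ψ ≠ 0 := fun h ↦ by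
    have := G.norm_sq hb ψ
    rw [h, hψ] at this
    simp at this
  refine ⟨G.amp τ / G.amp ψ, G.eq_of_amp hb ?_⟩
  rw [Gauge.amp_smul, div_mul_cancel₀ _ h0]

theorem IsQuantization.unique {T T' : S.QuantumSpace k →L[ℂ] S.QuantumSpace k}
    (h : S.IsQuantization k f T) (h' : S.IsQuantization k f T') : T = T' := by
  classical
  refine ContinuousLinearMap.ext fun x ↦ ?_
  have hx := lp.hasSum_single (p := 2) (by simp) x
  refine (hx.mapL T).unique ?_
  refine (hx.mapL T').congr_fun fun c ↦ lp.ext (funext fun b ↦ ?_)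
  obtain ⟨ψ, hψ⟩ := exists_norm_eq_one b.2
  have h1 := h c b (x c) ψ hψ
  have h2 := h' c b (x c) ψ hψ
  convert h1.trans h2.symm

open Classical in
/-- The vector of the quantum Hilbert space with the single component `ψ b`. -/
def basisVec (ψ : ∀ b : S.bohrSommerfeld k, S.FiberSpace k b) (b : S.bohrSommerfeld k) :
    S.QuantumSpace k := lp.single 2 b (ψ b)

variable {ψ : ∀ b : S.bohrSommerfeld k, S.FiberSpace k b}

theorem orthonormal_basisVec (hψ : ∀ b, ‖ψ b‖ = 1) : Orthonormal ℂ (basisVec ψ) := by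
  classical
  rw [orthonormal_iff_ite]
  intro b c
  rw [basisVec, lp.inner_single_left, basisVec]
  split_ifs with h
  · subst h
    rw [lp.single_apply_self, inner_self_eq_norm_sq_to_K, hψ]
    simp
  · rw [lp.single_apply_ne _ _ _ h, inner_zero_right]

/-- The quantization of `f` is given by the matrix of its coefficients, if only finitely many fibres
contribute. -/
theorem isQuantization_matOp (hψ : ∀ b, ‖ψ b‖ = 1) {s : Finset (S.bohrSommerfeld k)}
    (hs : ∀ b c, matrixCoeff f (ψ b) (ψ c) ≠ 0 → b ∈ s ∧ c ∈ s) :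
    S.IsQuantization k f (matOp (basisVec ψ) s fun b c ↦ matrixCoeff f (ψ b) (ψ c)) := by
  classical
  intro c b ξ φ hφ
  obtain ⟨v, rfl⟩ := exists_eq_smul (hψ c) ξ
  obtain ⟨u, rfl⟩ := exists_eq_smul (hψ b) φ
  have hu : starRingEnd ℂ u * u = 1 := by
    rw [norm_smul, hψ, mul_one] at hφ
    rw [Complex.conj_mul', hφ]; simp
  have hin : ∀ c', inner ℂ (basisVec ψ c') (lp.single 2 c (v • ψ c) : S.QuantumSpace k) =
      if c' = c then v else 0 := fun c' ↦ by
    rw [basisVec, lp.inner_single_left]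
    split_ifs with h
    · subst h
      rw [lp.single_apply_self, inner_smul_right, inner_self_eq_norm_sq_to_K, hψ]
      simp
    · rw [lp.single_apply_ne _ _ _ h, inner_zero_right]
  have hcomp : ∀ b', basisVec ψ b' b = if b' = b then ψ b else 0 := fun b' ↦ by
    rw [basisVec]
    split_ifs with h
    · subst h; exact lp.single_apply_self _ _ _
    · exact lp.single_apply_ne _ _ _ (Ne.symm h)
  rw [matOp_apply, matrixCoeff_smul, lp.coeFn_sum, Finset.sum_apply]
  simp only [hin, lp.coeFn_smul, Pi.smul_apply, hcomp, mul_ite, mul_zero, Finset.sum_ite_eq',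
    smul_ite, smul_zero]
  rw [smul_smul]
  have hR : starRingEnd ℂ u * v * matrixCoeff f (ψ b) (ψ c) * u = matrixCoeff f (ψ b) (ψ c) * v := by
    linear_combination (v * matrixCoeff f (ψ b) (ψ c)) * hu
  rw [hR]
  by_cases h : matrixCoeff f (ψ b) (ψ c) = 0
  · rw [h, zero_mul, zero_smul]
    simp
  · rw [if_pos (hs b c h).1, if_pos (hs b c h).2]

theorem IsQuantization.phi {T : S.QuantumSpace k →L[ℂ] S.QuantumSpace k}
    (h : S.IsQuantization k f T) : S.IsQuantization k f (S.phi k f) := by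
  have hex : ∃ T, S.IsQuantization k f T := ⟨T, h⟩
  rw [Setting.phi, dif_pos hex]
  exact hex.choose_spec

end Operators

/-! ### Counting Bohr-Sommerfeld fibres -/

section Counting

variable [T2Space X] [VectorBundle ℂ ℂ L] [ContMDiffVectorBundle ∞ ℂ L (𝓡 (2 * n))]

/-- A compact subset of the base contains `O(kⁿ)` Bohr-Sommerfeld points. -/
theorem exists_ncard_bound {K : Set B} (hK : IsCompact K) : ∃ C : ℝ, 0 ≤ C ∧ ∀ k : ℕ, 1 ≤ k →
    (S.bohrSommerfeld k ∩ K).Finite ∧ ((S.bohrSommerfeld k ∩ K).ncard : ℝ) ≤ C * (k : ℝ) ^ n := by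
  -- Locally, Bohr-Sommerfeld points lie in a translate of `k⁻¹ ℤⁿ`.
  refine hK.induction_on (p := fun K ↦ ∃ C : ℝ, 0 ≤ C ∧ ∀ k : ℕ, 1 ≤ k →
    (S.bohrSommerfeld k ∩ K).Finite ∧
      ((S.bohrSommerfeld k ∩ K).ncard : ℝ) ≤ C * (k : ℝ) ^ n) ?_ ?_ ?_ ?_
  · exact ⟨0, le_rfl, fun k _ ↦ by simp⟩
  · rintro s t hst ⟨C, hC0, hC⟩
    refine ⟨C, hC0, fun k hk ↦ ?_⟩
    have hsub : S.bohrSommerfeld k ∩ s ⊆ S.bohrSommerfeld k ∩ t := inter_subset_inter_right _ hst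
    refine ⟨(hC k hk).1.subset hsub, le_trans ?_ (hC k hk).2⟩
    exact_mod_cast ncard_le_ncard hsub (hC k hk).1
  · rintro s t ⟨C, hC0, hC⟩ ⟨C', hC0', hC'⟩
    refine ⟨C + C', by positivity, fun k hk ↦ ?_⟩
    rw [inter_union_distrib_left]
    refine ⟨(hC k hk).1.union (hC' k hk).1, ?_⟩
    rw [add_mul]
    refine le_trans ?_ (add_le_add (hC k hk).2 (hC' k hk).2)
    exact_mod_cast ncard_union_le _ _
  · intro z _
    obtain ⟨G, hz⟩ := S.exists_gauge_at z
    refine ⟨G.c.V ∩ G.c.x ⁻¹' (Metric.ball (G.c.x z) 1 ∩ G.W), mem_nhdsWithin_of_mem_nhds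
      ((isOpen_inter_preimage_x G.c (Metric.isOpen_ball.inter G.isOpen_W)).mem_nhds
        ⟨hz.1, Metric.mem_ball_self one_pos, hz.2⟩), 5 ^ n, by positivity, fun k hk ↦ ?_⟩
    rcases eq_empty_or_nonempty (S.bohrSommerfeld k ∩
      (G.c.V ∩ G.c.x ⁻¹' (Metric.ball (G.c.x z) 1 ∩ G.W))) with h | ⟨b₀, hb₀, hb₀V, hb₀z, hb₀W⟩
    · rw [h]; simp
    have hk0 : (0 : ℝ) < k := by exact_mod_cast hk
    have hp : ∀ b, ∃ p : Fin n → ℤ, b ∈ S.bohrSommerfeld k ∩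
        (G.c.V ∩ G.c.x ⁻¹' (Metric.ball (G.c.x z) 1 ∩ G.W)) →
        ∀ i, k * (G.c.x b i - G.c.x b₀ i) = p i := fun b ↦ by
      by_cases hb : b ∈ S.bohrSommerfeld k ∩
        (G.c.V ∩ G.c.x ⁻¹' (Metric.ball (G.c.x z) 1 ∩ G.W))
      · obtain ⟨p, hp⟩ := Gauge.exists_int_of_bohrSommerfeld G ⟨hb.2.1, hb.2.2.2⟩ hb.1
          ⟨hb₀V, hb₀W⟩ hb₀
        exact ⟨p, fun _ ↦ hp⟩
      · exact ⟨0, fun h ↦ absurd h hb⟩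
    choose p hp using hp
    set T := Finset.Icc (fun _ : Fin n ↦ (-(2 * k) : ℤ)) (fun _ ↦ (2 * k : ℤ))
    have hmaps : ∀ b ∈ S.bohrSommerfeld k ∩
        (G.c.V ∩ G.c.x ⁻¹' (Metric.ball (G.c.x z) 1 ∩ G.W)), p b ∈ (T : Set (Fin n → ℤ)) := by
      intro b hb
      have hle : ∀ i, |(p b i : ℝ)| ≤ 2 * k := fun i ↦ by
        rw [← hp b hb i, abs_mul, abs_of_pos hk0, mul_comm]
        have h1 := PiLp.norm_apply_le (G.c.x b - G.c.x b₀) i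
        rw [← dist_eq_norm] at h1
        have h2 := dist_triangle_right (G.c.x b) (G.c.x b₀) (G.c.x z)
        have h3 : dist (G.c.x b) (G.c.x z) < 1 := hb.2.2.1
        have h4 : dist (G.c.x b₀) (G.c.x z) < 1 := hb₀z
        refine mul_le_mul_of_nonneg_right ?_ hk0.le
        exact h1.trans (by linarith)
      refine Finset.mem_coe.2 (Finset.mem_Icc.2 ⟨fun i ↦ ?_, fun i ↦ ?_⟩)
      · exact_mod_cast (abs_le.1 (hle i)).1
      · exact_mod_cast (abs_le.1 (hle i)).2
    have hinj : InjOn p (S.bohrSommerfeld k ∩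
        (G.c.V ∩ G.c.x ⁻¹' (Metric.ball (G.c.x z) 1 ∩ G.W))) := fun b hb b' hb' h ↦ by
      refine G.c.injOn_x hb.2.1 hb'.2.1 ?_
      ext i
      have h1 := hp b hb i
      rw [h, ← hp b' hb' i] at h1
      exact sub_left_injective (mul_left_cancel₀ hk0.ne' h1)
    refine ⟨Set.Finite.of_injOn hmaps hinj T.finite_toSet, ?_⟩
    have h1 := ncard_le_ncard_of_injOn p hmaps hinj T.finite_toSet
    have h2 : T.card = (4 * k + 1) ^ n := by
      rw [Pi.card_Icc]
      simp only [Int.card_Icc, Finset.prod_const, Finset.card_univ, Fintype.card_fin]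
      congr 1
      omega
    rw [ncard_coe_finset, h2] at h1
    calc (_ : ℝ) ≤ ((4 * k + 1 : ℕ) : ℝ) ^ n := by exact_mod_cast h1
      _ ≤ (5 * k : ℝ) ^ n := by
        have : (1 : ℝ) ≤ k := by exact_mod_cast hk
        push_cast
        gcongr
        linarith
      _ = _ := mul_pow _ _ _

end Counting

/-! ### The product formula -/

section Main

variable [T2Space X] [T2Space B] [VectorBundle ℂ ℂ L] [ContMDiffVectorBundle ∞ ℂ L (𝓡 (2 * n))]

variable {f g h : X → ℂ} {K : Set B}

/-- The union of the closures of the members of the covering that meet `K`. -/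
def hull (S : Setting n X B L) (K : Set B) : Set B :=
  ⋃ U ∈ {U : S.𝒰 | ((U : Set B) ∩ K).Nonempty}, closure (U : Set B)

theorem isCompact_hull (hK : IsCompact K) : IsCompact (S.hull K) :=
  (S.cover.locallyFinite.finite_nonempty_inter_compact hK).isCompact_biUnion fun U _ ↦
    S.cover.compact_closure U U.2

theorem mem_hull_of_matrixCoeff_ne_zero (hK : ∀ p, S.μ p ∉ K → f p = 0) {k : ℕ} {c b : B}
    {ψ : S.FiberSpace k b} {ξ : S.FiberSpace k c} (h : matrixCoeff f ψ ξ ≠ 0) :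
    b ∈ S.hull K ∧ c ∈ S.hull K := by
  obtain ⟨-, -, U, hU, hb, hc, hne⟩ := exists_cover_of_matrixCoeff_ne_zero hK h
  exact ⟨mem_biUnion (x := (⟨U, hU⟩ : S.𝒰)) hne (subset_closure hb),
    mem_biUnion (x := (⟨U, hU⟩ : S.𝒰)) hne (subset_closure hc)⟩

/-- Only the finitely many Bohr-Sommerfeld fibres over the hull of the support contribute, so that
`φᵏ(f)` exists and is given by a finite matrix. -/
theorem isQuantization_phi (hK : IsCompact K) (hfK : ∀ p, S.μ p ∉ K → f p = 0) {k : ℕ}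
    (hk : 1 ≤ k) : S.IsQuantization k f (S.phi k f) := by
  obtain ⟨C, -, hC⟩ := exists_ncard_bound (S := S) (isCompact_hull (S := S) hK)
  choose ψ hψ using fun b : S.bohrSommerfeld k ↦ exists_norm_eq_one b.2
  have hfin : {b : S.bohrSommerfeld k | (b : B) ∈ S.hull K}.Finite := by
    refine Set.Finite.of_finite_image ((hC k hk).1.subset ?_) Subtype.val_injective.injOn
    rintro - ⟨b, hb, rfl⟩
    exact ⟨b.2, hb⟩
  refine IsQuantization.phi (isQuantization_matOp hψ (s := hfin.toFinset) fun b c hbc ↦ ?_)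
  simpa using mem_hull_of_matrixCoeff_ne_zero hfK hbc

theorem sum_ite_le_tsum {ι : Type*} {w : (Fin n → ℤ) → ℝ} (hw : Summable w) (hw0 : ∀ s, 0 ≤ w s)
    (T : Finset ι) {q : ι → Prop} [DecidablePred q] {s : ι → Fin n → ℤ}
    (hs : ∀ b, q b → ∀ c, q c → s b = s c → b = c) :
    ∑ b ∈ T, (if q b then w (s b) else 0) ≤ ∑' s, w s := by
  classical
  rw [← Finset.sum_filter]
  have hinj : Set.InjOn s (T.filter q) := fun b hb c hc ↦
    hs b (Finset.mem_filter.1 hb).2 c (Finset.mem_filter.1 hc).2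
  rw [← Finset.sum_image hinj]
  exact hw.sum_le_tsum _ fun s _ ↦ hw0 s

/-- The norm of the remainder in the product formula is `O(k⁻²)`: by Schur's test, the sums of the
rows and of the columns of its matrix have to be estimated. A matrix coefficient near the diagonal
is estimated by the product formula near one of finitely many points, all other ones by the decay
away from the diagonal. -/
theorem exists_remainder_bound (hf : S.SmoothInCharts f) (hg : S.SmoothInCharts g)
    (hh' : S.SmoothInCharts h) (hh : ∀ (c : S.Chart) (y : Euc n × Euc n), y.1 ∈ c.x '' c.V →
      h (c.Ψ y) = brk (fun y ↦ f (c.Ψ y)) (fun y ↦ g (c.Ψ y)) y)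
    (hK : IsCompact K) (hfK : ∀ p, S.μ p ∉ K → f p = 0) (hgK : ∀ p, S.μ p ∉ K → g p = 0)
    (hhK : ∀ p, S.μ p ∉ K → h p = 0) :
    ∃ C : ℝ, ∀ k : ℕ, 1 ≤ k → ‖S.phi k f ∘L S.phi k g - S.phi k (f * g)
      - (-Complex.I / (2 * k)) • S.phi k h‖ ≤ C * (1 / (k : ℝ) ^ 2) := by
  have hfgK : ∀ p, S.μ p ∉ K → (f * g) p = 0 := fun p hp ↦ by
    rw [Pi.mul_apply, hfK p hp, zero_mul]
  choose c₁ ρ w hz hρ hball hw hw0 hnear using fun z ↦ exists_near_bound hf hg hh z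
  have hK' := isCompact_hull (S := S) hK
  have hopen : ∀ z r, IsOpen (disc (c₁ z) z r) := fun z r ↦
    isOpen_inter_preimage_x (c₁ z) Metric.isOpen_ball
  obtain ⟨t, -, ht⟩ := hK'.elim_nhds_subcover (fun z ↦ disc (c₁ z) z (ρ z)) fun z _ ↦
    (hopen z _).mem_nhds ⟨hz z, Metric.mem_ball_self (hρ z)⟩
  -- the closed discs with radius `i ρ`, `i = 1, 2, 3`
  let I : B → ℝ → Set B := fun z r ↦ base (c₁ z) '' Metric.closedBall ((c₁ z).x z) (r * ρ z)
  have hsub : ∀ z r, r ≤ 3 → Metric.closedBall ((c₁ z).x z) (r * ρ z) ⊆ (c₁ z).x '' (c₁ z).V :=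
    fun z r hr ↦ (Metric.closedBall_subset_closedBall
      (mul_le_mul_of_nonneg_right hr (hρ z).le)).trans (hball z)
  have hI : ∀ z r, r ≤ 3 → IsCompact (I z r) := fun z r hr ↦
    (isCompact_closedBall _ _).image_of_continuousOn fun ξ hξ ↦
      (continuousAt_base (hsub z r hr hξ)).continuousWithinAt
  have hdI : ∀ z r, disc (c₁ z) z (r * ρ z) ⊆ I z r := fun z r b hb ↦
    ⟨(c₁ z).x b, Metric.ball_subset_closedBall hb.2, base_x hb.1⟩
  have hId : ∀ z r r', r < r' → r ≤ 3 → I z r ⊆ disc (c₁ z) z (r' * ρ z) := by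
    rintro z r r' hr hr3 - ⟨ξ, hξ, rfl⟩
    refine ⟨base_mem (hsub z r hr3 hξ), ?_⟩
    rw [mem_preimage, x_base (hsub z r hr3 hξ)]
    exact Metric.closedBall_subset_ball (mul_lt_mul_of_pos_right hr (hρ z)) hξ
  -- `R` is the neighbourhood of the diagonal of the pairs `(a, b)` for which `b` lies in the disc of
  -- radius `(i + 1) ρ` whenever `a` lies in the closed disc of radius `i ρ`, for `i = 1, 2`.
  let R : Set (B × B) := ⋂ z ∈ t, {y | (y.1 ∈ I z 1 → y.2 ∈ disc (c₁ z) z (2 * ρ z)) ∧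
    (y.1 ∈ I z 2 → y.2 ∈ disc (c₁ z) z (3 * ρ z))}
  have hRopen : IsOpen R := by
    refine isOpen_biInter_finset fun z _ ↦ ?_
    have h1 : ∀ r r', r ≤ 3 →
        IsOpen {y : B × B | y.1 ∈ I z r → y.2 ∈ disc (c₁ z) z (r' * ρ z)} := fun r r' hr ↦ by
      simp only [imp_iff_not_or]
      exact (((hI z r hr).isClosed.isOpen_compl).preimage continuous_fst).union
        ((hopen z _).preimage continuous_snd)
    exact (h1 1 2 (by norm_num)).inter (h1 2 3 (by norm_num))
  have hRdiag : ∀ b, (b, b) ∈ R := fun b ↦ mem_iInter₂.2 fun z _ ↦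
    ⟨fun hb ↦ hId z 1 2 (by norm_num) (by norm_num) hb,
      fun hb ↦ hId z 2 3 (by norm_num) (by norm_num) hb⟩
  -- Off `R` the coefficients are `O(k⁻²ⁿ⁻²)`; the exponent makes up for the number of summands, which
  -- is `O(kⁿ)` both in the product of matrices and in the sums of rows and columns.
  obtain ⟨C₁, hC₁, hfar₁⟩ := exists_far_bound hf hK hfK hRopen hRdiag (n + 1)
  obtain ⟨C₂, hC₂, hfar₂⟩ := exists_far_bound hg hK hgK hRopen hRdiag (n + 1)
  obtain ⟨C₃, hC₃, hfar₃⟩ := exists_far_bound (hf.mul hg) hK hfgK hRopen hRdiag (n + 1)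
  obtain ⟨C₄, hC₄, hfar₄⟩ := exists_far_bound hh' hK hhK hRopen hRdiag (n + 1)
  let K₂ : Set B := S.hull K ∪ ⋃ z ∈ t, I z 3
  have hK₂ : IsCompact K₂ := hK'.union (t.isCompact_biUnion fun z _ ↦ hI z 3 le_rfl)
  obtain ⟨Cₙ, hCₙ, hcount⟩ := exists_ncard_bound (S := S) hK₂
  obtain ⟨D, hD⟩ : ∃ D, D = Cₙ * (C₁ * C₂) + C₃ + C₄ := ⟨_, rfl⟩
  have hD0 : 0 ≤ D := by rw [hD]; positivity
  refine ⟨∑ z ∈ t, (∑' s, w z s) + Cₙ * D, fun k hk ↦ ?_⟩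
  have hk0 : (0 : ℝ) < k := by exact_mod_cast hk
  set κ := (k : ℝ)⁻¹ with hκ
  have hκ0 : 0 < κ := inv_pos.2 hk0
  have hκ1 : κ ≤ 1 := inv_le_one_of_one_le₀ (by exact_mod_cast hk)
  choose ψ hψ using fun b : S.bohrSommerfeld k ↦ exists_norm_eq_one b.2
  have hfin : {b : S.bohrSommerfeld k | (b : B) ∈ K₂}.Finite := by
    refine Set.Finite.of_finite_image ((hcount k hk).1.subset ?_) Subtype.val_injective.injOn
    rintro - ⟨b, hb, rfl⟩
    exact ⟨b.2, hb⟩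
  set T := hfin.toFinset with hT
  have hTmem : ∀ b, b ∈ T ↔ (b : B) ∈ K₂ := fun b ↦ by rw [hT, Set.Finite.mem_toFinset]; rfl
  have hcard : (T.card : ℝ) ≤ Cₙ * (k : ℝ) ^ n := by
    refine le_trans ?_ (hcount k hk).2
    rw [← ncard_coe_finset T]
    have h1 := ncard_le_ncard_of_injOn (s := (T : Set (S.bohrSommerfeld k)))
      (t := S.bohrSommerfeld k ∩ K₂) Subtype.val
      (fun b hb ↦ ⟨b.2, (hTmem b).1 (Finset.mem_coe.1 hb)⟩) Subtype.val_injective.injOn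
      (hcount k hk).1
    exact_mod_cast h1
  have hphi : ∀ {q : X → ℂ}, (∀ p, S.μ p ∉ K → q p = 0) → S.phi k q =
      matOp (basisVec ψ) T fun b c ↦ matrixCoeff q (ψ b) (ψ c) := fun {q} hq ↦
    (isQuantization_phi hK hq hk).unique (isQuantization_matOp hψ fun b c hbc ↦ by
      obtain ⟨hb, hc⟩ := mem_hull_of_matrixCoeff_ne_zero hq hbc
      exact ⟨(hTmem b).2 (Or.inl hb), (hTmem c).2 (Or.inl hc)⟩)
  have hon := orthonormal_basisVec hψ
  rw [hphi hfK, hphi hgK, hphi hfgK, hphi hhK, matOp_comp hon, matOp_sub, matOp_smul, matOp_sub]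
  set d : S.bohrSommerfeld k → S.bohrSommerfeld k → ℂ := fun a c ↦
    ∑ b ∈ T, matrixCoeff f (ψ a) (ψ b) * matrixCoeff g (ψ b) (ψ c) -
      matrixCoeff (f * g) (ψ a) (ψ c) - -Complex.I / (2 * k) * matrixCoeff h (ψ a) (ψ c) with hd
  classical
  choose s hs using fun z (a c : S.bohrSommerfeld k) ↦
    (show ∃ s, (a : B) ∈ disc (c₁ z) z (2 * ρ z) → (c : B) ∈ disc (c₁ z) z (3 * ρ z) → _ from by
      by_cases hac : (a : B) ∈ disc (c₁ z) z (2 * ρ z) ∧ (c : B) ∈ disc (c₁ z) z (3 * ρ z)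
      · obtain ⟨s, hs⟩ := hnear z k hk ψ hψ a c hac.1 hac.2
        exact ⟨s, fun _ _ ↦ hs⟩
      · exact ⟨0, fun h1 h2 ↦ absurd ⟨h1, h2⟩ hac⟩)
  let q : B → S.bohrSommerfeld k → S.bohrSommerfeld k → Prop := fun z a c ↦
    (a : B) ∈ disc (c₁ z) z (2 * ρ z) ∧ (c : B) ∈ disc (c₁ z) z (3 * ρ z)
  -- bounds for the coefficients of unit vectors
  have bd : ∀ {F : X → ℂ} {C : ℝ} (_ : ∀ (k : ℕ), 1 ≤ k → ∀ (b c : B) (ψ : S.FiberSpace k b)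
      (ξ : S.FiberSpace k c), ‖matrixCoeff F ψ ξ‖ ≤ C * (‖ψ‖ * ‖ξ‖) ∧ ((b, c) ∉ R →
      ‖matrixCoeff F ψ ξ‖ ≤ C * ((k : ℝ)⁻¹) ^ (2 * (n + 1)) * (‖ψ‖ * ‖ξ‖)))
      (a b : S.bohrSommerfeld k), ‖matrixCoeff F (ψ a) (ψ b)‖ ≤ C ∧
      (((a : B), (b : B)) ∉ R → ‖matrixCoeff F (ψ a) (ψ b)‖ ≤ C * κ ^ (2 * (n + 1))) :=
    fun {F C} hF a b ↦ by
      have := hF k hk a b (ψ a) (ψ b)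
      rwa [hψ, hψ, mul_one, mul_one, mul_one] at this
  have hprod : ∀ a b c : S.bohrSommerfeld k, (((a : B), (b : B)) ∉ R ∨ ((b : B), (c : B)) ∉ R) →
      ‖matrixCoeff f (ψ a) (ψ b) * matrixCoeff g (ψ b) (ψ c)‖ ≤ C₁ * C₂ * κ ^ (2 * (n + 1)) := by
    intro a b c habc
    rw [norm_mul]
    rcases habc with h1 | h1
    · calc _ ≤ (C₁ * κ ^ (2 * (n + 1))) * C₂ := mul_le_mul ((bd hfar₁ a b).2 h1)
            (bd hfar₂ b c).1 (norm_nonneg _) (by positivity)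
        _ = _ := by ring
    · calc _ ≤ C₁ * (C₂ * κ ^ (2 * (n + 1))) := mul_le_mul (bd hfar₁ a b).1
            ((bd hfar₂ b c).2 h1) (norm_nonneg _) (by positivity)
        _ = _ := by ring
  have hκn : (k : ℝ) ^ n * κ ^ (2 * (n + 1)) = κ ^ (n + 2) := by
    rw [show 2 * (n + 1) = n + (n + 2) by ring, pow_add, ← mul_assoc, ← mul_pow, hκ,
      mul_inv_cancel₀ hk0.ne', one_pow, one_mul]
  have hκn' : κ ^ (2 * (n + 1)) ≤ κ ^ (n + 2) := pow_le_pow_of_le_one hκ0.le hκ1 (by omega)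
  have hsumfar : ∀ (T' : Finset (S.bohrSommerfeld k)) (a c : S.bohrSommerfeld k), T' ⊆ T →
      (∀ b ∈ T', ((a : B), (b : B)) ∉ R ∨ ((b : B), (c : B)) ∉ R) →
      ‖∑ b ∈ T', matrixCoeff f (ψ a) (ψ b) * matrixCoeff g (ψ b) (ψ c)‖ ≤
        Cₙ * (C₁ * C₂) * κ ^ (n + 2) := by
    intro T' a c hT' hR'
    have hc' : (T'.card : ℝ) ≤ Cₙ * (k : ℝ) ^ n :=
      le_trans (by exact_mod_cast Finset.card_le_card hT') hcard
    calc _ ≤ ∑ b ∈ T', C₁ * C₂ * κ ^ (2 * (n + 1)) :=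
          norm_sum_le_of_le _ fun b hb ↦ hprod a b c (hR' b hb)
      _ = T'.card * (C₁ * C₂ * κ ^ (2 * (n + 1))) := by rw [Finset.sum_const, nsmul_eq_mul]
      _ ≤ (Cₙ * (k : ℝ) ^ n) * (C₁ * C₂ * κ ^ (2 * (n + 1))) := by gcongr
      _ = Cₙ * (C₁ * C₂) * ((k : ℝ) ^ n * κ ^ (2 * (n + 1))) := by ring
      _ = _ := by rw [hκn]
  have hdle : ∀ a c, ‖d a c‖ ≤ ∑ z ∈ t, (if q z a c then w z (s z a c) else 0) * κ ^ 2 +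
      D * κ ^ (n + 2) := by
    intro a c
    have hnn : ∀ z ∈ t, 0 ≤ (if q z a c then w z (s z a c) else 0) * κ ^ 2 := fun z _ ↦
      mul_nonneg (by split_ifs; exacts [hw0 z _, le_rfl]) (by positivity)
    have hnn' := Finset.sum_nonneg hnn
    by_cases haK : (a : B) ∈ S.hull K
    swap
    · have h0 : ∀ {F : X → ℂ} (_ : ∀ p, S.μ p ∉ K → F p = 0) b, matrixCoeff F (ψ a) (ψ b) = 0 :=
        fun {F} hF b ↦ by
        by_contra hne
        exact haK (mem_hull_of_matrixCoeff_ne_zero hF hne).1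
      have hd0 : d a c = 0 := by
        simp only [hd, h0 hfK, h0 hfgK, h0 hhK, zero_mul, mul_zero, Finset.sum_const_zero, sub_zero]
      rw [hd0, norm_zero]
      positivity
    obtain ⟨z, hzt, haz⟩ := mem_iUnion₂.1 (ht haK)
    have haI : (a : B) ∈ I z 1 := hdI z 1 (by rwa [one_mul])
    have ha2 := hId z 1 2 (by norm_num) (by norm_num) haI
    have hRz : ∀ {x y : B}, (x, y) ∈ R → (x ∈ I z 1 → y ∈ disc (c₁ z) z (2 * ρ z)) ∧
        (x ∈ I z 2 → y ∈ disc (c₁ z) z (3 * ρ z)) := fun hxy ↦ mem_iInter₂.1 hxy z hzt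
    have h23 : disc (c₁ z) z (2 * ρ z) ⊆ disc (c₁ z) z (3 * ρ z) :=
      (hdI z 2).trans (hId z 2 3 (by norm_num) (by norm_num))
    -- If `c` is near `a`, the summands with `b` near `z` are controlled by the product formula and
    -- all other ones by the decay. If not, `(a, c)`, and one of `(a, b)` and `(b, c)` for each `b`,
    -- are outside of `R`.
    by_cases hc3 : (c : B) ∈ disc (c₁ z) z (3 * ρ z)
    · obtain ⟨-, hbound⟩ := hs z a c ha2 hc3
      have h1 := hbound (T.filter fun b ↦ (b : B) ∈ disc (c₁ z) z (3 * ρ z)) fun b ↦ by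
        rw [Finset.mem_filter, and_iff_right_iff_imp]
        intro hb
        exact (hTmem b).2 (Or.inr (mem_biUnion hzt (hdI z 3 hb)))
      have h2 := hsumfar (T.filter fun b ↦ ¬ (b : B) ∈ disc (c₁ z) z (3 * ρ z)) a c
        (Finset.filter_subset _ _) fun b hb ↦ Or.inl fun hab ↦
          (Finset.mem_filter.1 hb).2 (h23 ((hRz hab).1 haI))
      have h3 : d a c = (∑ b ∈ T.filter fun b : S.bohrSommerfeld k ↦ (b : B) ∈ disc (c₁ z) z (3 * ρ z),
          matrixCoeff f (ψ a) (ψ b) * matrixCoeff g (ψ b) (ψ c) - (matrixCoeff (f * g) (ψ a) (ψ c) +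
            -Complex.I / (2 * k) * matrixCoeff h (ψ a) (ψ c))) +
          ∑ b ∈ T.filter fun b : S.bohrSommerfeld k ↦ ¬ (b : B) ∈ disc (c₁ z) z (3 * ρ z),
            matrixCoeff f (ψ a) (ψ b) * matrixCoeff g (ψ b) (ψ c) := by
        simp only [hd]
        rw [← Finset.sum_filter_add_sum_filter_not T
          (fun b : S.bohrSommerfeld k ↦ (b : B) ∈ disc (c₁ z) z (3 * ρ z))]
        ring
      rw [h3]
      refine (norm_add_le _ _).trans (add_le_add (h1.trans ?_) (h2.trans ?_))
      · refine le_trans (le_of_eq ?_) (Finset.single_le_sum hnn hzt)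
        rw [if_pos (show q z a c from ⟨ha2, hc3⟩)]
      · gcongr
        rw [hD]; linarith
    · have hcR : ((a : B), (c : B)) ∉ R := fun hac ↦ hc3 (h23 ((hRz hac).1 haI))
      have h2 := hsumfar T a c Subset.rfl fun b _ ↦ by
        by_contra! hb
        exact hc3 ((hRz hb.2).2 (hdI z 2 ((hRz hb.1).1 haI)))
      have h3 : ‖-Complex.I / (2 * k) * matrixCoeff h (ψ a) (ψ c)‖ ≤ C₄ * κ ^ (n + 2) := by
        have h4 : ‖-Complex.I / (2 * k)‖ ≤ 1 := by
          rw [norm_div, norm_neg, Complex.norm_I, norm_mul, Complex.norm_natCast,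
            Complex.norm_ofNat, div_le_one (by positivity)]
          have : (1 : ℝ) ≤ k := by exact_mod_cast hk
          linarith
        rw [norm_mul]
        refine (mul_le_of_le_one_left (norm_nonneg _) h4).trans (((bd hfar₄ a c).2 hcR).trans ?_)
        gcongr
      have h5 : ‖matrixCoeff (f * g) (ψ a) (ψ c)‖ ≤ C₃ * κ ^ (n + 2) :=
        ((bd hfar₃ a c).2 hcR).trans (by gcongr)
      calc ‖d a c‖ ≤ Cₙ * (C₁ * C₂) * κ ^ (n + 2) + C₃ * κ ^ (n + 2) + C₄ * κ ^ (n + 2) :=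
            (norm_sub_le _ _).trans (add_le_add ((norm_sub_le _ _).trans (add_le_add h2 h5)) h3)
        _ = D * κ ^ (n + 2) := by rw [hD]; ring
        _ ≤ _ := le_add_of_nonneg_left hnn'
  have hfarsum : T.card * (D * κ ^ (n + 2)) ≤ Cₙ * D * κ ^ 2 := by
    calc T.card * (D * κ ^ (n + 2)) ≤ (Cₙ * (k : ℝ) ^ n) * (D * κ ^ (n + 2)) := by gcongr
      _ = Cₙ * D * ((k : ℝ) * κ) ^ n * κ ^ 2 := by ring
      _ = _ := by rw [hκ, mul_inv_cancel₀ hk0.ne', one_pow, mul_one]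
  have hinjx : ∀ z (b c : S.bohrSommerfeld k), (b : B) ∈ (c₁ z).V → (c : B) ∈ (c₁ z).V →
      (c₁ z).x b = (c₁ z).x c → b = c := fun z b c hb hc hbc ↦
    Subtype.ext ((c₁ z).injOn_x hb hc hbc)
  have hone : (1 / (k : ℝ) ^ 2) = κ ^ 2 := by rw [hκ, inv_pow, one_div]
  rw [hone]
  refine norm_matOp_le hon T ?_ (fun a _ ↦ ?_) fun c _ ↦ ?_
  · have : 0 ≤ ∑ z ∈ t, ∑' s, w z s := Finset.sum_nonneg fun z _ ↦ tsum_nonneg (hw0 z)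
    positivity
  · refine (Finset.sum_le_sum fun c _ ↦ hdle a c).trans ?_
    rw [Finset.sum_add_distrib, Finset.sum_const, nsmul_eq_mul, add_mul, Finset.sum_comm,
      Finset.sum_mul]
    refine add_le_add (Finset.sum_le_sum fun z _ ↦ ?_) hfarsum
    rw [← Finset.sum_mul]
    refine mul_le_mul_of_nonneg_right (sum_ite_le_tsum (hw z) (hw0 z) T (q := fun c ↦ q z a c)
      fun b hb c hc hbc ↦ hinjx z b c hb.2.1 hc.2.1 ?_) (by positivity)
    have h1 := (hs z a b hb.1 hb.2).1
    have h2 := (hs z a c hc.1 hc.2).1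
    rw [hbc, h2] at h1
    exact (sub_right_injective (smul_right_injective _ hk0.ne' h1)).symm
  · refine (Finset.sum_le_sum fun a _ ↦ hdle a c).trans ?_
    rw [Finset.sum_add_distrib, Finset.sum_const, nsmul_eq_mul, add_mul, Finset.sum_comm,
      Finset.sum_mul]
    refine add_le_add (Finset.sum_le_sum fun z _ ↦ ?_) hfarsum
    rw [← Finset.sum_mul]
    refine mul_le_mul_of_nonneg_right (sum_ite_le_tsum (hw z) (hw0 z) T (q := fun a ↦ q z a c)
      (s := fun a ↦ s z a c) fun a ha b hb hab ↦ hinjx z a b ha.1.1 hb.1.1 ?_) (by positivity)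
    have h1 := (hs z a c ha.1 ha.2).1
    have h2 := (hs z b c hb.1 hb.2).1
    rw [hab, h2] at h1
    exact (sub_left_injective (smul_right_injective _ hk0.ne' h1)).symm

end Main

end Setting
end LagrangianQuantization

end

theorem mainTheorem2 {n : ℕ}
    {X : Type*} [TopologicalSpace X] [T2Space X] [SecondCountableTopology X]
    [ChartedSpace (LagrangianQuantization.Euc (2 * n)) X] [IsManifold (𝓡 (2 * n)) ∞ X]
    {B : Type*} [TopologicalSpace B] [T2Space B] [SecondCountableTopology B]
    [ChartedSpace (LagrangianQuantization.Euc n) B] [IsManifold (𝓡 n) ∞ B]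
    {L : X → Type*} [∀ p, NormedAddCommGroup (L p)] [∀ p, InnerProductSpace ℂ (L p)]
    [TopologicalSpace (TotalSpace ℂ L)] [FiberBundle ℂ L] [VectorBundle ℝ ℂ L]
    [VectorBundle ℂ ℂ L] [ContMDiffVectorBundle ∞ ℂ L (𝓡 (2 * n))]
    (S : LagrangianQuantization.Setting n X B L) :
    (∀ k : ℕ, 1 ≤ k → ∀ f : X → ℂ, ContMDiff (𝓡 (2 * n)) 𝓘(ℝ, ℂ) ∞ f → HasCompactSupport f →
      S.IsQuantization k f (S.phi k f)) ∧
    ∀ f g : X → ℂ, ContMDiff (𝓡 (2 * n)) 𝓘(ℝ, ℂ) ∞ f → HasCompactSupport f →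
      ContMDiff (𝓡 (2 * n)) 𝓘(ℝ, ℂ) ∞ g → HasCompactSupport g →
      (fun k : ℕ ↦ ‖S.phi k f ∘L S.phi k g - S.phi k (f * g)
          - (-Complex.I / (2 * k)) • S.phi k (LagrangianQuantization.poisson S.Ω f g)‖)
        =O[Filter.atTop] fun k : ℕ ↦ 1 / (k : ℝ) ^ 2 := by
  have hμ : Continuous S.μ := S.fibration.smooth.continuous
  have hsupp : ∀ {f : X → ℂ}, HasCompactSupport f →
      IsCompact (S.μ '' tsupport f) ∧ ∀ p, S.μ p ∉ S.μ '' tsupport f → f p = 0 := fun {f} hf ↦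
    ⟨hf.isCompact.image hμ, fun p hp ↦ image_eq_zero_of_notMem_tsupport fun h ↦
      hp (mem_image_of_mem _ h)⟩
  refine ⟨fun k hk f _ hfc ↦
    LagrangianQuantization.Setting.isQuantization_phi (hsupp hfc).1 (hsupp hfc).2 hk,
    fun f g hf hfc hg hgc ↦ ?_⟩
  obtain ⟨C, hC⟩ := LagrangianQuantization.Setting.exists_remainder_bound (S := S)
    (LagrangianQuantization.Setting.smoothInCharts hf)
    (LagrangianQuantization.Setting.smoothInCharts hg)
    (LagrangianQuantization.Setting.smoothInCharts_poisson hf hg)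
    (fun c y hy ↦ LagrangianQuantization.Setting.poisson_Ψ hf hg hy)
    ((hsupp hfc).1.union (hsupp hgc).1)
    (fun p hp ↦ (hsupp hfc).2 p fun h ↦ hp (Or.inl h))
    (fun p hp ↦ (hsupp hgc).2 p fun h ↦ hp (Or.inr h))
    fun p hp ↦ LagrangianQuantization.Setting.poisson_eq_zero fun h ↦
      hp (Or.inr (mem_image_of_mem _ h))
  refine Asymptotics.IsBigO.of_bound C ?_
  filter_upwards [Filter.eventually_ge_atTop 1] with k hk
  rw [Real.norm_of_nonneg (ContinuousLinearMap.opNorm_nonneg _),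
    Real.norm_of_nonneg (by positivity)]
  exact hC k hk
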